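/- **Setting.** Let $\Omega\subset\mathbb R^3$ and $I\subset\mathbb R$ (times) be open, and let $E(x,t),B(x,t)\in\mathbb R^3$ be given smooth fields on $\Omega\times I$ with $B\neq0$ and $\nabla_x\cdot B=0$. Put $b=B/|B|$, $c_\parallel=c\cdot b$, $\mu=\frac{|c|^2-c_\parallel^2}{2|B|}$ for $c\in\mathbb R^3$, $u_\parallel=u\cdot b$, $u_\perp=b\times(u\times b)$, $\mathbf f=b\times(b\cdot\nabla_x)b$; $\nabla_xu$ is the matrix $(\partial_{x_i}u_j)_{i,j}$. Consider, for small $\varepsilon>0$, families $(g^\varepsilon(x,c,t),u^\varepsilon(x,t))$ with $\int g^\varepsilon c\,dc=0$ that solve $$\partial_tg^\varepsilon+u^\varepsilon\cdot\nabla_xg^\varepsilon-c\cdot(\nabla_xu^\varepsilon)\nabla_cg^\varepsilon+\tfrac1\varepsilon\Big(c\cdot\nabla_xg^\varepsilon+\tfrac{\nabla_x\cdot\mathbb P^\varepsilon}{n^\varepsilon}\cdot\nabla_cg^\varepsilon\Big)+\tfrac1{\varepsilon^2}(c\times B)\cdot\nabla_cg^\varepsilon=0,$$ $$\partial_t(n^\varepsilon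 u^\varepsilon)+\nabla_x\cdot(n^\varepsilon u^\varepsilon\otimes u^\varepsilon)+\tfrac1{\varepsilon^2}\big(\nabla_x\cdot\mathbb P^\varepsilon-n^\varepsilon(E+u^\varepsilon\times B)\big)=0,$$ with $n^\varepsilon=\int g^\varepsilon dc$, $\mathbb P^\varepsilon=\int g^\varepsilon c\otimes c\,dc$; it is enough that the two left-hand sides tend to $0$ pointwise on $\Omega\times\mathbb R^3\times I$ and $\Omega\times I$ respectively as $\varepsilon\to0^+$ (this covers exact solutions and second-order truncations of formal power series solutions). Assume that the family has a Hilbert expansion $g^\varepsilon=g_0+\varepsilon g_1+\varepsilon^2g_2+o(\varepsilon^2)$, $u^\varepsilon=u_0+\varepsilon u_1+\varepsilon^2u_2+o(\varepsilon^2)$ as $\varepsilon\to 0^+$, where the $u_k$ are smooth, the $g_k$ are smooth with all derivatives decaying faster than any power of $|c|$ locally uniformly in $(x,t)$, $g^\varepsilon,u^\varepsilon$ are $C^1$ for small $\varepsilon$, and the remainders are $o(\varepsilon^2)$ together with their first derivatives, locally uniformly in $(x,t)$ (for $g^\varepsilon$: uniformly in $c$ with every polynomial weight in $c$). Assume $\int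 g_0\,dc\ne0$ on $\Omega\times I$. **Theorem 2.1.** Let $u=u_0$. Then $u^\varepsilon\to u$ pointwise, and there are functions $G(x,\mu,c_\parallel,t)$, $K(x,\mu,c_\parallel,t)$, continuous for $\mu\ge0$, smooth for $\mu>0$, all of whose moments in $(\mu,c_\parallel)\in(0,\infty)\times\mathbb R$ are finite and smooth in $(x,t)\in\Omega\times I$, such that $g^\varepsilon(x,c,t)\to G(x,\mu,c_\parallel,t)$ pointwise (so the limit does not depend on the gyrophase) and, with $\mathcal G=2\pi|B|G$, $\mathcal K=2\pi|B|K$, the following holds on $\Omega\times I$ (and, for the first line, for all $\mu>0$, $c_\parallel\in\mathbb R$): $$\partial_t\mathcal G+\mathcal S^\dagger\mathcal G+\mathcal C^\dagger\mathcal K=0,\qquad \mathcal C^\dagger\mathcal G=0,$$ $$\int\mathcal K\,c_\parallel\,d\mu\,dc_\parallel=0,$$ $$u_\perp=\frac{E\times b}{|B|}+\frac{b\times\nabla_xp_\perp}{n|B|}+\frac{p_\parallel-p_\perp}{n|B|}\,\mathbf f,$$ $$-3(b\cdot\nabla_x)\big(\nabla_x\cdot(p_\parallel u_\parallel b)\big)+2\nabla_x\cdot\big(u_\parallel\,\nabla_x\cdot(p_\parallel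 b)\,b\big)+(E\cdot b)\nabla_x\cdot(nu_\parallel b)+(\nabla_x\cdot b)\nabla_x\cdot\big((-3p_\parallel+p_\perp)u_\parallel b\big)+p_\perp(\nabla_x\cdot b)^2u_\parallel=R_3.$$ Here $n=\int\mathcal G\,d\mu dc_\parallel$, $p_\perp=\int\mathcal G\mu|B|\,d\mu dc_\parallel$, $p_\parallel=\int\mathcal Gc_\parallel^2\,d\mu dc_\parallel$, $\mathbb P=p_\perp(\mathrm{Id}-b\otimes b)+p_\parallel b\otimes b$, $\mathbb F=\frac{\nabla_x\cdot\mathbb P}{n}$, $\Phi=\frac1{|B|}(\mathbb F-\mu\nabla_x|B|)$, $$\mathcal C^\dagger\mathcal H=\nabla_x\cdot(c_\parallel\mathcal H\,b)+\partial_{c_\parallel}\big((B\cdot\Phi)\mathcal H\big),$$ $$\begin{aligned}\mathcal S^\dagger\mathcal G={}&\nabla_x\cdot\Big[\Big(u+\mu\nabla_x\times b-b\times\Phi+\big(\tfrac{c_\parallel^2}{|B|}-\mu\big)\mathbf f\Big)\mathcal G\Big]+\partial_{c_\parallel}\Big[\Big(-\nabla_xu:(b\otimes b)+\mu\nabla_x\cdot\mathbf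 f+\Phi\cdot\mathbf f\Big)c_\parallel\mathcal G\Big]\\&+\partial_\mu\Big[\Big(-(\partial_t+u\cdot\nabla_x)\ln|B|-\nabla_x\cdot u+\nabla_xu:(b\otimes b)+\tfrac1{|B|}\nabla_x\cdot(B\times\Phi)-\big(\tfrac{c_\parallel^2}{|B|}\nabla_x\cdot\mathbf f+\Phi\cdot\mathbf f\big)\Big)\mu\,\mathcal G\Big].\end{aligned}$$ With $M_{m,q}=\int\mathcal Gc_\parallel^m\mu^q\,d\mu dc_\parallel$, $K_{m,q}=\int\mathcal Kc_\parallel^m\mu^q\,d\mu dc_\parallel$, the right-hand side, which does not involve $u_\parallel$ ($u_\perp$ stands for its expression above), is $$R_3=-(b\cdot\nabla_x)R_1-(E\cdot b)\nabla_x\cdot(nu_\perp)-(\nabla_x\cdot b)(R_1-R_2)+n\,\partial_t(E\cdot b)-\partial_tb\cdot\nabla_xp_\parallel-(p_\parallel-p_\perp)\nabla_x\cdot\partial_tb,$$ $$\begin{aligned}R_1={}&-\nabla_x\cdot\Big[p_\parallel\big(u_\perp-\tfrac{b\times\mathbb F}{|B|}\big)+\big(|B|\nabla_x\times\tfrac b{|B|}-\mathbf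 f\big)M_{2,1}+\tfrac{\mathbf f}{|B|}M_{4,0}\Big]+2\Big[-\nabla_xu_\perp:(b\otimes b)+\tfrac{\mathbb F}{|B|}\cdot\mathbf f\Big]p_\parallel\\&+2|B|\big(\nabla_x\cdot\tfrac{\mathbf f}{|B|}\big)M_{2,1}-\nabla_x\cdot(K_{3,0}b)+2(b\cdot\mathbb F)K_{1,0}-2(b\cdot\nabla_x|B|)K_{1,1},\end{aligned}$$ $$\begin{aligned}R_2={}&-\nabla_x\cdot\Big[\big(u_\perp-\tfrac{b\times\mathbb F}{|B|}\big)p_\perp+\big(|B|\nabla_x\times\tfrac b{|B|}-\mathbf f\big)|B|M_{0,2}+\mathbf fM_{2,1}\Big]-\big(\nabla_x\cdot\tfrac{\mathbf f}{|B|}\big)|B|M_{2,1}-|B|\nabla_x\cdot(K_{1,1}b)\\&+\Big[\nabla_xu_\perp:(b\otimes b)-\tfrac{\mathbb F}{|B|}\cdot\mathbf f-\nabla_x\cdot u_\perp+\nabla_x\cdot\tfrac{b\times\mathbb F}{|B|}\Big]p_\perp.\end{aligned}$$ -/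

import Mathlib

open MeasureTheory Set Filter Topology
open scoped ContDiff

noncomputable section

namespace DriftKinetic

/-! ### Vector calculus in three dimensions -/

/-- Euclidean three-space (positions and velocities). -/
abbrev V3 : Type := EuclideanSpace ℝ (Fin 3)

/-- The canonical basis vectors. -/
def e (i : Fin 3) : V3 := EuclideanSpace.single i 1

/-- The vector product `a × b`. -/
def cross (a b : V3) : V3 :=
  WithLp.toLp 2 (crossProduct (WithLp.ofLp a) (WithLp.ofLp b))

/-- Divergence `∇ₓ · v` of a vector field. -/
def dvg (v : V3 → V3) (x : V3) : ℝ := ∑ i : Fin 3, (fderiv ℝ v x (e i)) i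

/-- Curl `∇ₓ × v = ∑ᵢ eᵢ × ∂ᵢ v` of a vector field. -/
def curl (v : V3 → V3) (x : V3) : V3 := ∑ i : Fin 3, cross (e i) (fderiv ℝ v x (e i))

/-- Divergence of a tensor field, `(∇ₓ · P)ⱼ = ∑ᵢ ∂ᵢ Pᵢⱼ`. -/
def tensorDvg (P : V3 → Matrix (Fin 3) (Fin 3) ℝ) (x : V3) : V3 :=
  WithLp.toLp 2 (fun j => ∑ i : Fin 3, fderiv ℝ (fun y => P y i j) x (e i))

/-- The tensor product `a ⊗ b`. -/
def tens (a b : V3) : Matrix (Fin 3) (Fin 3) ℝ := Matrix.of (fun i j => a i * b j)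

/-- Scalar fields `(x, t) ↦ φ x t`. -/
abbrev SField : Type := V3 → ℝ → ℝ

/-- Vector fields `(x, t) ↦ v x t`. -/
abbrev VField : Type := V3 → ℝ → V3

/-- Distribution functions `(x, c, t) ↦ g x c t` of the full random velocity `c`. -/
abbrev Distr : Type := V3 → V3 → ℝ → ℝ

/-- Reduced distribution functions `(x, μ, c∥, t) ↦ G x μ c∥ t`. -/
abbrev RDistr : Type := V3 → ℝ → ℝ → ℝ → ℝ

/-! ### The scaled Vlasov / momentum system -/

/-- Density `∫ g dc`. -/
def density (g : Distr) : SField := fun x t => ∫ c : V3, g x c t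

/-- Pressure tensor `∫ g c ⊗ c dc`. -/
def pressure (g : Distr) (x : V3) (t : ℝ) : Matrix (Fin 3) (Fin 3) ℝ :=
  Matrix.of (fun i j => ∫ c : V3, g x c t * (c i * c j))

/-- Left-hand side of the scaled Vlasov equation for the distribution of random velocities:
`∂ₜg + u·∇ₓg - c·(∇ₓu)∇_c g + ε⁻¹ (c·∇ₓg + (∇ₓ·P / n)·∇_c g) + ε⁻² (c × B)·∇_c g`,
where `∇ₓu` is the matrix `(∂ᵢ uⱼ)ᵢⱼ`, so `c·(∇ₓu)∇_c g = ((c·∇ₓ)u)·∇_c g`. -/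
def vlasovLHS (B : VField) (ε : ℝ) (g : Distr) (u : VField) (x c : V3) (t : ℝ) : ℝ :=
  deriv (fun s => g x c s) t
    + inner ℝ (u x t) (gradient (fun y => g y c t) x)
    - inner ℝ (fderiv ℝ (fun y => u y t) x c) (gradient (fun c' => g x c' t) c)
    + ε⁻¹ * (inner ℝ c (gradient (fun y => g y c t) x)
        + inner ℝ ((density g x t)⁻¹ • tensorDvg (fun y => pressure g y t) x)
            (gradient (fun c' => g x c' t) c))
    + (ε ^ 2)⁻¹ * inner ℝ (cross c (B x t)) (gradient (fun c' => g x c' t) c)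

/-- Left-hand side of the scaled momentum equation:
`∂ₜ(n u) + ∇ₓ·(n u ⊗ u) + ε⁻² (∇ₓ·P - n (E + u × B))`. -/
def momentumLHS (E B : VField) (ε : ℝ) (g : Distr) (u : VField) (x : V3) (t : ℝ) : V3 :=
  deriv (fun s => density g x s • u x s) t
    + tensorDvg (fun y => density g y t • tens (u y t) (u y t)) x
    + (ε ^ 2)⁻¹ • (tensorDvg (fun y => pressure g y t) x
        - density g x t • (E x t + cross (u x t) (B x t)))

/-- A family `(gᵋ, uᵋ)` solves the scaled Vlasov / momentum system on `Ω × I` in the formal sense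
as `ε → 0⁺`: both left-hand sides tend to `0` pointwise (they vanish identically if the family
consists of exact solutions; they are `O(ε)` if it is the truncation, at second order, of a formal
power series solution), and `cᵋ` is the random part of the velocity, `∫ gᵋ c dc = 0`. -/
structure FormalSolution (Ω : Set V3) (I : Set ℝ) (E B : VField)
    (g : ℝ → Distr) (u : ℝ → VField) : Prop where
  vlasov : ∀ x ∈ Ω, ∀ t ∈ I, ∀ c : V3,
    Tendsto (fun ε => vlasovLHS B ε (g ε) (u ε) x c t) (𝓝[>] 0) (𝓝 0)
  momentum : ∀ x ∈ Ω, ∀ t ∈ I,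
    Tendsto (fun ε => momentumLHS E B ε (g ε) (u ε) x t) (𝓝[>] 0) (𝓝 0)
  mean_zero : ∀ᶠ ε in 𝓝[>] (0 : ℝ), ∀ x ∈ Ω, ∀ t ∈ I, ∫ c : V3, g ε x c t • c = 0

/-! ### Hilbert expansions -/

/-- A distribution function as a function on `(x, c, t)`-space. -/
def onPhase (g : Distr) : V3 × V3 × ℝ → ℝ := fun z => g z.1 z.2.1 z.2.2

/-- A vector field as a function on `(x, t)`-space. -/
def onSpaceTime (v : VField) : V3 × ℝ → V3 := fun z => v z.1 z.2

/-- `g` is smooth on `Ω × ℝ³ × I` and all its derivatives decay faster than any power of `|c|`,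
locally uniformly in `(x, t)`. -/
def SmoothRapid (Ω : Set V3) (I : Set ℝ) (g : Distr) : Prop :=
  ContDiffOn ℝ ∞ (onPhase g) (Ω ×ˢ (univ : Set V3) ×ˢ I) ∧
  ∀ C : Set (V3 × ℝ), IsCompact C → C ⊆ Ω ×ˢ I → ∀ N j : ℕ, ∃ M : ℝ, ∀ p ∈ C, ∀ c : V3,
    (1 + ‖c‖) ^ N * ‖iteratedFDeriv ℝ j (onPhase g) (p.1, c, p.2)‖ ≤ M

/-- The family `(gᵋ, uᵋ)` admits the Hilbert expansion
`gᵋ = g₀ + ε g₁ + ε² g₂ + o(ε²)`, `uᵋ = u₀ + ε u₁ + ε² u₂ + o(ε²)` as `ε → 0⁺`, with smooth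
coefficients; the remainder is understood together with its first derivatives, locally uniformly in
`(x, t)` and, for `g`, with arbitrary polynomial weights in `c`. -/
structure HilbertExpansion (Ω : Set V3) (I : Set ℝ) (g : ℝ → Distr) (u : ℝ → VField)
    (gc : ℕ → Distr) (uc : ℕ → VField) : Prop where
  coeff_g : ∀ k < 3, SmoothRapid Ω I (gc k)
  coeff_u : ∀ k < 3, ContDiffOn ℝ ∞ (onSpaceTime (uc k)) (Ω ×ˢ I)
  reg_g : ∀ᶠ ε in 𝓝[>] (0 : ℝ), ContDiffOn ℝ 1 (onPhase (g ε)) (Ω ×ˢ (univ : Set V3) ×ˢ I)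
  reg_u : ∀ᶠ ε in 𝓝[>] (0 : ℝ), ContDiffOn ℝ 1 (onSpaceTime (u ε)) (Ω ×ˢ I)
  rem_g : ∀ C : Set (V3 × ℝ), IsCompact C → C ⊆ Ω ×ˢ I → ∀ N : ℕ, ∀ j ≤ 1, ∀ η > (0 : ℝ),
    ∀ᶠ ε in 𝓝[>] (0 : ℝ), ∀ p ∈ C, ∀ c : V3,
      (1 + ‖c‖) ^ N * ‖iteratedFDeriv ℝ j
        (fun z => onPhase (g ε) z - ∑ k ∈ Finset.range 3, ε ^ k * onPhase (gc k) z)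
        (p.1, c, p.2)‖ ≤ η * ε ^ 2
  rem_u : ∀ C : Set (V3 × ℝ), IsCompact C → C ⊆ Ω ×ˢ I → ∀ j ≤ 1, ∀ η > (0 : ℝ),
    ∀ᶠ ε in 𝓝[>] (0 : ℝ), ∀ p ∈ C,
      ‖iteratedFDeriv ℝ j
        (fun z => onSpaceTime (u ε) z - ∑ k ∈ Finset.range 3, ε ^ k • onSpaceTime (uc k) z)
        p‖ ≤ η * ε ^ 2

/-! ### Magnetic geometry -/

/-- Director of the magnetic field, `b = B / |B|`. -/
def bdir (B : VField) : VField := fun x t => ‖B x t‖⁻¹ • B x t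

/-- Parallel velocity `c∥ = c · b`. -/
def cPar (B : VField) (x c : V3) (t : ℝ) : ℝ := inner ℝ c (bdir B x t)

/-- Magnetic moment `μ = (|c|² - c∥²) / (2 |B|)`. -/
def magMoment (B : VField) (x c : V3) (t : ℝ) : ℝ :=
  (1 / ‖B x t‖) * ((‖c‖ ^ 2 - cPar B x c t ^ 2) / 2)

/-- Parallel bulk velocity `u∥ = u · b`. -/
def uPar (B u : VField) : SField := fun x t => inner ℝ (u x t) (bdir B x t)

/-- Perpendicular bulk velocity `u⊥ = b × (u × b)`. -/
def uPerp (B u : VField) : VField := fun x t =>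
  cross (bdir B x t) (cross (u x t) (bdir B x t))

/-- `(b · ∇ₓ) b`. -/
def curvature (B : VField) : VField := fun x t =>
  fderiv ℝ (fun y => bdir B y t) x (bdir B x t)

/-- `f = b × (b · ∇ₓ) b`. -/
def fvec (B : VField) : VField := fun x t => cross (bdir B x t) (curvature B x t)

/-- `∇ₓ · b`. -/
def divb (B : VField) : SField := fun x t => dvg (fun y => bdir B y t) x

/-- `∇ₓ |B|`. -/
def gradB (B : VField) : VField := fun x t => gradient (fun y => ‖B y t‖) x

/-- `(∇ₓ u) : (b ⊗ b) = ∑ᵢⱼ ∂ᵢuⱼ bᵢ bⱼ`. -/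
def stretch (B u : VField) : SField := fun x t =>
  inner ℝ (fderiv ℝ (fun y => u y t) x (bdir B x t)) (bdir B x t)

/-! ### Moments of the reduced distribution functions -/

/-- `2 π |B| G`. -/
def weighted (B : VField) (G : RDistr) : RDistr := fun x μ c t =>
  2 * Real.pi * ‖B x t‖ * G x μ c t

/-- The domain `{(μ, c∥) : μ > 0, c∥ ∈ ℝ}`. -/
def domMu : Set (ℝ × ℝ) := Ioi 0 ×ˢ univ

/-- Moments `∫ H c∥ᵐ μ^q dμ dc∥` (`M_{m,q}` for `H = 𝒢`, `K_{m,q}` for `H = 𝒦`). -/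
def mom (H : RDistr) (m q : ℕ) : SField := fun x t =>
  ∫ p in domMu, H x p.1 p.2 t * (p.2 ^ m * p.1 ^ q)

/-- `n = ∫ 𝒢 dμ dc∥`. -/
def dens (H : RDistr) : SField := fun x t => ∫ p in domMu, H x p.1 p.2 t

/-- `p⊥ = ∫ 𝒢 μ |B| dμ dc∥`. -/
def pPerp (B : VField) (H : RDistr) : SField := fun x t =>
  ∫ p in domMu, H x p.1 p.2 t * (p.1 * ‖B x t‖)

/-- `p∥ = ∫ 𝒢 c∥² dμ dc∥`. -/
def pPar (H : RDistr) : SField := fun x t => ∫ p in domMu, H x p.1 p.2 t * p.2 ^ 2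

/-- The gyrotropic pressure tensor `P = p⊥ (Id - b ⊗ b) + p∥ b ⊗ b`. -/
def gyroPressure (B : VField) (H : RDistr) (x : V3) (t : ℝ) : Matrix (Fin 3) (Fin 3) ℝ :=
  pPerp B H x t • (1 - tens (bdir B x t) (bdir B x t))
    + pPar H x t • tens (bdir B x t) (bdir B x t)

/-- `F = (∇ₓ · P) / n`. -/
def force (B : VField) (H : RDistr) : VField := fun x t =>
  (dens H x t)⁻¹ • tensorDvg (fun y => gyroPressure B H y t) x

/-- `Φ = (F - μ ∇ₓ|B|) / |B|`, a function of `(x, μ, t)`. -/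
def phi (B : VField) (H : RDistr) (x : V3) (μ t : ℝ) : V3 :=
  (1 / ‖B x t‖) • (force B H x t - μ • gradB B x t)

/-! ### The operators of the limit model -/

/-- `C† H = ∇ₓ·(c∥ H b) + ∂_{c∥}((B·Φ) H)`, where `Φ` is computed from `𝒢`. -/
def Cdag (B : VField) (𝒢 H : RDistr) (x : V3) (μ c t : ℝ) : ℝ :=
  dvg (fun y => (c * H y μ c t) • bdir B y t) x
    + deriv (fun c' => inner ℝ (B x t) (phi B 𝒢 x μ t) * H x μ c' t) c

/-- The spatial drift
`u + μ ∇ₓ × b - b × Φ + (c∥² / |B| - μ) f`. -/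
def driftX (B u : VField) (𝒢 : RDistr) (x : V3) (μ c t : ℝ) : V3 :=
  u x t + μ • curl (fun y => bdir B y t) x - cross (bdir B x t) (phi B 𝒢 x μ t)
    + (c ^ 2 / ‖B x t‖ - μ) • fvec B x t

/-- `- (∇ₓu) : (b ⊗ b) + μ ∇ₓ·f + Φ·f`. -/
def rateC (B u : VField) (𝒢 : RDistr) (x : V3) (μ t : ℝ) : ℝ :=
  - stretch B u x t + μ * dvg (fun y => fvec B y t) x + inner ℝ (phi B 𝒢 x μ t) (fvec B x t)

/-- `- (∂ₜ + u·∇ₓ) ln|B| - ∇ₓ·u + ∇ₓu : (b ⊗ b) + |B|⁻¹ ∇ₓ·(B × Φ) - (c∥²/|B| ∇ₓ·f + Φ·f)`. -/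
def rateMu (B u : VField) (𝒢 : RDistr) (x : V3) (μ c t : ℝ) : ℝ :=
  - (deriv (fun s => Real.log ‖B x s‖) t
      + inner ℝ (u x t) (gradient (fun y => Real.log ‖B y t‖) x))
    - dvg (fun y => u y t) x
    + stretch B u x t
    + 1 / ‖B x t‖ * dvg (fun y => cross (B y t) (phi B 𝒢 y μ t)) x
    - (c ^ 2 / ‖B x t‖ * dvg (fun y => fvec B y t) x + inner ℝ (phi B 𝒢 x μ t) (fvec B x t))

/-- `S† 𝒢`: the divergence in `(x, c∥, μ)` of `𝒢` times the drift. -/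
def Sdag (B u : VField) (𝒢 : RDistr) (x : V3) (μ c t : ℝ) : ℝ :=
  dvg (fun y => 𝒢 y μ c t • driftX B u 𝒢 y μ c t) x
    + deriv (fun c' => rateC B u 𝒢 x μ t * c' * 𝒢 x μ c' t) c
    + deriv (fun μ' => rateMu B u 𝒢 x μ' c t * μ' * 𝒢 x μ' c t) μ

/-! ### The bulk velocity of the limit model -/

/-- The sum of the `E × B` drift, the diamagnetic drift and the curvature-anisotropy drift:
`(E × b)/|B| + (b × ∇ₓp⊥)/(n|B|) + (p∥ - p⊥)/(n|B|) f`. -/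
def driftPerp (E B : VField) (𝒢 : RDistr) : VField := fun x t =>
  (1 / ‖B x t‖) • cross (E x t) (bdir B x t)
    + (1 / (dens 𝒢 x t * ‖B x t‖)) •
        cross (bdir B x t) (gradient (fun y => pPerp B 𝒢 y t) x)
    + ((pPar 𝒢 x t - pPerp B 𝒢 x t) / (dens 𝒢 x t * ‖B x t‖)) • fvec B x t

/-- The anisotropic elliptic operator along the field lines, applied to `w = u∥`:
`-3 (b·∇ₓ)(∇ₓ·(p∥ w b)) + 2 ∇ₓ·(w ∇ₓ·(p∥ b) b) + (E·b) ∇ₓ·(n w b)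
  + (∇ₓ·b) ∇ₓ·((-3 p∥ + p⊥) w b) + p⊥ (∇ₓ·b)² w`. -/
def ellipticLHS (E B : VField) (𝒢 : RDistr) (w : SField) (x : V3) (t : ℝ) : ℝ :=
  -3 * inner ℝ (bdir B x t)
      (gradient (fun z => dvg (fun y => (pPar 𝒢 y t * w y t) • bdir B y t) z) x)
    + 2 * dvg (fun z => (w z t * dvg (fun y => pPar 𝒢 y t • bdir B y t) z) • bdir B z t) x
    + inner ℝ (E x t) (bdir B x t) * dvg (fun y => (dens 𝒢 y t * w y t) • bdir B y t) x
    + divb B x t * dvg (fun y => ((-3 * pPar 𝒢 y t + pPerp B 𝒢 y t) * w y t) • bdir B y t) x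
    + pPerp B 𝒢 x t * divb B x t ^ 2 * w x t

/-- `(b × F) / |B|`. -/
def bF (B : VField) (𝒢 : RDistr) : VField := fun x t =>
  (1 / ‖B x t‖) • cross (bdir B x t) (force B 𝒢 x t)

/-- `|B| (∇ₓ × (b / |B|)) - f`. -/
def magDrift (B : VField) : VField := fun x t =>
  ‖B x t‖ • curl (fun y => (1 / ‖B y t‖) • bdir B y t) x - fvec B x t

/-- `∇ₓ · (f / |B|)`. -/
def divfB (B : VField) : SField := fun x t => dvg (fun y => (1 / ‖B y t‖) • fvec B y t) x

/-- The source term `R₁` (the part of `∂ₜ p∥` that does not involve `u∥`). The perpendicular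
velocity enters through its explicit expression `driftPerp`, so that `R₁`, `R₂` and `R₃` depend
on `E`, `B`, `𝒢`, `𝒦` only. -/
def R1 (E B : VField) (𝒢 𝒦 : RDistr) : SField := fun x t =>
  - dvg (fun y => pPar 𝒢 y t • (driftPerp E B 𝒢 y t - bF B 𝒢 y t)
        + mom 𝒢 2 1 y t • magDrift B y t
        + (mom 𝒢 4 0 y t / ‖B y t‖) • fvec B y t) x
    + 2 * (- stretch B (driftPerp E B 𝒢) x t
        + inner ℝ ((1 / ‖B x t‖) • force B 𝒢 x t) (fvec B x t)) * pPar 𝒢 x t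
    + 2 * ‖B x t‖ * divfB B x t * mom 𝒢 2 1 x t
    - dvg (fun y => mom 𝒦 3 0 y t • bdir B y t) x
    + 2 * inner ℝ (bdir B x t) (force B 𝒢 x t) * mom 𝒦 1 0 x t
    - 2 * inner ℝ (bdir B x t) (gradB B x t) * mom 𝒦 1 1 x t

/-- The source term `R₂` (the part of `∂ₜ p⊥` that does not involve `u∥`). -/
def R2 (E B : VField) (𝒢 𝒦 : RDistr) : SField := fun x t =>
  - dvg (fun y => pPerp B 𝒢 y t • (driftPerp E B 𝒢 y t - bF B 𝒢 y t)
        + (‖B y t‖ * mom 𝒢 0 2 y t) • magDrift B y t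
        + mom 𝒢 2 1 y t • fvec B y t) x
    + (stretch B (driftPerp E B 𝒢) x t
        - inner ℝ ((1 / ‖B x t‖) • force B 𝒢 x t) (fvec B x t)
        - dvg (fun y => driftPerp E B 𝒢 y t) x
        + dvg (fun y => bF B 𝒢 y t) x) * pPerp B 𝒢 x t
    - divfB B x t * ‖B x t‖ * mom 𝒢 2 1 x t
    - ‖B x t‖ * dvg (fun y => mom 𝒦 1 1 y t • bdir B y t) x

/-- The right-hand side `R₃` of the elliptic equation:
`-(b·∇ₓ)R₁ - (E·b) ∇ₓ·(n u⊥) - (∇ₓ·b)(R₁ - R₂) + n ∂ₜ(E·b) - ∂ₜb·∇ₓp∥ - (p∥ - p⊥) ∇ₓ·∂ₜb`. -/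
def R3 (E B : VField) (𝒢 𝒦 : RDistr) : SField := fun x t =>
  - inner ℝ (bdir B x t) (gradient (fun y => R1 E B 𝒢 𝒦 y t) x)
    - inner ℝ (E x t) (bdir B x t) * dvg (fun y => dens 𝒢 y t • driftPerp E B 𝒢 y t) x
    - divb B x t * (R1 E B 𝒢 𝒦 x t - R2 E B 𝒢 𝒦 x t)
    + dens 𝒢 x t * deriv (fun s => inner ℝ (E x s) (bdir B x s)) t
    - inner ℝ (deriv (fun s => bdir B x s) t) (gradient (fun y => pPar 𝒢 y t) x)
    - (pPar 𝒢 x t - pPerp B 𝒢 x t) * dvg (fun y => deriv (fun s => bdir B y s) t) x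

/-! ### Regularity of reduced distribution functions -/

/-- `G` is continuous for `μ ≥ 0`, smooth for `μ > 0`, and all its `(μ, c∥)`-moments are finite and
depend smoothly on `(x, t)`. -/
structure RegularReduced (Ω : Set V3) (I : Set ℝ) (G : RDistr) : Prop where
  continuous : ContinuousOn (fun z : V3 × ℝ × ℝ × ℝ => G z.1 z.2.1 z.2.2.1 z.2.2.2)
    (Ω ×ˢ Ici (0 : ℝ) ×ˢ (univ : Set ℝ) ×ˢ I)
  smooth : ContDiffOn ℝ ∞ (fun z : V3 × ℝ × ℝ × ℝ => G z.1 z.2.1 z.2.2.1 z.2.2.2)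
    (Ω ×ˢ Ioi (0 : ℝ) ×ˢ (univ : Set ℝ) ×ˢ I)
  integrable : ∀ x ∈ Ω, ∀ t ∈ I, ∀ m q : ℕ,
    IntegrableOn (fun p : ℝ × ℝ => G x p.1 p.2 t * (p.2 ^ m * p.1 ^ q)) domMu
  moments : ∀ m q : ℕ,
    ContDiffOn ℝ ∞ (fun z : V3 × ℝ => mom G m q z.1 z.2) (Ω ×ˢ I)

end DriftKinetic

end

open DriftKinetic

/-!
The theorem is the averaging of a fast gyration, followed by one compatibility condition.

*Orders in `ε`.* The momentum equation forces `∇ · P₀ = n₀ (E + u₀ × B)`, with an error that is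
controlled to the next order (`tensorDvg_pressure_eq`, `force_isLittleO`). Hence the Vlasov equation
can be read off at the orders `ε⁻²`, `ε⁻¹`, `ε⁰` (`vlasov_orders`); the outcome is `KineticHierarchy`.

*Averaging.* At order `ε⁻²` the coefficient `g₀` is constant along the gyration, so it is a function
of `(x, |c|² / 2, c · b, t)`. The gyro-average of the order `ε⁻¹` is the constraint `C† 𝒢 = 0`
(`streamAvg_zeroth`); its oscillating part determines `g₁` up to a gyro-invariant function
(`first_eq`), namely the gyro-average `K`. The oscillating part is explicit, because the
derivatives along the streaming of the gyro-invariant variables are, up to their averages,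
derivatives along the gyration (`stream_gyroVars`). The average of the order `ε⁰` is then the
transport equation (`transport`). The variables `(x, E, s, t)`, with `E` the kinetic energy, keep
these averages polynomial; `reduced_constraint` and `reduced_transport` pass to `(x, μ, s, t)`, and
`Sdag_weighted`, `Cdag_weighted` to divergence form, which rests on the Liouville property
`liouville` of the drift.

*Fluid equations.* Moments are computed in velocity space from the hierarchy (`balance`, `flux`)
rather than by integrating the reduced equations by parts, so no boundary terms at `μ = 0` occur.
They give the continuity equation and the evolution of both pressures (`continuity`,
`parallel_pressure`, `perpendicular_pressure`). The leading momentum equation, for a gyrotropic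
pressure, gives `u_⊥` (`uPerp_eq`) and `n E · b = b · ∇p_∥ + (p_∥ - p_⊥) ∇ · b`
(`parallel_force_balance`). The last relation has no time derivative; differentiating it in time
and inserting the evolution equations gives the equation for `u_∥` (`elliptic_of_constraint`).
-/

noncomputable section

namespace DriftKinetic

section

/-! ### Functions of moderate growth and of rapid decay in the velocity -/

/-- Space-time, the domain of the fields. -/
abbrev SpaceTime : Type := V3 × ℝ

/-- Phase space-time: points `(x, c, t)`. -/
abbrev Phase : Type := V3 × V3 × ℝ

/-- The part of phase space-time that lies over `Ω × I`. -/
def phaseSet (Ω : Set V3) (I : Set ℝ) : Set Phase := Ω ×ˢ (univ : Set V3) ×ˢ I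

/-- The foot point `(x, t)` of `(x, c, t)`, as a continuous linear map. -/
def foot : Phase →L[ℝ] SpaceTime :=
  (ContinuousLinearMap.fst ℝ V3 (V3 × ℝ)).prod
    ((ContinuousLinearMap.snd ℝ V3 ℝ).comp (ContinuousLinearMap.snd ℝ V3 (V3 × ℝ)))

@[simp] lemma foot_apply (z : Phase) : foot z = (z.1, z.2.2) := rfl

/-- The inclusion `(x, t) ↦ (x, 0, t)`. -/
def lift : SpaceTime →L[ℝ] Phase :=
  (ContinuousLinearMap.fst ℝ V3 ℝ).prod
    ((0 : SpaceTime →L[ℝ] V3).prod (ContinuousLinearMap.snd ℝ V3 ℝ))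

@[simp] lemma lift_apply (w : SpaceTime) : lift w = (w.1, 0, w.2) := rfl

variable {Ω : Set V3} {I : Set ℝ} {F G H : Type} [NormedAddCommGroup F] [NormedSpace ℝ F]
  [NormedAddCommGroup G] [NormedSpace ℝ G] [NormedAddCommGroup H] [NormedSpace ℝ H]

lemma isOpen_phaseSet (hΩ : IsOpen Ω) (hI : IsOpen I) : IsOpen (phaseSet Ω I) :=
  hΩ.prod (isOpen_univ.prod hI)

/-- Smooth functions on phase space which, with all derivatives, decay faster than any power of
`|c|`, locally uniformly in `(x, t)`; for scalar functions this is `SmoothRapid`. -/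
def Rapid (Ω : Set V3) (I : Set ℝ) (f : Phase → F) : Prop :=
  ContDiffOn ℝ ∞ f (phaseSet Ω I) ∧
  ∀ C : Set SpaceTime, IsCompact C → C ⊆ Ω ×ˢ I → ∀ N j : ℕ, ∃ M : ℝ, ∀ p ∈ C, ∀ c : V3,
    (1 + ‖c‖) ^ N * ‖iteratedFDeriv ℝ j f (p.1, c, p.2)‖ ≤ M

/-- Smooth functions on phase space each of whose derivatives grows at most polynomially in `|c|`,
locally uniformly in `(x, t)`. -/
def Moderate (Ω : Set V3) (I : Set ℝ) (f : Phase → F) : Prop :=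
  ContDiffOn ℝ ∞ f (phaseSet Ω I) ∧
  ∀ C : Set SpaceTime, IsCompact C → C ⊆ Ω ×ˢ I → ∀ j : ℕ, ∃ N : ℕ, ∃ M : ℝ, ∀ p ∈ C, ∀ c : V3,
    ‖iteratedFDeriv ℝ j f (p.1, c, p.2)‖ ≤ M * (1 + ‖c‖) ^ N

lemma SmoothRapid.rapid {g : Distr} (h : SmoothRapid Ω I g) : Rapid Ω I (onPhase g) := h

lemma mem_phaseSet_of_mem {C : Set SpaceTime} (hC : C ⊆ Ω ×ˢ I) {p : SpaceTime} (hp : p ∈ C)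
    (c : V3) : ((p.1, c, p.2) : Phase) ∈ phaseSet Ω I :=
  ⟨(hC hp).1, mem_univ _, (hC hp).2⟩

section Closure

variable (hΩ : IsOpen Ω) (hI : IsOpen I)
include hΩ hI

lemma iteratedFDeriv_bilin_le (L : F →L[ℝ] G →L[ℝ] H) {f : Phase → F} {g : Phase → G}
    (hf : ContDiffOn ℝ ∞ f (phaseSet Ω I)) (hg : ContDiffOn ℝ ∞ g (phaseSet Ω I)) (j : ℕ)
    {z : Phase} (hz : z ∈ phaseSet Ω I) :
    ‖iteratedFDeriv ℝ j (fun y => L (f y) (g y)) z‖ ≤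
      ‖L‖ * ∑ i ∈ Finset.range (j + 1), (j.choose i : ℝ) * ‖iteratedFDeriv ℝ i f z‖ *
        ‖iteratedFDeriv ℝ (j - i) g z‖ := by
  have hS := isOpen_phaseSet hΩ hI
  have := L.norm_iteratedFDerivWithin_le_of_bilinear hf hg hS.uniqueDiffOn hz
    (n := j) (by exact_mod_cast le_top)
  simpa only [iteratedFDerivWithin_of_isOpen _ hS hz] using this

lemma Moderate.bilin (L : F →L[ℝ] G →L[ℝ] H) {f : Phase → F} {g : Phase → G}
    (hf : Moderate Ω I f) (hg : Moderate Ω I g) : Moderate Ω I (fun y => L (f y) (g y)) := by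
  refine ⟨L.isBoundedBilinearMap.contDiff.comp_contDiffOn (hf.1.prodMk hg.1), ?_⟩
  intro C hC hCs j
  choose N M hM using fun i => hf.2 C hC hCs i
  choose N' M' hM' using fun i => hg.2 C hC hCs i
  let NN := ∑ i ∈ Finset.range (j + 1), (N i + N' (j - i))
  refine ⟨NN, ‖L‖ * ∑ i ∈ Finset.range (j + 1), (j.choose i : ℝ) * |M i| * |M' (j - i)|, ?_⟩
  intro p hp c
  refine (iteratedFDeriv_bilin_le hΩ hI L hf.1 hg.1 j (mem_phaseSet_of_mem hCs hp c)).trans ?_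
  rw [mul_assoc, Finset.sum_mul]
  refine mul_le_mul_of_nonneg_left (Finset.sum_le_sum fun i hi => ?_) (by positivity)
  have h1 : (1 : ℝ) ≤ 1 + ‖c‖ := by linarith [norm_nonneg c]
  have hN : N i + N' (j - i) ≤ NN :=
    Finset.single_le_sum (f := fun i => N i + N' (j - i)) (fun _ _ => Nat.zero_le _) hi
  calc (j.choose i : ℝ) * ‖iteratedFDeriv ℝ i f (p.1, c, p.2)‖ *
          ‖iteratedFDeriv ℝ (j - i) g (p.1, c, p.2)‖
      ≤ (j.choose i : ℝ) * (|M i| * (1 + ‖c‖) ^ N i) * (|M' (j - i)| * (1 + ‖c‖) ^ N' (j - i)) := by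
        gcongr
        · exact (hM i p hp c).trans (by gcongr; exact le_abs_self _)
        · exact (hM' (j - i) p hp c).trans (by gcongr; exact le_abs_self _)
    _ = (j.choose i : ℝ) * |M i| * |M' (j - i)| * (1 + ‖c‖) ^ (N i + N' (j - i)) := by
        rw [pow_add]; ring
    _ ≤ _ := by gcongr

lemma Rapid.bilin (L : F →L[ℝ] G →L[ℝ] H) {f : Phase → F} {g : Phase → G}
    (hf : Moderate Ω I f) (hg : Rapid Ω I g) : Rapid Ω I (fun y => L (f y) (g y)) := by
  refine ⟨L.isBoundedBilinearMap.contDiff.comp_contDiffOn (hf.1.prodMk hg.1), ?_⟩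
  intro C hC hCs K j
  choose N M hM using fun i => hf.2 C hC hCs i
  choose M' hM' using fun n i => hg.2 C hC hCs n i
  refine ⟨‖L‖ * ∑ i ∈ Finset.range (j + 1), (j.choose i : ℝ) * |M i| * M' (N i + K) (j - i), ?_⟩
  intro p hp c
  have := iteratedFDeriv_bilin_le hΩ hI L hf.1 hg.1 j (mem_phaseSet_of_mem hCs hp c)
  refine (mul_le_mul_of_nonneg_left this (by positivity)).trans ?_
  rw [mul_left_comm, Finset.mul_sum]
  refine mul_le_mul_of_nonneg_left (Finset.sum_le_sum fun i hi => ?_) (by positivity)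
  calc (1 + ‖c‖) ^ K * ((j.choose i : ℝ) * ‖iteratedFDeriv ℝ i f (p.1, c, p.2)‖ *
          ‖iteratedFDeriv ℝ (j - i) g (p.1, c, p.2)‖)
      ≤ (1 + ‖c‖) ^ K * ((j.choose i : ℝ) * (|M i| * (1 + ‖c‖) ^ N i) *
          ‖iteratedFDeriv ℝ (j - i) g (p.1, c, p.2)‖) := by
        gcongr
        exact (hM i p hp c).trans (by gcongr; exact le_abs_self _)
    _ = (j.choose i : ℝ) * |M i| * ((1 + ‖c‖) ^ (N i + K) *
          ‖iteratedFDeriv ℝ (j - i) g (p.1, c, p.2)‖) := by rw [pow_add]; ring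
    _ ≤ _ := by
        gcongr
        exact hM' (N i + K) (j - i) p hp c

lemma Moderate.add {f g : Phase → F} (hf : Moderate Ω I f) (hg : Moderate Ω I g) :
    Moderate Ω I (fun y => f y + g y) := by
  refine ⟨hf.1.add hg.1, fun C hC hCs j => ?_⟩
  obtain ⟨N, M, hM⟩ := hf.2 C hC hCs j
  obtain ⟨N', M', hM'⟩ := hg.2 C hC hCs j
  refine ⟨N + N', |M| + |M'|, fun p hp c => ?_⟩
  have hz := mem_phaseSet_of_mem hCs hp c
  have hS := (isOpen_phaseSet hΩ hI).mem_nhds hz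
  have : iteratedFDeriv ℝ j (fun y => f y + g y) (p.1, c, p.2) = _ :=
    iteratedFDeriv_add_apply ((hf.1.contDiffAt hS).of_le (by exact_mod_cast le_top))
      ((hg.1.contDiffAt hS).of_le (by exact_mod_cast le_top))
  rw [this, add_mul]
  have h1 : (1 : ℝ) ≤ 1 + ‖c‖ := by linarith [norm_nonneg c]
  refine (norm_add_le _ _).trans (add_le_add ?_ ?_)
  · refine (hM p hp c).trans (mul_le_mul (le_abs_self _) (pow_le_pow_right₀ h1 ?_) ?_ ?_) <;>
      first | omega | positivity
  · refine (hM' p hp c).trans (mul_le_mul (le_abs_self _) (pow_le_pow_right₀ h1 ?_) ?_ ?_) <;>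
      first | omega | positivity

omit hΩ hI in
lemma Moderate.const (a : F) : Moderate Ω I (fun _ => a) := by
  refine ⟨contDiffOn_const, fun C hC hCs j => ⟨0, ‖a‖, fun p hp c => ?_⟩⟩
  rcases Nat.eq_zero_or_pos j with rfl | hj
  · simp
  · rw [iteratedFDeriv_const_of_ne hj.ne']; simp

lemma Moderate.clm (L : F →L[ℝ] G) {f : Phase → F} (hf : Moderate Ω I f) :
    Moderate Ω I (fun y => L (f y)) :=
  Moderate.bilin hΩ hI (ContinuousLinearMap.id ℝ (F →L[ℝ] G)) (.const L) hf

lemma Rapid.clm (L : F →L[ℝ] G) {f : Phase → F} (hf : Rapid Ω I f) :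
    Rapid Ω I (fun y => L (f y)) :=
  Rapid.bilin hΩ hI (ContinuousLinearMap.id ℝ (F →L[ℝ] G)) (.const L) hf

omit hΩ hI in
lemma Moderate.linear (L : Phase →L[ℝ] F) : Moderate Ω I (fun y => L y) := by
  refine ⟨L.contDiff.contDiffOn, fun C hC hCs j => ?_⟩
  rcases j with _ | j
  · obtain ⟨R, hR⟩ := hC.isBounded.exists_norm_le
    refine ⟨1, ‖L‖ * (1 + |R|), fun p hp c => ?_⟩
    rw [norm_iteratedFDeriv_zero]
    refine (L.le_opNorm _).trans ?_
    rw [mul_assoc]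
    gcongr
    have h1 : ‖p.1‖ ≤ R := (norm_fst_le p).trans (hR p hp)
    have h2 : ‖p.2‖ ≤ R := (norm_snd_le p).trans (hR p hp)
    have h3 := le_abs_self R
    have h4 := norm_nonneg c
    have h5 := abs_nonneg R
    rw [pow_one]
    refine max_le ?_ (max_le ?_ ?_) <;> dsimp only <;> nlinarith
  · rcases Nat.eq_zero_or_pos j with rfl | hj
    · refine ⟨0, ‖L‖, fun p hp c => ?_⟩
      rw [← norm_iteratedFDeriv_fderiv, norm_iteratedFDeriv_zero, L.fderiv]; simp
    · refine ⟨0, 0, fun p hp c => ?_⟩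
      have : fderiv ℝ (fun y => L y) = fun _ => L := by ext1 z; exact L.fderiv
      rw [← norm_iteratedFDeriv_fderiv, this, iteratedFDeriv_const_of_ne hj.ne']; simp

lemma Moderate.differential {f : Phase → F} (hf : Moderate Ω I f) :
    Moderate Ω I (fun z => fderiv ℝ f z) := by
  refine ⟨hf.1.fderiv_of_isOpen (isOpen_phaseSet hΩ hI) (by norm_cast), fun C hC hCs j => ?_⟩
  obtain ⟨N, M, h⟩ := hf.2 C hC hCs (j + 1)
  exact ⟨N, M, fun p hp c => by rw [norm_iteratedFDeriv_fderiv]; exact h p hp c⟩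

lemma Rapid.differential {f : Phase → F} (hf : Rapid Ω I f) :
    Rapid Ω I (fun z => fderiv ℝ f z) := by
  refine ⟨hf.1.fderiv_of_isOpen (isOpen_phaseSet hΩ hI) (by norm_cast), fun C hC hCs N j => ?_⟩
  obtain ⟨M, h⟩ := hf.2 C hC hCs N (j + 1)
  exact ⟨M, fun p hp c => by rw [norm_iteratedFDeriv_fderiv]; exact h p hp c⟩

/-- A smooth field on `Ω × I`, seen as a function on phase space, has moderate growth. -/
lemma Moderate.field {a : SpaceTime → F} (ha : ContDiffOn ℝ ∞ a (Ω ×ˢ I)) :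
    Moderate Ω I (fun z => a (z.1, z.2.2)) := by
  have hW : IsOpen (Ω ×ˢ I) := hΩ.prod hI
  have hpre : foot ⁻¹' (Ω ×ˢ I) = phaseSet Ω I := by
    ext z; simp [phaseSet]
  have hfun : (fun z : Phase => a (z.1, z.2.2)) = a ∘ foot := rfl
  have hS := isOpen_phaseSet hΩ hI
  refine ⟨?_, fun C hC hCs j => ?_⟩
  · rw [hfun, ← hpre]; exact ha.comp_continuousLinearMap foot
  · have hcont : ContinuousOn (fun w => ‖iteratedFDeriv ℝ j a w‖ * ‖foot‖ ^ j) C := by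
      refine ContinuousOn.mul (ContinuousOn.norm ?_) continuousOn_const
      refine ((ha.continuousOn_iteratedFDerivWithin (m := j) (by exact_mod_cast le_top)
        hW.uniqueDiffOn).mono hCs).congr fun w hw => ?_
      rw [iteratedFDerivWithin_of_isOpen _ hW (hCs hw)]
    obtain ⟨M, hM⟩ := hC.bddAbove_image hcont
    refine ⟨0, M, fun p hp c => ?_⟩
    have hz := mem_phaseSet_of_mem hCs hp c
    have key := foot.iteratedFDerivWithin_comp_right ha hW.uniqueDiffOn
      (by rw [hpre]; exact hS.uniqueDiffOn) (x := (p.1, c, p.2)) (by exact hCs hp)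
      (i := j) (by exact_mod_cast le_top)
    rw [hpre, iteratedFDerivWithin_of_isOpen _ hS hz,
      iteratedFDerivWithin_of_isOpen _ hW (by exact hCs hp)] at key
    rw [hfun, key, pow_zero, mul_one]
    refine (ContinuousMultilinearMap.norm_compContinuousLinearMap_le _ _).trans ?_
    simp only [Finset.prod_const, Finset.card_univ, Fintype.card_fin]
    exact hM ⟨p, hp, rfl⟩

end Closure

lemma Moderate.vel : Moderate Ω I (fun z : Phase => z.2.1) :=
  Moderate.linear ((ContinuousLinearMap.fst ℝ V3 ℝ).comp (ContinuousLinearMap.snd ℝ V3 (V3 × ℝ)))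

end

section

/-! ### Smoothness of integrals that depend on a parameter -/

section ParamIntegral

variable {P Z' A F : Type} [NormedAddCommGroup P] [NormedSpace ℝ P]
  [NormedAddCommGroup Z'] [NormedSpace ℝ Z'] [NormedAddCommGroup F] [NormedSpace ℝ F]
  [TopologicalSpace A] [MeasurableSpace A] [OpensMeasurableSpace A] [SecondCountableTopology A]
  {ν : Measure A} {e : P → A → Z'} {D : P →L[ℝ] Z'} {U : Set Z'} {s : Set P}

lemma hasFDerivAt_integral_of_contDiffOn {f : Z' → F}
    (he : ∀ w a, HasFDerivAt (fun w => e w a) D w) (hec : ∀ w, Continuous (e w))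
    (hU : IsOpen U) (hs : IsOpen s) (hmem : ∀ w ∈ s, ∀ a, e w a ∈ U)
    (hf : ContDiffOn ℝ 1 f U) {w₀ : P} (hw₀ : w₀ ∈ s)
    (hint : Integrable (fun a => f (e w₀ a)) ν) {V : Set P} (hV : V ∈ 𝓝 w₀) {bound : A → ℝ}
    (hbi : Integrable bound ν)
    (hb : ∀ᵐ a ∂ν, ∀ w ∈ V, ‖fderiv ℝ f (e w a)‖ ≤ bound a) :
    HasFDerivAt (fun w => ∫ a, f (e w a) ∂ν) (∫ a, (fderiv ℝ f (e w₀ a)).comp D ∂ν) w₀ := by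
  have hmeas : ∀ w ∈ s, AEStronglyMeasurable (fun a => f (e w a)) ν := fun w hw => by
    refine Continuous.aestronglyMeasurable ?_
    exact hf.continuousOn.comp_continuous (hec w) (hmem w hw)
  have hfd : ContinuousOn (fderiv ℝ f) U := hf.continuousOn_fderiv_of_isOpen hU le_rfl
  refine hasFDerivAt_integral_of_dominated_of_fderiv_le (s := V ∩ s)
    (bound := fun a => bound a * ‖D‖)
    (F' := fun w a => (fderiv ℝ f (e w a)).comp D)
    (inter_mem hV (hs.mem_nhds hw₀)) ?_ hint ?_ ?_ (hbi.mul_const _) ?_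
  · filter_upwards [hs.mem_nhds hw₀] with w hw using hmeas w hw
  · have : SecondCountableTopologyEither A (P →L[ℝ] F) := ⟨Or.inl inferInstance⟩
    refine Continuous.aestronglyMeasurable ?_
    have : Continuous (fun a => fderiv ℝ f (e w₀ a)) :=
      hfd.comp_continuous (hec w₀) (hmem w₀ hw₀)
    exact this.clm_comp continuous_const
  · filter_upwards [hb] with a ha w hw
    refine (ContinuousLinearMap.opNorm_comp_le _ _).trans ?_
    gcongr
    exact ha w hw.1
  · refine Eventually.of_forall fun a w hw => ?_
    have h1 : DifferentiableAt ℝ f (e w a) :=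
      (hf.contDiffAt (hU.mem_nhds (hmem w hw.2 a))).differentiableAt one_ne_zero
    exact h1.hasFDerivAt.comp w (he w a)

/-- If all derivatives of `f` are dominated by integrable functions, locally uniformly in the
parameter, then the integral of `f` is a smooth function of the parameter. -/
lemma contDiffOn_integral_of_dominated
    (he : ∀ w a, HasFDerivAt (fun w => e w a) D w) (hec : ∀ w, Continuous (e w))
    (hU : IsOpen U) (hs : IsOpen s) (hmem : ∀ w ∈ s, ∀ a, e w a ∈ U)
    {f : Z' → F} (hf : ContDiffOn ℝ ∞ f U)
    (hdom : ∀ j : ℕ, ∀ w₀ ∈ s, ∃ V ∈ 𝓝 w₀, ∃ bound : A → ℝ, Integrable bound ν ∧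
      ∀ᵐ a ∂ν, ∀ w ∈ V, ‖iteratedFDeriv ℝ j f (e w a)‖ ≤ bound a) :
    ContDiffOn ℝ ∞ (fun w => ∫ a, f (e w a) ∂ν) s := by
  rw [contDiffOn_infty]
  intro n
  induction n generalizing F with
  | zero =>
    rw [show ((0 : ℕ) : WithTop ℕ∞) = 0 from rfl, contDiffOn_zero]
    intro w₀ hw₀
    obtain ⟨V, hV, bound, hbi, hb⟩ := hdom 0 w₀ hw₀
    refine ContinuousAt.continuousWithinAt ?_
    refine continuousAt_of_dominated (bound := bound) ?_ ?_ hbi ?_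
    · filter_upwards [hs.mem_nhds hw₀] with w hw
      exact (hf.continuousOn.comp_continuous (hec w) (hmem w hw)).aestronglyMeasurable
    · filter_upwards [hV] with w hw
      filter_upwards [hb] with a ha
      simpa using ha w hw
    · refine Eventually.of_forall fun a => ?_
      exact ContinuousAt.comp (f := fun w => e w a)
        (hf.contDiffAt (hU.mem_nhds (hmem w₀ hw₀ a))).continuousAt (he w₀ a).continuousAt
  | succ n ih =>
    have hderiv : ∀ w ∈ s, HasFDerivAt (fun w => ∫ a, f (e w a) ∂ν)
        (∫ a, (fderiv ℝ f (e w a)).comp D ∂ν) w := by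
      intro w₀ hw₀
      obtain ⟨V, hV, bound, hbi, hb⟩ := hdom 1 w₀ hw₀
      obtain ⟨V0, hV0, bound0, hbi0, hb0⟩ := hdom 0 w₀ hw₀
      refine hasFDerivAt_integral_of_contDiffOn he hec hU hs hmem
        (hf.of_le (by exact_mod_cast le_top)) hw₀ ?_ hV hbi ?_
      · refine hbi0.mono' ?_ ?_
        · exact (hf.continuousOn.comp_continuous (hec w₀) (hmem w₀ hw₀)).aestronglyMeasurable
        · filter_upwards [hb0] with a ha
          simpa using ha w₀ (mem_of_mem_nhds hV0)
      · filter_upwards [hb] with a ha w hw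
        simpa [norm_iteratedFDeriv_one] using ha w hw
    rw [show ((n + 1 : ℕ) : WithTop ℕ∞) = (n : WithTop ℕ∞) + 1 from rfl,
      contDiffOn_succ_iff_fderiv_of_isOpen hs]
    refine ⟨fun w hw => (hderiv w hw).differentiableAt.differentiableWithinAt, by simp, ?_⟩
    have hf' : ContDiffOn ℝ ∞ (fderiv ℝ f) U := hf.fderiv_of_isOpen hU (by norm_cast)
    let L : (Z' →L[ℝ] F) →L[ℝ] (P →L[ℝ] F) := ContinuousLinearMap.precomp F D
    have := ih (f := fun z => L (fderiv ℝ f z)) (L.contDiff.comp_contDiffOn hf') (by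
      intro j w₀ hw₀
      obtain ⟨V, hV, bound, hbi, hb⟩ := hdom (j + 1) w₀ hw₀
      refine ⟨V ∩ s, inter_mem hV (hs.mem_nhds hw₀), fun a => ‖L‖ * bound a, hbi.const_mul _, ?_⟩
      filter_upwards [hb] with a ha w hw
      have h1 := L.norm_iteratedFDeriv_comp_left (n := j)
        ((hf'.contDiffAt (hU.mem_nhds (hmem w hw.2 a)))) (by exact_mod_cast le_top)
      refine h1.trans ?_
      rw [norm_iteratedFDeriv_fderiv]
      gcongr
      exact ha w hw.1)
    exact this.congr fun w hw => (hderiv w hw).fderiv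

end ParamIntegral

/-! ### Velocity integrals -/

variable {Ω : Set V3} {I : Set ℝ} {F G : Type} [NormedAddCommGroup F] [NormedSpace ℝ F]
  [NormedAddCommGroup G] [NormedSpace ℝ G]

/-- The integral over the velocity, `(x, t) ↦ ∫ h(x, c, t) dc`. -/
def velInt (h : Phase → F) (w : SpaceTime) : F := ∫ c : V3, h (w.1, c, w.2)

lemma integrable_one_add_norm_pow_inv : Integrable (fun c : V3 => ((1 + ‖c‖) ^ 4)⁻¹) := by
  have h := integrable_one_add_norm (E := V3) (μ := volume) (r := 4) (by simp; norm_num)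
  refine h.congr (Eventually.of_forall fun c => ?_)
  have : (0 : ℝ) < 1 + ‖c‖ := by positivity
  simp only [Real.rpow_neg this.le]
  norm_cast

lemma exists_compact_nhds (hΩ : IsOpen Ω) (hI : IsOpen I) {w : SpaceTime} (hw : w ∈ Ω ×ˢ I) :
    ∃ C : Set SpaceTime, IsCompact C ∧ C ⊆ Ω ×ˢ I ∧ C ∈ 𝓝 w := by
  obtain ⟨C, hC, hwC, hCs⟩ := exists_compact_subset (hΩ.prod hI) hw
  exact ⟨C, hC, hCs, mem_interior_iff_mem_nhds.1 hwC⟩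

lemma le_of_weight_le {N : ℕ} {a M r : ℝ} (hr : 0 ≤ r) (h : (1 + r) ^ N * a ≤ M) :
    a ≤ M * ((1 + r) ^ N)⁻¹ := by
  rw [← div_eq_mul_inv, le_div_iff₀ (by positivity)]; linarith

lemma hasFDerivAt_fiber (w : SpaceTime) (c : V3) :
    HasFDerivAt (fun w : SpaceTime => ((w.1, c, w.2) : Phase)) lift w := by
  exact hasFDerivAt_fst.prodMk ((hasFDerivAt_const c w).prodMk hasFDerivAt_snd)

lemma continuous_fiber (w : SpaceTime) : Continuous (fun c : V3 => ((w.1, c, w.2) : Phase)) := by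
  fun_prop

lemma fiber_mem {w : SpaceTime} (hw : w ∈ Ω ×ˢ I) (c : V3) :
    ((w.1, c, w.2) : Phase) ∈ phaseSet Ω I := ⟨hw.1, mem_univ _, hw.2⟩

lemma Rapid.continuous {h : Phase → F} (hh : Rapid Ω I h) {w : SpaceTime} (hw : w ∈ Ω ×ˢ I) :
    Continuous (fun c : V3 => h (w.1, c, w.2)) :=
  hh.1.continuousOn.comp_continuous (continuous_fiber w) (fiber_mem hw)

lemma Rapid.integrable {h : Phase → F} (hh : Rapid Ω I h) {w : SpaceTime} (hw : w ∈ Ω ×ˢ I) :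
    Integrable (fun c : V3 => h (w.1, c, w.2)) := by
  obtain ⟨M, hM⟩ := hh.2 {w} isCompact_singleton (by simpa using hw) 4 0
  refine (integrable_one_add_norm_pow_inv.const_mul M).mono'
    (hh.continuous hw).aestronglyMeasurable (Eventually.of_forall fun c => ?_)
  have := hM w rfl c
  rw [norm_iteratedFDeriv_zero] at this
  exact le_of_weight_le (norm_nonneg c) this

lemma Rapid.dominated (hΩ : IsOpen Ω) (hI : IsOpen I) {h : Phase → F} (hh : Rapid Ω I h) (j : ℕ)
    (w₀ : SpaceTime) (hw₀ : w₀ ∈ Ω ×ˢ I) :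
    ∃ V ∈ 𝓝 w₀, ∃ bound : V3 → ℝ, Integrable bound volume ∧
      ∀ᵐ c : V3, ∀ w ∈ V, ‖iteratedFDeriv ℝ j h (w.1, c, w.2)‖ ≤ bound c := by
  obtain ⟨C, hC, hCs, hCn⟩ := exists_compact_nhds hΩ hI hw₀
  obtain ⟨M, hM⟩ := hh.2 C hC hCs 4 j
  exact ⟨C, hCn, fun c => M * ((1 + ‖c‖) ^ 4)⁻¹, integrable_one_add_norm_pow_inv.const_mul M,
    Eventually.of_forall fun c w hw => le_of_weight_le (norm_nonneg c) (hM w hw c)⟩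

lemma Rapid.contDiffOn_velInt (hΩ : IsOpen Ω) (hI : IsOpen I) {h : Phase → F}
    (hh : Rapid Ω I h) : ContDiffOn ℝ ∞ (velInt h) (Ω ×ˢ I) :=
  contDiffOn_integral_of_dominated hasFDerivAt_fiber continuous_fiber (isOpen_phaseSet hΩ hI)
    (hΩ.prod hI) (fun _ hw c => fiber_mem hw c) hh.1 (hh.dominated hΩ hI)

lemma Rapid.hasFDerivAt_velInt (hΩ : IsOpen Ω) (hI : IsOpen I) {h : Phase → F}
    (hh : Rapid Ω I h) {w : SpaceTime} (hw : w ∈ Ω ×ˢ I) :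
    HasFDerivAt (velInt h) (∫ c : V3, (fderiv ℝ h (w.1, c, w.2)).comp lift) w := by
  obtain ⟨V, hV, bound, hbi, hb⟩ := hh.dominated hΩ hI 1 w hw
  refine hasFDerivAt_integral_of_contDiffOn hasFDerivAt_fiber continuous_fiber
    (isOpen_phaseSet hΩ hI) (hΩ.prod hI) (fun _ hw c => fiber_mem hw c)
    (hh.1.of_le (by exact_mod_cast le_top)) hw (hh.integrable hw) hV hbi ?_
  filter_upwards [hb] with c hc w hw
  simpa [norm_iteratedFDeriv_one] using hc w hw

lemma Rapid.fderiv_velInt_apply [CompleteSpace F] (hΩ : IsOpen Ω) (hI : IsOpen I) {h : Phase → F}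
    (hh : Rapid Ω I h) {w : SpaceTime} (hw : w ∈ Ω ×ˢ I) (v : SpaceTime) :
    fderiv ℝ (velInt h) w v
      = ∫ c : V3, fderiv ℝ h (w.1, c, w.2) (v.1, 0, v.2) := by
  rw [(hh.hasFDerivAt_velInt hΩ hI hw).fderiv]
  have hint : Integrable (fun c : V3 => (fderiv ℝ h (w.1, c, w.2)).comp lift) := by
    have := (Rapid.clm hΩ hI (ContinuousLinearMap.precomp F lift) (hh.differential hΩ hI)).integrable hw
    exact this
  rw [ContinuousLinearMap.integral_apply hint]
  simp

/-- The integral of a velocity derivative in a fixed direction vanishes. -/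
lemma Rapid.integral_fderiv_vel [CompleteSpace F] (hΩ : IsOpen Ω) (hI : IsOpen I) {h : Phase → F}
    (hh : Rapid Ω I h) {w : SpaceTime} (hw : w ∈ Ω ×ˢ I) (v : V3) :
    ∫ c : V3, fderiv ℝ h (w.1, c, w.2) (0, v, 0) = 0 := by
  have hd : ∀ c : V3, HasFDerivAt (fun c => h (w.1, c, w.2))
      ((fderiv ℝ h (w.1, c, w.2)).comp
        ((0 : V3 →L[ℝ] V3).prod ((ContinuousLinearMap.id ℝ V3).prod (0 : V3 →L[ℝ] ℝ)))) c := by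
    intro c
    have h1 : DifferentiableAt ℝ h (w.1, c, w.2) :=
      (hh.1.contDiffAt ((isOpen_phaseSet hΩ hI).mem_nhds (fiber_mem hw c))).differentiableAt
        (by simp)
    exact h1.hasFDerivAt.comp c ((hasFDerivAt_const w.1 c).prodMk
      ((hasFDerivAt_id c).prodMk (hasFDerivAt_const w.2 c)))
  have hint : Integrable (fun c : V3 => fderiv ℝ h (w.1, c, w.2) (0, v, 0)) :=
    (Rapid.clm hΩ hI (ContinuousLinearMap.apply ℝ F ((0, v, 0) : Phase))
      (hh.differential hΩ hI)).integrable hw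
  have key := integral_bilinear_hasFDerivAt_right_eq_neg_left_of_integrable (μ := volume)
    (f := fun _ : V3 => (1 : ℝ)) (f' := fun _ => 0) (g := fun c => h (w.1, c, w.2)) (v := v)
    (B := ContinuousLinearMap.lsmul ℝ ℝ) (by simp) (by simpa using hint)
    (by simpa using hh.integrable hw) (fun x _ => hasFDerivAt_const _ _) (fun x _ => hd x)
  simpa using key

end

section

/-! ### Vector algebra -/

lemma inner_eq (a b : V3) : inner ℝ a b = a 0 * b 0 + a 1 * b 1 + a 2 * b 2 := by
  simp [PiLp.inner_apply, Fin.sum_univ_three, mul_comm]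

@[simp] lemma cross_zero' (a b : V3) : cross a b 0 = a 1 * b 2 - a 2 * b 1 := by
  simp [cross, cross_apply]

@[simp] lemma cross_one' (a b : V3) : cross a b 1 = a 2 * b 0 - a 0 * b 2 := by
  simp [cross, cross_apply]

@[simp] lemma cross_two' (a b : V3) : cross a b 2 = a 0 * b 1 - a 1 * b 0 := by
  simp [cross, cross_apply]

lemma e_apply (i j : Fin 3) : e i j = if j = i then 1 else 0 := by
  simp [e]

lemma v3_ext {a b : V3} (h0 : a 0 = b 0) (h1 : a 1 = b 1) (h2 : a 2 = b 2) : a = b := by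
  ext i; fin_cases i <;> assumption

lemma sum_smul_e (c : V3) : ∑ i : Fin 3, c i • e i = c := by
  apply v3_ext <;> simp [Fin.sum_univ_three, e_apply]

/-- The vector product as a continuous bilinear map. -/
def crossL : V3 →L[ℝ] V3 →L[ℝ] V3 :=
  LinearMap.toContinuousBilinearMap (LinearMap.mk₂ ℝ cross
    (fun a a' b => by apply v3_ext <;> simp <;> ring)
    (fun r a b => by apply v3_ext <;> simp <;> ring)
    (fun a b b' => by apply v3_ext <;> simp <;> ring)
    (fun r a b => by apply v3_ext <;> simp <;> ring))

@[simp] lemma crossL_apply (a b : V3) : crossL a b = cross a b := rfl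

lemma cross_add_left (a a' b : V3) : cross (a + a') b = cross a b + cross a' b := by
  simp [← crossL_apply]

lemma cross_add_right (a b b' : V3) : cross a (b + b') = cross a b + cross a b' := by
  simp [← crossL_apply]

lemma cross_smul_left (r : ℝ) (a b : V3) : cross (r • a) b = r • cross a b := by
  simp [← crossL_apply]

lemma cross_smul_right (r : ℝ) (a b : V3) : cross a (r • b) = r • cross a b := by
  simp [← crossL_apply]

lemma cross_sub_right (a b b' : V3) : cross a (b - b') = cross a b - cross a b' := by
  simp [← crossL_apply]

lemma cross_self' (a : V3) : cross a a = 0 := by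
  apply v3_ext <;> simp <;> ring

lemma cross_anti (a b : V3) : cross a b = -cross b a := by
  apply v3_ext <;> simp <;> ring

lemma inner_cross_self_left (a b : V3) : inner ℝ a (cross a b) = 0 := by
  simp only [inner_eq, cross_zero', cross_one', cross_two']; ring

lemma inner_cross_self_right (a b : V3) : inner ℝ b (cross a b) = 0 := by
  simp only [inner_eq, cross_zero', cross_one', cross_two']; ring

lemma cross_cross_eq (a b c : V3) :
    cross a (cross b c) = (inner ℝ a c : ℝ) • b - (inner ℝ a b : ℝ) • c := by
  apply v3_ext <;> simp [inner_eq] <;> ring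

lemma unit_sq {b : V3} (hb : ‖b‖ = 1) : b 0 * b 0 + b 1 * b 1 + b 2 * b 2 = 1 := by
  rw [← inner_eq, real_inner_self_eq_norm_sq, hb]; norm_num

lemma norm_sq_eq (a : V3) : ‖a‖ ^ 2 = a 0 * a 0 + a 1 * a 1 + a 2 * a 2 := by
  rw [← inner_eq, real_inner_self_eq_norm_sq]

lemma perp_pair_real {b₀ b₁ b₂ p₀ p₁ p₂ : ℝ} (h1 : b₀ * b₀ + b₁ * b₁ + b₂ * b₂ = 1)
    (hp : p₀ * b₀ + p₁ * b₁ + p₂ * b₂ = 0) :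
    let s := p₀ * p₀ + p₁ * p₁ + p₂ * p₂
    let q₀ := b₁ * p₂ - b₂ * p₁
    let q₁ := b₂ * p₀ - b₀ * p₂
    let q₂ := b₀ * p₁ - b₁ * p₀
    p₀ * p₀ + q₀ * q₀ = s * (1 - b₀ * b₀) ∧ p₁ * p₁ + q₁ * q₁ = s * (1 - b₁ * b₁) ∧
    p₂ * p₂ + q₂ * q₂ = s * (1 - b₂ * b₂) ∧ p₀ * p₁ + q₀ * q₁ = -(s * (b₀ * b₁)) ∧
    p₀ * p₂ + q₀ * q₂ = -(s * (b₀ * b₂)) ∧ p₁ * p₂ + q₁ * q₂ = -(s * (b₁ * b₂)) := by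
  refine ⟨?_, ?_, ?_, ?_, ?_, ?_⟩ <;> grind

/-- For a unit vector `b` and `p ⊥ b`, the vectors `p` and `b × p` span the plane `b^⊥`:
`p ⊗ p + (b × p) ⊗ (b × p) = |p|² (Id - b ⊗ b)`. -/
lemma perp_pair {b p : V3} (hb : ‖b‖ = 1) (hp : inner ℝ p b = 0) (i j : Fin 3) :
    p i * p j + cross b p i * cross b p j
      = ‖p‖ ^ 2 * ((if i = j then 1 else 0) - b i * b j) := by
  have h1 := unit_sq hb
  rw [inner_eq] at hp
  rw [norm_sq_eq]
  obtain ⟨d0, d1, d2, o01, o02, o12⟩ := perp_pair_real h1 hp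
  fin_cases i <;> fin_cases j <;> simp <;> linarith

/-- The perpendicular trace of a bilinear map, through the pair `p`, `b × p`. -/
lemma perp_pair_bilin {F : Type} [NormedAddCommGroup F] [NormedSpace ℝ F]
    (S : V3 →L[ℝ] V3 →L[ℝ] F) {b p : V3} (hb : ‖b‖ = 1) (hp : inner ℝ p b = 0) :
    S p p + S (cross b p) (cross b p)
      = ‖p‖ ^ 2 • ((∑ i, S (e i) (e i)) - S b b) := by
  have key : ∀ c : V3, S c c = ∑ i, ∑ j, (c i * c j) • S (e i) (e j) := by
    intro c
    conv_lhs => rw [← sum_smul_e c]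
    simp only [map_sum, map_smul, _root_.sum_apply, _root_.smul_apply,
      Finset.smul_sum, smul_smul]
    rw [Finset.sum_comm]
    simp only [mul_comm]
  have hdiag : ∑ i, S (e i) (e i)
      = ∑ i : Fin 3, ∑ j : Fin 3, (if i = j then (1 : ℝ) else 0) • S (e i) (e j) := by
    simp
  rw [key p, key (cross b p), key b, hdiag, ← Finset.sum_add_distrib, ← Finset.sum_sub_distrib,
    Finset.smul_sum]
  refine Finset.sum_congr rfl fun i _ => ?_
  rw [← Finset.sum_add_distrib, ← Finset.sum_sub_distrib, Finset.smul_sum]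
  refine Finset.sum_congr rfl fun j _ => ?_
  rw [← add_smul, perp_pair hb hp, ← sub_smul, smul_smul]

/-! ### Vector calculus -/

lemma inner_gradient {φ : V3 → ℝ} (x v : V3) : inner ℝ (gradient φ x) v = fderiv ℝ φ x v := by
  simp [gradient]

lemma gradient_apply {φ : V3 → ℝ} (x : V3) (i : Fin 3) :
    gradient φ x i = fderiv ℝ φ x (e i) := by
  rw [← inner_gradient, e, EuclideanSpace.inner_single_right]; simp

lemma fderiv_coord {E : Type} [NormedAddCommGroup E] [NormedSpace ℝ E] {v : E → V3} {x : E}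
    (hv : DifferentiableAt ℝ v x) (h : E) (i : Fin 3) :
    fderiv ℝ (fun y => v y i) x h = (fderiv ℝ v x h) i := by
  have := ((EuclideanSpace.proj (𝕜 := ℝ) i).hasFDerivAt.comp x
    hv.hasFDerivAt).fderiv
  rw [show (fun y => v y i) = (EuclideanSpace.proj (𝕜 := ℝ) i) ∘ v
    from rfl, this]
  rfl

lemma DifferentiableAt.cross {E : Type} [NormedAddCommGroup E] [NormedSpace ℝ E] {a b : E → V3}
    {x : E} (ha : DifferentiableAt ℝ a x) (hb : DifferentiableAt ℝ b x) :
    DifferentiableAt ℝ (fun y => cross (a y) (b y)) x :=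
  (crossL.hasFDerivAt_of_bilinear ha.hasFDerivAt hb.hasFDerivAt).differentiableAt

lemma fderiv_cross {E : Type} [NormedAddCommGroup E] [NormedSpace ℝ E] {a b : E → V3} {x : E}
    (ha : DifferentiableAt ℝ a x) (hb : DifferentiableAt ℝ b x) (h : E) :
    fderiv ℝ (fun y => cross (a y) (b y)) x h
      = cross (fderiv ℝ a x h) (b x) + cross (a x) (fderiv ℝ b x h) := by
  have := (crossL.hasFDerivAt_of_bilinear ha.hasFDerivAt hb.hasFDerivAt).fderiv
  simp only [crossL_apply] at this
  rw [this]
  simp [add_comm]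

lemma ContDiffOn.cross {E : Type} [NormedAddCommGroup E] [NormedSpace ℝ E] {a b : E → V3}
    {s : Set E} {n : WithTop ℕ∞} (ha : ContDiffOn ℝ n a s) (hb : ContDiffOn ℝ n b s) :
    ContDiffOn ℝ n (fun y => cross (a y) (b y)) s :=
  crossL.isBoundedBilinearMap.contDiff.comp_contDiffOn (ha.prodMk hb)

lemma dvg_congr {v w : V3 → V3} {x : V3} (h : v =ᶠ[𝓝 x] w) : dvg v x = dvg w x := by
  simp only [dvg, h.fderiv_eq]

section
variable {v w : V3 → V3} {φ : V3 → ℝ} {x : V3}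

lemma dvg_add (hv : DifferentiableAt ℝ v x) (hw : DifferentiableAt ℝ w x) :
    dvg (fun y => v y + w y) x = dvg v x + dvg w x := by
  simp only [dvg, ← Finset.sum_add_distrib]
  rw [show (fun y => v y + w y) = v + w from rfl, fderiv_add hv hw]
  simp

lemma dvg_sub (hv : DifferentiableAt ℝ v x) (hw : DifferentiableAt ℝ w x) :
    dvg (fun y => v y - w y) x = dvg v x - dvg w x := by
  simp only [dvg, ← Finset.sum_sub_distrib]
  rw [show (fun y => v y - w y) = v - w from rfl, fderiv_sub hv hw]
  simp

lemma dvg_const_smul (r : ℝ) (hv : DifferentiableAt ℝ v x) :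
    dvg (fun y => r • v y) x = r * dvg v x := by
  simp only [dvg, Finset.mul_sum]
  rw [show (fun y => r • v y) = r • v from rfl, fderiv_const_smul hv]
  simp

lemma sum_coord_fderiv (φ : V3 → ℝ) (x a : V3) :
    ∑ i : Fin 3, a i * fderiv ℝ φ x (e i) = fderiv ℝ φ x a := by
  conv_rhs => rw [← sum_smul_e a]
  simp [map_sum]

lemma fderiv_smul_apply {E E' : Type} [NormedAddCommGroup E] [NormedSpace ℝ E]
    [NormedAddCommGroup E'] [NormedSpace ℝ E'] {φ : E → ℝ} {v : E → E'} {x : E}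
    (hφ : DifferentiableAt ℝ φ x) (hv : DifferentiableAt ℝ v x) (h : E) :
    fderiv ℝ (fun y => φ y • v y) x h = φ x • fderiv ℝ v x h + fderiv ℝ φ x h • v x := by
  rw [(hφ.hasFDerivAt.fun_smul hv.hasFDerivAt).fderiv]; simp

lemma dvg_smul (hφ : DifferentiableAt ℝ φ x) (hv : DifferentiableAt ℝ v x) :
    dvg (fun y => φ y • v y) x = φ x * dvg v x + fderiv ℝ φ x (v x) := by
  simp only [dvg, fderiv_smul_apply hφ hv]
  rw [← sum_coord_fderiv, Finset.mul_sum, ← Finset.sum_add_distrib]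
  refine Finset.sum_congr rfl fun i _ => ?_
  simp; ring

lemma curl_smul (hφ : DifferentiableAt ℝ φ x) (hv : DifferentiableAt ℝ v x) :
    curl (fun y => φ y • v y) x = φ x • curl v x + cross (gradient φ x) (v x) := by
  simp only [curl, fderiv_smul_apply hφ hv]
  apply v3_ext <;> simp [Fin.sum_univ_three, e_apply, gradient_apply] <;> ring

lemma dvg_cross (hv : DifferentiableAt ℝ v x) (hw : DifferentiableAt ℝ w x) :
    dvg (fun y => cross (v y) (w y)) x = inner ℝ (w x) (curl v x) - inner ℝ (v x) (curl w x) := by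
  simp only [dvg, fderiv_cross hv hw, curl, inner_eq]
  simp [Fin.sum_univ_three, e_apply]; ring

lemma second_deriv_symm {F : Type} [NormedAddCommGroup F] [NormedSpace ℝ F]
    {E : Type} [NormedAddCommGroup E] [NormedSpace ℝ E] {φ : E → F} {x : E}
    (h : ContDiffAt ℝ 2 φ x) (a b : E) :
    fderiv ℝ (fderiv ℝ φ) x a b = fderiv ℝ (fderiv ℝ φ) x b a :=
  h.isSymmSndFDerivAt (by simp) a b

lemma fderiv_fderiv_apply {F : Type} [NormedAddCommGroup F] [NormedSpace ℝ F]
    {E : Type} [NormedAddCommGroup E] [NormedSpace ℝ E] {φ : E → F} {x : E}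
    (h : ContDiffAt ℝ 2 φ x) (a b : E) :
    fderiv ℝ (fun y => fderiv ℝ φ y b) x a = fderiv ℝ (fderiv ℝ φ) x a b := by
  have h1 : DifferentiableAt ℝ (fderiv ℝ φ) x :=
    (h.fderiv_right (m := 1) (by norm_num)).differentiableAt one_ne_zero
  exact (by simp [fderiv_clm_apply h1 (differentiableAt_const b)])

lemma differentiableAt_fderiv {F : Type} [NormedAddCommGroup F] [NormedSpace ℝ F]
    {E : Type} [NormedAddCommGroup E] [NormedSpace ℝ E] {φ : E → F} {x : E}
    (h : ContDiffAt ℝ 2 φ x) : DifferentiableAt ℝ (fderiv ℝ φ) x :=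
  (h.fderiv_right (m := 1) (by norm_num)).differentiableAt one_ne_zero

lemma dvg_curl (hv : ContDiffAt ℝ 2 v x) : dvg (curl v) x = 0 := by
  have hd : ∀ i : Fin 3, DifferentiableAt ℝ (fun y => fderiv ℝ v y (e i)) x := fun i =>
    (differentiableAt_fderiv hv).clm_apply (differentiableAt_const _)
  have hc : ∀ i : Fin 3, DifferentiableAt ℝ (fun y => cross (e i) (fderiv ℝ v y (e i))) x :=
    fun i => DifferentiableAt.cross (differentiableAt_const _) (hd i)
  have h1 : ∀ a : V3, fderiv ℝ (curl v) x a
      = ∑ i : Fin 3, cross (e i) (fderiv ℝ (fderiv ℝ v) x a (e i)) := by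
    intro a
    have : curl v = fun y => ∑ i : Fin 3, cross (e i) (fderiv ℝ v y (e i)) := rfl
    rw [this, fderiv_fun_sum (fun i _ => hc i)]
    simp only [_root_.sum_apply]
    refine Finset.sum_congr rfl fun i _ => ?_
    rw [fderiv_cross (differentiableAt_const _) (hd i), fderiv_fderiv_apply hv]
    simp [← crossL_apply]
  simp only [dvg, h1]
  have s01 := second_deriv_symm hv (e 0) (e 1)
  have s02 := second_deriv_symm hv (e 0) (e 2)
  have s12 := second_deriv_symm hv (e 1) (e 2)
  simp [Fin.sum_univ_three, e_apply, s01, s02, s12]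
  ring

lemma contDiffAt_gradient {n : WithTop ℕ∞} (hφ : ContDiffAt ℝ (n + 1) φ x) :
    ContDiffAt ℝ n (gradient φ) x := by
  have h1 : ContDiffAt ℝ n (fderiv ℝ φ) x := hφ.fderiv_right le_rfl
  exact ((InnerProductSpace.toDual ℝ V3).symm.toContinuousLinearEquiv.contDiff).contDiffAt.comp x h1

lemma curl_gradient (hφ : ContDiffAt ℝ 2 φ x) : curl (gradient φ) x = 0 := by
  have hg : DifferentiableAt ℝ (gradient φ) x :=
    (contDiffAt_gradient (n := 1) (by simpa [one_add_one_eq_two] using hφ)).differentiableAt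
      one_ne_zero
  have h1 : ∀ (a : V3) (i : Fin 3), (fderiv ℝ (gradient φ) x a) i
      = fderiv ℝ (fderiv ℝ φ) x a (e i) := by
    intro a i
    rw [← fderiv_coord hg, ← fderiv_fderiv_apply hφ]
    simp only [gradient_apply]
  have s01 := second_deriv_symm hφ (e 0) (e 1)
  have s02 := second_deriv_symm hφ (e 0) (e 2)
  have s12 := second_deriv_symm hφ (e 1) (e 2)
  apply v3_ext <;> simp [curl, Fin.sum_univ_three, e_apply, h1, s01, s02, s12]

end

end

section

/-! ### Derivatives along slices -/

section Slices
variable {F : Type} [NormedAddCommGroup F] [NormedSpace ℝ F]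

lemma fderiv_slice_pos {f : Phase → F} {x c : V3} {t : ℝ}
    (hf : DifferentiableAt ℝ f (x, c, t)) (v : V3) :
    fderiv ℝ (fun y => f (y, c, t)) x v = fderiv ℝ f (x, c, t) (v, 0, 0) := by
  have h := (hasFDerivAt_id (𝕜 := ℝ) x).prodMk (hasFDerivAt_const ((c, t) : V3 × ℝ) x)
  have := (hf.hasFDerivAt.comp x h).fderiv
  exact (congrArg (fun L => L v) this).trans rfl

lemma fderiv_slice_vel {f : Phase → F} {x c : V3} {t : ℝ}
    (hf : DifferentiableAt ℝ f (x, c, t)) (v : V3) :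
    fderiv ℝ (fun c' => f (x, c', t)) c v = fderiv ℝ f (x, c, t) (0, v, 0) := by
  have h := (hasFDerivAt_const (𝕜 := ℝ) x c).prodMk
    ((hasFDerivAt_id (𝕜 := ℝ) c).prodMk (hasFDerivAt_const t c))
  have := (hf.hasFDerivAt.comp c h).fderiv
  exact (congrArg (fun L => L v) this).trans rfl

lemma deriv_slice_time {f : Phase → F} {x c : V3} {t : ℝ}
    (hf : DifferentiableAt ℝ f (x, c, t)) :
    deriv (fun s => f (x, c, s)) t = fderiv ℝ f (x, c, t) (0, 0, 1) := by
  have h := (hasFDerivAt_const (𝕜 := ℝ) x t).prodMk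
    ((hasFDerivAt_const (𝕜 := ℝ) c t).prodMk (hasFDerivAt_id t))
  have := (hf.hasFDerivAt.comp t h).hasDerivAt.deriv
  exact this.trans (by simp)

lemma fderiv_slice_space {a : SpaceTime → F} {x : V3} {t : ℝ}
    (ha : DifferentiableAt ℝ a (x, t)) (v : V3) :
    fderiv ℝ (fun y => a (y, t)) x v = fderiv ℝ a (x, t) (v, 0) := by
  have h := (hasFDerivAt_id (𝕜 := ℝ) x).prodMk (hasFDerivAt_const t x)
  have := (ha.hasFDerivAt.comp x h).fderiv
  exact (congrArg (fun L => L v) this).trans rfl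

lemma deriv_slice_field {a : SpaceTime → F} {x : V3} {t : ℝ}
    (ha : DifferentiableAt ℝ a (x, t)) :
    deriv (fun s => a (x, s)) t = fderiv ℝ a (x, t) (0, 1) := by
  have h := (hasFDerivAt_const (𝕜 := ℝ) x t).prodMk (hasFDerivAt_id (𝕜 := ℝ) t)
  have := (ha.hasFDerivAt.comp t h).hasDerivAt.deriv
  exact this.trans (by simp)

end Slices

/-! ### Second order expansions in the small parameter -/

/-- `A ε = a₀ + ε a₁ + ε² a₂ + o(ε²)` as `ε → 0⁺`. -/
def Expansion {X : Type} [NormedAddCommGroup X] [NormedSpace ℝ X] (A : ℝ → X) (a : ℕ → X) : Prop :=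
  (fun ε => A ε - ∑ k ∈ Finset.range 3, ε ^ k • a k) =o[𝓝[>] (0 : ℝ)] fun ε => ε ^ 2

section Expansion
variable {X Y : Type} [NormedAddCommGroup X] [NormedSpace ℝ X]
  [NormedAddCommGroup Y] [NormedSpace ℝ Y] {A : ℝ → X} {a : ℕ → X}

lemma Expansion.clm (L : X →L[ℝ] Y) (h : Expansion A a) :
    Expansion (fun ε => L (A ε)) (fun k => L (a k)) := by
  have h1 := (L.isBigO_comp (fun ε => A ε - ∑ k ∈ Finset.range 3, ε ^ k • a k)
    (𝓝[>] (0 : ℝ))).trans_isLittleO h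
  refine h1.congr_left fun ε => ?_
  simp [map_sub, map_sum, map_smul]

lemma tendsto_pow_zero {n : ℕ} (hn : n ≠ 0) : Tendsto (fun ε : ℝ => ε ^ n) (𝓝[>] 0) (𝓝 0) := by
  have : Tendsto (fun ε : ℝ => ε ^ n) (𝓝 0) (𝓝 (0 ^ n)) := (continuous_pow n).tendsto 0
  rw [zero_pow hn] at this
  exact this.mono_left nhdsWithin_le_nhds

lemma Expansion.first (h : Expansion A a) :
    (fun ε => A ε - (a 0 + ε • a 1)) =o[𝓝[>] (0 : ℝ)] fun ε => ε := by
  have h2 : (fun ε : ℝ => ε ^ 2) =o[𝓝[>] (0 : ℝ)] fun ε => ε := by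
    have := (Asymptotics.isLittleO_pow_pow (𝕜 := ℝ) (show 1 < 2 by norm_num)).mono
      (nhdsWithin_le_nhds (s := Ioi (0 : ℝ)))
    simpa using this
  have h4 : (fun ε : ℝ => ε ^ 2 • a 2) =o[𝓝[>] (0 : ℝ)] fun ε => ε := by
    have := h2.smul_isBigO (Asymptotics.isBigO_const_const (a 2) (one_ne_zero (α := ℝ))
      (𝓝[>] (0 : ℝ)))
    simpa using this
  have h3 := (h.trans h2).add h4
  refine h3.congr_left fun ε => ?_
  simp only [Finset.sum_range_succ, Finset.sum_range_zero, pow_zero, one_smul, pow_one, zero_add]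
  module

lemma Expansion.tendsto (h : Expansion A a) : Tendsto A (𝓝[>] 0) (𝓝 (a 0)) := by
  have h1 : Tendsto (fun ε => A ε - (a 0 + ε • a 1)) (𝓝[>] 0) (𝓝 0) :=
    h.first.trans_tendsto (tendsto_id.mono_left nhdsWithin_le_nhds)
  have h2 : Tendsto (fun ε : ℝ => a 0 + ε • a 1) (𝓝[>] 0) (𝓝 (a 0)) := by
    have : Tendsto (fun ε : ℝ => a 0 + ε • a 1) (𝓝 0) (𝓝 (a 0 + (0 : ℝ) • a 1)) :=
      (by fun_prop : Continuous fun ε : ℝ => a 0 + ε • a 1).tendsto 0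
    simpa using this.mono_left nhdsWithin_le_nhds
  simpa using h1.add h2

lemma Expansion.of_eventually_le {K : ℝ} (hK : 0 ≤ K)
    (h : ∀ η > (0 : ℝ), ∀ᶠ ε in 𝓝[>] (0 : ℝ),
      ‖A ε - ∑ k ∈ Finset.range 3, ε ^ k • a k‖ ≤ K * (η * ε ^ 2)) : Expansion A a := by
  refine Asymptotics.isLittleO_iff.2 fun η hη => ?_
  have hη' : 0 < η / (K + 1) := by positivity
  filter_upwards [h _ hη'] with ε hε
  refine hε.trans ?_
  rw [Real.norm_of_nonneg (by positivity)]
  have : K * (η / (K + 1)) ≤ η := by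
    rw [← mul_div_assoc, div_le_iff₀ (by positivity)]; nlinarith
  nlinarith [sq_nonneg ε]

/-- An expansion that vanishes identically for small `ε` has vanishing coefficients. -/
lemma Expansion.eq_zero_of_eventually (h : Expansion A a) (h0 : ∀ᶠ ε in 𝓝[>] (0 : ℝ), A ε = 0) :
    a 1 = 0 := by
  have ha0 : a 0 = 0 := tendsto_nhds_unique h.tendsto
    (tendsto_const_nhds.congr' (h0.mono fun ε hε => hε.symm))
  have h1 := h.first
  have h2 : (fun ε : ℝ => ε • a 1) =o[𝓝[>] (0 : ℝ)] fun ε => ε := by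
    refine h1.neg_left.congr' (h0.mono fun ε hε => ?_) .rfl
    simp [hε, ha0]
  have h3 := Asymptotics.isLittleO_iff.1 h2
  by_contra hne
  have hpos : 0 < ‖a 1‖ := norm_pos_iff.2 hne
  obtain ⟨ε, hε, hε0⟩ := ((h3 (half_pos hpos)).and self_mem_nhdsWithin).exists
  rw [norm_smul] at hε
  have : 0 < ‖ε‖ := norm_pos_iff.2 (ne_of_gt hε0)
  nlinarith

/-- Matching of the orders `ε⁻²`, `ε⁻¹` and `ε⁰`. -/
lemma match_orders {p q r : ℝ → ℝ} {p₀ q₀ q₁ : ℝ} {d : ℕ → ℝ} (hp : Tendsto p (𝓝[>] 0) (𝓝 p₀))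
    (hq : (fun ε => q ε - (q₀ + ε * q₁)) =o[𝓝[>] (0 : ℝ)] fun ε => ε)
    (hr : Expansion r d)
    (h : Tendsto (fun ε => p ε + ε⁻¹ * q ε + (ε ^ 2)⁻¹ * r ε) (𝓝[>] 0) (𝓝 0)) :
    d 0 = 0 ∧ q₀ + d 1 = 0 ∧ p₀ + q₁ + d 2 = 0 := by
  have hpos : ∀ᶠ ε in 𝓝[>] (0 : ℝ), ε ≠ 0 := by
    filter_upwards [self_mem_nhdsWithin] with ε hε using ne_of_gt hε
  have e1 : Tendsto (fun ε : ℝ => ε) (𝓝[>] 0) (𝓝 0) := tendsto_id.mono_left nhdsWithin_le_nhds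
  have e2 : Tendsto (fun ε : ℝ => ε ^ 2) (𝓝[>] 0) (𝓝 0) := tendsto_pow_zero (by norm_num)
  have hq' := hq.tendsto_div_nhds_zero
  have hr' := hr.tendsto_div_nhds_zero
  set m : ℝ → ℝ := fun ε => p ε + (q ε - (q₀ + ε * q₁)) / ε + q₁
    + (r ε - ∑ k ∈ Finset.range 3, ε ^ k • d k) / ε ^ 2 + d 2 with hm
  have hmt : Tendsto m (𝓝[>] 0) (𝓝 (p₀ + 0 + q₁ + 0 + d 2)) :=
    (((hp.add hq').add tendsto_const_nhds).add hr').add tendsto_const_nhds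
  have heq : ∀ᶠ ε in 𝓝[>] (0 : ℝ), p ε + ε⁻¹ * q ε + (ε ^ 2)⁻¹ * r ε
      = m ε + ε⁻¹ * (q₀ + d 1) + (ε ^ 2)⁻¹ * d 0 := by
    filter_upwards [hpos] with ε hε
    simp only [hm, Finset.sum_range_succ, Finset.sum_range_zero, smul_eq_mul]
    field_simp
    ring
  have h' := h.congr' heq
  have hd0 : d 0 = 0 := by
    have l1 := e2.mul h'
    have l2 : Tendsto (fun ε => ε ^ 2 * m ε + ε * (q₀ + d 1) + d 0) (𝓝[>] 0)
        (𝓝 (0 * (p₀ + 0 + q₁ + 0 + d 2) + 0 * (q₀ + d 1) + d 0)) :=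
      ((e2.mul hmt).add (e1.mul tendsto_const_nhds)).add tendsto_const_nhds
    have := tendsto_nhds_unique (l1.congr' (by
      filter_upwards [hpos] with ε hε
      field_simp)) l2
    simpa using this.symm
  have hq0 : q₀ + d 1 = 0 := by
    have l1 := e1.mul h'
    have l2 : Tendsto (fun ε => ε * m ε + (q₀ + d 1)) (𝓝[>] 0)
        (𝓝 (0 * (p₀ + 0 + q₁ + 0 + d 2) + (q₀ + d 1))) :=
      (e1.mul hmt).add tendsto_const_nhds
    have := tendsto_nhds_unique (l1.congr' (by
      filter_upwards [hpos] with ε hε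
      rw [hd0]
      field_simp
      ring)) l2
    simpa using this.symm
  refine ⟨hd0, hq0, ?_⟩
  have := tendsto_nhds_unique h' (by simpa [hd0, hq0] using hmt)
  linarith

end Expansion

end

section

/-! ### Expansion of the Vlasov / momentum system -/

/-- Weights in the velocity with at most quadratic growth. -/
structure QuadraticWeight (φ : V3 → ℝ) : Prop where
  contDiff : ContDiff ℝ 1 φ
  le : ∀ c, |φ c| ≤ (1 + ‖c‖) ^ 2
  fderiv_le : ∀ c, ‖fderiv ℝ φ c‖ ≤ 2 * (1 + ‖c‖) ^ 2

lemma quadraticWeight_one : QuadraticWeight (fun _ => 1) := by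
  refine ⟨contDiff_const, fun c => ?_, fun c => ?_⟩
  · have := norm_nonneg c
    rw [abs_one]; nlinarith
  · simp; positivity

lemma abs_coord_le (c : V3) (i : Fin 3) : |c i| ≤ ‖c‖ := PiLp.norm_apply_le c i

lemma quadraticWeight_coord (i : Fin 3) : QuadraticWeight (fun c => c i) := by
  refine ⟨by fun_prop, fun c => ?_, fun c => ?_⟩
  · have := norm_nonneg c
    have := abs_coord_le c i
    nlinarith
  · have : ‖fderiv ℝ (fun c : V3 => c i) c‖ ≤ 1 := by
      refine ContinuousLinearMap.opNorm_le_bound _ zero_le_one fun v => ?_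
      rw [fderiv_coord differentiableAt_fun_id]
      simpa using abs_coord_le v i
    have := norm_nonneg c
    nlinarith

lemma quadraticWeight_mul (i j : Fin 3) : QuadraticWeight (fun c => c i * c j) := by
  refine ⟨by fun_prop, fun c => ?_, fun c => ?_⟩
  · have := norm_nonneg c
    have h1 := abs_coord_le c i
    have h2 := abs_coord_le c j
    rw [abs_mul]
    nlinarith [abs_nonneg (c i), abs_nonneg (c j)]
  · have hd : ∀ i : Fin 3, DifferentiableAt ℝ (fun c : V3 => c i) c := fun i => by fun_prop
    have : ‖fderiv ℝ (fun c : V3 => c i * c j) c‖ ≤ 2 * ‖c‖ := by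
      refine ContinuousLinearMap.opNorm_le_bound _ (by positivity) fun v => ?_
      rw [fderiv_fun_mul (hd i) (hd j)]
      simp only [_root_.add_apply, _root_.smul_apply, smul_eq_mul]
      rw [fderiv_coord differentiableAt_fun_id, fderiv_coord differentiableAt_fun_id]
      simp only [fderiv_fun_id, ContinuousLinearMap.coe_id', id_eq, Real.norm_eq_abs]
      have h1 := abs_coord_le c i
      have h2 := abs_coord_le c j
      have h3 := abs_coord_le v i
      have h4 := abs_coord_le v j
      refine (abs_add_le _ _).trans ?_
      rw [abs_mul, abs_mul]
      have := mul_le_mul h1 h4 (abs_nonneg _) (norm_nonneg c)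
      have := mul_le_mul h2 h3 (abs_nonneg _) (norm_nonneg c)
      linarith
    have := norm_nonneg c
    nlinarith

variable {Ω : Set V3} {I : Set ℝ}

/-- The moment `∫ h φ(c) dc` as a function of `(x, t)`. -/
def weightInt (h : Phase → ℝ) (φ : V3 → ℝ) (w : SpaceTime) : ℝ :=
  velInt (fun z => h z * φ z.2.1) w

lemma fderiv_mul_weight_le {f : Phase → ℝ} {φ : V3 → ℝ} (hφ : QuadraticWeight φ) {z : Phase}
    (hf : DifferentiableAt ℝ f z) {δ : ℝ} (h0 : (1 + ‖z.2.1‖) ^ 6 * |f z| ≤ δ)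
    (h1 : (1 + ‖z.2.1‖) ^ 6 * ‖fderiv ℝ f z‖ ≤ δ) :
    ‖fderiv ℝ (fun z : Phase => f z * φ z.2.1) z‖ ≤ 3 * δ * ((1 + ‖z.2.1‖) ^ 4)⁻¹ := by
  have hφd : DifferentiableAt ℝ φ z.2.1 := (hφ.contDiff.differentiable one_ne_zero) _
  have hpr : HasFDerivAt (fun z : Phase => z.2.1)
      ((ContinuousLinearMap.fst ℝ V3 ℝ).comp (ContinuousLinearMap.snd ℝ V3 (V3 × ℝ))) z :=
    hasFDerivAt_fst.comp z hasFDerivAt_snd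
  have hcomp := hφd.hasFDerivAt.comp z hpr
  have hm := hf.hasFDerivAt.mul hcomp
  rw [show (fun z : Phase => f z * φ z.2.1) = f * (φ ∘ fun z : Phase => z.2.1) from rfl, hm.fderiv]
  set r := 1 + ‖z.2.1‖ with hr
  have hr1 : 1 ≤ r := by rw [hr]; linarith [norm_nonneg z.2.1]
  have hpr1 : ‖(ContinuousLinearMap.fst ℝ V3 ℝ).comp
      (ContinuousLinearMap.snd ℝ V3 (V3 × ℝ))‖ ≤ 1 := by
    refine ContinuousLinearMap.opNorm_le_bound _ zero_le_one fun v => ?_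
    rw [one_mul]
    exact (norm_fst_le v.2).trans (norm_snd_le v)
  have b1 : ‖f z • (fderiv ℝ φ z.2.1).comp ((ContinuousLinearMap.fst ℝ V3 ℝ).comp
      (ContinuousLinearMap.snd ℝ V3 (V3 × ℝ)))‖ ≤ |f z| * (2 * r ^ 2) := by
    rw [norm_smul, Real.norm_eq_abs]
    gcongr
    refine (ContinuousLinearMap.opNorm_comp_le _ _).trans ?_
    have := hφ.fderiv_le z.2.1
    nlinarith [norm_nonneg (fderiv ℝ φ z.2.1)]
  have b2 : ‖φ z.2.1 • fderiv ℝ f z‖ ≤ r ^ 2 * ‖fderiv ℝ f z‖ := by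
    rw [norm_smul, Real.norm_eq_abs]
    gcongr
    exact hφ.le z.2.1
  refine (norm_add_le_of_le b1 b2).trans ?_
  rw [← div_eq_mul_inv, le_div_iff₀ (by positivity)]
  have e1 : (|f z| * (2 * r ^ 2) + r ^ 2 * ‖fderiv ℝ f z‖) * r ^ 4
      = 2 * (r ^ 6 * |f z|) + r ^ 6 * ‖fderiv ℝ f z‖ := by ring
  rw [e1]; linarith

/-- Moments of a remainder that is small with its first derivatives are small with their first
derivatives. -/
lemma weightInt_small (hΩ : IsOpen Ω) (hI : IsOpen I) {f : Phase → ℝ} {φ : V3 → ℝ}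
    (hφ : QuadraticWeight φ) (hf : ContDiffOn ℝ 1 f (phaseSet Ω I)) {w : SpaceTime}
    {C : Set SpaceTime} (hCs : C ⊆ Ω ×ˢ I) (hC : C ∈ 𝓝 w) {δ : ℝ}
    (h0 : ∀ p ∈ C, ∀ c : V3, (1 + ‖c‖) ^ 6 * |f (p.1, c, p.2)| ≤ δ)
    (h1 : ∀ p ∈ C, ∀ c : V3, (1 + ‖c‖) ^ 6 * ‖fderiv ℝ f (p.1, c, p.2)‖ ≤ δ) :
    (∀ p ∈ C, Integrable (fun c : V3 => f (p.1, c, p.2) * φ c)) ∧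
    DifferentiableAt ℝ (weightInt f φ) w ∧
    |weightInt f φ w| ≤ (∫ c : V3, ((1 + ‖c‖) ^ 4)⁻¹) * δ ∧
    ‖fderiv ℝ (weightInt f φ) w‖ ≤ (3 * ‖lift‖ * ∫ c : V3, ((1 + ‖c‖) ^ 4)⁻¹) * δ := by
  have hS := isOpen_phaseSet hΩ hI
  have hwC : w ∈ C := mem_of_mem_nhds hC
  have hdiff : ∀ p ∈ C, ∀ c : V3, DifferentiableAt ℝ f (p.1, c, p.2) := fun p hp c =>
    (hf.contDiffAt (hS.mem_nhds (mem_phaseSet_of_mem hCs hp c))).differentiableAt one_ne_zero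
  have hφc : ContDiff ℝ 1 (fun z : Phase => φ z.2.1) := hφ.contDiff.comp (by fun_prop)
  have hfφ : ContDiffOn ℝ 1 (fun z : Phase => f z * φ z.2.1) (phaseSet Ω I) :=
    hf.mul hφc.contDiffOn
  have hval : ∀ p ∈ C, ∀ c : V3, |f (p.1, c, p.2) * φ c| ≤ δ * ((1 + ‖c‖) ^ 4)⁻¹ := by
    intro p hp c
    have hr1 : 0 < 1 + ‖c‖ := by positivity
    rw [abs_mul, ← div_eq_mul_inv, le_div_iff₀ (by positivity)]
    have := h0 p hp c
    have hφ' := hφ.le c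
    calc |f (p.1, c, p.2)| * |φ c| * (1 + ‖c‖) ^ 4
        ≤ |f (p.1, c, p.2)| * (1 + ‖c‖) ^ 2 * (1 + ‖c‖) ^ 4 := by gcongr
      _ = (1 + ‖c‖) ^ 6 * |f (p.1, c, p.2)| := by ring
      _ ≤ δ := this
  have hint : ∀ p ∈ C, Integrable (fun c : V3 => f (p.1, c, p.2) * φ c) := by
    intro p hp
    refine (integrable_one_add_norm_pow_inv.const_mul δ).mono'
      (Continuous.aestronglyMeasurable ?_) (Eventually.of_forall fun c => hval p hp c)
    exact hfφ.continuousOn.comp_continuous (continuous_fiber p) (fiber_mem (hCs hp))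
  have hfd : ∀ p ∈ C, ∀ c : V3, ‖fderiv ℝ (fun z : Phase => f z * φ z.2.1) (p.1, c, p.2)‖
      ≤ 3 * δ * ((1 + ‖c‖) ^ 4)⁻¹ := fun p hp c =>
    fderiv_mul_weight_le hφ (hdiff p hp c) (h0 p hp c) (h1 p hp c)
  have hder := hasFDerivAt_integral_of_contDiffOn (ν := volume) hasFDerivAt_fiber continuous_fiber
    hS (hΩ.prod hI) (fun _ hw c => fiber_mem hw c) hfφ (hCs hwC) (hint w hwC) hC
    (integrable_one_add_norm_pow_inv.const_mul (3 * δ))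
    (Eventually.of_forall fun c p hp => hfd p hp c)
  refine ⟨hint, hder.differentiableAt, ?_, ?_⟩
  · refine (norm_integral_le_of_norm_le (integrable_one_add_norm_pow_inv.const_mul δ)
      (f := fun c : V3 => f (w.1, c, w.2) * φ c)
      (Eventually.of_forall fun c => hval w hwC c)).trans ?_
    rw [integral_const_mul, mul_comm]
  · have : fderiv ℝ (weightInt f φ) w = _ := hder.fderiv
    rw [this]
    refine (norm_integral_le_of_norm_le
      (integrable_one_add_norm_pow_inv.const_mul (3 * δ * ‖lift‖))
      (Eventually.of_forall fun c => ?_)).trans ?_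
    · refine (ContinuousLinearMap.opNorm_comp_le _ _).trans ?_
      have := mul_le_mul_of_nonneg_right (hfd w hwC c) (norm_nonneg lift)
      calc _ ≤ _ := this
        _ = _ := by ring
    · rw [integral_const_mul]; apply le_of_eq; ring

section
variable {E B : VField} {g : ℝ → Distr} {u : ℝ → VField} {gc : ℕ → Distr} {uc : ℕ → VField}
variable (hΩ : IsOpen Ω) (hI : IsOpen I) (hexp : HilbertExpansion Ω I g u gc uc)
include hΩ hI hexp

lemma rem_fderiv_g {z : Phase} (hz : z ∈ phaseSet Ω I) {ε : ℝ}
    (hreg : ContDiffOn ℝ 1 (onPhase (g ε)) (phaseSet Ω I)) :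
    fderiv ℝ (fun z => onPhase (g ε) z - ∑ k ∈ Finset.range 3, ε ^ k * onPhase (gc k) z) z
      = fderiv ℝ (onPhase (g ε)) z
        - ∑ k ∈ Finset.range 3, ε ^ k • fderiv ℝ (onPhase (gc k)) z := by
  have hS := (isOpen_phaseSet hΩ hI).mem_nhds hz
  have hd : ∀ k < 3, DifferentiableAt ℝ (onPhase (gc k)) z := fun k hk =>
    ((hexp.coeff_g k hk).1.contDiffAt hS).differentiableAt (by simp)
  have hdε : DifferentiableAt ℝ (onPhase (g ε)) z :=
    (hreg.contDiffAt hS).differentiableAt one_ne_zero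
  rw [fderiv_fun_sub hdε (DifferentiableAt.fun_sum fun k hk =>
    (hd k (Finset.mem_range.1 hk)).const_mul _), fderiv_fun_sum (fun k hk =>
    (hd k (Finset.mem_range.1 hk)).const_mul _)]
  congr 1
  refine Finset.sum_congr rfl fun k hk => ?_
  rw [fderiv_const_mul (hd k (Finset.mem_range.1 hk))]

omit hΩ hI in
lemma expansion_g {z : Phase} (hz : z ∈ phaseSet Ω I) :
    Expansion (fun ε => onPhase (g ε) z) (fun k => onPhase (gc k) z) := by
  refine Expansion.of_eventually_le zero_le_one fun η hη => ?_
  filter_upwards [hexp.rem_g {foot z} isCompact_singleton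
    (by rw [singleton_subset_iff]; exact ⟨hz.1, hz.2.2⟩) 0 0 (by norm_num) η hη] with ε h
  have := h (foot z) rfl z.2.1
  rw [norm_iteratedFDeriv_zero] at this
  simpa using this

lemma expansion_fderiv_g {z : Phase} (hz : z ∈ phaseSet Ω I) :
    Expansion (fun ε => fderiv ℝ (onPhase (g ε)) z) (fun k => fderiv ℝ (onPhase (gc k)) z) := by
  refine Expansion.of_eventually_le zero_le_one fun η hη => ?_
  filter_upwards [hexp.rem_g {foot z} isCompact_singleton
    (by rw [singleton_subset_iff]; exact ⟨hz.1, hz.2.2⟩) 0 1 (by norm_num) η hη,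
    hexp.reg_g] with ε h hreg
  have := h (foot z) rfl z.2.1
  rw [norm_iteratedFDeriv_one, pow_zero, one_mul] at this
  rw [one_mul, ← rem_fderiv_g hΩ hI hexp hz hreg]
  exact this

omit hΩ hI in
lemma expansion_u {w : SpaceTime} (hw : w ∈ Ω ×ˢ I) :
    Expansion (fun ε => onSpaceTime (u ε) w) (fun k => onSpaceTime (uc k) w) := by
  refine Expansion.of_eventually_le zero_le_one fun η hη => ?_
  filter_upwards [hexp.rem_u {w} isCompact_singleton
    (by rw [singleton_subset_iff]; exact hw) 0 (by norm_num) η hη] with ε h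
  have := h w rfl
  rw [norm_iteratedFDeriv_zero] at this
  simpa using this

lemma expansion_fderiv_u {w : SpaceTime} (hw : w ∈ Ω ×ˢ I) :
    Expansion (fun ε => fderiv ℝ (onSpaceTime (u ε)) w)
      (fun k => fderiv ℝ (onSpaceTime (uc k)) w) := by
  refine Expansion.of_eventually_le zero_le_one fun η hη => ?_
  filter_upwards [hexp.rem_u {w} isCompact_singleton
    (by rw [singleton_subset_iff]; exact hw) 1 (by norm_num) η hη,
    hexp.reg_u] with ε h hreg
  have := h w rfl
  have hS := (hΩ.prod hI).mem_nhds hw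
  have hd : ∀ k < 3, DifferentiableAt ℝ (onSpaceTime (uc k)) w := fun k hk =>
    ((hexp.coeff_u k hk).contDiffAt hS).differentiableAt (by simp)
  have hdε : DifferentiableAt ℝ (onSpaceTime (u ε)) w :=
    (hreg.contDiffAt hS).differentiableAt one_ne_zero
  rw [norm_iteratedFDeriv_one, fderiv_fun_sub hdε (DifferentiableAt.fun_sum fun k hk =>
    (hd k (Finset.mem_range.1 hk)).fun_const_smul _), fderiv_fun_sum (fun k hk =>
    (hd k (Finset.mem_range.1 hk)).fun_const_smul _)] at this
  have e1 : ∀ k ∈ Finset.range 3, fderiv ℝ (fun z => ε ^ k • onSpaceTime (uc k) z) w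
      = ε ^ k • fderiv ℝ (onSpaceTime (uc k)) w := fun k hk =>
    fderiv_fun_const_smul (hd k (Finset.mem_range.1 hk)) _
  rw [Finset.sum_congr rfl e1] at this
  rwa [one_mul]

/-- Moments and their first derivatives inherit the expansion. -/
lemma expansion_weightInt {φ : V3 → ℝ} (hφ : QuadraticWeight φ)
    (hφm : Moderate Ω I (fun z : Phase => φ z.2.1)) {w : SpaceTime} (hw : w ∈ Ω ×ˢ I) :
    Expansion (fun ε => weightInt (onPhase (g ε)) φ w)
      (fun k => weightInt (onPhase (gc k)) φ w) ∧
    Expansion (fun ε => fderiv ℝ (weightInt (onPhase (g ε)) φ) w)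
      (fun k => fderiv ℝ (weightInt (onPhase (gc k)) φ) w) ∧
    ∀ᶠ ε in 𝓝[>] (0 : ℝ), DifferentiableAt ℝ (weightInt (onPhase (g ε)) φ) w ∧
      Integrable (fun c : V3 => onPhase (g ε) (w.1, c, w.2) * φ c) := by
  obtain ⟨C, hC, hCs, hCn⟩ := exists_compact_nhds hΩ hI hw
  have hJ : 0 ≤ ∫ c : V3, ((1 + ‖c‖) ^ 4)⁻¹ := integral_nonneg fun c => by positivity
  have hR : ∀ k < 3, Rapid Ω I (fun z : Phase => onPhase (gc k) z * φ z.2.1) := fun k hk => by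
    have := Rapid.bilin hΩ hI (ContinuousLinearMap.mul ℝ ℝ) hφm (hexp.coeff_g k hk).rapid
    simpa [mul_comm] using this
  have key : ∀ η > (0 : ℝ), ∀ᶠ ε in 𝓝[>] (0 : ℝ),
      (DifferentiableAt ℝ (weightInt (onPhase (g ε)) φ) w ∧
        Integrable (fun c : V3 => onPhase (g ε) (w.1, c, w.2) * φ c)) ∧
      ‖weightInt (onPhase (g ε)) φ w
        - ∑ k ∈ Finset.range 3, ε ^ k • weightInt (onPhase (gc k)) φ w‖
        ≤ (∫ c : V3, ((1 + ‖c‖) ^ 4)⁻¹) * (η * ε ^ 2) ∧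
      ‖fderiv ℝ (weightInt (onPhase (g ε)) φ) w
        - ∑ k ∈ Finset.range 3, ε ^ k • fderiv ℝ (weightInt (onPhase (gc k)) φ) w‖
        ≤ (3 * ‖lift‖ * ∫ c : V3, ((1 + ‖c‖) ^ 4)⁻¹) * (η * ε ^ 2) := by
    intro η hη
    filter_upwards [hexp.rem_g C hC hCs 6 0 (by norm_num) η hη,
      hexp.rem_g C hC hCs 6 1 (by norm_num) η hη, hexp.reg_g] with ε h0 h1 hreg
    set f : Phase → ℝ := fun z => onPhase (g ε) z - ∑ k ∈ Finset.range 3, ε ^ k * onPhase (gc k) z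
      with hfdef
    have hf : ContDiffOn ℝ 1 f (phaseSet Ω I) := by
      refine hreg.sub (ContDiffOn.sum fun k hk => contDiffOn_const.mul ?_)
      exact (hexp.coeff_g k (Finset.mem_range.1 hk)).1.of_le (by exact_mod_cast le_top)
    obtain ⟨hint, hd, hv, hfd⟩ := weightInt_small hΩ hI hφ hf hCs hCn (δ := η * ε ^ 2)
      (fun p hp c => by simpa [norm_iteratedFDeriv_zero] using h0 p hp c)
      (fun p hp c => by simpa [norm_iteratedFDeriv_one] using h1 p hp c)
    have hsum : ∀ p ∈ C, weightInt (onPhase (g ε)) φ p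
        = weightInt f φ p + ∑ k ∈ Finset.range 3, ε ^ k • weightInt (onPhase (gc k)) φ p := by
      intro p hp
      have hk : ∀ k ∈ Finset.range 3, Integrable (fun c : V3 =>
          ε ^ k * (onPhase (gc k) (p.1, c, p.2) * φ c)) := fun k hk =>
        ((hR k (Finset.mem_range.1 hk)).integrable (hCs hp)).const_mul _
      simp only [weightInt, velInt, smul_eq_mul, ← integral_const_mul]
      rw [← integral_finsetSum _ hk, ← integral_add (hint p hp) (integrable_finsetSum _ hk)]
      refine integral_congr_ae (Eventually.of_forall fun c => ?_)
      simp only [hfdef, sub_mul, Finset.sum_mul, mul_assoc]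
      ring
    have hdk : ∀ k ∈ Finset.range 3, DifferentiableAt ℝ (weightInt (onPhase (gc k)) φ) w :=
      fun k hk => ((hR k (Finset.mem_range.1 hk)).hasFDerivAt_velInt hΩ hI hw).differentiableAt
    have hev : weightInt (onPhase (g ε)) φ =ᶠ[𝓝 w] fun p => weightInt f φ p
        + ∑ k ∈ Finset.range 3, ε ^ k • weightInt (onPhase (gc k)) φ p := by
      filter_upwards [hCn] with p hp using hsum p hp
    have hds : DifferentiableAt ℝ
        (fun p => ∑ k ∈ Finset.range 3, ε ^ k • weightInt (onPhase (gc k)) φ p) w :=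
      DifferentiableAt.fun_sum fun k hk => (hdk k hk).fun_const_smul _
    refine ⟨⟨(hd.add hds).congr_of_eventuallyEq hev, ?_⟩, ?_, ?_⟩
    · have hk : ∀ k ∈ Finset.range 3, Integrable (fun c : V3 =>
          ε ^ k * (onPhase (gc k) (w.1, c, w.2) * φ c)) := fun k hk =>
        ((hR k (Finset.mem_range.1 hk)).integrable hw).const_mul _
      refine ((hint w (mem_of_mem_nhds hCn)).add (integrable_finsetSum _ hk)).congr
        (Eventually.of_forall fun c => ?_)
      simp only [hfdef, sub_mul, Finset.sum_mul, mul_assoc, Pi.add_apply]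
      ring
    · rw [hsum w (mem_of_mem_nhds hCn), add_sub_cancel_right]; exact hv
    · rw [hev.fderiv_eq, fderiv_fun_add hd hds,
        fderiv_fun_sum (fun k hk => (hdk k hk).fun_const_smul _)]
      have : ∀ k ∈ Finset.range 3, fderiv ℝ (fun p => ε ^ k • weightInt (onPhase (gc k)) φ p) w
          = ε ^ k • fderiv ℝ (weightInt (onPhase (gc k)) φ) w := fun k hk =>
        fderiv_fun_const_smul (hdk k hk) _
      rw [Finset.sum_congr rfl this, add_sub_cancel_right]; exact hfd
  refine ⟨Expansion.of_eventually_le hJ fun η hη => (key η hη).mono fun ε h => h.2.1,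
    Expansion.of_eventually_le (by positivity) fun η hη => (key η hη).mono fun ε h => h.2.2,
    (key 1 one_pos).mono fun ε h => h.1⟩

end

end

section

variable {Ω : Set V3} {I : Set ℝ}

lemma density_eq_weightInt (g : Distr) (x : V3) (t : ℝ) :
    density g x t = weightInt (onPhase g) (fun _ => 1) (x, t) := by
  simp [density, weightInt, velInt, onPhase]

lemma tensorDvg_pressure {g : Distr} {x : V3} {t : ℝ}
    (h : ∀ i j : Fin 3,
      DifferentiableAt ℝ (weightInt (onPhase g) (fun c => c i * c j)) (x, t)) :
    tensorDvg (fun y => pressure g y t) x = WithLp.toLp 2 (fun j => ∑ i : Fin 3,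
      fderiv ℝ (weightInt (onPhase g) (fun c => c i * c j)) (x, t) (e i, 0)) := by
  simp only [tensorDvg]
  congr 1
  ext j
  refine Finset.sum_congr rfl fun i _ => ?_
  exact fderiv_slice_space (h i j) (e i)

lemma tendsto_toLp {l : Filter ℝ} {f : ℝ → Fin 3 → ℝ} {a : Fin 3 → ℝ}
    (h : ∀ j, Tendsto (fun ε => f ε j) l (𝓝 (a j))) :
    Tendsto (fun ε => (WithLp.toLp 2 (f ε) : V3)) l (𝓝 (WithLp.toLp 2 a)) :=
  ((PiLp.continuous_toLp 2 (fun _ : Fin 3 => ℝ)).tendsto a).comp (tendsto_pi_nhds.2 h)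

lemma moderate_one : Moderate Ω I (fun _ : Phase => (1 : ℝ)) := .const 1

lemma moderate_coord (hΩ : IsOpen Ω) (hI : IsOpen I) (i : Fin 3) :
    Moderate Ω I (fun z : Phase => z.2.1 i) :=
  Moderate.clm hΩ hI (EuclideanSpace.proj (𝕜 := ℝ) i) Moderate.vel

lemma Moderate.mul (hΩ : IsOpen Ω) (hI : IsOpen I) {f g : Phase → ℝ} (hf : Moderate Ω I f)
    (hg : Moderate Ω I g) : Moderate Ω I (fun z => f z * g z) :=
  Moderate.bilin hΩ hI (ContinuousLinearMap.mul ℝ ℝ) hf hg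

/-- The value at a point of the product rule for `∂ (n uᵢ uⱼ)` depends continuously on the
values and the derivatives of `n` and `u`. -/
lemma fderiv_mul_mul_coord {N : SpaceTime → ℝ} {U : SpaceTime → V3} {w : SpaceTime}
    (hN : DifferentiableAt ℝ N w) (hU : DifferentiableAt ℝ U w) (i j : Fin 3) (v : SpaceTime) :
    fderiv ℝ (fun p => N p * (U p i * U p j)) w v
      = N w * (U w i * (fderiv ℝ U w v) j + U w j * (fderiv ℝ U w v) i)
        + U w i * U w j * fderiv ℝ N w v := by
  have hd : ∀ i : Fin 3, DifferentiableAt ℝ (fun p => U p i) w := fun i => by fun_prop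
  rw [fderiv_fun_mul hN ((hd i).fun_mul (hd j)), fderiv_fun_mul (hd i) (hd j)]
  simp [fderiv_coord hU]
  ring

lemma vlasovLHS_eq {B : VField} {g : Distr} {u : VField} {x c : V3} {t ε : ℝ}
    (hg : DifferentiableAt ℝ (onPhase g) (x, c, t))
    (hu : DifferentiableAt ℝ (onSpaceTime u) (x, t)) :
    vlasovLHS B ε g u x c t
      = fderiv ℝ (onPhase g) (x, c, t) (u x t, -fderiv ℝ (onSpaceTime u) (x, t) (c, 0), 1)
        + ε⁻¹ * fderiv ℝ (onPhase g) (x, c, t)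
          (c, (density g x t)⁻¹ • tensorDvg (fun y => pressure g y t) x, 0)
        + (ε ^ 2)⁻¹ * fderiv ℝ (onPhase g) (x, c, t) (0, cross c (B x t), 0) := by
  have k1 : ∀ v : V3, inner ℝ v (gradient (fun y => g y c t) x)
      = fderiv ℝ (onPhase g) (x, c, t) (v, 0, 0) := fun v => by
    rw [real_inner_comm, inner_gradient]; exact fderiv_slice_pos hg v
  have k2 : ∀ v : V3, inner ℝ v (gradient (fun c' => g x c' t) c)
      = fderiv ℝ (onPhase g) (x, c, t) (0, v, 0) := fun v => by
    rw [real_inner_comm, inner_gradient]; exact fderiv_slice_vel hg v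
  have k3 : deriv (fun s => g x c s) t = fderiv ℝ (onPhase g) (x, c, t) (0, 0, 1) :=
    deriv_slice_time hg
  have k4 : fderiv ℝ (fun y => u y t) x c = fderiv ℝ (onSpaceTime u) (x, t) (c, 0) :=
    fderiv_slice_space hu c
  have s1 : ∀ v : V3, (((u x t, -v, 1) : Phase)) = (0, 0, 1) + (u x t, 0, 0) - (0, v, 0) := by
    intro v; simp
  have s2 : ∀ v : V3, (((c, v, 0) : Phase)) = (c, 0, 0) + (0, v, 0) := by intro v; simp
  simp only [vlasovLHS, k1, k2, k3, k4]
  rw [s1, s2 ((density g x t)⁻¹ • _), map_sub, map_add, map_add]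

section
variable {E B : VField} {g : ℝ → Distr} {u : ℝ → VField} {gc : ℕ → Distr} {uc : ℕ → VField}
variable (hΩ : IsOpen Ω) (hI : IsOpen I) (hexp : HilbertExpansion Ω I g u gc uc)
include hΩ hI hexp

lemma tendsto_momentum_flux {x : V3} (hx : x ∈ Ω) {t : ℝ} (ht : t ∈ I) :
    ∃ a₀ : V3, Tendsto (fun ε => deriv (fun s => density (g ε) x s • u ε x s) t
      + tensorDvg (fun y => density (g ε) y t • tens (u ε y t) (u ε y t)) x)
      (𝓝[>] 0) (𝓝 a₀) := by
  have hw : ((x, t) : SpaceTime) ∈ Ω ×ˢ I := ⟨hx, ht⟩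
  obtain ⟨n0, n1, n2⟩ := expansion_weightInt hΩ hI hexp quadraticWeight_one moderate_one hw
  have u0 := expansion_u hexp hw
  have u1 := expansion_fderiv_u hΩ hI hexp hw
  have ud : ∀ᶠ ε in 𝓝[>] (0 : ℝ), DifferentiableAt ℝ (onSpaceTime (u ε)) (x, t) := by
    filter_upwards [hexp.reg_u] with ε h
    exact (h.contDiffAt ((hΩ.prod hI).mem_nhds hw)).differentiableAt one_ne_zero
  have hu : ∀ i : Fin 3, Tendsto (fun ε => onSpaceTime (u ε) (x, t) i) (𝓝[>] 0) _ := fun i =>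
    (u0.clm (EuclideanSpace.proj (𝕜 := ℝ) i)).tendsto
  have hDu : ∀ v, Tendsto (fun ε => fderiv ℝ (onSpaceTime (u ε)) (x, t) v) (𝓝[>] 0) _ := fun v =>
    (u1.clm (ContinuousLinearMap.apply ℝ V3 v)).tendsto
  have hDui : ∀ v (i : Fin 3),
      Tendsto (fun ε => (fderiv ℝ (onSpaceTime (u ε)) (x, t) v) i) (𝓝[>] 0) _ := fun v i =>
    ((u1.clm (ContinuousLinearMap.apply ℝ V3 v)).clm (EuclideanSpace.proj (𝕜 := ℝ) i)).tendsto
  have hDn : ∀ v, Tendsto (fun ε => fderiv ℝ (weightInt (onPhase (g ε)) (fun _ => 1)) (x, t) v)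
      (𝓝[>] 0) _ := fun v => (n1.clm (ContinuousLinearMap.apply ℝ ℝ v)).tendsto
  have A1 := (n0.tendsto.smul (hDu (0, 1))).add ((hDn (0, 1)).smul u0.tendsto)
  have A2 := tendsto_toLp (f := fun ε j => ∑ i : Fin 3,
      (weightInt (onPhase (g ε)) (fun _ => 1) (x, t) * (onSpaceTime (u ε) (x, t) i *
        (fderiv ℝ (onSpaceTime (u ε)) (x, t) (e i, 0)) j + onSpaceTime (u ε) (x, t) j *
        (fderiv ℝ (onSpaceTime (u ε)) (x, t) (e i, 0)) i)
        + onSpaceTime (u ε) (x, t) i * onSpaceTime (u ε) (x, t) j *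
        fderiv ℝ (weightInt (onPhase (g ε)) (fun _ => 1)) (x, t) (e i, 0)))
    (fun j => tendsto_finsetSum Finset.univ fun i _ =>
      (n0.tendsto.mul (((hu i).mul (hDui (e i, 0) j)).add ((hu j).mul (hDui (e i, 0) i)))).add
        (((hu i).mul (hu j)).mul (hDn (e i, 0))))
  refine ⟨_, (A1.add A2).congr' ?_⟩
  filter_upwards [n2, ud] with ε ⟨hnd, _⟩ hud
  have e1 : deriv (fun s => density (g ε) x s • u ε x s) t
      = weightInt (onPhase (g ε)) (fun _ => 1) (x, t) • fderiv ℝ (onSpaceTime (u ε)) (x, t) (0, 1)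
        + fderiv ℝ (weightInt (onPhase (g ε)) (fun _ => 1)) (x, t) (0, 1)
          • onSpaceTime (u ε) (x, t) := by
    simp only [density_eq_weightInt]
    refine (deriv_slice_field (a := fun p => weightInt (onPhase (g ε)) (fun _ => 1) p •
      onSpaceTime (u ε) p) (hnd.smul hud)).trans ?_
    rw [fderiv_smul_apply hnd hud]
  have e2 : tensorDvg (fun y => density (g ε) y t • tens (u ε y t) (u ε y t)) x
      = WithLp.toLp 2 (fun j => ∑ i : Fin 3,
      (weightInt (onPhase (g ε)) (fun _ => 1) (x, t) * (onSpaceTime (u ε) (x, t) i *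
        (fderiv ℝ (onSpaceTime (u ε)) (x, t) (e i, 0)) j + onSpaceTime (u ε) (x, t) j *
        (fderiv ℝ (onSpaceTime (u ε)) (x, t) (e i, 0)) i)
        + onSpaceTime (u ε) (x, t) i * onSpaceTime (u ε) (x, t) j *
        fderiv ℝ (weightInt (onPhase (g ε)) (fun _ => 1)) (x, t) (e i, 0))) := by
    simp only [tensorDvg]
    congr 1
    ext j
    refine Finset.sum_congr rfl fun i _ => ?_
    rw [← fderiv_mul_mul_coord hnd hud, ← fderiv_slice_space]
    · simp only [density_eq_weightInt, tens, Matrix.smul_apply, Matrix.of_apply, smul_eq_mul]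
      rfl
    · exact hnd.mul ((by fun_prop : DifferentiableAt ℝ (fun p => onSpaceTime (u ε) p i) (x, t)).mul
        (by fun_prop))
  rw [e1, e2]

variable (hsol : FormalSolution Ω I E B g u)
include hsol

lemma momentum_isLittleO {x : V3} (hx : x ∈ Ω) {t : ℝ} (ht : t ∈ I) :
    (fun ε => tensorDvg (fun y => pressure (g ε) y t) x
        - density (g ε) x t • (E x t + cross (u ε x t) (B x t)))
      =o[𝓝[>] (0 : ℝ)] fun ε => ε := by
  obtain ⟨a₀, ha⟩ := tendsto_momentum_flux hΩ hI hexp hx ht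
  have h := (hsol.momentum x hx t ht).sub ha
  have h2 : (fun ε : ℝ => ε ^ 2) =o[𝓝[>] (0 : ℝ)] fun ε => ε := by
    have := (Asymptotics.isLittleO_pow_pow (𝕜 := ℝ) (show 1 < 2 by norm_num)).mono
      (nhdsWithin_le_nhds (s := Ioi (0 : ℝ)))
    simpa using this
  have h3 := h2.smul_isBigO (h.isBigO_one ℝ)
  simp only [smul_eq_mul, mul_one] at h3
  refine h3.congr' ?_ .rfl
  filter_upwards [self_mem_nhdsWithin] with ε hε
  have hε0 : ε ^ 2 ≠ 0 := pow_ne_zero _ (ne_of_gt hε)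
  simp only [momentumLHS]
  rw [add_sub_cancel_left, smul_smul, mul_inv_cancel₀ hε0, one_smul]

lemma tensorDvg_pressure_eq {x : V3} (hx : x ∈ Ω) {t : ℝ} (ht : t ∈ I) :
    tensorDvg (fun y => pressure (gc 0) y t) x
      = density (gc 0) x t • (E x t + cross (uc 0 x t) (B x t)) := by
  have hw : ((x, t) : SpaceTime) ∈ Ω ×ˢ I := ⟨hx, ht⟩
  obtain ⟨n0, -, -⟩ := expansion_weightInt hΩ hI hexp quadraticWeight_one moderate_one hw
  have hp := fun i j => expansion_weightInt hΩ hI hexp (quadraticWeight_mul i j)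
    ((moderate_coord hΩ hI i).mul hΩ hI (moderate_coord hΩ hI j)) hw
  have hpd : ∀ᶠ ε in 𝓝[>] (0 : ℝ), ∀ i j : Fin 3,
      DifferentiableAt ℝ (weightInt (onPhase (g ε)) (fun c => c i * c j)) (x, t) := by
    simp only [eventually_all]
    exact fun i j => (hp i j).2.2.mono fun _ h => h.1
  have hP : Tendsto (fun ε => tensorDvg (fun y => pressure (g ε) y t) x) (𝓝[>] 0)
      (𝓝 (tensorDvg (fun y => pressure (gc 0) y t) x)) := by
    rw [tensorDvg_pressure (fun i j => by
      have := Rapid.bilin hΩ hI (ContinuousLinearMap.mul ℝ ℝ)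
        ((moderate_coord hΩ hI i).mul hΩ hI (moderate_coord hΩ hI j))
        (hexp.coeff_g 0 (by norm_num)).rapid
      refine (Rapid.hasFDerivAt_velInt hΩ hI (h := fun z : Phase => onPhase (gc 0) z *
        (z.2.1 i * z.2.1 j)) (by simpa [mul_comm] using this) hw).differentiableAt)]
    refine (tendsto_toLp fun j => tendsto_finsetSum Finset.univ fun i _ =>
      ((hp i j).2.1.clm (ContinuousLinearMap.apply ℝ ℝ ((e i, 0) : SpaceTime))).tendsto).congr' ?_
    filter_upwards [hpd] with ε h
    rw [tensorDvg_pressure h]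
    rfl
  have hu := (expansion_u hexp hw).tendsto
  have hR : Tendsto (fun ε => density (g ε) x t • (E x t + cross (u ε x t) (B x t))) (𝓝[>] 0)
      (𝓝 (density (gc 0) x t • (E x t + cross (uc 0 x t) (B x t)))) := by
    simp only [density_eq_weightInt]
    refine n0.tendsto.smul (tendsto_const_nhds.add ?_)
    have hc : Continuous fun v : V3 => crossL v (B x t) := by fun_prop
    exact (hc.tendsto _).comp hu
  have h0 := (momentum_isLittleO hΩ hI hexp hsol hx ht).trans_tendsto
    (tendsto_id.mono_left nhdsWithin_le_nhds)
  have := tendsto_nhds_unique h0 (hP.sub hR)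
  exact (sub_eq_zero.1 this.symm)

/-- The force in the Vlasov equation is `E + u × B` up to first order. -/
lemma force_isLittleO (hn : ∀ x ∈ Ω, ∀ t ∈ I, density (gc 0) x t ≠ 0)
    {x : V3} (hx : x ∈ Ω) {t : ℝ} (ht : t ∈ I) :
    (fun ε => (density (g ε) x t)⁻¹ • tensorDvg (fun y => pressure (g ε) y t) x
        - ((E x t + cross (uc 0 x t) (B x t)) + ε • cross (uc 1 x t) (B x t)))
      =o[𝓝[>] (0 : ℝ)] fun ε => ε := by
  have hw : ((x, t) : SpaceTime) ∈ Ω ×ˢ I := ⟨hx, ht⟩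
  obtain ⟨n0, -, -⟩ := expansion_weightInt hΩ hI hexp quadraticWeight_one moderate_one hw
  have hn0 : Tendsto (fun ε => density (g ε) x t) (𝓝[>] 0) (𝓝 (density (gc 0) x t)) := by
    simp only [density_eq_weightInt]; exact n0.tendsto
  have h1 := ((hn0.inv₀ (hn x hx t ht)).isBigO_one ℝ).smul_isLittleO
    (momentum_isLittleO hΩ hI hexp hsol hx ht)
  simp only [smul_eq_mul, one_mul] at h1
  have h2 := ((expansion_u hexp hw).clm (crossL.flip (B x t))).first
  refine (h1.add h2).congr' ?_ .rfl
  filter_upwards [hn0.eventually_ne (hn x hx t ht)] with ε hε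
  have h3 : crossL.flip (B x t) (onSpaceTime (u ε) (x, t)) = cross (u ε x t) (B x t) := rfl
  have h4 : ∀ k, crossL.flip (B x t) (onSpaceTime (uc k) (x, t)) = cross (uc k x t) (B x t) :=
    fun _ => rfl
  rw [smul_sub, smul_smul, inv_mul_cancel₀ hε, h3, h4, h4]
  module

/-- The Vlasov equation at the orders `ε⁻²`, `ε⁻¹` and `ε⁰`. -/
lemma vlasov_orders (hn : ∀ x ∈ Ω, ∀ t ∈ I, density (gc 0) x t ≠ 0)
    {x : V3} (hx : x ∈ Ω) (c : V3) {t : ℝ} (ht : t ∈ I) :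
    fderiv ℝ (onPhase (gc 0)) (x, c, t) (0, cross c (B x t), 0) = 0 ∧
    fderiv ℝ (onPhase (gc 0)) (x, c, t) (c, E x t + cross (uc 0 x t) (B x t), 0)
      + fderiv ℝ (onPhase (gc 1)) (x, c, t) (0, cross c (B x t), 0) = 0 ∧
    fderiv ℝ (onPhase (gc 0)) (x, c, t)
        (uc 0 x t, -fderiv ℝ (onSpaceTime (uc 0)) (x, t) (c, 0), 1)
      + (fderiv ℝ (onPhase (gc 1)) (x, c, t) (c, E x t + cross (uc 0 x t) (B x t), 0)
        + fderiv ℝ (onPhase (gc 0)) (x, c, t) (0, cross (uc 1 x t) (B x t), 0))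
      + fderiv ℝ (onPhase (gc 2)) (x, c, t) (0, cross c (B x t), 0) = 0 := by
  have hw : ((x, t) : SpaceTime) ∈ Ω ×ˢ I := ⟨hx, ht⟩
  have hz : ((x, c, t) : Phase) ∈ phaseSet Ω I := ⟨hx, mem_univ _, ht⟩
  have hA := expansion_fderiv_g hΩ hI hexp hz
  have hu := expansion_u hexp hw
  have hdu := expansion_fderiv_u hΩ hI hexp hw
  have hF := force_isLittleO hΩ hI hexp hsol hn hx ht
  set Fε : ℝ → V3 := fun ε => (density (g ε) x t)⁻¹ • tensorDvg (fun y => pressure (g ε) y t) x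
    with hFε
  set F0 : V3 := E x t + cross (uc 0 x t) (B x t) with hF0
  set F1 : V3 := cross (uc 1 x t) (B x t) with hF1
  set A : ℝ → (Phase →L[ℝ] ℝ) := fun ε => fderiv ℝ (onPhase (g ε)) (x, c, t) with hAdef
  set A' : ℕ → (Phase →L[ℝ] ℝ) := fun k => fderiv ℝ (onPhase (gc k)) (x, c, t) with hA'def
  have hr := hA.clm (ContinuousLinearMap.apply ℝ ℝ ((0, cross c (B x t), 0) : Phase))
  have hp : Tendsto (fun ε => A ε (u ε x t, -fderiv ℝ (onSpaceTime (u ε)) (x, t) (c, 0), 1))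
      (𝓝[>] 0) (𝓝 (A' 0 (uc 0 x t, -fderiv ℝ (onSpaceTime (uc 0)) (x, t) (c, 0), 1))) := by
    have h1 : Tendsto (fun ε => ((u ε x t, -fderiv ℝ (onSpaceTime (u ε)) (x, t) (c, 0), 1) : Phase))
        (𝓝[>] 0) (𝓝 (uc 0 x t, -fderiv ℝ (onSpaceTime (uc 0)) (x, t) (c, 0), 1)) :=
      hu.tendsto.prodMk_nhds (((hdu.clm (ContinuousLinearMap.apply ℝ V3
        ((c, 0) : SpaceTime))).tendsto.neg).prodMk_nhds tendsto_const_nhds)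
    exact (isBoundedBilinearMap_apply.continuous.tendsto _).comp (hA.tendsto.prodMk_nhds h1)
  have hq : (fun ε => A ε (c, Fε ε, 0) - (A' 0 (c, F0, 0) + ε * (A' 1 (c, F0, 0)
      + A' 0 (0, F1, 0)))) =o[𝓝[>] (0 : ℝ)] fun ε => ε := by
    have a1 := hA.first
    have b1 : (fun ε => A ε (0, Fε ε - (F0 + ε • F1), 0)) =o[𝓝[>] (0 : ℝ)] fun ε => ε := by
      let J : V3 →L[ℝ] Phase := (0 : V3 →L[ℝ] V3).prod
        ((ContinuousLinearMap.id ℝ V3).prod (0 : V3 →L[ℝ] ℝ))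
      have hb : (fun ε => A ε) =O[𝓝[>] (0 : ℝ)] fun _ => (1 : ℝ) := hA.tendsto.isBigO_one ℝ
      have hj : (fun ε => J (Fε ε - (F0 + ε • F1))) =o[𝓝[>] (0 : ℝ)] fun ε => ε :=
        (J.isBigO_comp _ _).trans_isLittleO hF
      have := (hb.norm_left.smul_isLittleO hj.norm_left)
      simp only [smul_eq_mul, one_mul] at this
      refine Asymptotics.IsBigO.trans_isLittleO (.of_bound 1 (Eventually.of_forall fun ε => ?_)) this
      rw [one_mul, norm_mul, norm_norm, norm_norm]
      exact (A ε).le_opNorm _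
    have c1 : (fun ε => (A ε - (A' 0 + ε • A' 1)) (c, F0 + ε • F1, 0))
        =o[𝓝[>] (0 : ℝ)] fun ε => ε := by
      have hv : Tendsto (fun ε : ℝ => ((c, F0 + ε • F1, 0) : Phase)) (𝓝[>] 0)
          (𝓝 (c, F0 + (0 : ℝ) • F1, 0)) :=
        ((by fun_prop : Continuous fun ε : ℝ => ((c, F0 + ε • F1, 0) : Phase)).tendsto 0).mono_left
          nhdsWithin_le_nhds
      have := a1.norm_left.smul_isBigO (hv.isBigO_one ℝ).norm_left
      simp only [smul_eq_mul, mul_one] at this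
      refine Asymptotics.IsBigO.trans_isLittleO (.of_bound 1 (Eventually.of_forall fun ε => ?_)) this
      rw [one_mul, norm_mul, norm_norm, norm_norm]
      exact (A ε - (A' 0 + ε • A' 1)).le_opNorm _
    have d1 : (fun ε : ℝ => ε ^ 2 * A' 1 (0, F1, 0)) =o[𝓝[>] (0 : ℝ)] fun ε => ε := by
      have h2 : (fun ε : ℝ => ε ^ 2) =o[𝓝[>] (0 : ℝ)] fun ε => ε := by
        have := (Asymptotics.isLittleO_pow_pow (𝕜 := ℝ) (show 1 < 2 by norm_num)).mono
          (nhdsWithin_le_nhds (s := Ioi (0 : ℝ)))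
        simpa using this
      simpa [mul_comm] using h2.const_mul_left (A' 1 (0, F1, 0))
    refine ((b1.add c1).add d1).congr_left fun ε => ?_
    have s1 : ((0, Fε ε - (F0 + ε • F1), 0) : Phase) = (c, Fε ε, 0) - (c, F0 + ε • F1, 0) := by
      simp
    have s2 : ((c, F0 + ε • F1, 0) : Phase) = (c, F0, 0) + ε • (0, F1, 0) := by simp
    rw [s1, map_sub, s2]
    simp only [_root_.sub_apply, _root_.add_apply, _root_.smul_apply, map_add, map_smul,
      smul_eq_mul]
    ring
  have hd : ∀ᶠ ε in 𝓝[>] (0 : ℝ), vlasovLHS B ε (g ε) (u ε) x c t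
      = A ε (u ε x t, -fderiv ℝ (onSpaceTime (u ε)) (x, t) (c, 0), 1) + ε⁻¹ * A ε (c, Fε ε, 0)
        + (ε ^ 2)⁻¹ * A ε (0, cross c (B x t), 0) := by
    filter_upwards [hexp.reg_u, hexp.reg_g] with ε h1 h2
    exact vlasovLHS_eq
      ((h2.contDiffAt ((isOpen_phaseSet hΩ hI).mem_nhds hz)).differentiableAt one_ne_zero)
      ((h1.contDiffAt ((hΩ.prod hI).mem_nhds hw)).differentiableAt one_ne_zero)
  exact match_orders hp hq hr ((hsol.vlasov x hx t ht c).congr' hd)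

/-- The first order correction has no mean velocity. -/
lemma first_moment_zero {w : SpaceTime} (hw : w ∈ Ω ×ˢ I) (i : Fin 3) :
    weightInt (onPhase (gc 1)) (fun c => c i) w = 0 := by
  have h := fun i => expansion_weightInt hΩ hI hexp (quadraticWeight_coord i)
    (moderate_coord hΩ hI i) hw
  refine (h i).1.eq_zero_of_eventually ?_
  filter_upwards [hsol.mean_zero, eventually_all.2 fun i => (h i).2.2] with ε h0 h2
  have h1 := h0 w.1 hw.1 w.2 hw.2
  have hint : Integrable (fun c : V3 => g ε w.1 c w.2 • c) := by
    have h3 : Integrable (fun c : V3 => ∑ i, (g ε w.1 c w.2 * c i) • e i) :=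
      integrable_finsetSum _ fun i _ => (h2 i).2.smul_const (e i)
    refine h3.congr (Eventually.of_forall fun c => ?_)
    simp only [mul_smul, ← Finset.smul_sum, sum_smul_e]
  have h3 := (EuclideanSpace.proj (𝕜 := ℝ) (ι := Fin 3) i).integral_comp_comm hint
  rw [h1, map_zero] at h3
  simpa [weightInt, velInt, onPhase] using h3

end

end

section

/-! ### Rotations about the magnetic field and averages over circles -/

/-- The rotation of `c` by the angle `θ` about the unit vector `b`. -/
def rot (b : V3) (θ : ℝ) (c : V3) : V3 :=
  (inner ℝ c b : ℝ) • b + Real.cos θ • (c - (inner ℝ c b : ℝ) • b) + Real.sin θ • cross b c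

section Rot
variable {b : V3}

lemma rot_zero (b c : V3) : rot b 0 c = c := by simp [rot]

lemma inner_self_of_unit (hb : ‖b‖ = 1) : inner ℝ b b = (1 : ℝ) := by
  rw [real_inner_self_eq_norm_sq, hb]; norm_num

lemma inner_rot (hb : ‖b‖ = 1) (θ : ℝ) (c : V3) : inner ℝ (rot b θ c) b = (inner ℝ c b : ℝ) := by
  simp only [rot, inner_add_left, inner_smul_left, inner_sub_left, inner_self_of_unit hb]
  rw [real_inner_comm b (cross b c), inner_cross_self_left]
  simp

lemma cross_rot (hb : ‖b‖ = 1) (θ : ℝ) (c : V3) :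
    cross b (rot b θ c) = Real.cos θ • cross b c - Real.sin θ • (c - (inner ℝ c b : ℝ) • b) := by
  simp only [rot, cross_add_right, cross_smul_right, cross_sub_right, cross_self',
    cross_cross_eq, inner_self_of_unit hb, real_inner_comm c b]
  simp only [smul_zero, sub_zero, one_smul, zero_add]
  module

lemma rot_rot (hb : ‖b‖ = 1) (θ φ : ℝ) (c : V3) : rot b θ (rot b φ c) = rot b (θ + φ) c := by
  conv_lhs => rw [rot]
  rw [inner_rot hb, cross_rot hb]
  simp only [rot, Real.cos_add, Real.sin_add]
  module

lemma rot_two_pi (b : V3) (θ : ℝ) (c : V3) : rot b (θ + 2 * Real.pi) c = rot b θ c := by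
  simp [rot]

lemma norm_sq_decomp (hb : ‖b‖ = 1) (c : V3) :
    ‖c‖ ^ 2 = (inner ℝ c b : ℝ) ^ 2 + ‖c - (inner ℝ c b : ℝ) • b‖ ^ 2 := by
  rw [@norm_sub_sq_real, inner_smul_right, norm_smul, hb, Real.norm_eq_abs, mul_one, sq_abs]
  ring

lemma norm_cross_sq (hb : ‖b‖ = 1) (c : V3) :
    ‖cross b c‖ ^ 2 = ‖c - (inner ℝ c b : ℝ) • b‖ ^ 2 := by
  have h := norm_sq_decomp hb c
  have : ‖cross b c‖ ^ 2 = ‖c‖ ^ 2 - (inner ℝ c b : ℝ) ^ 2 := by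
    have h1 := unit_sq hb
    simp only [norm_sq_eq, inner_eq, cross_zero', cross_one', cross_two']
    linear_combination (c 0 * c 0 + c 1 * c 1 + c 2 * c 2) * h1
  linarith

lemma inner_perp_cross (b c : V3) : inner ℝ (c - (inner ℝ c b : ℝ) • b) (cross b c) = (0 : ℝ) := by
  rw [inner_sub_left, inner_smul_left, inner_cross_self_left, inner_cross_self_right]; simp

lemma inner_perp_self (hb : ‖b‖ = 1) (c : V3) :
    inner ℝ (c - (inner ℝ c b : ℝ) • b) b = (0 : ℝ) := by
  rw [inner_sub_left, inner_smul_left, inner_self_of_unit hb]; simp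

lemma norm_rot (hb : ‖b‖ = 1) (θ : ℝ) (c : V3) : ‖rot b θ c‖ = ‖c‖ := by
  have h1 := norm_sq_decomp hb (rot b θ c)
  have h2 := norm_sq_decomp hb c
  have h3 : rot b θ c - (inner ℝ c b : ℝ) • b
      = Real.cos θ • (c - (inner ℝ c b : ℝ) • b) + Real.sin θ • cross b c := by
    simp only [rot]; module
  rw [inner_rot hb, h3, @norm_add_sq_real, norm_smul, norm_smul, inner_smul_left,
    inner_smul_right, inner_perp_cross, mul_pow, mul_pow, norm_cross_sq hb] at h1
  simp only [Real.norm_eq_abs, sq_abs, mul_zero, add_zero] at h1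
  have h4 : ‖rot b θ c‖ ^ 2 = ‖c‖ ^ 2 := by
    rw [h1, h2]
    linear_combination ‖c - (inner ℝ c b : ℝ) • b‖ ^ 2 * Real.sin_sq_add_cos_sq θ
  exact (pow_left_inj₀ (norm_nonneg _) (norm_nonneg _) two_ne_zero).1 h4

lemma hasDerivAt_rot (hb : ‖b‖ = 1) (c : V3) (θ : ℝ) :
    HasDerivAt (fun θ => rot b θ c) (cross b (rot b θ c)) θ := by
  rw [cross_rot hb]
  have h := (((Real.hasDerivAt_cos θ).smul_const (c - (inner ℝ c b : ℝ) • b)).const_add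
    ((inner ℝ c b : ℝ) • b)).add ((Real.hasDerivAt_sin θ).smul_const (cross b c))
  refine h.congr_deriv ?_
  module

lemma continuous_rot (b c : V3) : Continuous (fun θ => rot b θ c) := by
  unfold rot; fun_prop

lemma exists_angle {x y : ℝ} (h : x ^ 2 + y ^ 2 = 1) : ∃ θ : ℝ, Real.cos θ = x ∧ Real.sin θ = y := by
  have hn : ‖(⟨x, y⟩ : ℂ)‖ = 1 := by
    have h1 := Complex.sq_norm (⟨x, y⟩ : ℂ)
    rw [Complex.normSq_mk] at h1
    have h2 : ‖(⟨x, y⟩ : ℂ)‖ ^ 2 = 1 := by rw [h1]; linarith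
    exact (pow_eq_one_iff_of_nonneg (norm_nonneg _) two_ne_zero).1 h2
  have h0 : (⟨x, y⟩ : ℂ) ≠ 0 := by rw [← norm_ne_zero_iff, hn]; norm_num
  refine ⟨Complex.arg ⟨x, y⟩, ?_, ?_⟩
  · rw [Complex.cos_arg h0, hn, div_one]
  · rw [Complex.sin_arg, hn, div_one]

/-- Vectors with the same length and the same component along `b` are rotations of each other. -/
lemma exists_rot_eq (hb : ‖b‖ = 1) {c c' : V3} (h : inner ℝ c b = (inner ℝ c' b : ℝ))
    (hn : ‖c‖ = ‖c'‖) : ∃ θ, rot b θ c = c' := by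
  set p := c - (inner ℝ c b : ℝ) • b with hp
  set p' := c' - (inner ℝ c' b : ℝ) • b with hp'
  have hpp : ‖p‖ ^ 2 = ‖p'‖ ^ 2 := by
    have h1 := norm_sq_decomp hb c
    have h2 := norm_sq_decomp hb c'
    rw [hn, h] at h1
    rw [← hp', h1, ← h] at h2
    linarith
  have hc : c = (inner ℝ c b : ℝ) • b + p := by rw [hp]; module
  have hc' : c' = (inner ℝ c b : ℝ) • b + p' := by rw [hp', ← h]; module
  have hq : cross b c = cross b p := by
    rw [hp, cross_sub_right, cross_smul_right, cross_self']; simp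
  by_cases h0 : ‖p‖ = 0
  · refine ⟨0, ?_⟩
    have h1 : ‖p'‖ = 0 := by rw [h0] at hpp; simpa using hpp.symm
    rw [rot_zero, hc, hc', norm_eq_zero.1 h0, norm_eq_zero.1 h1]
  have hpb : inner ℝ p b = (0 : ℝ) := inner_perp_self hb c
  have hpb' : inner ℝ p' b = (0 : ℝ) := inner_perp_self hb c'
  have hr : ‖p‖ ^ 2 ≠ 0 := pow_ne_zero _ h0
  have hexp : ‖p‖ ^ 2 • p' = (inner ℝ p' p : ℝ) • p + (inner ℝ p' (cross b p) : ℝ) • cross b p := by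
    have hP := fun i j => perp_pair hb hpb i j
    rw [inner_eq] at hpb'
    ext i
    simp only [inner_eq p' p, inner_eq p' (cross b p), PiLp.smul_apply, PiLp.add_apply, smul_eq_mul]
    have key := congrArg₂ (· + ·) (congrArg₂ (· + ·) (congrArg (p' 0 * ·) (hP 0 i))
      (congrArg (p' 1 * ·) (hP 1 i))) (congrArg (p' 2 * ·) (hP 2 i))
    simp only at key
    have hsum : p' 0 * (if (0 : Fin 3) = i then (1 : ℝ) else 0)
        + p' 1 * (if (1 : Fin 3) = i then (1 : ℝ) else 0)
        + p' 2 * (if (2 : Fin 3) = i then (1 : ℝ) else 0) = p' i := by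
      fin_cases i <;> simp
    linear_combination -key - ‖p‖ ^ 2 * hsum + ‖p‖ ^ 2 * b i * hpb'
  have hnq : ‖cross b p‖ ^ 2 = ‖p‖ ^ 2 := by
    rw [norm_cross_sq hb, hpb]; simp
  have hpq : inner ℝ p (cross b p) = (0 : ℝ) := inner_cross_self_right b p
  have hnorm : (inner ℝ p' p / ‖p‖ ^ 2 : ℝ) ^ 2 + (inner ℝ p' (cross b p) / ‖p‖ ^ 2 : ℝ) ^ 2 = 1 := by
    have h1 := congrArg (fun v => inner ℝ v v) hexp
    simp only [inner_add_left, inner_add_right, inner_smul_left, inner_smul_right, hpq,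
      real_inner_self_eq_norm_sq, hnq, real_inner_comm p (cross b p)] at h1
    simp only [conj_trivial, ← hpp] at h1
    field_simp
    have h2 : ‖p‖ ^ 2 * (inner ℝ p' p ^ 2 + inner ℝ p' (cross b p) ^ 2) = ‖p‖ ^ 2 * (‖p‖ ^ 2) ^ 2 := by
      linear_combination -h1
    have := mul_left_cancel₀ hr h2
    linear_combination this
  obtain ⟨θ, hcos, hsin⟩ := exists_angle hnorm
  refine ⟨θ, ?_⟩
  rw [rot, ← hp, hcos, hsin, hq, hc', add_assoc]
  congr 1
  rw [← smul_right_injective V3 hr |>.eq_iff]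
  rw [hexp, smul_add, smul_smul, smul_smul, mul_div_cancel₀ _ hr, mul_div_cancel₀ _ hr]

end Rot

/-- The average of `X` over the circle through `c` around the axis `b`. -/
def circAvg (b : V3) (X : V3 → ℝ) (c : V3) : ℝ :=
  (2 * Real.pi)⁻¹ * ∫ θ in (0 : ℝ)..(2 * Real.pi), X (rot b θ c)

section CircAvg
variable {b : V3} {X Y : V3 → ℝ} {c : V3}

lemma circAvg_of_eq {Q : ℝ} (h : ∀ θ, X (rot b θ c) = Q) : circAvg b X c = Q := by
  have := Real.pi_pos
  simp only [circAvg, h, intervalIntegral.integral_const, sub_zero, smul_eq_mul]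
  field_simp

lemma circAvg_congr (h : ∀ θ, X (rot b θ c) = Y (rot b θ c)) : circAvg b X c = circAvg b Y c := by
  simp only [circAvg, h]

lemma circAvg_rot (hb : ‖b‖ = 1) (φ : ℝ) : circAvg b X (rot b φ c) = circAvg b X c := by
  simp only [circAvg, rot_rot hb]
  congr 1
  have hper : Function.Periodic (fun θ => X (rot b θ c)) (2 * Real.pi) := fun θ => by
    simp only [rot_two_pi]
  rw [intervalIntegral.integral_comp_add_right (fun θ => X (rot b θ c)) φ]
  have := hper.intervalIntegral_add_eq φ 0
  rw [zero_add, add_comm φ] at this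
  rw [zero_add, this]

lemma circAvg_eq_of_inner_norm (hb : ‖b‖ = 1) {c' : V3} (h : inner ℝ c b = (inner ℝ c' b : ℝ))
    (hn : ‖c‖ = ‖c'‖) : circAvg b X c = circAvg b X c' := by
  obtain ⟨θ, rfl⟩ := exists_rot_eq hb h hn
  exact (circAvg_rot hb θ).symm

lemma circAvg_add (hX : Continuous fun θ => X (rot b θ c)) (hY : Continuous fun θ => Y (rot b θ c)) :
    circAvg b (fun c => X c + Y c) c = circAvg b X c + circAvg b Y c := by
  simp only [circAvg]
  rw [intervalIntegral.integral_add (hX.intervalIntegrable _ _) (hY.intervalIntegrable _ _),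
    mul_add]

lemma circAvg_const_mul (r : ℝ) : circAvg b (fun c => r * X c) c = r * circAvg b X c := by
  simp only [circAvg, intervalIntegral.integral_const_mul]; ring

lemma circAvg_neg : circAvg b (fun c => -X c) c = -circAvg b X c := by
  simpa using circAvg_const_mul (b := b) (X := X) (c := c) (-1)

lemma circAvg_sub (hX : Continuous fun θ => X (rot b θ c)) (hY : Continuous fun θ => Y (rot b θ c)) :
    circAvg b (fun c => X c - Y c) c = circAvg b X c - circAvg b Y c := by
  simp only [sub_eq_add_neg]
  rw [circAvg_add hX hY.neg, circAvg_neg]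

/-- Averages can be computed from the four points at right angles. -/
lemma circAvg_of_four (hb : ‖b‖ = 1) (hX : Continuous fun θ => X (rot b θ c)) {Q : ℝ}
    (h : ∀ p : V3, inner ℝ p b = (0 : ℝ) → ‖p‖ ^ 2 = ‖c‖ ^ 2 - (inner ℝ c b : ℝ) ^ 2 →
      X ((inner ℝ c b : ℝ) • b + p) + X ((inner ℝ c b : ℝ) • b + cross b p)
      + X ((inner ℝ c b : ℝ) • b - p) + X ((inner ℝ c b : ℝ) • b - cross b p) = 4 * Q) :
    circAvg b X c = Q := by
  have hsh : ∀ φ, circAvg b (fun c' => X (rot b φ c')) c = circAvg b X c := by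
    intro φ
    rw [← circAvg_rot (X := X) hb φ]
    refine (circAvg_congr fun θ => ?_).trans
      (show circAvg b (fun c' => X (rot b φ c')) c = _ from ?_)
    · rfl
    · simp only [circAvg, rot_rot hb, add_comm]
  have hc : ∀ φ, Continuous fun θ => X (rot b φ (rot b θ c)) := by
    intro φ
    simp only [rot_rot hb]
    exact hX.comp (continuous_const.add continuous_id)
  have h4 : circAvg b (fun c' => (X c' + X (rot b (Real.pi / 2) c') + X (rot b Real.pi c'))
      + X (rot b (Real.pi + Real.pi / 2) c')) c = 4 * Q := by
    refine circAvg_of_eq fun θ => ?_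
    have hs : (inner ℝ (rot b θ c) b : ℝ) = inner ℝ c b := inner_rot hb θ c
    have hnr := norm_rot hb θ c
    generalize rot b θ c = c' at hs hnr
    have hn := norm_sq_decomp hb c'
    have hp := h (c' - (inner ℝ c' b : ℝ) • b) (inner_perp_self hb c')
      (by rw [← hs, ← hnr]; linarith)
    have hq : cross b (c' - (inner ℝ c' b : ℝ) • b) = cross b c' := by
      rw [cross_sub_right, cross_smul_right, cross_self']; simp
    rw [hq, ← hs] at hp
    rw [← hp]
    simp only [rot, Real.cos_add, Real.sin_add, Real.cos_pi, Real.sin_pi, Real.cos_pi_div_two,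
      Real.sin_pi_div_two]
    congr 1
    · congr 1
      · congr 1
        · congr 1; module
        · congr 1; module
      · congr 1; module
    · congr 1; module
  have a1 := circAvg_add (X := X) (Y := fun c' => X (rot b (Real.pi / 2) c')) hX
    (hc (Real.pi / 2))
  have a2 := circAvg_add (X := fun c' => X c' + X (rot b (Real.pi / 2) c'))
    (Y := fun c' => X (rot b Real.pi c')) (hX.add (hc (Real.pi / 2))) (hc Real.pi)
  have a3 := circAvg_add (X := fun c' => X c' + X (rot b (Real.pi / 2) c') + X (rot b Real.pi c'))
    (Y := fun c' => X (rot b (Real.pi + Real.pi / 2) c')) 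
    ((hX.add (hc (Real.pi / 2))).add (hc Real.pi)) (hc (Real.pi + Real.pi / 2))
  rw [hsh] at a1 a2 a3
  linarith

/-- The average of a derivative along the circles vanishes. -/
lemma circAvg_deriv (hb : ‖b‖ = 1) (hX : ∀ θ, DifferentiableAt ℝ X (rot b θ c))
    (hc : Continuous fun θ => fderiv ℝ X (rot b θ c) (cross b (rot b θ c))) :
    circAvg b (fun c => fderiv ℝ X c (cross b c)) c = 0 := by
  have hd : ∀ θ, HasDerivAt (fun θ => X (rot b θ c))
      (fderiv ℝ X (rot b θ c) (cross b (rot b θ c))) θ := fun θ =>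
    (hX θ).hasFDerivAt.comp_hasDerivAt θ (hasDerivAt_rot hb c θ)
  simp only [circAvg]
  rw [intervalIntegral.integral_eq_sub_of_hasDerivAt (fun θ _ => hd θ) (hc.intervalIntegrable _ _)]
  have := rot_two_pi b 0 c
  rw [zero_add] at this
  rw [this]; simp

/-- A function whose derivative along the circles vanishes is invariant under rotations. -/
lemma rot_invariant (hb : ‖b‖ = 1) (hX : ∀ θ, DifferentiableAt ℝ X (rot b θ c))
    (h0 : ∀ θ, fderiv ℝ X (rot b θ c) (cross b (rot b θ c)) = 0) (θ : ℝ) :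
    X (rot b θ c) = X c := by
  have hd : ∀ θ, HasDerivAt (fun θ => X (rot b θ c)) 0 θ := fun θ => by
    have := (hX θ).hasFDerivAt.comp_hasDerivAt θ (hasDerivAt_rot hb c θ)
    rwa [h0] at this
  have := is_const_of_deriv_eq_zero (fun θ => (hd θ).differentiableAt) (fun θ => (hd θ).deriv) θ 0
  simpa [rot_zero] using this

/-- The circle average of a polynomial of degree three in the velocity. -/
lemma circAvg_poly (hb : ‖b‖ = 1) (x₀ : ℝ) (L : V3 →L[ℝ] ℝ) (S : V3 →L[ℝ] V3 →L[ℝ] ℝ)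
    (T : V3 →L[ℝ] V3 →L[ℝ] V3 →L[ℝ] ℝ) (c : V3) :
    circAvg b (fun c => x₀ + L c + S c c + T c c c) c
      = x₀ + (inner ℝ c b : ℝ) * L b + (inner ℝ c b : ℝ) ^ 2 * S b b
        + (inner ℝ c b : ℝ) ^ 3 * T b b b
        + (‖c‖ ^ 2 - (inner ℝ c b : ℝ) ^ 2) / 2 * ((∑ i, S (e i) (e i)) - S b b)
        + (inner ℝ c b : ℝ) * ((‖c‖ ^ 2 - (inner ℝ c b : ℝ) ^ 2) / 2) *
          ((∑ i, (T b (e i) (e i) + T (e i) b (e i) + T (e i) (e i) b)) - 3 * T b b b) := by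
  refine circAvg_of_four hb ?_ fun p hp hn => ?_
  · have := continuous_rot b c
    fun_prop
  have k1 := perp_pair_bilin S hb hp
  have k2 := perp_pair_bilin (T b) hb hp
  have k3 := perp_pair_bilin (T.flip b) hb hp
  have k4 := perp_pair_bilin
    (((ContinuousLinearMap.apply ℝ ℝ b).postcomp V3).comp T) hb hp
  simp only [ContinuousLinearMap.flip_apply, ContinuousLinearMap.comp_apply, smul_eq_mul,
    ContinuousLinearMap.postcomp_apply, ContinuousLinearMap.apply_apply, hn] at k1 k2 k3 k4
  simp only [map_add, map_sub, map_smul, _root_.add_apply, _root_.sub_apply, _root_.smul_apply,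
    smul_eq_mul, Finset.sum_add_distrib]
  linear_combination 2 * k1 + 2 * (inner ℝ c b : ℝ) * (k2 + k3 + k4)

end CircAvg

end

section

/-! ### The gyro-average of a function on phase space -/

section Frame

lemma exists_perp (b : V3) : ∃ a : V3, ‖a‖ = 1 ∧ inner ℝ a b = (0 : ℝ) := by
  obtain ⟨v, hv, hvb⟩ : ∃ v : V3, v ≠ 0 ∧ inner ℝ v b = (0 : ℝ) := by
    by_cases h : b 0 = 0
    · refine ⟨e 0, fun h0 => ?_, ?_⟩
      · simpa [e] using congrArg (fun v : V3 => v 0) h0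
      · simp [inner_eq, e_apply, h]
    · refine ⟨b 1 • e 0 - b 0 • e 1, fun h0 => h ?_, ?_⟩
      · simpa [e_apply] using congrArg (fun v : V3 => v 1) h0
      · simp [inner_eq, e_apply]; ring
  refine ⟨‖v‖⁻¹ • v, ?_, ?_⟩
  · rw [norm_smul, norm_inv, norm_norm, inv_mul_cancel₀ (norm_ne_zero_iff.2 hv)]
  · rw [inner_smul_left, hvb, mul_zero]

/-- A unit vector perpendicular to `b`. -/
def perpVec (b : V3) : V3 := (exists_perp b).choose

lemma norm_perpVec (b : V3) : ‖perpVec b‖ = 1 := (exists_perp b).choose_spec.1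

lemma inner_perpVec (b : V3) : inner ℝ (perpVec b) b = (0 : ℝ) := (exists_perp b).choose_spec.2

lemma inner_gyro {b a : V3} (hb : ‖b‖ = 1) (hab : inner ℝ a b = (0 : ℝ)) (s r : ℝ) :
    inner ℝ (s • b + r • a) b = s := by
  rw [inner_add_left, inner_smul_left, inner_smul_left, hab, inner_self_of_unit hb]; simp

lemma norm_sq_gyro {b a : V3} (hb : ‖b‖ = 1) (ha : ‖a‖ = 1) (hab : inner ℝ a b = (0 : ℝ))
    (s r : ℝ) : ‖s • b + r • a‖ ^ 2 = s ^ 2 + r ^ 2 := by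
  rw [@norm_add_sq_real, inner_smul_left, inner_smul_right, real_inner_comm, hab, norm_smul,
    norm_smul, hb, ha]
  simp

end Frame

variable {Ω : Set V3} {I : Set ℝ} {B : VField}

/-- The average of `h` over the gyrophase, `(x, μ, c∥, t) ↦ (2π)⁻¹ ∮ h(x, c, t)` over the circle of
the velocities with magnetic moment `μ` and parallel component `c∥`. -/
def red (B : VField) (h : Phase → ℝ) : RDistr := fun x μ s t =>
  circAvg (bdir B x t) (fun c => h (x, c, t))
    (s • bdir B x t + √(2 * μ * ‖B x t‖) • perpVec (bdir B x t))

/-- The average of `h` over the gyrophase, as a function on phase space. -/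
def gyroAvg (B : VField) (h : Phase → ℝ) (z : Phase) : ℝ :=
  circAvg (bdir B z.1 z.2.2) (fun c => h (z.1, c, z.2.2)) z.2.1

lemma norm_bdir {x : V3} {t : ℝ} (h : B x t ≠ 0) : ‖bdir B x t‖ = 1 := by
  rw [bdir, norm_smul, norm_inv, norm_norm, inv_mul_cancel₀ (norm_ne_zero_iff.2 h)]

lemma norm_smul_bdir {x : V3} {t : ℝ} (h : B x t ≠ 0) : ‖B x t‖ • bdir B x t = B x t := by
  rw [bdir, smul_smul, mul_inv_cancel₀ (norm_ne_zero_iff.2 h), one_smul]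

lemma red_eq_gyroAvg {h : Phase → ℝ} {x : V3} {t μ s : ℝ} (hB : B x t ≠ 0) {a : V3}
    (ha : ‖a‖ = 1) (hab : inner ℝ a (bdir B x t) = (0 : ℝ)) :
    red B h x μ s t = gyroAvg B h (x, s • bdir B x t + √(2 * μ * ‖B x t‖) • a, t) := by
  have hb := norm_bdir hB
  refine circAvg_eq_of_inner_norm hb ?_ ?_
  · rw [inner_gyro hb hab, inner_gyro hb (inner_perpVec _)]
  · have h1 := norm_sq_gyro hb ha hab s √(2 * μ * ‖B x t‖)
    rw [← norm_sq_gyro hb (norm_perpVec _) (inner_perpVec _)] at h1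
    exact ((pow_left_inj₀ (norm_nonneg _) (norm_nonneg _) two_ne_zero).1 h1).symm

lemma two_mul_magMoment {x c : V3} {t : ℝ} (hB : B x t ≠ 0) :
    2 * magMoment B x c t * ‖B x t‖ = ‖c‖ ^ 2 - cPar B x c t ^ 2 := by
  have := norm_ne_zero_iff.2 hB
  simp only [magMoment]; field_simp

lemma cPar_sq_le {x c : V3} {t : ℝ} (hB : B x t ≠ 0) : cPar B x c t ^ 2 ≤ ‖c‖ ^ 2 := by
  have := norm_sq_decomp (norm_bdir hB) c
  rw [cPar]; nlinarith [sq_nonneg ‖c - (inner ℝ c (bdir B x t) : ℝ) • bdir B x t‖]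

lemma red_apply {h : Phase → ℝ} {x c : V3} {t : ℝ} (hB : B x t ≠ 0) :
    red B h x (magMoment B x c t) (cPar B x c t) t = gyroAvg B h (x, c, t) := by
  have hb := norm_bdir hB
  refine circAvg_eq_of_inner_norm hb ?_ ?_
  · rw [inner_gyro hb (inner_perpVec _)]; rfl
  · rw [two_mul_magMoment hB, ← pow_left_inj₀ (norm_nonneg _) (norm_nonneg _) two_ne_zero,
      norm_sq_gyro hb (norm_perpVec _) (inner_perpVec _), Real.sq_sqrt]
    · ring
    · linarith [cPar_sq_le (c := c) hB]

section Regularity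
variable (hΩ : IsOpen Ω) (hI : IsOpen I) (hB : ContDiffOn ℝ ∞ (onSpaceTime B) (Ω ×ˢ I))
  (hB0 : ∀ x ∈ Ω, ∀ t ∈ I, B x t ≠ 0)

section
include hB hB0

lemma contDiffOn_normB : ContDiffOn ℝ ∞ (fun w : SpaceTime => ‖B w.1 w.2‖) (Ω ×ˢ I) :=
  hB.norm ℝ fun w hw => hB0 w.1 hw.1 w.2 hw.2

lemma contDiffOn_invB : ContDiffOn ℝ ∞ (fun w : SpaceTime => ‖B w.1 w.2‖⁻¹) (Ω ×ˢ I) :=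
  (contDiffOn_normB hB hB0).inv fun w hw => norm_ne_zero_iff.2 (hB0 w.1 hw.1 w.2 hw.2)

lemma contDiffOn_bdir : ContDiffOn ℝ ∞ (onSpaceTime (bdir B)) (Ω ×ˢ I) :=
  (contDiffOn_invB hB hB0).smul hB

include hΩ hI

/-- Near every point there is a smooth field of unit vectors perpendicular to the magnetic field. -/
lemma exists_frame {w₀ : SpaceTime} (hw₀ : w₀ ∈ Ω ×ˢ I) :
    ∃ U : Set SpaceTime, IsOpen U ∧ w₀ ∈ U ∧ U ⊆ Ω ×ˢ I ∧ ∃ a : SpaceTime → V3,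
      ContDiffOn ℝ ∞ a U ∧ ∀ w ∈ U, ‖a w‖ = 1 ∧ inner ℝ (a w) (bdir B w.1 w.2) = (0 : ℝ) := by
  have hb := contDiffOn_bdir hB hB0
  set v₀ := perpVec (bdir B w₀.1 w₀.2) with hv₀
  let v : SpaceTime → V3 := fun w =>
    v₀ - (inner ℝ v₀ (onSpaceTime (bdir B) w) : ℝ) • onSpaceTime (bdir B) w
  have hv : ContDiffOn ℝ ∞ v (Ω ×ˢ I) :=
    contDiffOn_const.sub ((contDiffOn_const.inner ℝ hb).smul hb)
  have hvw₀ : v w₀ ≠ 0 := by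
    have h1 : inner ℝ v₀ (onSpaceTime (bdir B) w₀) = (0 : ℝ) := inner_perpVec _
    simp only [v, h1, zero_smul, sub_zero]
    rw [← norm_ne_zero_iff, hv₀, norm_perpVec]; norm_num
  refine ⟨(Ω ×ˢ I) ∩ v ⁻¹' {0}ᶜ, hv.continuousOn.isOpen_inter_preimage (hΩ.prod hI)
    isOpen_compl_singleton, ⟨hw₀, hvw₀⟩, inter_subset_left, fun w => ‖v w‖⁻¹ • v w, ?_, ?_⟩
  · have hv' := hv.mono (inter_subset_left (t := v ⁻¹' {0}ᶜ))
    exact ((hv'.norm ℝ fun w hw => hw.2).inv fun w hw => norm_ne_zero_iff.2 hw.2).smul hv'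
  · intro w hw
    have h0 : v w ≠ 0 := hw.2
    refine ⟨by rw [norm_smul, norm_inv, norm_norm, inv_mul_cancel₀ (norm_ne_zero_iff.2 h0)], ?_⟩
    have := inner_perp_self (norm_bdir (hB0 w.1 hw.1.1 w.2 hw.1.2)) v₀
    rw [inner_smul_left]
    exact mul_eq_zero_of_right _ this

lemma contDiffOn_gyroAvg {h : Phase → ℝ} (hh : ContDiffOn ℝ ∞ h (phaseSet Ω I)) :
    ContDiffOn ℝ ∞ (gyroAvg B h) (phaseSet Ω I) := by
  have hS := isOpen_phaseSet hΩ hI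
  have hb : ContDiffOn ℝ ∞ (fun q : Phase × ℝ => bdir B q.1.1 q.1.2.2)
      (phaseSet Ω I ×ˢ (univ : Set ℝ)) :=
    (contDiffOn_bdir hB hB0).comp (f := fun q : Phase × ℝ => ((q.1.1, q.1.2.2) : SpaceTime))
      (by fun_prop) fun q hq => ⟨hq.1.1, hq.1.2.2⟩
  have hc : ContDiffOn ℝ ∞ (fun q : Phase × ℝ => q.1.2.1) (phaseSet Ω I ×ˢ (univ : Set ℝ)) := by
    fun_prop
  have hrot : ContDiffOn ℝ ∞ (fun q : Phase × ℝ => rot (bdir B q.1.1 q.1.2.2) q.2 q.1.2.1)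
      (phaseSet Ω I ×ˢ (univ : Set ℝ)) := by
    have hi := (hc.inner ℝ hb).smul hb
    have h1 : ContDiffOn ℝ ∞ (fun q : Phase × ℝ => Real.cos q.2)
        (phaseSet Ω I ×ˢ (univ : Set ℝ)) := by fun_prop
    have h2 : ContDiffOn ℝ ∞ (fun q : Phase × ℝ => Real.sin q.2)
        (phaseSet Ω I ×ˢ (univ : Set ℝ)) := by fun_prop
    exact (hi.add (h1.smul (hc.sub hi))).add (h2.smul (ContDiffOn.cross hb hc))
  let f : Phase × ℝ → ℝ := fun q =>
    h (q.1.1, rot (bdir B q.1.1 q.1.2.2) q.2 q.1.2.1, q.1.2.2)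
  have hU : IsOpen (phaseSet Ω I ×ˢ (univ : Set ℝ)) := hS.prod isOpen_univ
  have hf : ContDiffOn ℝ ∞ f (phaseSet Ω I ×ˢ (univ : Set ℝ)) := by
    refine hh.comp (f := fun q : Phase × ℝ =>
      ((q.1.1, rot (bdir B q.1.1 q.1.2.2) q.2 q.1.2.1, q.1.2.2) : Phase)) ?_
      fun q hq => ⟨hq.1.1, mem_univ _, hq.1.2.2⟩
    exact (by fun_prop : ContDiffOn ℝ ∞ (fun q : Phase × ℝ => q.1.1) _).prodMk
      (hrot.prodMk (by fun_prop))
  have hmain := contDiffOn_integral_of_dominated (P := Phase) (Z' := Phase × ℝ) (A := ℝ)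
    (ν := volume.restrict (Ioc 0 (2 * Real.pi))) (e := fun z θ => (z, θ))
    (D := ContinuousLinearMap.inl ℝ Phase ℝ) (U := phaseSet Ω I ×ˢ (univ : Set ℝ))
    (s := phaseSet Ω I) (f := f)
    (fun z θ => hasFDerivAt_prodMk_left z θ) (fun z => by fun_prop) hU hS
    (fun z hz θ => ⟨hz, mem_univ _⟩) hf ?_
  · refine (contDiffOn_const (c := (2 * Real.pi)⁻¹)).mul hmain |>.congr fun z hz => ?_
    simp only [gyroAvg, circAvg, f]
    rw [intervalIntegral.integral_of_le (by positivity)]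
  · intro j z₀ hz₀
    obtain ⟨V, hV, hzV, hVs⟩ := exists_compact_subset hS hz₀
    have hcont : ContinuousOn (fun q => ‖iteratedFDeriv ℝ j f q‖) (V ×ˢ Icc 0 (2 * Real.pi)) := by
      refine ContinuousOn.norm ?_
      refine ((hf.continuousOn_iteratedFDerivWithin (m := j) (by exact_mod_cast le_top)
        hU.uniqueDiffOn).mono (prod_mono hVs (subset_univ _))).congr fun q hq => ?_
      exact (iteratedFDerivWithin_of_isOpen j hU ⟨hVs hq.1, mem_univ _⟩).symm
    obtain ⟨M, hM⟩ := (hV.prod isCompact_Icc).bddAbove_image hcont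
    refine ⟨V, mem_interior_iff_mem_nhds.1 hzV, fun _ => M, integrable_const _, ?_⟩
    filter_upwards [ae_restrict_mem measurableSet_Ioc] with θ hθ z hz
    exact hM ⟨(z, θ), ⟨hz, Ioc_subset_Icc_self hθ⟩, rfl⟩

lemma contDiffOn_red {h : Phase → ℝ} (hh : ContDiffOn ℝ ∞ h (phaseSet Ω I)) :
    ContDiffOn ℝ ∞ (fun z : V3 × ℝ × ℝ × ℝ => red B h z.1 z.2.1 z.2.2.1 z.2.2.2)
      (Ω ×ˢ Ioi (0 : ℝ) ×ˢ (univ : Set ℝ) ×ˢ I) := by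
  intro z₀ hz₀
  obtain ⟨U, hU, hwU, hUs, a, ha, hau⟩ :=
    exists_frame hΩ hI hB hB0 (w₀ := (z₀.1, z₀.2.2.2)) ⟨hz₀.1, hz₀.2.2.2⟩
  let π' : V3 × ℝ × ℝ × ℝ → SpaceTime := fun z => (z.1, z.2.2.2)
  have hπc : Continuous π' := by fun_prop
  let W : Set (V3 × ℝ × ℝ × ℝ) := π' ⁻¹' U ∩ {z | 0 < z.2.1}
  have hW : IsOpen W := (hU.preimage hπc).inter (isOpen_lt continuous_const (by fun_prop))
  have hπ : ContDiffOn ℝ ∞ π' W := by fun_prop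
  have hb := ((contDiffOn_bdir hB hB0).mono hUs).comp hπ fun z hz => hz.1
  have hm := ((contDiffOn_normB hB hB0).mono hUs).comp hπ fun z hz => hz.1
  have ha' := ha.comp hπ fun z hz => hz.1
  have hsq : ContDiffOn ℝ ∞ (fun z : V3 × ℝ × ℝ × ℝ => √(2 * z.2.1 * ‖B z.1 z.2.2.2‖)) W := by
    refine ContDiffOn.sqrt ?_ fun z hz => ?_
    · exact (by fun_prop : ContDiffOn ℝ ∞ (fun z : V3 × ℝ × ℝ × ℝ => 2 * z.2.1) W).mul hm
    · have h1 : 0 < ‖B z.1 z.2.2.2‖ := norm_pos_iff.2 (hB0 _ (hUs hz.1).1 _ (hUs hz.1).2)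
      have h2 : 0 < z.2.1 := hz.2
      positivity
  have hcirc : ContDiffOn ℝ ∞ (fun z : V3 × ℝ × ℝ × ℝ => ((z.1, z.2.2.1 • bdir B z.1 z.2.2.2
      + √(2 * z.2.1 * ‖B z.1 z.2.2.2‖) • a (z.1, z.2.2.2), z.2.2.2) : Phase)) W :=
    (by fun_prop : ContDiffOn ℝ ∞ (fun z : V3 × ℝ × ℝ × ℝ => z.1) W).prodMk
      ((((by fun_prop : ContDiffOn ℝ ∞ (fun z : V3 × ℝ × ℝ × ℝ => z.2.2.1) W).smul hb).add
        (hsq.smul ha')).prodMk (by fun_prop))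
  have hcomp := (contDiffOn_gyroAvg hΩ hI hB hB0 hh).comp hcirc
    fun z hz => ⟨(hUs hz.1).1, mem_univ _, (hUs hz.1).2⟩
  have hz₀W : z₀ ∈ W := ⟨hwU, hz₀.2.1⟩
  refine ((hcomp.contDiffAt (hW.mem_nhds hz₀W)).congr_of_eventuallyEq ?_).contDiffWithinAt
  filter_upwards [hW.mem_nhds hz₀W] with z hz
  exact red_eq_gyroAvg (hB0 _ (hUs hz.1).1 _ (hUs hz.1).2) (hau _ hz.1).1 (hau _ hz.1).2

lemma continuousOn_red {h : Phase → ℝ} (hh : ContDiffOn ℝ ∞ h (phaseSet Ω I)) :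
    ContinuousOn (fun z : V3 × ℝ × ℝ × ℝ => red B h z.1 z.2.1 z.2.2.1 z.2.2.2)
      (Ω ×ˢ Ici (0 : ℝ) ×ˢ (univ : Set ℝ) ×ˢ I) := by
  intro z₀ hz₀
  obtain ⟨U, hU, hwU, hUs, a, ha, hau⟩ :=
    exists_frame hΩ hI hB hB0 (w₀ := (z₀.1, z₀.2.2.2)) ⟨hz₀.1, hz₀.2.2.2⟩
  let π' : V3 × ℝ × ℝ × ℝ → SpaceTime := fun z => (z.1, z.2.2.2)
  have hπc : Continuous π' := by fun_prop
  have hW : IsOpen (π' ⁻¹' U) := hU.preimage hπc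
  have hπ : ContinuousOn π' (π' ⁻¹' U) := hπc.continuousOn
  have hb := ((contDiffOn_bdir hB hB0).mono hUs).continuousOn.comp hπ fun z hz => hz
  have hm := ((contDiffOn_normB hB hB0).mono hUs).continuousOn.comp hπ fun z hz => hz
  have ha' := ha.continuousOn.comp hπ fun z hz => hz
  have hcirc : ContinuousOn (fun z : V3 × ℝ × ℝ × ℝ => ((z.1, z.2.2.1 • bdir B z.1 z.2.2.2
      + √(2 * z.2.1 * ‖B z.1 z.2.2.2‖) • a (z.1, z.2.2.2), z.2.2.2) : Phase)) (π' ⁻¹' U) :=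
    (by fun_prop : ContinuousOn (fun z : V3 × ℝ × ℝ × ℝ => z.1) _).prodMk
      ((((by fun_prop : ContinuousOn (fun z : V3 × ℝ × ℝ × ℝ => z.2.2.1) _).smul hb).add
        ((((by fun_prop : ContinuousOn (fun z : V3 × ℝ × ℝ × ℝ => 2 * z.2.1) _).mul hm).sqrt).smul
        ha')).prodMk (by fun_prop))
  have hcomp := (contDiffOn_gyroAvg hΩ hI hB hB0 hh).continuousOn.comp hcirc
    fun z hz => ⟨(hUs hz).1, mem_univ _, (hUs hz).2⟩
  refine ((hcomp.continuousAt (hW.mem_nhds hwU)).congr_of_eventuallyEq ?_).continuousWithinAt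
  filter_upwards [hW.mem_nhds hwU] with z hz
  exact red_eq_gyroAvg (hB0 _ (hUs hz).1 _ (hUs hz).2) (hau _ hz).1 (hau _ hz).2

end
end Regularity

end

section

/-! ### Velocity integrals in gyro-coordinates -/

lemma abs_circAvg_le {b c : V3} {X : V3 → ℝ} {Q : ℝ} (h : ∀ θ, |X (rot b θ c)| ≤ Q) :
    |circAvg b X c| ≤ Q := by
  have hpi := Real.pi_pos
  have := intervalIntegral.norm_integral_le_of_norm_le_const (a := 0) (b := 2 * Real.pi)
    (f := fun θ => X (rot b θ c)) (C := Q) (fun θ _ => h θ)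
  rw [circAvg, abs_mul, abs_of_pos (by positivity), inv_mul_le_iff₀ (by positivity)]
  rw [sub_zero, abs_of_pos (by positivity)] at this
  exact this.trans_eq (mul_comm _ _)

section Cylindrical
variable {b a : V3} (hb : ‖b‖ = 1) (ha : ‖a‖ = 1) (hab : inner ℝ a b = (0 : ℝ))
  {h : V3 → ℝ} (hc : Continuous h) {M : ℝ} (hM : ∀ c, |h c| ≤ M * ((1 + ‖c‖) ^ 8)⁻¹)
include hb ha hab

lemma norm_cross_perp : ‖cross b a‖ = 1 := by
  have := norm_cross_sq hb a
  rw [hab, zero_smul, sub_zero, ha, one_pow] at this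
  exact (pow_eq_one_iff_of_nonneg (norm_nonneg _) two_ne_zero).1 this

omit ha in
lemma rot_gyro (s r θ : ℝ) : rot b θ (s • b + r • a)
    = s • b + (r * Real.cos θ) • a + (r * Real.sin θ) • cross b a := by
  rw [rot, inner_gyro hb hab, cross_add_right, cross_smul_right, cross_smul_right, cross_self']
  module

/-- The orthonormal basis `a, b × a, b`. -/
lemma exists_orthonormalBasis : ∃ v : OrthonormalBasis (Fin 3) ℝ V3,
    v 0 = a ∧ v 1 = cross b a ∧ v 2 = b := by
  have hon : Orthonormal ℝ ![a, cross b a, b] := by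
    have h1 : inner ℝ a (cross b a) = (0 : ℝ) := inner_cross_self_right b a
    have h2 : inner ℝ (cross b a) b = (0 : ℝ) := by
      rw [real_inner_comm, inner_cross_self_left]
    constructor
    · intro i; fin_cases i <;> simp [ha, hb, norm_cross_perp hb ha hab]
    · intro i j hij
      fin_cases i <;> fin_cases j <;>
        simp_all [real_inner_comm]
  have hcard : Fintype.card (Fin 3) = Module.finrank ℝ V3 := by simp
  refine ⟨OrthonormalBasis.mk hon
    (hon.linearIndependent.span_eq_top_of_card_eq_finrank' hcard).ge, ?_, ?_, ?_⟩ <;> simp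

omit ha hab hb in
lemma integrable_of_decay (hc : Continuous h) (hM : ∀ c, |h c| ≤ M * ((1 + ‖c‖) ^ 8)⁻¹) :
    Integrable h := by
  have hM0 : 0 ≤ M := by
    have := (abs_nonneg _).trans (hM 0)
    simpa using this
  refine (integrable_one_add_norm_pow_inv.const_mul M).mono' hc.aestronglyMeasurable
    (Eventually.of_forall fun c => (hM c).trans ?_)
  gcongr
  · linarith [norm_nonneg c]
  · norm_num

include hc hM

lemma integral_eq_iterated : ∫ c, h c
    = ∫ s : ℝ, ∫ y : ℝ × ℝ, h (s • b + y.1 • a + y.2 • cross b a) := by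
  obtain ⟨v, v0, v1, v2⟩ := exists_orthonormalBasis hb ha hab
  have hi := integrable_of_decay hc hM
  have e1 := v.measurePreserving_repr_symm
  have e2 := PiLp.volume_preserving_toLp (Fin 3)
  have e3 := (volume_preserving_piFinSuccAbove (fun _ : Fin 3 => ℝ) 2).symm
  have m2 : MeasurableEmbedding (WithLp.toLp 2 : (Fin 3 → ℝ) → V3) :=
    (MeasurableEquiv.toLp 2 (Fin 3 → ℝ)).measurableEmbedding
  have m1 : MeasurableEmbedding v.repr.symm := v.measurableEquiv.symm.measurableEmbedding
  have hval : ∀ p : ℝ × (Fin 2 → ℝ), v.repr.symm (WithLp.toLp 2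
      ((MeasurableEquiv.piFinSuccAbove (fun _ : Fin 3 => ℝ) 2).symm p))
      = p.1 • b + p.2 0 • a + p.2 1 • cross b a := by
    intro p
    rw [← OrthonormalBasis.sum_repr_symm, Fin.sum_univ_three, v0, v1, v2]
    have k0 : (MeasurableEquiv.piFinSuccAbove (fun _ : Fin 3 => ℝ) 2).symm p 0 = p.2 0 := rfl
    have k1 : (MeasurableEquiv.piFinSuccAbove (fun _ : Fin 3 => ℝ) 2).symm p 1 = p.2 1 := rfl
    have k2 : (MeasurableEquiv.piFinSuccAbove (fun _ : Fin 3 => ℝ) 2).symm p 2 = p.1 := rfl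
    simp only [k0, k1, k2]
    module
  have hint := ((e1.integrable_comp_emb m1).2 hi)
  have hint := ((e2.integrable_comp_emb m2).2 hint)
  have hint := ((e3.integrable_comp_emb (MeasurableEquiv.measurableEmbedding _)).2 hint)
  rw [← e1.integral_comp m1, ← e2.integral_comp m2,
    ← e3.integral_comp (MeasurableEquiv.measurableEmbedding _)]
  simp only [Function.comp_def, hval] at hint ⊢
  rw [Measure.volume_eq_prod, integral_prod _ hint]
  refine integral_congr_ae (Eventually.of_forall fun s => ?_)
  exact (volume_preserving_finTwoArrow ℝ).integral_comp (MeasurableEquiv.measurableEmbedding _)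
    (fun y => h (s • b + y.1 • a + y.2 • cross b a))

lemma integral_perp_eq (s : ℝ) : ∫ y : ℝ × ℝ, h (s • b + y.1 • a + y.2 • cross b a)
    = ∫ r in Ioi (0 : ℝ), r * (2 * Real.pi * circAvg b h (s • b + r • a)) := by
  have hM0 : 0 ≤ M := by simpa using (abs_nonneg _).trans (hM 0)
  have hpt : ∀ r θ : ℝ, s • b + (r * Real.cos θ) • a + (r * Real.sin θ) • cross b a
      = rot b θ (s • b + r • a) := fun r θ => (rot_gyro hb hab s r θ).symm
  rw [← integral_comp_polarCoord_symm, polarCoord_target]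
  simp only [polarCoord_symm_apply, hpt, smul_eq_mul]
  rw [Measure.volume_eq_prod, setIntegral_prod]
  · refine setIntegral_congr_fun measurableSet_Ioi fun r _ => ?_
    simp only
    rw [integral_const_mul, ← integral_Ioc_eq_integral_Ioo,
      ← intervalIntegral.integral_of_le (by linarith [Real.pi_pos])]
    have hper : Function.Periodic (fun θ => h (rot b θ (s • b + r • a))) (2 * Real.pi) :=
      fun θ => by simp only [rot_two_pi]
    have := hper.intervalIntegral_add_eq (-Real.pi) 0
    rw [show -Real.pi + 2 * Real.pi = Real.pi by ring, zero_add] at this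
    rw [this, circAvg]
    have := Real.pi_pos
    field_simp
  · have hg : Integrable (fun p : ℝ × ℝ => M * (1 + p.1 ^ 2)⁻¹ * 1)
        ((volume.restrict (Ioi (0 : ℝ))).prod (volume.restrict (Ioo (-Real.pi) Real.pi))) := by
      refine Integrable.mul_prod (f := fun r : ℝ => M * (1 + r ^ 2)⁻¹) (g := fun _ => 1) ?_ ?_
      · exact (integrable_inv_one_add_sq.const_mul M).restrict
      · exact integrable_const _
    rw [IntegrableOn, ← Measure.prod_restrict]
    refine hg.mono' (Continuous.aestronglyMeasurable ?_) ?_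
    · have : Continuous fun p : ℝ × ℝ => rot b p.2 (s • b + p.1 • a) := by
        simp only [← hpt]; fun_prop
      exact continuous_fst.mul (hc.comp this)
    · rw [Measure.prod_restrict]
      filter_upwards [ae_restrict_mem (measurableSet_Ioi.prod measurableSet_Ioo)] with p hp
      have hr : 0 < p.1 := hp.1
      rw [Real.norm_eq_abs, abs_mul, abs_of_pos hr, mul_one]
      have h1 := hM (rot b p.2 (s • b + p.1 • a))
      rw [norm_rot hb] at h1
      have h2 := norm_sq_gyro hb ha hab s p.1
      have h3 : p.1 ≤ ‖s • b + p.1 • a‖ := by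
        refine (pow_le_pow_iff_left₀ hr.le (norm_nonneg _) two_ne_zero).1 ?_
        rw [h2]; nlinarith [sq_nonneg s]
      have h4 : ((1 + ‖s • b + p.1 • a‖) ^ 8)⁻¹ ≤ ((1 + p.1) ^ 8)⁻¹ := by gcongr
      have h5 : p.1 * ((1 + p.1) ^ 8)⁻¹ ≤ (1 + p.1 ^ 2)⁻¹ := by
        rw [← div_eq_mul_inv, div_le_iff₀ (by positivity), inv_mul_eq_div,
          le_div_iff₀ (by positivity)]
        have h6 : (1 + p.1) ^ 3 ≤ (1 + p.1) ^ 8 := pow_le_pow_right₀ (by linarith) (by norm_num)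
        nlinarith [pow_pos hr 2, pow_pos hr 3]
      calc p.1 * |h (rot b p.2 (s • b + p.1 • a))|
          ≤ p.1 * (M * ((1 + p.1) ^ 8)⁻¹) := by
            refine mul_le_mul_of_nonneg_left (h1.trans ?_) hr.le
            gcongr
        _ = M * (p.1 * ((1 + p.1) ^ 8)⁻¹) := by ring
        _ ≤ M * (1 + p.1 ^ 2)⁻¹ := by gcongr

omit hb ha hab hc hM in
lemma integral_sqrt_substitution {m : ℝ} (hm : 0 < m) (ψ : ℝ → ℝ) :
    ∫ r in Ioi (0 : ℝ), r * ψ r = ∫ μ in Ioi (0 : ℝ), m * ψ √(2 * μ * m) := by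
  have h1 := integral_comp_rpow_Ioi_of_pos (g := fun y => ψ √y / 2) (p := 2) (by norm_num)
  have h2 := integral_comp_mul_left_Ioi (fun y => ψ √y / 2) 0 (b := 2 * m) (by positivity)
  rw [mul_zero] at h2
  have h3 : ∫ r in Ioi (0 : ℝ), r * ψ r
      = ∫ x in Ioi (0 : ℝ), (2 * x ^ ((2 : ℝ) - 1)) • (ψ √(x ^ (2 : ℝ)) / 2) := by
    refine setIntegral_congr_fun measurableSet_Ioi fun r hr => ?_
    have hr : 0 < r := hr
    have e1 : (2 : ℝ) - 1 = 1 := by norm_num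
    simp only [e1, Real.rpow_one, smul_eq_mul, Real.rpow_two, Real.sqrt_sq hr.le]
    ring
  rw [h3, h1]
  have h4 : ∫ μ in Ioi (0 : ℝ), m * ψ √(2 * μ * m)
      = ∫ μ in Ioi (0 : ℝ), (2 * m) * (ψ √(2 * m * μ) / 2) := by
    refine setIntegral_congr_fun measurableSet_Ioi fun μ _ => ?_
    rw [show 2 * μ * m = 2 * m * μ by ring]; ring
  rw [h4, integral_const_mul, h2, smul_eq_mul, mul_inv_cancel_left₀ (by positivity)]

omit hc in
lemma abs_circAvg_gyro_le {m : ℝ} (hm : 0 < m) {μ : ℝ} (hμ : 0 < μ) (s : ℝ) :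
    |circAvg b h (s • b + √(2 * μ * m) • a)|
      ≤ M * (1 + ((2 * m) ^ 2)⁻¹) * ((1 + μ ^ 2)⁻¹ * (1 + s ^ 2)⁻¹) := by
  have hM0 : 0 ≤ M := by simpa using (abs_nonneg _).trans (hM 0)
  set c := s • b + √(2 * μ * m) • a with hcdef
  have hn : ‖c‖ ^ 2 = s ^ 2 + 2 * μ * m := by
    rw [hcdef, norm_sq_gyro hb ha hab, Real.sq_sqrt (by positivity)]
  have h0 : 0 ≤ ‖c‖ := norm_nonneg c
  refine (abs_circAvg_le (Q := M * ((1 + ‖c‖) ^ 8)⁻¹) fun θ => ?_).trans ?_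
  · have := hM (rot b θ c)
    rwa [norm_rot hb] at this
  rw [mul_assoc]
  refine mul_le_mul_of_nonneg_left ?_ hM0
  rw [← mul_inv, ← div_eq_mul_inv, le_div_iff₀ (by positivity), inv_mul_le_iff₀ (by positivity)]
  have e1 : 1 + s ^ 2 ≤ (1 + ‖c‖) ^ 2 := by nlinarith [mul_pos hμ hm]
  have e2 : 1 + (2 * m * μ) ^ 2 ≤ (1 + ‖c‖) ^ 4 := by
    have : 2 * m * μ ≤ ‖c‖ ^ 2 := by nlinarith [sq_nonneg s]
    have h4 : (2 * m * μ) ^ 2 ≤ (‖c‖ ^ 2) ^ 2 := by gcongr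
    nlinarith [pow_nonneg h0 3, pow_nonneg h0 2, pow_nonneg h0 4]
  have e3 : 1 + μ ^ 2 ≤ (1 + ((2 * m) ^ 2)⁻¹) * (1 + (2 * m * μ) ^ 2) := by
    have h1 : ((2 * m) ^ 2)⁻¹ * (2 * m * μ) ^ 2 = μ ^ 2 := by field_simp
    have h2 : 0 ≤ ((2 * m) ^ 2)⁻¹ := by positivity
    nlinarith [sq_nonneg (2 * m * μ)]
  calc (1 + μ ^ 2) * (1 + s ^ 2)
      ≤ ((1 + ((2 * m) ^ 2)⁻¹) * (1 + ‖c‖) ^ 4) * (1 + ‖c‖) ^ 2 := by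
        refine mul_le_mul (e3.trans ?_) e1 (by positivity) (by positivity)
        gcongr
    _ = (1 + ‖c‖) ^ 6 * (1 + ((2 * m) ^ 2)⁻¹) := by ring
    _ ≤ _ := by gcongr <;> linarith

lemma integrableOn_gyro {m : ℝ} (hm : 0 < m) :
    IntegrableOn (fun p : ℝ × ℝ => circAvg b h (p.2 • b + √(2 * p.1 * m) • a)) domMu := by
  have hg : Integrable (fun p : ℝ × ℝ => (M * (1 + ((2 * m) ^ 2)⁻¹)) *
      ((1 + p.1 ^ 2)⁻¹ * (1 + p.2 ^ 2)⁻¹)) :=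
    (integrable_inv_one_add_sq.mul_prod integrable_inv_one_add_sq).const_mul _
  have hcirc : Continuous fun p : ℝ × ℝ => circAvg b h (p.2 • b + √(2 * p.1 * m) • a) := by
    unfold circAvg
    refine continuous_const.mul ?_
    refine intervalIntegral.continuous_parametric_intervalIntegral_of_continuous' ?_ _ _
    simp only [Function.uncurry_def, rot_gyro hb hab]
    fun_prop
  refine hg.restrict.mono' hcirc.aestronglyMeasurable ?_
  filter_upwards [ae_restrict_mem (measurableSet_Ioi.prod MeasurableSet.univ)] with p hp
  exact abs_circAvg_gyro_le hb ha hab hM hm hp.1 p.2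

/-- Velocity integrals in the coordinates magnetic moment, parallel velocity and gyrophase. -/
lemma integral_eq_gyro {m : ℝ} (hm : 0 < m) :
    ∫ c, h c = ∫ p in domMu, 2 * Real.pi * m * circAvg b h (p.2 • b + √(2 * p.1 * m) • a) := by
  rw [integral_eq_iterated hb ha hab hc hM]
  have h1 : ∀ s : ℝ, ∫ y : ℝ × ℝ, h (s • b + y.1 • a + y.2 • cross b a)
      = ∫ μ in Ioi (0 : ℝ), 2 * Real.pi * m * circAvg b h (s • b + √(2 * μ * m) • a) := by
    intro s
    rw [integral_perp_eq hb ha hab hc hM, integral_sqrt_substitution hm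
      (fun r => 2 * Real.pi * circAvg b h (s • b + r • a))]
    refine setIntegral_congr_fun measurableSet_Ioi fun μ _ => ?_
    ring
  simp only [h1]
  have hi := (integrableOn_gyro hb ha hab hc hM hm).const_mul (2 * Real.pi * m)
  rw [domMu, Measure.volume_eq_prod, ← Measure.prod_restrict,
    Measure.restrict_univ] at hi
  rw [domMu, Measure.volume_eq_prod, ← Measure.prod_restrict, Measure.restrict_univ,
    integral_prod_symm _ hi]

end Cylindrical

end

section

/-! ### Moments of gyro-averages -/

variable {Ω : Set V3} {I : Set ℝ} {B : VField} {F : Type} [NormedAddCommGroup F] [NormedSpace ℝ F]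

/-- The parallel velocity as a function on phase space. -/
def parF (B : VField) (z : Phase) : ℝ := cPar B z.1 z.2.1 z.2.2

/-- The magnetic moment as a function on phase space. -/
def magF (B : VField) (z : Phase) : ℝ := magMoment B z.1 z.2.1 z.2.2

section Closure
variable (hΩ : IsOpen Ω) (hI : IsOpen I)
include hΩ hI

lemma Moderate.neg {f : Phase → F} (hf : Moderate Ω I f) : Moderate Ω I (fun z => -f z) :=
  Moderate.clm hΩ hI (-ContinuousLinearMap.id ℝ F) hf

lemma Moderate.sub {f g : Phase → F} (hf : Moderate Ω I f)
    (hg : Moderate Ω I g) : Moderate Ω I (fun z => f z - g z) := by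
  simpa only [sub_eq_add_neg] using hf.add hΩ hI (hg.neg hΩ hI)

lemma Moderate.inner {f g : Phase → V3} (hf : Moderate Ω I f)
    (hg : Moderate Ω I g) : Moderate Ω I (fun z => (inner ℝ (f z) (g z) : ℝ)) :=
  Moderate.bilin hΩ hI (innerSL ℝ) hf hg

lemma Moderate.cross {f g : Phase → V3} (hf : Moderate Ω I f)
    (hg : Moderate Ω I g) : Moderate Ω I (fun z => DriftKinetic.cross (f z) (g z)) :=
  Moderate.bilin hΩ hI crossL hf hg

lemma Moderate.pow {f : Phase → ℝ} (hf : Moderate Ω I f) (n : ℕ) :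
    Moderate Ω I (fun z => f z ^ n) := by
  induction n with
  | zero => simpa using moderate_one
  | succ n ih => simpa only [pow_succ] using ih.mul hΩ hI hf

lemma Rapid.mul_moderate {h f : Phase → ℝ} (hh : Rapid Ω I h) (hf : Moderate Ω I f) :
    Rapid Ω I (fun z => h z * f z) :=
  Rapid.bilin hΩ hI (ContinuousLinearMap.mul ℝ ℝ).flip hf hh

lemma Rapid.smul_moderate {h : Phase → ℝ} {f : Phase → F} (hh : Rapid Ω I h)
    (hf : Moderate Ω I f) : Rapid Ω I (fun z => h z • f z) :=
  Rapid.bilin hΩ hI (ContinuousLinearMap.lsmul ℝ ℝ).flip hf hh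

end Closure

lemma Rapid.decay {h : Phase → ℝ} (hh : Rapid Ω I h) {x : V3} (hx : x ∈ Ω) {t : ℝ} (ht : t ∈ I) :
    ∃ M, ∀ c, |h (x, c, t)| ≤ M * ((1 + ‖c‖) ^ 8)⁻¹ := by
  obtain ⟨M, hM⟩ := hh.2 {(x, t)} isCompact_singleton
    (by rw [singleton_subset_iff]; exact ⟨hx, ht⟩) 8 0
  refine ⟨M, fun c => le_of_weight_le (norm_nonneg c) ?_⟩
  have := hM (x, t) rfl c
  rwa [norm_iteratedFDeriv_zero] at this

lemma cPar_gyro {x : V3} {t : ℝ} (hB : B x t ≠ 0) {s μ θ : ℝ} {a : V3}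
    (hab : inner ℝ a (bdir B x t) = (0 : ℝ)) :
    cPar B x (rot (bdir B x t) θ (s • bdir B x t + √(2 * μ * ‖B x t‖) • a)) t = s := by
  rw [cPar, inner_rot (norm_bdir hB), inner_gyro (norm_bdir hB) hab]

lemma magMoment_gyro {x : V3} {t : ℝ} (hB : B x t ≠ 0) {s μ θ : ℝ} (hμ : 0 ≤ μ) {a : V3}
    (ha : ‖a‖ = 1) (hab : inner ℝ a (bdir B x t) = (0 : ℝ)) :
    magMoment B x (rot (bdir B x t) θ (s • bdir B x t + √(2 * μ * ‖B x t‖) • a)) t = μ := by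
  have hm := norm_ne_zero_iff.2 hB
  rw [magMoment, cPar_gyro hB hab, norm_rot (norm_bdir hB), norm_sq_gyro (norm_bdir hB) ha hab,
    Real.sq_sqrt (by positivity)]
  field_simp
  ring

section
variable (hΩ : IsOpen Ω) (hI : IsOpen I) (hB : ContDiffOn ℝ ∞ (onSpaceTime B) (Ω ×ˢ I))
  (hB0 : ∀ x ∈ Ω, ∀ t ∈ I, B x t ≠ 0)
include hB hB0

omit hB in
lemma velInt_eq_red {h : Phase → ℝ} (hh : Rapid Ω I h) {x : V3} (hx : x ∈ Ω) {t : ℝ} (ht : t ∈ I) :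
    velInt h (x, t) = ∫ p in domMu, weighted B (red B h) x p.1 p.2 t := by
  obtain ⟨M, hM⟩ := hh.decay hx ht
  have hBx := hB0 x hx t ht
  exact integral_eq_gyro (norm_bdir hBx) (norm_perpVec _) (inner_perpVec _)
    (hh.continuous (w := (x, t)) ⟨hx, ht⟩) hM (norm_pos_iff.2 hBx)

omit hB in
lemma integrableOn_red {h : Phase → ℝ} (hh : Rapid Ω I h) {x : V3} (hx : x ∈ Ω) {t : ℝ}
    (ht : t ∈ I) : IntegrableOn (fun p : ℝ × ℝ => red B h x p.1 p.2 t) domMu := by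
  obtain ⟨M, hM⟩ := hh.decay hx ht
  have hBx := hB0 x hx t ht
  exact integrableOn_gyro (norm_bdir hBx) (norm_perpVec _) (inner_perpVec _)
    (hh.continuous (w := (x, t)) ⟨hx, ht⟩) hM (norm_pos_iff.2 hBx)

omit hB in
/-- Functions of the magnetic moment and of the parallel velocity pass through the average. -/
lemma red_mul {h : Phase → ℝ} {x : V3} (hx : x ∈ Ω) {t : ℝ} (ht : t ∈ I) {μ : ℝ} (hμ : 0 ≤ μ)
    (s : ℝ) (m q : ℕ) :
    red B (fun z => h z * (parF B z ^ m * magF B z ^ q)) x μ s t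
      = red B h x μ s t * (s ^ m * μ ^ q) := by
  have hBx := hB0 x hx t ht
  rw [red, circAvg_congr (Y := fun c => (s ^ m * μ ^ q) * h (x, c, t)), circAvg_const_mul, mul_comm]
  · rfl
  · intro θ
    simp only [parF, magF]
    rw [cPar_gyro hBx (inner_perpVec _), magMoment_gyro hBx hμ (norm_perpVec _) (inner_perpVec _),
      mul_comm]

include hΩ hI

lemma moderate_bdir : Moderate Ω I (fun z : Phase => bdir B z.1 z.2.2) :=
  Moderate.field hΩ hI (contDiffOn_bdir hB hB0)

lemma moderate_invB : Moderate Ω I (fun z : Phase => ‖B z.1 z.2.2‖⁻¹) :=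
  Moderate.field hΩ hI (contDiffOn_invB hB hB0)

lemma moderate_parF : Moderate Ω I (parF B) :=
  Moderate.vel.inner hΩ hI (moderate_bdir hΩ hI hB hB0)

lemma moderate_magF : Moderate Ω I (magF B) := by
  have h1 : Moderate Ω I (fun z : Phase => (inner ℝ z.2.1 z.2.1 : ℝ)) :=
    Moderate.vel.inner hΩ hI Moderate.vel
  have h2 := (h1.sub hΩ hI ((moderate_parF hΩ hI hB hB0).pow hΩ hI 2)).mul hΩ hI
    (.const (1 / 2 : ℝ))
  have h3 := (moderate_invB hΩ hI hB hB0).mul hΩ hI h2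
  convert h3 using 2 with z
  simp only [magF, magMoment, parF, real_inner_self_eq_norm_sq]
  ring

lemma rapid_moment {h : Phase → ℝ} (hh : Rapid Ω I h) (m q : ℕ) :
    Rapid Ω I (fun z => h z * (parF B z ^ m * magF B z ^ q)) :=
  hh.mul_moderate hΩ hI (((moderate_parF hΩ hI hB hB0).pow hΩ hI m).mul hΩ hI
    ((moderate_magF hΩ hI hB hB0).pow hΩ hI q))

/-- The moments of the weighted gyro-average are velocity moments. -/
lemma mom_weighted_red {h : Phase → ℝ} (hh : Rapid Ω I h) (m q : ℕ) {x : V3} (hx : x ∈ Ω)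
    {t : ℝ} (ht : t ∈ I) :
    mom (weighted B (red B h)) m q x t
      = velInt (fun z => h z * (parF B z ^ m * magF B z ^ q)) (x, t) := by
  rw [velInt_eq_red hB0 (rapid_moment hΩ hI hB hB0 hh m q) hx ht, mom]
  refine setIntegral_congr_fun (measurableSet_Ioi.prod MeasurableSet.univ) fun p hp => ?_
  have hp0 : 0 < p.1 := hp.1
  simp only [weighted, red_mul hB0 hx ht hp0.le]
  ring

lemma regularReduced_red {h : Phase → ℝ} (hh : Rapid Ω I h) : RegularReduced Ω I (red B h) where
  continuous := continuousOn_red hΩ hI hB hB0 hh.1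
  smooth := contDiffOn_red hΩ hI hB hB0 hh.1
  integrable x hx t ht m q := by
    refine (integrableOn_red hB0 (rapid_moment hΩ hI hB hB0 hh m q) hx ht).congr_fun
      (fun p hp => ?_) (measurableSet_Ioi.prod MeasurableSet.univ)
    have hp0 : 0 < p.1 := hp.1
    exact red_mul hB0 hx ht hp0.le p.2 m q
  moments m q := by
    have h1 := (rapid_moment hΩ hI hB hB0 hh m q).contDiffOn_velInt hΩ hI
    refine ((contDiffOn_const (c := (2 * Real.pi)⁻¹)).mul (contDiffOn_invB hB hB0) |>.mul h1).congr
      fun w hw => ?_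
    have h2 : ‖B w.1 w.2‖ ≠ 0 := norm_ne_zero_iff.2 (hB0 w.1 hw.1 w.2 hw.2)
    have h3 := Real.pi_ne_zero
    rw [show w = (w.1, w.2) from rfl, ← mom_weighted_red hΩ hI hB hB0 hh m q hw.1 hw.2]
    simp only [mom, weighted, mul_assoc, integral_const_mul]
    field_simp

omit hΩ hI hB in
lemma dens_red {h : Phase → ℝ} (hh : Rapid Ω I h) {x : V3} (hx : x ∈ Ω) {t : ℝ} (ht : t ∈ I) :
    dens (weighted B (red B h)) x t = velInt h (x, t) :=
  (velInt_eq_red hB0 hh hx ht).symm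

lemma pPar_red {h : Phase → ℝ} (hh : Rapid Ω I h) {x : V3} (hx : x ∈ Ω) {t : ℝ} (ht : t ∈ I) :
    pPar (weighted B (red B h)) x t = velInt (fun z => h z * parF B z ^ 2) (x, t) := by
  have := mom_weighted_red hΩ hI hB hB0 hh 2 0 hx ht
  simpa [mom, pPar] using this

lemma pPerp_red {h : Phase → ℝ} (hh : Rapid Ω I h) {x : V3} (hx : x ∈ Ω) {t : ℝ} (ht : t ∈ I) :
    pPerp B (weighted B (red B h)) x t
      = ‖B x t‖ * velInt (fun z => h z * magF B z) (x, t) := by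
  have := mom_weighted_red hΩ hI hB hB0 hh 0 1 hx ht
  simp only [mom, pow_zero, pow_one, one_mul] at this
  rw [← this, ← integral_const_mul, pPerp]
  congr 1 with p
  ring

end

end

section

/-! ### Algebra of the gyrophase -/

section Algebra
variable {b : V3} {N : V3 →L[ℝ] V3}

/-- The projection onto the plane perpendicular to `b`. -/
def perpProj (b : V3) : V3 →L[ℝ] V3 :=
  ContinuousLinearMap.id ℝ V3 - (innerSL ℝ b).smulRight b

lemma perpProj_apply (b v : V3) : perpProj b v = v - (inner ℝ v b : ℝ) • b := by
  simp [perpProj, real_inner_comm]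

/-- The trace-free part of `N` that rotates with the gyrophase, precomposed with a quarter turn: the
quadratic form of `gyroOp b N` is a primitive, along the circles around `b`, of the oscillating part
of the quadratic form of `N` in the plane perpendicular to `b`. -/
def gyroOp (b : V3) (N : V3 →L[ℝ] V3) : V3 →L[ℝ] V3 :=
  (4⁻¹ : ℝ) • (N ∘L crossL b - crossL b ∘L N ∘L perpProj b)

lemma gyroOp_apply (v : V3) : gyroOp b N v
    = (4⁻¹ : ℝ) • (N (cross b v) - cross b (N (v - (inner ℝ v b : ℝ) • b))) := by
  simp [gyroOp, perpProj_apply]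

lemma gyroOp_self (hb : ‖b‖ = 1) : gyroOp b N b = 0 := by
  rw [gyroOp_apply, cross_self', inner_self_of_unit hb, one_smul, sub_self, map_zero]
  simp [← crossL_apply]

lemma inner_gyroOp (hN : ∀ v, inner ℝ (N v) b = (0 : ℝ)) (v : V3) :
    inner ℝ (gyroOp b N v) b = (0 : ℝ) := by
  rw [gyroOp_apply, inner_smul_left, inner_sub_left, hN, real_inner_comm, inner_cross_self_left]
  simp

lemma inner_cross_cross (hb : ‖b‖ = 1) (v w : V3) :
    inner ℝ (cross b v) (cross b w) = (inner ℝ v w - inner ℝ v b * inner ℝ w b : ℝ) := by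
  have h1 := unit_sq hb
  simp only [inner_eq, cross_zero', cross_one', cross_two']
  linear_combination (v 0 * w 0 + v 1 * w 1 + v 2 * w 2) * h1

lemma inner_cross_left (b v w : V3) : inner ℝ v (cross b w) = (-inner ℝ (cross b v) w : ℝ) := by
  simp only [inner_eq, cross_zero', cross_one', cross_two']; ring

lemma gyroOp_rotate (hb : ‖b‖ = 1) (hN : ∀ v, inner ℝ (N v) b = (0 : ℝ)) (c : V3) :
    -(inner ℝ (cross b c) (gyroOp b N c) + inner ℝ c (gyroOp b N (cross b c)))
      = (inner ℝ c (N (c - (inner ℝ c b : ℝ) • b))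
        - (‖c‖ ^ 2 - (inner ℝ c b : ℝ) ^ 2) / 2 * ∑ i, inner ℝ (e i) (N (e i)) : ℝ) := by
  set p := c - (inner ℝ c b : ℝ) • b with hp
  have hpb : inner ℝ p b = (0 : ℝ) := inner_perp_self hb c
  have hq : cross b c = cross b p := by
    rw [hp, cross_sub_right, cross_smul_right, cross_self']; simp
  have hqb : inner ℝ (cross b c) b = (0 : ℝ) := by rw [real_inner_comm, inner_cross_self_left]
  have hqq : cross b (cross b c) = -p := by
    rw [cross_cross_eq, inner_self_of_unit hb, hp, real_inner_comm]; module
  have key := perp_pair_bilin ((innerSL ℝ).flip.comp N |>.flip) hb hpb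
  simp only [ContinuousLinearMap.flip_apply, ContinuousLinearMap.comp_apply, innerSL_apply_apply,
    smul_eq_mul] at key
  rw [real_inner_comm (N b) b, hN, sub_zero, ← hq] at key
  have hpn : ‖p‖ ^ 2 = ‖c‖ ^ 2 - (inner ℝ c b : ℝ) ^ 2 := by
    have := norm_sq_decomp hb c
    rw [← hp] at this; linarith
  have hcp : (inner ℝ p (N p) : ℝ) = inner ℝ c (N p) := by
    conv_lhs => rw [hp]
    rw [inner_sub_left, inner_smul_left, real_inner_comm (N _) b, ← hp, hN]
    simp
  rw [gyroOp_apply, gyroOp_apply, hqb, zero_smul, sub_zero, hqq, ← hp]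
  simp only [inner_smul_right, inner_sub_right, map_neg, inner_neg_right]
  rw [inner_cross_cross hb, hN, inner_cross_left b c (N (cross b c))]
  rw [hpn, hcp] at key
  linear_combination (-1 / 2 : ℝ) * key

lemma clm_eq_sum (N : V3 →L[ℝ] V3) (v : V3) :
    N v = v 0 • N (e 0) + v 1 • N (e 1) + v 2 • N (e 2) := by
  conv_lhs => rw [← sum_smul_e v]
  simp [Fin.sum_univ_three]

lemma trace_gyroOp (b : V3) (N : V3 →L[ℝ] V3) :
    ∑ i, inner ℝ (e i) (gyroOp b N (e i)) = (0 : ℝ) := by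
  simp only [gyroOp_apply, Fin.sum_univ_three, inner_smul_right, inner_sub_right]
  rw [clm_eq_sum N (cross b (e 0)), clm_eq_sum N (cross b (e 1)), clm_eq_sum N (cross b (e 2)),
    map_sub, map_sub, map_sub, map_smul, map_smul, map_smul, clm_eq_sum N b]
  simp only [inner_eq, cross_zero', cross_one', cross_two', PiLp.add_apply, PiLp.smul_apply,
    PiLp.sub_apply, smul_eq_mul, e_apply]
  simp
  ring

lemma trace_gyroOp_comp (hN : ∀ v, inner ℝ (N v) b = (0 : ℝ)) :
    ∑ i, (inner ℝ (N (e i)) (gyroOp b N (e i)) + inner ℝ (e i) (gyroOp b N (N (e i)))) = (0 : ℝ) := by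
  have h1 : ∀ v, (inner ℝ (N v) (cross b (N v)) : ℝ) = 0 := fun v => inner_cross_self_right _ _
  have h2 : ∑ i, inner ℝ (N (e i)) (cross b (N (e i - (inner ℝ (e i) b : ℝ) • b))) = (0 : ℝ) := by
    have h3 : ∑ i, (inner ℝ (e i) b : ℝ) * inner ℝ (N (e i)) (cross b (N b))
        = inner ℝ (N b) (cross b (N b)) := by
      rw [clm_eq_sum N b]
      simp only [Fin.sum_univ_three, inner_add_left, inner_smul_left]
      simp [inner_eq, e_apply]
    rw [h1] at h3
    simp only [map_sub, map_smul, cross_sub_right, cross_smul_right, inner_sub_right,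
      inner_smul_right, h1, Finset.sum_sub_distrib, Finset.sum_const_zero, h3, sub_zero]
  have h4 : ∑ i, inner ℝ (N (e i)) (N (cross b (e i))) = (0 : ℝ) := by
    simp only [Fin.sum_univ_three]
    rw [clm_eq_sum N (cross b (e 0)), clm_eq_sum N (cross b (e 1)), clm_eq_sum N (cross b (e 2))]
    simp only [inner_eq, cross_zero', cross_one', cross_two', PiLp.add_apply, PiLp.smul_apply,
      smul_eq_mul, e_apply]
    simp
    ring
  have h5 : ∑ i, (inner ℝ (e i) (N (cross b (N (e i)))) - inner ℝ (e i) (cross b (N (N (e i)))))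
      = (0 : ℝ) := by
    simp only [Fin.sum_univ_three]
    rw [clm_eq_sum N (cross b _), clm_eq_sum N (cross b (N (e 1))),
      clm_eq_sum N (cross b (N (e 2))), clm_eq_sum N (N (e 0)), clm_eq_sum N (N (e 1)),
      clm_eq_sum N (N (e 2))]
    simp only [inner_eq, cross_zero', cross_one', cross_two', PiLp.add_apply, PiLp.smul_apply,
      smul_eq_mul, e_apply]
    simp
    ring
  simp only [gyroOp_apply, inner_smul_right, inner_sub_right, hN, zero_smul, sub_zero]
  have h6 : ∀ i, (4⁻¹ : ℝ) * (inner ℝ (N (e i)) (N (cross b (e i)))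
      - inner ℝ (N (e i)) (cross b (N (e i - (inner ℝ (e i) b : ℝ) • b))))
      + 4⁻¹ * (inner ℝ (e i) (N (cross b (N (e i)))) - inner ℝ (e i) (cross b (N (N (e i)))))
      = 4⁻¹ * inner ℝ (N (e i)) (N (cross b (e i)))
        - 4⁻¹ * inner ℝ (N (e i)) (cross b (N (e i - (inner ℝ (e i) b : ℝ) • b)))
        + 4⁻¹ * (inner ℝ (e i) (N (cross b (N (e i))))
          - inner ℝ (e i) (cross b (N (N (e i))))) := fun i => by ring
  simp only [h6, Finset.sum_add_distrib, Finset.sum_sub_distrib (f := fun i =>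
    (4⁻¹ : ℝ) * inner ℝ (N (e i)) (N (cross b (e i)))), ← Finset.mul_sum, h2, h4, h5]
  simp

end Algebra

/-! ### Fields derived from the magnetic field -/

variable {Ω : Set V3} {I : Set ℝ} {B : VField}

lemma inner_e (i : Fin 3) (v : V3) : inner ℝ (e i) v = v i := by
  rw [inner_eq]; fin_cases i <;> simp [e_apply]

lemma fderiv_field_space {F : Type} [NormedAddCommGroup F] [NormedSpace ℝ F] {a : SpaceTime → F}
    {w : SpaceTime} (ha : DifferentiableAt ℝ a w) (v : V3) :
    fderiv ℝ (fun y => a (y, w.2)) w.1 v = fderiv ℝ a w (v, 0) :=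
  fderiv_slice_space (x := w.1) (t := w.2) ha v

lemma dvg_field {a : SpaceTime → V3} {w : SpaceTime} (ha : DifferentiableAt ℝ a w) :
    dvg (fun y => a (y, w.2)) w.1 = ∑ i, inner ℝ (e i) (fderiv ℝ a w (e i, 0)) := by
  simp only [dvg, inner_e, fderiv_field_space ha]

lemma curl_field {a : SpaceTime → V3} {w : SpaceTime} (ha : DifferentiableAt ℝ a w) :
    curl (fun y => a (y, w.2)) w.1 = ∑ i, cross (e i) (fderiv ℝ a w (e i, 0)) := by
  simp only [curl, fderiv_field_space ha]

/-- The spatial differential of `b`. -/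
def gradb (B : VField) (w : SpaceTime) : V3 →L[ℝ] V3 :=
  (fderiv ℝ (onSpaceTime (bdir B)) w).comp (ContinuousLinearMap.inl ℝ V3 ℝ)

lemma gradb_apply (B : VField) (w : SpaceTime) (v : V3) :
    gradb B w v = fderiv ℝ (onSpaceTime (bdir B)) w (v, 0) := rfl

section
variable (hΩ : IsOpen Ω) (hI : IsOpen I) (hB : ContDiffOn ℝ ∞ (onSpaceTime B) (Ω ×ˢ I))
  (hB0 : ∀ x ∈ Ω, ∀ t ∈ I, B x t ≠ 0)
include hΩ hI

lemma differentiableAt_of_contDiffOn {F : Type} [NormedAddCommGroup F] [NormedSpace ℝ F]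
    {a : SpaceTime → F} (ha : ContDiffOn ℝ ∞ a (Ω ×ˢ I)) {w : SpaceTime} (hw : w ∈ Ω ×ˢ I) :
    DifferentiableAt ℝ a w :=
  (ha.contDiffAt ((hΩ.prod hI).mem_nhds hw)).differentiableAt (by simp)

/-- An identity between fields on `Ω × I` can be differentiated. -/
lemma fderiv_eq_of_eqOn {F : Type} [NormedAddCommGroup F] [NormedSpace ℝ F]
    {a a' : SpaceTime → F} (h : ∀ w ∈ Ω ×ˢ I, a w = a' w) {w : SpaceTime} (hw : w ∈ Ω ×ˢ I) :
    fderiv ℝ a w = fderiv ℝ a' w := by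
  refine EventuallyEq.fderiv_eq ?_
  filter_upwards [(hΩ.prod hI).mem_nhds hw] with w' hw' using h w' hw'

include hB hB0

lemma inner_fderiv_bdir {w : SpaceTime} (hw : w ∈ Ω ×ˢ I) (v : SpaceTime) :
    inner ℝ (fderiv ℝ (onSpaceTime (bdir B)) w v) (bdir B w.1 w.2) = (0 : ℝ) := by
  have hd := differentiableAt_of_contDiffOn hΩ hI (contDiffOn_bdir hB hB0) hw
  have h1 := fderiv_eq_of_eqOn hΩ hI (a := fun w => (inner ℝ (onSpaceTime (bdir B) w)
    (onSpaceTime (bdir B) w) : ℝ)) (a' := fun _ => 1)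
    (fun w hw => inner_self_of_unit (norm_bdir (hB0 w.1 hw.1 w.2 hw.2))) hw
  have h2 := fderiv_inner_apply ℝ hd hd v
  rw [h1] at h2
  simp only [fderiv_fun_const, Pi.zero_apply, _root_.zero_apply] at h2
  rw [real_inner_comm] at h2
  have h3 : onSpaceTime (bdir B) w = bdir B w.1 w.2 := rfl
  rw [h3] at h2
  linarith

lemma inner_gradb {w : SpaceTime} (hw : w ∈ Ω ×ˢ I) (v : V3) :
    inner ℝ (gradb B w v) (bdir B w.1 w.2) = (0 : ℝ) :=
  inner_fderiv_bdir hΩ hI hB hB0 hw (v, 0)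

lemma contDiffOn_fderiv_bdir :
    ContDiffOn ℝ ∞ (fderiv ℝ (onSpaceTime (bdir B))) (Ω ×ˢ I) :=
  (contDiffOn_bdir hB hB0).fderiv_of_isOpen (hΩ.prod hI) (by norm_cast)

lemma contDiffOn_gradb : ContDiffOn ℝ ∞ (gradb B) (Ω ×ˢ I) :=
  (contDiffOn_fderiv_bdir hΩ hI hB hB0).clm_comp contDiffOn_const

lemma curvature_eq {w : SpaceTime} (hw : w ∈ Ω ×ˢ I) :
    curvature B w.1 w.2 = gradb B w (bdir B w.1 w.2) :=
  fderiv_slice_space (a := onSpaceTime (bdir B)) (x := w.1) (t := w.2)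
    (differentiableAt_of_contDiffOn hΩ hI (contDiffOn_bdir hB hB0) hw) _

lemma contDiffOn_fvec : ContDiffOn ℝ ∞ (onSpaceTime (fvec B)) (Ω ×ˢ I) := by
  have hb := contDiffOn_bdir hB hB0
  refine (ContDiffOn.cross hb ((contDiffOn_gradb hΩ hI hB hB0).clm_apply hb)).congr fun w hw => ?_
  rw [onSpaceTime, fvec, curvature_eq hΩ hI hB hB0 hw]; rfl

omit hΩ hI hB hB0 in
lemma inner_fvec (B : VField) (x : V3) (t : ℝ) : inner ℝ (fvec B x t) (bdir B x t) = (0 : ℝ) := by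
  rw [fvec, real_inner_comm, inner_cross_self_left]

omit hΩ hI hB hB0 in
lemma inner_curvature_fvec (B : VField) (x : V3) (t : ℝ) :
    inner ℝ (curvature B x t) (fvec B x t) = (0 : ℝ) := by
  rw [fvec, inner_cross_self_right]

lemma divb_eq {w : SpaceTime} (hw : w ∈ Ω ×ˢ I) :
    divb B w.1 w.2 = ∑ i, inner ℝ (e i) (gradb B w (e i)) :=
  dvg_field (differentiableAt_of_contDiffOn hΩ hI (contDiffOn_bdir hB hB0) hw)

lemma contDiffOn_divb : ContDiffOn ℝ ∞ (fun w : SpaceTime => divb B w.1 w.2) (Ω ×ˢ I) :=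
  (ContDiffOn.sum (s := Finset.univ) fun i _ => ContDiffOn.inner ℝ
    (contDiffOn_const (c := e i)) ((contDiffOn_gradb hΩ hI hB hB0).clm_apply
    (contDiffOn_const (c := e i)))).congr fun _ hw => divb_eq hΩ hI hB hB0 hw

end

end

section

/-! ### Phase functions and their derivatives along the characteristics -/

variable {Ω : Set V3} {I : Set ℝ} {B : VField}

section Generic
variable {F : Type} [NormedAddCommGroup F] [NormedSpace ℝ F]

lemma hasFDerivAt_field {a : SpaceTime → F} {z : Phase} (ha : DifferentiableAt ℝ a (foot z)) :
    HasFDerivAt (fun z => a (foot z)) ((fderiv ℝ a (foot z)).comp foot) z :=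
  ha.hasFDerivAt.comp z foot.hasFDerivAt

lemma fderiv_field {a : SpaceTime → F} {z : Phase} (ha : DifferentiableAt ℝ a (foot z))
    (d : Phase) : fderiv ℝ (fun z => a (foot z)) z d = fderiv ℝ a (foot z) (foot d) := by
  rw [(hasFDerivAt_field ha).fderiv]; rfl

lemma differentiableAt_field {a : SpaceTime → F} {z : Phase} (ha : DifferentiableAt ℝ a (foot z)) :
    DifferentiableAt ℝ (fun z => a (foot z)) z := (hasFDerivAt_field ha).differentiableAt

lemma differentiableAt_vel (z : Phase) : DifferentiableAt ℝ (fun z : Phase => z.2.1) z := by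
  fun_prop

lemma fderiv_vel (z d : Phase) : fderiv ℝ (fun z : Phase => z.2.1) z d = d.2.1 := by
  have : HasFDerivAt (fun z : Phase => z.2.1)
      ((ContinuousLinearMap.fst ℝ V3 ℝ).comp (ContinuousLinearMap.snd ℝ V3 (V3 × ℝ))) z :=
    hasFDerivAt_fst.comp z hasFDerivAt_snd
  rw [this.fderiv]; rfl

end Generic

/-- The kinetic energy `|c|² / 2`. -/
def kinF (z : Phase) : ℝ := inner ℝ z.2.1 z.2.1 / 2

/-- `b / |B|`. -/
def invBb (B : VField) (w : SpaceTime) : V3 := ‖B w.1 w.2‖⁻¹ • bdir B w.1 w.2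

/-- `f / |B|`. -/
def invBf (B : VField) (w : SpaceTime) : V3 := ‖B w.1 w.2‖⁻¹ • fvec B w.1 w.2

/-- The operator `gyroOp b (∇b)`, divided by the gyrofrequency. -/
def gyroField (B : VField) (w : SpaceTime) : V3 →L[ℝ] V3 :=
  ‖B w.1 w.2‖⁻¹ • gyroOp (bdir B w.1 w.2) (gradb B w)

/-- The drift `(b × F) / |B|` of a force field `F`. -/
def driftF (B : VField) (F : SpaceTime → V3) (w : SpaceTime) : V3 := cross (invBb B w) (F w)

/-- The displacement of the guiding centre, which is the oscillating part of the position. -/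
def thX (B : VField) (z : Phase) : V3 := cross (invBb B (foot z)) z.2.1

/-- The oscillating part of the kinetic energy: the work of the force `F` along `thX`. -/
def thE (B : VField) (F : SpaceTime → V3) (z : Phase) : ℝ := inner ℝ (F (foot z)) (thX B z)

/-- The oscillating part of the parallel velocity. -/
def thPar (B : VField) (z : Phase) : ℝ :=
  inner ℝ z.2.1 (gyroField B (foot z) z.2.1) - parF B z * inner ℝ z.2.1 (invBf B (foot z))

section
variable (hΩ : IsOpen Ω) (hI : IsOpen I) (hB : ContDiffOn ℝ ∞ (onSpaceTime B) (Ω ×ˢ I))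
  (hB0 : ∀ x ∈ Ω, ∀ t ∈ I, B x t ≠ 0)

section
include hB hB0

lemma contDiffOn_invBb : ContDiffOn ℝ ∞ (invBb B) (Ω ×ˢ I) :=
  (contDiffOn_invB hB hB0).smul (contDiffOn_bdir hB hB0)

lemma contDiffOn_driftF {F : SpaceTime → V3} (hF : ContDiffOn ℝ ∞ F (Ω ×ˢ I)) :
    ContDiffOn ℝ ∞ (driftF B F) (Ω ×ˢ I) := ContDiffOn.cross (contDiffOn_invBb hB hB0) hF

include hΩ hI

lemma contDiffOn_invBf : ContDiffOn ℝ ∞ (invBf B) (Ω ×ˢ I) :=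
  (contDiffOn_invB hB hB0).smul (contDiffOn_fvec hΩ hI hB hB0)

lemma contDiffOn_gyroField : ContDiffOn ℝ ∞ (gyroField B) (Ω ×ˢ I) := by
  have hb := contDiffOn_bdir hB hB0
  have hN := contDiffOn_gradb hΩ hI hB hB0
  have hR : ContDiffOn ℝ ∞ (fun w => crossL (onSpaceTime (bdir B) w)) (Ω ×ˢ I) :=
    crossL.contDiff.comp_contDiffOn hb
  have hi : ContDiffOn ℝ ∞ (fun w => innerSL ℝ (onSpaceTime (bdir B) w)) (Ω ×ˢ I) :=
    (innerSL ℝ).contDiff.comp_contDiffOn hb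
  have hP : ContDiffOn ℝ ∞ (fun w => perpProj (onSpaceTime (bdir B) w)) (Ω ×ˢ I) := by
    unfold perpProj
    exact contDiffOn_const.sub (hi.smulRight hb)
  have h : ContDiffOn ℝ ∞ (fun w => gyroOp (bdir B w.1 w.2) (gradb B w)) (Ω ×ˢ I) :=
    ((hN.clm_comp hR).sub (hR.clm_comp (hN.clm_comp hP))).const_smul (4⁻¹ : ℝ)
  exact (contDiffOn_invB hB hB0).smul h

end

section Pointwise
variable {z : Phase} (hz : foot z ∈ Ω ×ˢ I) (d : Phase)

lemma fderiv_kinF (z d : Phase) : fderiv ℝ kinF z d = inner ℝ z.2.1 d.2.1 := by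
  have h := fderiv_inner_apply ℝ (differentiableAt_vel z) (differentiableAt_vel z) d
  rw [fderiv_vel] at h
  have h2 : DifferentiableAt ℝ (fun z : Phase => (inner ℝ z.2.1 z.2.1 : ℝ)) z :=
    (differentiableAt_vel z).inner ℝ (differentiableAt_vel z)
  have : kinF = fun z : Phase => (inner ℝ z.2.1 z.2.1 : ℝ) * (1 / 2) := by
    ext z; rw [kinF]; ring
  rw [this, fderiv_mul_const h2]
  simp only [_root_.smul_apply, smul_eq_mul]
  rw [h, real_inner_comm d.2.1]; ring

include hΩ hI hB hB0 hz

lemma diff_bdir : DifferentiableAt ℝ (onSpaceTime (bdir B)) (foot z) :=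
  differentiableAt_of_contDiffOn hΩ hI (contDiffOn_bdir hB hB0) hz

lemma diff_invBb : DifferentiableAt ℝ (invBb B) (foot z) :=
  differentiableAt_of_contDiffOn hΩ hI (contDiffOn_invBb hB hB0) hz

lemma diff_invBf : DifferentiableAt ℝ (invBf B) (foot z) :=
  differentiableAt_of_contDiffOn hΩ hI (contDiffOn_invBf hΩ hI hB hB0) hz

lemma diff_gyroField : DifferentiableAt ℝ (gyroField B) (foot z) :=
  differentiableAt_of_contDiffOn hΩ hI (contDiffOn_gyroField hΩ hI hB hB0) hz

lemma differentiableAt_parF : DifferentiableAt ℝ (parF B) z :=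
  (differentiableAt_vel z).inner ℝ (differentiableAt_field (diff_bdir hΩ hI hB hB0 hz))

lemma fderiv_parF : fderiv ℝ (parF B) z d
    = inner ℝ d.2.1 (bdir B z.1 z.2.2)
      + inner ℝ z.2.1 (fderiv ℝ (onSpaceTime (bdir B)) (foot z) (foot d)) := by
  have hb := diff_bdir hΩ hI hB hB0 hz
  have h := fderiv_inner_apply ℝ (differentiableAt_vel z) (differentiableAt_field hb) d
  rw [fderiv_field hb, fderiv_vel] at h
  rw [add_comm]
  exact h

lemma differentiableAt_thX : DifferentiableAt ℝ (thX B) z :=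
  DifferentiableAt.cross (differentiableAt_field (diff_invBb hΩ hI hB hB0 hz))
    (differentiableAt_vel z)

lemma fderiv_thX : fderiv ℝ (thX B) z d
    = cross (fderiv ℝ (invBb B) (foot z) (foot d)) z.2.1 + cross (invBb B (foot z)) d.2.1 := by
  have hb := diff_invBb hΩ hI hB hB0 hz
  have h := fderiv_cross (differentiableAt_field hb) (differentiableAt_vel z) d
  rw [fderiv_field hb, fderiv_vel] at h
  exact h

omit hΩ hI hB hB0 hz in
lemma thE_eq (F : SpaceTime → V3) (z : Phase) :
    thE B F z = -inner ℝ z.2.1 (driftF B F (foot z)) := by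
  simp only [thE, thX, driftF]
  rw [inner_cross_left, inner_cross_left, real_inner_comm]
  rw [inner_cross_left (invBb B (foot z)) z.2.1 (F (foot z)), real_inner_comm]

variable {F : SpaceTime → V3} (hF : ContDiffOn ℝ ∞ F (Ω ×ˢ I))
include hF

lemma diff_driftF : DifferentiableAt ℝ (driftF B F) (foot z) :=
  differentiableAt_of_contDiffOn hΩ hI (contDiffOn_driftF hB hB0 hF) hz

lemma differentiableAt_thE : DifferentiableAt ℝ (thE B F) z :=
  (differentiableAt_field (differentiableAt_of_contDiffOn hΩ hI hF hz)).inner ℝ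
    (differentiableAt_thX hΩ hI hB hB0 hz)

lemma fderiv_thE : fderiv ℝ (thE B F) z d
    = -(inner ℝ d.2.1 (driftF B F (foot z))
      + inner ℝ z.2.1 (fderiv ℝ (driftF B F) (foot z) (foot d))) := by
  have hb := diff_driftF hΩ hI hB hB0 hz hF
  have h := fderiv_inner_apply ℝ (differentiableAt_vel z) (differentiableAt_field hb) d
  rw [fderiv_field hb, fderiv_vel] at h
  rw [show thE B F = fun z => -(inner ℝ z.2.1 (driftF B F (foot z)) : ℝ) from
    funext fun z => thE_eq F z, fderiv_fun_neg, _root_.neg_apply, h, add_comm]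

omit hF

lemma differentiableAt_gyroField_vel :
    DifferentiableAt ℝ (fun z : Phase => gyroField B (foot z) z.2.1) z :=
  (differentiableAt_field (diff_gyroField hΩ hI hB hB0 hz)).clm_apply (differentiableAt_vel z)

lemma differentiableAt_thPar : DifferentiableAt ℝ (thPar B) z :=
  ((differentiableAt_vel z).inner ℝ (differentiableAt_gyroField_vel hΩ hI hB hB0 hz)).sub
    ((differentiableAt_parF hΩ hI hB hB0 hz).mul ((differentiableAt_vel z).inner ℝ
      (differentiableAt_field (diff_invBf hΩ hI hB hB0 hz))))

lemma fderiv_thPar : fderiv ℝ (thPar B) z d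
    = inner ℝ d.2.1 (gyroField B (foot z) z.2.1)
      + inner ℝ z.2.1 (gyroField B (foot z) d.2.1)
      + inner ℝ z.2.1 (fderiv ℝ (gyroField B) (foot z) (foot d) z.2.1)
      - (fderiv ℝ (parF B) z d * inner ℝ z.2.1 (invBf B (foot z))
        + parF B z * (inner ℝ d.2.1 (invBf B (foot z))
          + inner ℝ z.2.1 (fderiv ℝ (invBf B) (foot z) (foot d)))) := by
  have hv := differentiableAt_vel z
  have hQ := diff_gyroField hΩ hI hB hB0 hz
  have hφ := diff_invBf hΩ hI hB hB0 hz
  have hQv := differentiableAt_gyroField_vel hΩ hI hB hB0 hz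
  have hp := differentiableAt_parF hΩ hI hB hB0 hz
  have h1 := fderiv_inner_apply ℝ hv hQv d
  have h2 := fderiv_inner_apply ℝ hv (differentiableAt_field hφ) d
  have h3 : fderiv ℝ (fun z : Phase => gyroField B (foot z) z.2.1) z d
      = gyroField B (foot z) d.2.1 + fderiv ℝ (gyroField B) (foot z) (foot d) z.2.1 := by
    have h := ((hasFDerivAt_field hQ).clm_apply hv.hasFDerivAt).fderiv
    rw [h]
    simp [fderiv_vel]
  rw [fderiv_field hφ, fderiv_vel] at h2
  rw [h3, fderiv_vel, inner_add_right] at h1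
  have h4 := fderiv_fun_sub (hv.inner ℝ hQv) (hp.mul (hv.inner ℝ (differentiableAt_field hφ)))
  have h5 := fderiv_fun_mul hp (hv.inner ℝ (differentiableAt_field hφ))
  have h6 : fderiv ℝ (thPar B) z = _ := h4
  rw [h6, _root_.sub_apply, h1]
  have h7 : fderiv ℝ (fun z => parF B z * inner ℝ z.2.1 (invBf B (foot z))) z d
      = parF B z * (inner ℝ d.2.1 (invBf B (foot z))
          + inner ℝ z.2.1 (fderiv ℝ (invBf B) (foot z) (foot d)))
        + inner ℝ z.2.1 (invBf B (foot z)) * fderiv ℝ (parF B) z d := by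
    rw [h5]
    simp only [_root_.add_apply, _root_.smul_apply, smul_eq_mul]
    rw [h2]; ring
  have h8 : (fderiv ℝ ((parF B) * fun z : Phase => (inner ℝ z.2.1 (invBf B (foot z)) : ℝ)) z) d
    = _ := h7
  rw [h8]
  ring

end Pointwise

end

end

section

/-! ### Gyro-averages of the derivatives of the phase functions -/

variable {Ω : Set V3} {I : Set ℝ} {B : VField}

/-- The inner product of `V3` as a real bilinear map. -/
def innerL : V3 →L[ℝ] V3 →L[ℝ] ℝ := innerSL ℝ

@[simp] lemma innerL_apply (a v : V3) : innerL a v = inner ℝ a v := rfl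

section Poly
variable {b : V3}

/-- The half square of the perpendicular velocity. -/
def perpEnergy (b c : V3) : ℝ := (‖c‖ ^ 2 - (inner ℝ c b : ℝ) ^ 2) / 2

lemma circAvg_linear (hb : ‖b‖ = 1) (L : V3 →L[ℝ] ℝ) (c : V3) :
    circAvg b (fun c => L c) c = (inner ℝ c b : ℝ) * L b := by
  simpa using circAvg_poly hb 0 L 0 0 c

lemma circAvg_quadratic (hb : ‖b‖ = 1) (S : V3 →L[ℝ] V3 →L[ℝ] ℝ) (c : V3) :
    circAvg b (fun c => S c c) c = (inner ℝ c b : ℝ) ^ 2 * S b b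
      + perpEnergy b c * ((∑ i, S (e i) (e i)) - S b b) := by
  unfold perpEnergy
  simpa using circAvg_poly hb 0 0 S 0 c

end Poly

/-- The direction of the fast gyration. -/
def gyroDir (B : VField) (z : Phase) : Phase := (0, cross z.2.1 (B z.1 z.2.2), 0)

/-- The direction of the streaming in a force field `F`. -/
def streamDir (F : SpaceTime → V3) (z : Phase) : Phase := (z.2.1, F (foot z), 0)

/-- The direction of the slow transport with the bulk velocity `u`. -/
def slowDir (u : SpaceTime → V3) (z : Phase) : Phase :=
  (u (foot z), -fderiv ℝ u (foot z) (z.2.1, 0), 1)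

section
variable (hΩ : IsOpen Ω) (hI : IsOpen I) (hB : ContDiffOn ℝ ∞ (onSpaceTime B) (Ω ×ˢ I))
  (hB0 : ∀ x ∈ Ω, ∀ t ∈ I, B x t ≠ 0)
variable {w : SpaceTime} (hw : w ∈ Ω ×ˢ I)

section
include hB0 hw

lemma unit_bdir : ‖bdir B w.1 w.2‖ = 1 := norm_bdir (hB0 w.1 hw.1 w.2 hw.2)

lemma normB_ne : ‖B w.1 w.2‖ ≠ 0 := norm_ne_zero_iff.2 (hB0 w.1 hw.1 w.2 hw.2)

lemma cross_B (c : V3) : cross c (B w.1 w.2) = -(‖B w.1 w.2‖ • cross (bdir B w.1 w.2) c) := by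
  rw [← cross_smul_left, norm_smul_bdir (hB0 w.1 hw.1 w.2 hw.2), cross_anti]

lemma inner_cross_B (c : V3) : inner ℝ (cross c (B w.1 w.2)) (bdir B w.1 w.2) = (0 : ℝ) := by
  rw [cross_B hB0 hw, inner_neg_left, inner_smul_left, real_inner_comm, inner_cross_self_left]
  simp

lemma invBb_cross_B (c : V3) : cross (invBb B w) (cross c (B w.1 w.2))
    = c - (inner ℝ c (bdir B w.1 w.2) : ℝ) • bdir B w.1 w.2 := by
  have hm := normB_ne hB0 hw
  rw [invBb, cross_B hB0 hw, ← neg_smul, cross_smul_right, cross_smul_left, smul_smul,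
    cross_cross_eq, inner_self_of_unit (unit_bdir hB0 hw), real_inner_comm, neg_mul,
    mul_inv_cancel₀ hm]
  module

end

section Gyration
include hΩ hI hB hB0 hw

omit hΩ hI hB hB0 hw in
lemma gyro_kinF (z : Phase) : fderiv ℝ kinF z (gyroDir B z) = 0 := by
  rw [fderiv_kinF]
  have := inner_cross_self_left z.2.1 (B z.1 z.2.2)
  exact this

lemma gyro_parF (c : V3) : fderiv ℝ (parF B) (w.1, c, w.2) (gyroDir B (w.1, c, w.2)) = 0 := by
  rw [fderiv_parF hΩ hI hB hB0 (z := (w.1, c, w.2)) hw]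
  simp only [gyroDir, foot_apply, inner_cross_B hB0 hw]
  rw [show ((0 : V3), (0 : ℝ)) = 0 from rfl, map_zero, inner_zero_right, add_zero]

/-- Along the gyration, `thX` is a primitive of the perpendicular velocity. -/
lemma gyro_thX (c : V3) : fderiv ℝ (thX B) (w.1, c, w.2) (gyroDir B (w.1, c, w.2))
    = c - parF B (w.1, c, w.2) • bdir B w.1 w.2 := by
  rw [fderiv_thX hΩ hI hB hB0 (z := (w.1, c, w.2)) hw]
  simp only [gyroDir, foot_apply]
  rw [show ((0 : V3), (0 : ℝ)) = 0 from rfl, map_zero, ← crossL_apply 0, map_zero,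
    _root_.zero_apply, zero_add]
  exact invBb_cross_B hB0 hw c

lemma gyro_thE {F : SpaceTime → V3} (hF : ContDiffOn ℝ ∞ F (Ω ×ˢ I)) (c : V3) :
    fderiv ℝ (thE B F) (w.1, c, w.2) (gyroDir B (w.1, c, w.2))
      = inner ℝ c (F w) - parF B (w.1, c, w.2) * inner ℝ (F w) (bdir B w.1 w.2) := by
  rw [fderiv_thE hΩ hI hB hB0 (z := (w.1, c, w.2)) hw _ hF]
  simp only [gyroDir, foot_apply]
  rw [show ((0 : V3), (0 : ℝ)) = 0 from rfl, map_zero, inner_zero_right, add_zero, driftF,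
    inner_cross_left, neg_neg, show ((w.1, w.2) : SpaceTime) = w from rfl, invBb_cross_B hB0 hw,
    inner_sub_left, inner_smul_left, real_inner_comm (bdir B w.1 w.2) (F w)]
  rfl

lemma inner_invBf (v : V3) : inner ℝ (cross (bdir B w.1 w.2) v) (invBf B w)
    = (‖B w.1 w.2‖⁻¹ * inner ℝ v (gradb B w (bdir B w.1 w.2)) : ℝ) := by
  rw [invBf, inner_smul_right, fvec, inner_cross_cross (unit_bdir hB0 hw),
    curvature_eq hΩ hI hB hB0 hw, inner_gradb hΩ hI hB hB0 hw, mul_zero, sub_zero]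

lemma gyro_thPar (c : V3) : fderiv ℝ (thPar B) (w.1, c, w.2) (gyroDir B (w.1, c, w.2))
    = inner ℝ c (gradb B w c) - perpEnergy (bdir B w.1 w.2) c * divb B w.1 w.2 := by
  have hm := normB_ne hB0 hw
  have hN := inner_gradb hΩ hI hB hB0 hw
  have hr := gyroOp_rotate (unit_bdir hB0 hw) hN c
  have hf := inner_invBf hΩ hI hB hB0 hw c
  rw [fderiv_thPar hΩ hI hB hB0 (z := (w.1, c, w.2)) hw, gyro_parF hΩ hI hB hB0 hw]
  simp only [gyroDir, foot_apply]
  rw [show ((0 : V3), (0 : ℝ)) = 0 from rfl, map_zero, map_zero, inner_zero_right, zero_mul,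
    show ((w.1, w.2) : SpaceTime) = w from rfl, divb_eq hΩ hI hB hB0 hw, cross_B hB0 hw]
  simp only [gyroField, _root_.smul_apply, _root_.zero_apply, inner_zero_right, map_neg, map_smul,
    inner_neg_left, inner_neg_right, inner_smul_left, inner_smul_right, hf, add_zero, zero_add,
    parF, cPar, perpEnergy, conj_trivial]
  rw [map_sub, map_smul, inner_sub_right, inner_smul_right] at hr
  field_simp at hr ⊢
  linear_combination hr

/-- The change of the parallel velocity along the streaming, up to an oscillating term. -/
lemma stream_parF {F : SpaceTime → V3} (c : V3) :
    fderiv ℝ (parF B) (w.1, c, w.2) (streamDir F (w.1, c, w.2))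
      = inner ℝ (F w) (bdir B w.1 w.2) + perpEnergy (bdir B w.1 w.2) c * divb B w.1 w.2
        + fderiv ℝ (thPar B) (w.1, c, w.2) (gyroDir B (w.1, c, w.2)) := by
  rw [gyro_thPar hΩ hI hB hB0 hw, fderiv_parF hΩ hI hB hB0 (z := (w.1, c, w.2)) hw, gradb_apply]
  simp only [streamDir, foot_apply]
  rw [show ((w.1, w.2) : SpaceTime) = w from rfl]
  ring

end Gyration

section Averages
include hB0 hw

lemma avg_thX (a c : V3) :
    circAvg (bdir B w.1 w.2) (fun c => inner ℝ a (thX B (w.1, c, w.2))) c = 0 := by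
  have h := circAvg_linear (unit_bdir hB0 hw) ((innerL a) ∘L crossL (invBb B w)) c
  refine h.trans ?_
  simp [invBb, cross_self']

lemma avg_thE (F : SpaceTime → V3) (c : V3) :
    circAvg (bdir B w.1 w.2) (fun c => thE B F (w.1, c, w.2)) c = 0 :=
  avg_thX hB0 hw (F w) c

include hΩ hI hB

omit hΩ hI hB in
lemma gyroField_bdir : gyroField B w (bdir B w.1 w.2) = 0 := by
  rw [gyroField, _root_.smul_apply, gyroOp_self (unit_bdir hB0 hw), smul_zero]

lemma inner_gyroField (v : V3) : inner ℝ (gyroField B w v) (bdir B w.1 w.2) = (0 : ℝ) := by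
  rw [gyroField, _root_.smul_apply, inner_smul_left, inner_gyroOp (inner_gradb hΩ hI hB hB0 hw),
    mul_zero]

omit hΩ hI hB hB0 hw in
lemma trace_gyroField (B : VField) (w : SpaceTime) :
    ∑ i, inner ℝ (e i) (gyroField B w (e i)) = (0 : ℝ) := by
  simp only [gyroField, _root_.smul_apply, inner_smul_right, ← Finset.mul_sum, trace_gyroOp,
    mul_zero]

lemma trace_gyroField_comp : ∑ i, (inner ℝ (gradb B w (e i)) (gyroField B w (e i))
    + inner ℝ (e i) (gyroField B w (gradb B w (e i)))) = (0 : ℝ) := by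
  have := trace_gyroOp_comp (inner_gradb hΩ hI hB hB0 hw)
  simp only [gyroField, _root_.smul_apply, inner_smul_right, ← mul_add, ← Finset.mul_sum, this,
    mul_zero]

omit hΩ hI hB hB0 hw in
lemma inner_invBf_bdir (B : VField) (w : SpaceTime) :
    inner ℝ (invBf B w) (bdir B w.1 w.2) = (0 : ℝ) := by
  rw [invBf, inner_smul_left, inner_fvec, mul_zero]

omit hΩ hI hB in
lemma parF_rot (c : V3) (θ : ℝ) :
    parF B (w.1, rot (bdir B w.1 w.2) θ c, w.2) = parF B (w.1, c, w.2) :=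
  inner_rot (unit_bdir hB0 hw) θ c

omit hΩ hI hB in
lemma avg_thPar (c : V3) :
    circAvg (bdir B w.1 w.2) (fun c => thPar B (w.1, c, w.2)) c = 0 := by
  have hb := unit_bdir hB0 hw
  have h := circAvg_poly hb 0 (-(inner ℝ c (bdir B w.1 w.2) : ℝ) • innerL (invBf B w))
    ((innerL) ∘L gyroField B w) 0 c
  refine (circAvg_congr fun θ => ?_).trans (h.trans ?_)
  · simp only [thPar, foot_apply, parF_rot hB0 hw]
    simp only [parF, cPar, ContinuousLinearMap.comp_apply,
      _root_.smul_apply, _root_.zero_apply, innerL_apply, smul_eq_mul]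
    rw [real_inner_comm (gyroField B _ _), real_inner_comm (invBf B _)]
    ring
  · have h1 := trace_gyroField B w
    simp only [real_inner_comm (gyroField B w _)] at h1
    simp [gyroField_bdir hB0 hw, inner_invBf_bdir, h1, innerL_apply]

/-- The average of the slow change of the parallel velocity. -/
lemma avg_slow_parF {u : SpaceTime → V3} (c : V3) :
    circAvg (bdir B w.1 w.2)
      (fun c => fderiv ℝ (parF B) (w.1, c, w.2) (slowDir u (w.1, c, w.2))) c
      = -(inner ℝ c (bdir B w.1 w.2) *
          inner ℝ (fderiv ℝ u w (bdir B w.1 w.2, 0)) (bdir B w.1 w.2)) := by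
  have hb := unit_bdir hB0 hw
  have h := circAvg_linear hb (innerL (fderiv ℝ (onSpaceTime (bdir B)) w (u w, 1))
    - (innerL (bdir B w.1 w.2)) ∘L ((fderiv ℝ u w).comp (ContinuousLinearMap.inl ℝ V3 ℝ))) c
  refine (circAvg_congr fun θ => ?_).trans (h.trans ?_)
  · rw [fderiv_parF hΩ hI hB hB0 (z := (w.1, rot (bdir B w.1 w.2) θ c, w.2)) hw]
    simp only [slowDir, foot_apply, ContinuousLinearMap.comp_apply, _root_.sub_apply,
      innerL_apply, ContinuousLinearMap.inl_apply, inner_neg_left]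
    rw [real_inner_comm (bdir B w.1 w.2), real_inner_comm (rot _ _ _)]
    ring
  · simp only [ContinuousLinearMap.comp_apply, _root_.sub_apply,
      innerL_apply, ContinuousLinearMap.inl_apply]
    rw [inner_fderiv_bdir hΩ hI hB hB0 hw,
      real_inner_comm (bdir B w.1 w.2) (fderiv ℝ u w _)]
    ring

omit hΩ hI hB in
/-- The average of the slow change of the kinetic energy. -/
lemma avg_slow_kinF {u : SpaceTime → V3} (hu : DifferentiableAt ℝ u w) (c : V3) :
    circAvg (bdir B w.1 w.2) (fun c => fderiv ℝ kinF (w.1, c, w.2) (slowDir u (w.1, c, w.2))) c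
      = -((inner ℝ c (bdir B w.1 w.2) : ℝ) ^ 2 *
          inner ℝ (fderiv ℝ u w (bdir B w.1 w.2, 0)) (bdir B w.1 w.2)
        + perpEnergy (bdir B w.1 w.2) c * (dvg (fun y => u (y, w.2)) w.1
          - inner ℝ (fderiv ℝ u w (bdir B w.1 w.2, 0)) (bdir B w.1 w.2))) := by
  have hb := unit_bdir hB0 hw
  have h := circAvg_quadratic hb (-((innerL) ∘L
    ((fderiv ℝ u w).comp (ContinuousLinearMap.inl ℝ V3 ℝ)))) c
  refine (circAvg_congr fun θ => ?_).trans (h.trans ?_)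
  · rw [fderiv_kinF]
    simp only [slowDir, foot_apply, ContinuousLinearMap.comp_apply, _root_.neg_apply,
      innerL_apply, ContinuousLinearMap.inl_apply, inner_neg_right]
    rw [real_inner_comm (rot _ _ _)]
  · simp only [ContinuousLinearMap.comp_apply, _root_.neg_apply, Finset.sum_neg_distrib,
      innerL_apply, ContinuousLinearMap.inl_apply, dvg_field hu]
    simp only [real_inner_comm (e _)]
    ring

lemma fderiv_invBb_bdir_cross : cross (fderiv ℝ (invBb B) w (bdir B w.1 w.2, 0)) (bdir B w.1 w.2)
    = -invBf B w := by
  have hb := diff_bdir hΩ hI hB hB0 (z := (w.1, 0, w.2)) hw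
  have hβ := differentiableAt_of_contDiffOn hΩ hI (contDiffOn_invB hB hB0) hw
  have h1 := fderiv_smul_apply hβ (v := onSpaceTime (bdir B)) hb (bdir B w.1 w.2, 0)
  have h2 : fderiv ℝ (invBb B) w (bdir B w.1 w.2, 0) = _ := h1
  rw [h2, cross_add_left, cross_smul_left, cross_smul_left]
  have h3 : onSpaceTime (bdir B) w = bdir B w.1 w.2 := rfl
  rw [h3, cross_self', smul_zero, add_zero, invBf, fvec, curvature_eq hΩ hI hB hB0 hw, gradb_apply,
    cross_anti, smul_neg]

/-- The average of the drift of the guiding centre along the streaming. -/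
lemma avg_stream_thX (F : SpaceTime → V3) (a c : V3) :
    circAvg (bdir B w.1 w.2)
      (fun c => inner ℝ a (fderiv ℝ (thX B) (w.1, c, w.2) (streamDir F (w.1, c, w.2)))) c
      = inner ℝ a (driftF B F w - (inner ℝ c (bdir B w.1 w.2) : ℝ) ^ 2 • invBf B w
        - perpEnergy (bdir B w.1 w.2) c •
          (curl (fun y => invBb B (y, w.2)) w.1 - invBf B w)) := by
  have hb := unit_bdir hB0 hw
  have h := circAvg_poly hb (inner ℝ a (driftF B F w)) 0 (((innerL a).postcomp V3) ∘L crossL ∘L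
    ((fderiv ℝ (invBb B) w).comp (ContinuousLinearMap.inl ℝ V3 ℝ))) 0 c
  refine (circAvg_congr fun θ => ?_).trans (h.trans ?_)
  · rw [fderiv_thX hΩ hI hB hB0 (z := (w.1, rot (bdir B w.1 w.2) θ c, w.2)) hw]
    simp only [streamDir, foot_apply, ContinuousLinearMap.comp_apply, _root_.zero_apply,
      ContinuousLinearMap.postcomp_apply, innerL_apply, ContinuousLinearMap.inl_apply,
      inner_add_right, crossL_apply, driftF]
    ring
  · have hd : DifferentiableAt ℝ (invBb B) w :=
      diff_invBb hΩ hI hB hB0 (z := (w.1, 0, w.2)) hw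
    simp only [ContinuousLinearMap.comp_apply, _root_.zero_apply,
      ContinuousLinearMap.postcomp_apply, innerL_apply, ContinuousLinearMap.inl_apply,
      crossL_apply, fderiv_invBb_bdir_cross hΩ hI hB hB0 hw, curl_field hd, inner_sub_right,
      inner_smul_right, inner_sum, inner_neg_right, perpEnergy]
    simp only [cross_anti (e _), inner_neg_right, Finset.sum_neg_distrib]
    simp
    ring

omit hΩ hI hB hB0 hw in
lemma inner_driftF_bdir (B : VField) (F : SpaceTime → V3) (w : SpaceTime) :
    inner ℝ (bdir B w.1 w.2) (driftF B F w) = (0 : ℝ) := by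
  rw [driftF, invBb, cross_smul_left, inner_smul_right, inner_cross_self_left, mul_zero]

/-- The average of the work of the force along the drift. -/
lemma avg_stream_thE {F : SpaceTime → V3} (hF : ContDiffOn ℝ ∞ F (Ω ×ˢ I)) (c : V3) :
    circAvg (bdir B w.1 w.2)
      (fun c => fderiv ℝ (thE B F) (w.1, c, w.2) (streamDir F (w.1, c, w.2))) c
      = -((inner ℝ c (bdir B w.1 w.2) : ℝ) ^ 2 * inner ℝ (F w) (invBf B w)
        + perpEnergy (bdir B w.1 w.2) c *
          (dvg (fun y => driftF B F (y, w.2)) w.1 - inner ℝ (F w) (invBf B w))) := by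
  have hb := unit_bdir hB0 hw
  have hd : DifferentiableAt ℝ (driftF B F) w :=
    diff_driftF hΩ hI hB hB0 (z := (w.1, 0, w.2)) hw hF
  have hdb : DifferentiableAt ℝ (onSpaceTime (bdir B)) w :=
    diff_bdir hΩ hI hB hB0 (z := (w.1, 0, w.2)) hw
  have h := circAvg_quadratic hb (-(innerL ∘L
    ((fderiv ℝ (driftF B F) w).comp (ContinuousLinearMap.inl ℝ V3 ℝ)))) c
  have h0 : (inner ℝ (F w) (driftF B F w) : ℝ) = 0 := inner_cross_self_right _ _
  have h1 : (inner ℝ (fderiv ℝ (driftF B F) w (bdir B w.1 w.2, 0)) (bdir B w.1 w.2) : ℝ)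
      = inner ℝ (F w) (invBf B w) := by
    have h2 := fderiv_inner_apply ℝ hd hdb (bdir B w.1 w.2, 0)
    have h3 : (fun w => inner ℝ (driftF B F w) (onSpaceTime (bdir B) w) : SpaceTime → ℝ)
        = fun _ => 0 := by
      funext v
      rw [real_inner_comm]
      exact inner_driftF_bdir B F v
    rw [h3, fderiv_fun_const] at h2
    have h4 : (inner ℝ (driftF B F w) (fderiv ℝ (onSpaceTime (bdir B)) w (bdir B w.1 w.2, 0)) : ℝ)
        = -inner ℝ (F w) (invBf B w) := by
      rw [← gradb_apply, ← curvature_eq hΩ hI hB hB0 hw, driftF, invBb, cross_smul_left,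
        inner_smul_left, invBf, inner_smul_right, fvec, inner_cross_left]
      simp
    rw [h4] at h2
    have h5 : (inner ℝ (fderiv ℝ (driftF B F) w (bdir B w.1 w.2, 0))
      (onSpaceTime (bdir B) w) : ℝ) = inner ℝ (fderiv ℝ (driftF B F) w (bdir B w.1 w.2, 0))
        (bdir B w.1 w.2) := rfl
    rw [h5] at h2
    simp only [Pi.zero_apply, _root_.zero_apply] at h2
    linarith
  refine (circAvg_congr fun θ => ?_).trans (h.trans ?_)
  · rw [fderiv_thE hΩ hI hB hB0 (z := (w.1, rot (bdir B w.1 w.2) θ c, w.2)) hw _ hF]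
    simp only [streamDir, foot_apply, ContinuousLinearMap.comp_apply, _root_.neg_apply,
      innerL_apply, ContinuousLinearMap.inl_apply]
    rw [show ((w.1, w.2) : SpaceTime) = w from rfl, h0, zero_add,
      real_inner_comm (rot (bdir B w.1 w.2) θ c)]
  · simp only [ContinuousLinearMap.comp_apply, _root_.neg_apply, Finset.sum_neg_distrib,
      innerL_apply, ContinuousLinearMap.inl_apply, dvg_field hd, h1]
    simp only [real_inner_comm (e _)]
    ring

lemma inner_fderiv_invBf_bdir :
    (inner ℝ (fderiv ℝ (invBf B) w (bdir B w.1 w.2, 0)) (bdir B w.1 w.2) : ℝ) = 0 := by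
  have hd : DifferentiableAt ℝ (invBf B) w := diff_invBf hΩ hI hB hB0 (z := (w.1, 0, w.2)) hw
  have hdb : DifferentiableAt ℝ (onSpaceTime (bdir B)) w :=
    diff_bdir hΩ hI hB hB0 (z := (w.1, 0, w.2)) hw
  have h2 := fderiv_inner_apply ℝ hd hdb (bdir B w.1 w.2, 0)
  have h3 : (fun w => inner ℝ (invBf B w) (onSpaceTime (bdir B) w) : SpaceTime → ℝ)
      = fun _ => 0 := funext fun v => inner_invBf_bdir B v
  rw [h3, fderiv_fun_const] at h2
  have h4 : (inner ℝ (invBf B w) (fderiv ℝ (onSpaceTime (bdir B)) w (bdir B w.1 w.2, 0)) : ℝ)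
      = 0 := by
    rw [← gradb_apply, ← curvature_eq hΩ hI hB hB0 hw, invBf, inner_smul_left, real_inner_comm,
      inner_curvature_fvec, mul_zero]
  rw [h4] at h2
  have h5 : onSpaceTime (bdir B) w = bdir B w.1 w.2 := rfl
  rw [h5] at h2
  simpa using h2.symm

/-- Differentiation of `⟨Q v, b⟩ = 0`, where `Q = gyroField B`. -/
lemma inner_fderiv_gyroField (d : SpaceTime) (v : V3) :
    inner ℝ (fderiv ℝ (gyroField B) w d v) (bdir B w.1 w.2)
      = (-inner ℝ (gyroField B w v) (fderiv ℝ (onSpaceTime (bdir B)) w d) : ℝ) := by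
  have hQ : DifferentiableAt ℝ (gyroField B) w :=
    diff_gyroField hΩ hI hB hB0 (z := (w.1, 0, w.2)) hw
  have hdb : DifferentiableAt ℝ (onSpaceTime (bdir B)) w :=
    diff_bdir hΩ hI hB hB0 (z := (w.1, 0, w.2)) hw
  have hQv : HasFDerivAt (fun w => gyroField B w v) ((fderiv ℝ (gyroField B) w).flip v) w := by
    simpa using hQ.hasFDerivAt.clm_apply (hasFDerivAt_const v w)
  have h2 := fderiv_inner_apply ℝ hQv.differentiableAt hdb d
  rw [fderiv_eq_of_eqOn hΩ hI (a := fun w => inner ℝ (gyroField B w v) (onSpaceTime (bdir B) w))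
    (a' := fun _ => (0 : ℝ))
    (fun y hy => inner_gyroField hΩ hI hB hB0 hy v) hw, hQv.fderiv] at h2
  simp only [fderiv_fun_const, Pi.zero_apply, _root_.zero_apply,
    ContinuousLinearMap.flip_apply] at h2
  have h3 : (onSpaceTime (bdir B) w) = bdir B w.1 w.2 := rfl
  rw [h3] at h2
  linarith

/-- Differentiation of `Q b = 0`, where `Q = gyroField B`. -/
lemma fderiv_gyroField_bdir (d : SpaceTime) :
    fderiv ℝ (gyroField B) w d (bdir B w.1 w.2)
      = -gyroField B w (fderiv ℝ (onSpaceTime (bdir B)) w d) := by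
  have hQ : DifferentiableAt ℝ (gyroField B) w :=
    diff_gyroField hΩ hI hB hB0 (z := (w.1, 0, w.2)) hw
  have hdb : DifferentiableAt ℝ (onSpaceTime (bdir B)) w :=
    diff_bdir hΩ hI hB hB0 (z := (w.1, 0, w.2)) hw
  have h2 := (hQ.hasFDerivAt.clm_apply hdb.hasFDerivAt).fderiv
  rw [fderiv_eq_of_eqOn hΩ hI (a := fun w => gyroField B w (onSpaceTime (bdir B) w))
    (a' := fun _ => (0 : V3)) (fun y hy => gyroField_bdir hB0 hy) hw] at h2
  have h3 := congrArg (fun T => T d) h2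
  simp only [fderiv_fun_const, Pi.zero_apply, _root_.zero_apply, _root_.add_apply,
    ContinuousLinearMap.comp_apply, ContinuousLinearMap.flip_apply] at h3
  exact eq_neg_of_add_eq_zero_right h3.symm

lemma trace_fderiv_gyroField (d : SpaceTime) :
    ∑ i, inner ℝ (fderiv ℝ (gyroField B) w d (e i)) (e i) = (0 : ℝ) := by
  have hQ : DifferentiableAt ℝ (gyroField B) w :=
    diff_gyroField hΩ hI hB hB0 (z := (w.1, 0, w.2)) hw
  let T : (V3 →L[ℝ] V3) →L[ℝ] ℝ :=
    ∑ i, (innerL (e i)) ∘L (ContinuousLinearMap.apply ℝ V3 (e i))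
  have hT : ∀ A, T A = ∑ i, inner ℝ (e i) (A (e i)) := fun A => by
    simp [T, _root_.sum_apply]
  have h := (T.hasFDerivAt.comp w hQ.hasFDerivAt).fderiv
  have h0 : (T ∘ gyroField B) = fun _ => 0 := by
    funext v
    exact (hT _).trans (trace_gyroField B v)
  rw [h0, fderiv_fun_const] at h
  have h3 := congrArg (fun T => T d) h
  simp only [Pi.zero_apply, _root_.zero_apply, ContinuousLinearMap.comp_apply, hT] at h3
  simp only [real_inner_comm (e _)]
  exact h3.symm

/-- The average of the oscillating part of the parallel acceleration along the streaming. -/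
lemma avg_stream_thPar (F : SpaceTime → V3) (c : V3) :
    circAvg (bdir B w.1 w.2)
      (fun c => fderiv ℝ (thPar B) (w.1, c, w.2) (streamDir F (w.1, c, w.2))) c
      = -(inner ℝ c (bdir B w.1 w.2) * inner ℝ (F w) (invBf B w)
        + inner ℝ c (bdir B w.1 w.2) * perpEnergy (bdir B w.1 w.2) c *
          dvg (fun y => invBf B (y, w.2)) w.1) := by
  have hb := unit_bdir hB0 hw
  have hd : DifferentiableAt ℝ (invBf B) w := diff_invBf hΩ hI hB hB0 (z := (w.1, 0, w.2)) hw
  have h := circAvg_poly hb (-(inner ℝ c (bdir B w.1 w.2) * inner ℝ (F w) (invBf B w)))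
    (innerL (F w) ∘L gyroField B w + innerL (gyroField B w (F w))
      - (inner ℝ (F w) (bdir B w.1 w.2) : ℝ) • innerL (invBf B w))
    (-(inner ℝ c (bdir B w.1 w.2) : ℝ) • (innerL ∘L
      ((fderiv ℝ (invBf B) w).comp (ContinuousLinearMap.inl ℝ V3 ℝ))))
    (innerL.postcomp V3 ∘L ((fderiv ℝ (gyroField B) w).comp (ContinuousLinearMap.inl ℝ V3 ℝ)
      - (ContinuousLinearMap.toSpanSingleton ℝ (invBf B w)).postcomp V3 ∘L
        (innerL ∘L gradb B w))) c
  refine (circAvg_congr fun θ => ?_).trans (h.trans ?_)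
  · rw [fderiv_thPar hΩ hI hB hB0 (z := (w.1, rot (bdir B w.1 w.2) θ c, w.2)) hw,
      fderiv_parF hΩ hI hB hB0 (z := (w.1, rot (bdir B w.1 w.2) θ c, w.2)) hw]
    simp only [parF_rot hB0 hw]
    generalize rot (bdir B w.1 w.2) θ c = v
    simp only [streamDir, foot_apply, ContinuousLinearMap.comp_apply,
      _root_.add_apply, _root_.sub_apply, _root_.smul_apply, smul_eq_mul,
      ContinuousLinearMap.postcomp_apply, ContinuousLinearMap.toSpanSingleton_apply,
      innerL_apply, ContinuousLinearMap.inl_apply, gradb_apply, parF, cPar]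
    rw [show ((w.1, w.2) : SpaceTime) = w from rfl, real_inner_comm v (gyroField B w (F w)),
      real_inner_comm v (invBf B w), real_inner_comm v (fderiv ℝ (invBf B) w (v, 0)),
      real_inner_comm v (fderiv ℝ (onSpaceTime (bdir B)) w (v, 0)), inner_sub_left,
      inner_smul_left, real_inner_comm v (fderiv ℝ (gyroField B) w (v, 0) v),
      real_inner_comm v (invBf B w)]
    simp only [conj_trivial]
    ring
  · have hN := inner_gradb hΩ hI hB hB0 hw
    have hφb := inner_invBf_bdir B w
    have e1 : ∑ i, (inner ℝ (fderiv ℝ (gyroField B) w (e i, 0) (bdir B w.1 w.2)) (e i)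
        + inner ℝ (fderiv ℝ (gyroField B) w (e i, 0) (e i)) (bdir B w.1 w.2)) = (0 : ℝ) := by
      have h1 := trace_gyroField_comp hΩ hI hB hB0 hw
      simp only [gradb_apply] at h1
      rw [← neg_eq_zero, ← Finset.sum_neg_distrib]
      refine Eq.trans (Finset.sum_congr rfl fun i _ => ?_) h1
      rw [fderiv_gyroField_bdir hΩ hI hB hB0 hw, inner_fderiv_gyroField hΩ hI hB hB0 hw,
        inner_neg_left, real_inner_comm (e i), real_inner_comm (gyroField B w (e i))]
      ring
    have e2 : ∑ i, inner ℝ (gradb B w (bdir B w.1 w.2)) (e i) * inner ℝ (invBf B w) (e i)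
        = (0 : ℝ) := by
      have h1 := inner_curvature_fvec B w.1 w.2
      rw [curvature_eq hΩ hI hB hB0 hw] at h1
      have h2 : (inner ℝ (gradb B w (bdir B w.1 w.2)) (invBf B w) : ℝ) = 0 := by
        rw [invBf, inner_smul_right, h1, mul_zero]
      simp only [real_inner_comm (e _), inner_e]
      rw [← h2, PiLp.inner_apply]
      simp [mul_comm]
    have e3 : (inner ℝ (fderiv ℝ (gyroField B) w (bdir B w.1 w.2, 0) (bdir B w.1 w.2))
        (bdir B w.1 w.2) : ℝ) = 0 := by
      rw [inner_fderiv_gyroField hΩ hI hB hB0 hw, gyroField_bdir hB0 hw]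
      simp
    have e4 := trace_fderiv_gyroField hΩ hI hB hB0 hw (bdir B w.1 w.2, 0)
    rw [Finset.sum_add_distrib] at e1
    simp only [ContinuousLinearMap.comp_apply,
      _root_.add_apply, _root_.sub_apply, _root_.smul_apply, smul_eq_mul,
      ContinuousLinearMap.postcomp_apply, ContinuousLinearMap.toSpanSingleton_apply,
      innerL_apply, ContinuousLinearMap.inl_apply, inner_sub_left, inner_smul_left, conj_trivial,
      inner_gyroField hΩ hI hB hB0 hw, gyroField_bdir hB0 hw, hφb, inner_zero_right, hN, e3,
      inner_fderiv_invBf_bdir hΩ hI hB hB0 hw, Finset.sum_add_distrib, Finset.sum_sub_distrib,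
      ← Finset.mul_sum, e4, e2, mul_zero, zero_mul, sub_zero]
    rw [dvg_field hd]
    simp only [real_inner_comm (e _) (fderiv ℝ (invBf B) w _)]
    rw [perpEnergy]
    linear_combination (inner ℝ c (bdir B w.1 w.2) * ((‖c‖ ^ 2 - inner ℝ c (bdir B w.1 w.2) ^ 2) / 2)) * e1

end Averages

end
end

section

/-! ### The averaged kinetic equation -/

variable {Ω : Set V3} {I : Set ℝ} {B : VField}

/-- The space of the variables `(x, E, s, t)`: position, kinetic energy, parallel velocity, time. -/
abbrev GyroSpace : Type := V3 × ℝ × ℝ × ℝ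

lemma circAvg_prod {b c : V3} {X : V3 → V3} {Y Z : V3 → ℝ} {x : V3} {y z : ℝ} (τ : ℝ)
    (hX : Continuous fun θ => X (rot b θ c)) (hY : Continuous fun θ => Y (rot b θ c))
    (hZ : Continuous fun θ => Z (rot b θ c))
    (aX : ∀ a : V3, circAvg b (fun c => inner ℝ a (X c)) c = inner ℝ a x)
    (aY : circAvg b Y c = y) (aZ : circAvg b Z c = z) (ℓ : GyroSpace →L[ℝ] ℝ) :
    circAvg b (fun c => ℓ (X c, Y c, Z c, τ)) c = ℓ (x, y, z, τ) := by
  set a : V3 := (InnerProductSpace.toDual ℝ V3).symm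
    (ℓ.comp (ContinuousLinearMap.inl ℝ V3 (ℝ × ℝ × ℝ))) with ha
  have ha' : ∀ v, (inner ℝ a v : ℝ) = ℓ (v, 0) := fun v => by
    rw [ha, InnerProductSpace.toDual_symm_apply]; rfl
  have e : ∀ (v : V3) (p q r : ℝ), ℓ (v, p, q, r) = inner ℝ a v + (ℓ (0, 1, 0, 0) * p
      + (ℓ (0, 0, 1, 0) * q + ℓ (0, 0, 0, 1) * r)) := by
    intro v p q r
    have h : ((v, p, q, r) : GyroSpace) = (v, 0) + (p • (0, 1, 0, 0)
      + (q • (0, 0, 1, 0) + r • (0, 0, 0, 1))) := by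
      simp
    rw [h, map_add, map_add, map_add, map_smul, map_smul, map_smul, ha']
    simp only [smul_eq_mul]
    ring
  have hYc : Continuous fun θ => ℓ (0, 1, 0, 0) * Y (rot b θ c) := continuous_const.mul hY
  have hZc : Continuous fun θ => ℓ (0, 0, 1, 0) * Z (rot b θ c) := continuous_const.mul hZ
  have hτ : Continuous fun _ : ℝ => ℓ (0, 0, 0, 1) * τ := continuous_const
  have hXa : Continuous fun θ => (inner ℝ a (X (rot b θ c)) : ℝ) := continuous_const.inner hX
  have h1 := circAvg_add (b := b) (c := c) (X := fun c => (inner ℝ a (X c) : ℝ))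
    (Y := fun c => ℓ (0, 1, 0, 0) * Y c + (ℓ (0, 0, 1, 0) * Z c + ℓ (0, 0, 0, 1) * τ)) hXa
    (hYc.add (hZc.add hτ))
  have h2 := circAvg_add (b := b) (c := c) (X := fun c => ℓ (0, 1, 0, 0) * Y c)
    (Y := fun c => ℓ (0, 0, 1, 0) * Z c + ℓ (0, 0, 0, 1) * τ) hYc (hZc.add hτ)
  have h3 := circAvg_add (b := b) (c := c) (X := fun c => ℓ (0, 0, 1, 0) * Z c)
    (Y := fun _ => ℓ (0, 0, 0, 1) * τ) hZc hτ
  have h4 : circAvg b (fun _ => ℓ (0, 0, 0, 1) * τ) c = ℓ (0, 0, 0, 1) * τ :=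
    circAvg_of_eq fun _ => rfl
  refine (circAvg_congr (Y := fun c => (inner ℝ a (X c) : ℝ) + (ℓ (0, 1, 0, 0) * Y c
    + (ℓ (0, 0, 1, 0) * Z c + ℓ (0, 0, 0, 1) * τ))) fun θ => e _ _ _ _).trans ?_
  rw [e x y z τ, h1, h2, h3, h4, circAvg_const_mul, circAvg_const_mul, aX, aY, aZ]

section
variable (hΩ : IsOpen Ω) (hI : IsOpen I) (hB : ContDiffOn ℝ ∞ (onSpaceTime B) (Ω ×ˢ I))
  (hB0 : ∀ x ∈ Ω, ∀ t ∈ I, B x t ≠ 0)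

section Circle
variable {w : SpaceTime} (hw : w ∈ Ω ×ˢ I) {c : V3}

lemma continuous_circle {F : Type} [TopologicalSpace F] {b : V3} {w : SpaceTime} {f : Phase → F}
    (hf : ∀ θ, ContinuousAt f (w.1, rot b θ c, w.2)) :
    Continuous fun θ => f (w.1, rot b θ c, w.2) := by
  have h : Continuous fun θ => ((w.1, rot b θ c, w.2) : Phase) :=
    continuous_const.prodMk ((continuous_rot b c).prodMk continuous_const)
  exact continuous_iff_continuousAt.2 fun θ => (hf θ).comp (f := fun θ =>
    ((w.1, rot b θ c, w.2) : Phase)) h.continuousAt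

lemma hasFDerivAt_vel_fiber (w : SpaceTime) (c : V3) :
    HasFDerivAt (fun c : V3 => ((w.1, c, w.2) : Phase))
      ((0 : V3 →L[ℝ] V3).prod ((ContinuousLinearMap.id ℝ V3).prod (0 : V3 →L[ℝ] ℝ))) c :=
  (hasFDerivAt_const _ _).prodMk ((hasFDerivAt_id (𝕜 := ℝ) c).prodMk (hasFDerivAt_const _ _))

include hB0 hw

lemma fderiv_vel_gyro {h : Phase → ℝ} (hh : DifferentiableAt ℝ h (w.1, c, w.2)) :
    fderiv ℝ (fun c => h (w.1, c, w.2)) c (cross (bdir B w.1 w.2) c)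
      = -‖B w.1 w.2‖⁻¹ * fderiv ℝ h (w.1, c, w.2) (gyroDir B (w.1, c, w.2)) := by
  have h1 := (hh.hasFDerivAt.comp c (hasFDerivAt_vel_fiber w c)).fderiv
  have h2 : fderiv ℝ (fun c => h (w.1, c, w.2)) c = _ := h1
  have hm := normB_ne hB0 hw
  have h3 : gyroDir B (w.1, c, w.2)
      = (-‖B w.1 w.2‖) • ((0, cross (bdir B w.1 w.2) c, 0) : Phase) := by
    simp only [gyroDir, cross_B hB0 hw, Prod.smul_mk, smul_zero, neg_smul]
    simp only [Prod.neg_mk, neg_zero]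
  rw [h2, h3, map_smul, smul_eq_mul, ← mul_assoc, neg_mul_neg, inv_mul_cancel₀ hm, one_mul]
  rfl

lemma avg_gyro {h : Phase → ℝ}
    (hh : ∀ θ, ContDiffAt ℝ 1 h (w.1, rot (bdir B w.1 w.2) θ c, w.2)) :
    circAvg (bdir B w.1 w.2) (fun c => fderiv ℝ h (w.1, c, w.2) (gyroDir B (w.1, c, w.2))) c
      = 0 := by
  have hm := normB_ne hB0 hw
  have hd : ∀ θ, DifferentiableAt ℝ h (w.1, rot (bdir B w.1 w.2) θ c, w.2) :=
    fun θ => (hh θ).differentiableAt one_ne_zero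
  have hv : ∀ θ, DifferentiableAt ℝ (fun c => h (w.1, c, w.2)) (rot (bdir B w.1 w.2) θ c) :=
    fun θ => ((hd θ).hasFDerivAt.comp (rot (bdir B w.1 w.2) θ c)
      (hasFDerivAt_vel_fiber w _)).differentiableAt
  have hc : Continuous fun θ => fderiv ℝ h (w.1, rot (bdir B w.1 w.2) θ c, w.2)
      (gyroDir B (w.1, rot (bdir B w.1 w.2) θ c, w.2)) := by
    have h1 : Continuous fun θ => fderiv ℝ h (w.1, rot (bdir B w.1 w.2) θ c, w.2) :=
      continuous_circle fun θ =>
        ((hh θ).fderiv_right (m := 0) (by norm_num)).continuousAt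
    have h2 : Continuous fun θ => gyroDir B (w.1, rot (bdir B w.1 w.2) θ c, w.2) :=
      continuous_const.prodMk (((crossL.flip (B w.1 w.2)).continuous.comp
        (continuous_rot _ c)).prodMk continuous_const)
    exact h1.clm_apply h2
  have key := circAvg_deriv (unit_bdir hB0 hw) (X := fun c => h (w.1, c, w.2)) (c := c) hv
    (by
      simp only [fderiv_vel_gyro hB0 hw (hd _)]
      exact continuous_const.mul hc)
  rw [circAvg_congr (Y := fun c => -‖B w.1 w.2‖⁻¹ * fderiv ℝ h (w.1, c, w.2)
    (gyroDir B (w.1, c, w.2))) (fun θ => fderiv_vel_gyro hB0 hw (hd θ)), circAvg_const_mul] at key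
  exact (mul_eq_zero.1 key).resolve_left (neg_ne_zero.2 (inv_ne_zero hm))

lemma gyro_invariant {h : Phase → ℝ}
    (hh : ∀ θ, DifferentiableAt ℝ h (w.1, rot (bdir B w.1 w.2) θ c, w.2))
    (h0 : ∀ θ, fderiv ℝ h (w.1, rot (bdir B w.1 w.2) θ c, w.2)
      (gyroDir B (w.1, rot (bdir B w.1 w.2) θ c, w.2)) = 0) (θ : ℝ) :
    h (w.1, rot (bdir B w.1 w.2) θ c, w.2) = h (w.1, c, w.2) := by
  refine rot_invariant (unit_bdir hB0 hw) (X := fun c => h (w.1, c, w.2))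
    (fun θ => ((hh θ).hasFDerivAt.comp (rot (bdir B w.1 w.2) θ c)
      (hasFDerivAt_vel_fiber w _)).differentiableAt)
    (fun θ => ?_) θ
  rw [fderiv_vel_gyro hB0 hw (hh θ), h0, mul_zero]

end Circle

/-! #### The variables `(x, E, s, t)` -/

/-- A gyro-average as a function of `(x, E, s, t)`, where `E` is the kinetic energy. -/
def redE (B : VField) (h : Phase → ℝ) (y : GyroSpace) : ℝ :=
  red B h y.1 (‖B y.1 y.2.2.2‖⁻¹ * (y.2.1 - y.2.2.1 ^ 2 / 2)) y.2.2.1 y.2.2.2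

/-- The admissible values of `(x, E, s, t)`: the perpendicular energy is positive. -/
def energySet (Ω : Set V3) (I : Set ℝ) : Set GyroSpace :=
  {y | y.1 ∈ Ω ∧ y.2.2.2 ∈ I ∧ 0 < y.2.1 - y.2.2.1 ^ 2 / 2}

/-- The gyro-invariant variables `(x, |c|² / 2, c · b, t)` on phase space. -/
def gyroVars (B : VField) (z : Phase) : GyroSpace := (z.1, kinF z, parF B z, z.2.2)

/-- The oscillating parts of the gyro-invariant variables. -/
def osc (B : VField) (F : SpaceTime → V3) (z : Phase) : GyroSpace :=
  (thX B z, thE B F z, thPar B z, 0)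

/-- The gyro-average of the streaming direction, in the variables `(x, E, s, t)`. -/
def streamAvg (B : VField) (F : SpaceTime → V3) (z : Phase) : GyroSpace :=
  (parF B z • bdir B z.1 z.2.2, parF B z * inner ℝ (F (foot z)) (bdir B z.1 z.2.2),
    inner ℝ (F (foot z)) (bdir B z.1 z.2.2)
      + perpEnergy (bdir B z.1 z.2.2) z.2.1 * divb B z.1 z.2.2, 0)

/-- The gyro-average of the slow transport direction, in the variables `(x, E, s, t)`. -/
def slowAvg (B : VField) (u : SpaceTime → V3) (z : Phase) : GyroSpace :=
  (u (foot z),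
    -(parF B z ^ 2 * inner ℝ (fderiv ℝ u (foot z) (bdir B z.1 z.2.2, 0)) (bdir B z.1 z.2.2)
      + perpEnergy (bdir B z.1 z.2.2) z.2.1 * (dvg (fun y => u (y, z.2.2)) z.1
        - inner ℝ (fderiv ℝ u (foot z) (bdir B z.1 z.2.2, 0)) (bdir B z.1 z.2.2))),
    -(parF B z * inner ℝ (fderiv ℝ u (foot z) (bdir B z.1 z.2.2, 0)) (bdir B z.1 z.2.2)), 1)

/-- The gyro-average of the derivative of `osc` along the streaming direction. -/
def oscAvg (B : VField) (F : SpaceTime → V3) (z : Phase) : GyroSpace :=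
  (driftF B F (foot z) - parF B z ^ 2 • invBf B (foot z)
      - perpEnergy (bdir B z.1 z.2.2) z.2.1 •
        (curl (fun y => invBb B (y, z.2.2)) z.1 - invBf B (foot z)),
    -(parF B z ^ 2 * inner ℝ (F (foot z)) (invBf B (foot z))
      + perpEnergy (bdir B z.1 z.2.2) z.2.1 *
        (dvg (fun y => driftF B F (y, z.2.2)) z.1 - inner ℝ (F (foot z)) (invBf B (foot z)))),
    -(parF B z * inner ℝ (F (foot z)) (invBf B (foot z))
      + parF B z * perpEnergy (bdir B z.1 z.2.2) z.2.1 * dvg (fun y => invBf B (y, z.2.2)) z.1), 0)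

section Vars
include hΩ hI

lemma isOpen_energySet : IsOpen (energySet Ω I) := by
  have h1 : IsOpen {y : GyroSpace | y.1 ∈ Ω} := hΩ.preimage continuous_fst
  have h2 : IsOpen {y : GyroSpace | y.2.2.2 ∈ I} := hI.preimage (by fun_prop)
  have h3 : IsOpen {y : GyroSpace | 0 < y.2.1 - y.2.2.1 ^ 2 / 2} :=
    isOpen_lt continuous_const (by fun_prop)
  exact h1.inter (h2.inter h3)

include hB hB0

lemma contDiffOn_redE {h : Phase → ℝ} (hh : ContDiffOn ℝ ∞ h (phaseSet Ω I)) :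
    ContDiffOn ℝ ∞ (redE B h) (energySet Ω I) := by
  have hβ : ContDiffOn ℝ ∞ (fun y : GyroSpace => ‖B y.1 y.2.2.2‖⁻¹) (energySet Ω I) :=
    (contDiffOn_invB hB hB0).comp (f := fun y : GyroSpace => (y.1, y.2.2.2))
      (contDiff_fst.prodMk contDiff_snd.snd.snd).contDiffOn (fun y hy => ⟨hy.1, hy.2.1⟩)
  have hρ : ContDiff ℝ ∞ (fun y : GyroSpace => y.2.1 - y.2.2.1 ^ 2 / 2) := by fun_prop
  refine (contDiffOn_red hΩ hI hB hB0 hh).comp (f := fun y : GyroSpace =>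
    (y.1, ‖B y.1 y.2.2.2‖⁻¹ * (y.2.1 - y.2.2.1 ^ 2 / 2), y.2.2.1, y.2.2.2))
    (contDiff_fst.contDiffOn.prodMk ((hβ.mul hρ.contDiffOn).prodMk
      (contDiff_snd.snd.contDiffOn))) (fun y hy => ⟨hy.1, ?_, mem_univ _, hy.2.1⟩)
  exact mul_pos (inv_pos.2 (norm_pos_iff.2 (hB0 _ hy.1 _ hy.2.1))) hy.2.2

omit hΩ hI hB hB0 in
lemma kinF_sub_parF (z : Phase) :
    kinF z - parF B z ^ 2 / 2 = perpEnergy (bdir B z.1 z.2.2) z.2.1 := by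
  rw [kinF, parF, cPar, perpEnergy, real_inner_self_eq_norm_sq]; ring

omit hΩ hI hB in
lemma redE_gyroVars {h : Phase → ℝ} {z : Phase} (hz : foot z ∈ Ω ×ˢ I) :
    redE B h (gyroVars B z) = gyroAvg B h z := by
  rw [← red_apply (hB0 z.1 hz.1 z.2.2 hz.2)]
  have h := kinF_sub_parF (B := B) z
  simp only [perpEnergy, parF, cPar] at h
  simp only [redE, gyroVars, h, magMoment, parF, one_div, cPar]

omit hΩ hI hB in
lemma gyroVars_rot {w : SpaceTime} (hw : w ∈ Ω ×ˢ I) (c : V3) (θ : ℝ) :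
    gyroVars B (w.1, rot (bdir B w.1 w.2) θ c, w.2) = gyroVars B (w.1, c, w.2) := by
  have hb := unit_bdir hB0 hw
  simp only [gyroVars, parF_rot hB0 hw, kinF, real_inner_self_eq_norm_sq, norm_rot hb]

omit hΩ hI hB hB0 in
lemma gyroVars_mem {z : Phase} (hz : foot z ∈ Ω ×ˢ I)
    (hc : 0 < perpEnergy (bdir B z.1 z.2.2) z.2.1) : gyroVars B z ∈ energySet Ω I :=
  ⟨hz.1, hz.2, by simpa only [gyroVars, kinF_sub_parF] using hc⟩

omit hB hB0 in
lemma moderate_kinF : Moderate Ω I kinF := by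
  have h := (Moderate.inner hΩ hI Moderate.vel Moderate.vel).mul hΩ hI
    (Moderate.const (Ω := Ω) (I := I) (1 / 2 : ℝ))
  convert h using 2 with z
  rw [kinF]; ring

lemma moderate_thX : Moderate Ω I (thX B) :=
  Moderate.cross hΩ hI (Moderate.field hΩ hI (contDiffOn_invBb hB hB0)) Moderate.vel

lemma moderate_thPar : Moderate Ω I (thPar B) := by
  have h1 : Moderate Ω I (fun z : Phase => gyroField B (foot z) z.2.1) :=
    Moderate.bilin hΩ hI (ContinuousLinearMap.id ℝ (V3 →L[ℝ] V3))
      (Moderate.field hΩ hI (contDiffOn_gyroField hΩ hI hB hB0)) Moderate.vel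
  exact (Moderate.vel.inner hΩ hI h1).sub hΩ hI ((moderate_parF hΩ hI hB hB0).mul hΩ hI
    (Moderate.vel.inner hΩ hI (Moderate.field hΩ hI (contDiffOn_invBf hΩ hI hB hB0))))

lemma contDiffOn_gyroVars : ContDiffOn ℝ ∞ (gyroVars B) (phaseSet Ω I) :=
  contDiff_fst.contDiffOn.prodMk ((moderate_kinF hΩ hI).1.prodMk
    ((moderate_parF hΩ hI hB hB0).1.prodMk contDiff_snd.snd.contDiffOn))

variable {F : SpaceTime → V3} (hF : ContDiffOn ℝ ∞ F (Ω ×ˢ I))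
include hF

lemma moderate_thE : Moderate Ω I (thE B F) :=
  Moderate.inner hΩ hI (Moderate.field hΩ hI hF) (moderate_thX hΩ hI hB hB0)

lemma contDiffOn_osc : ContDiffOn ℝ ∞ (osc B F) (phaseSet Ω I) :=
  (moderate_thX hΩ hI hB hB0).1.prodMk ((moderate_thE hΩ hI hB hB0 hF).1.prodMk
    ((moderate_thPar hΩ hI hB hB0).1.prodMk contDiffOn_const))

omit hF

section AtPoint
variable {z : Phase} (hz : foot z ∈ Ω ×ˢ I)
include hz

omit hB hB0 in
lemma phase_nhds : phaseSet Ω I ∈ 𝓝 z :=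
  (isOpen_phaseSet hΩ hI).mem_nhds ⟨hz.1, mem_univ _, hz.2⟩

lemma fderiv_gyroVars (d : Phase) : fderiv ℝ (gyroVars B) z d
    = (d.1, fderiv ℝ kinF z d, fderiv ℝ (parF B) z d, d.2.2) := by
  have hS := phase_nhds hΩ hI hz
  have h1 : DifferentiableAt ℝ kinF z :=
    ((moderate_kinF hΩ hI).1.contDiffAt hS).differentiableAt (by simp)
  have h2 := differentiableAt_parF hΩ hI hB hB0 hz
  have h3 : HasFDerivAt (fun z : Phase => z.2.2)
      ((ContinuousLinearMap.snd ℝ V3 ℝ).comp (ContinuousLinearMap.snd ℝ V3 (V3 × ℝ))) z :=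
    hasFDerivAt_snd.comp z hasFDerivAt_snd
  have h4 : HasFDerivAt (gyroVars B) _ z :=
    hasFDerivAt_fst.prodMk (h1.hasFDerivAt.prodMk (h2.hasFDerivAt.prodMk h3))
  rw [h4.fderiv]
  rfl

lemma fderiv_osc (hF : ContDiffOn ℝ ∞ F (Ω ×ˢ I)) (d : Phase) : fderiv ℝ (osc B F) z d
    = (fderiv ℝ (thX B) z d, fderiv ℝ (thE B F) z d, fderiv ℝ (thPar B) z d, 0) := by
  have h4 : HasFDerivAt (osc B F) _ z :=
    (differentiableAt_thX hΩ hI hB hB0 hz).hasFDerivAt.prodMk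
      ((differentiableAt_thE hΩ hI hB hB0 hz hF).hasFDerivAt.prodMk
      ((differentiableAt_thPar hΩ hI hB hB0 hz).hasFDerivAt.prodMk (hasFDerivAt_const 0 z)))
  rw [h4.fderiv]
  rfl

/-- Along the streaming, the gyro-invariant variables change by their gyro-average and by an
oscillating part, which is the derivative of `osc` along the gyration. -/
lemma stream_gyroVars (hF : ContDiffOn ℝ ∞ F (Ω ×ˢ I)) :
    fderiv ℝ (gyroVars B) z (streamDir F z)
      = streamAvg B F z + fderiv ℝ (osc B F) z (gyroDir B z) := by
  obtain ⟨x, c, t⟩ := z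
  have hw : ((x, t) : SpaceTime) ∈ Ω ×ˢ I := hz
  rw [fderiv_gyroVars hΩ hI hB hB0 hz, fderiv_osc hΩ hI hB hB0 hz hF,
    gyro_thX hΩ hI hB hB0 hw, gyro_thE hΩ hI hB hB0 hw hF, stream_parF hΩ hI hB hB0 hw,
    fderiv_kinF]
  simp only [streamAvg, streamDir, foot_apply, Prod.mk_add_mk]
  refine Prod.ext ?_ (Prod.ext ?_ (Prod.ext ?_ ?_))
  · simp
  · simp
  · simp
  · simp

end AtPoint

section OnCircle
variable {w : SpaceTime} (hw : w ∈ Ω ×ˢ I) (c : V3)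
include hw

omit hB hB0 in
lemma continuous_circle_of_contDiffOn {G : Type} [NormedAddCommGroup G] [NormedSpace ℝ G]
    {f : Phase → G} (hf : ContDiffOn ℝ ∞ f (phaseSet Ω I)) (b : V3) :
    Continuous fun θ => f (w.1, rot b θ c, w.2) :=
  continuous_circle fun θ =>
    (hf.contDiffAt (phase_nhds hΩ hI (z := (w.1, rot b θ c, w.2)) hw)).continuousAt

omit hB hB0 in
lemma continuous_circle_fderiv {G : Type} [NormedAddCommGroup G] [NormedSpace ℝ G]
    {f : Phase → G} (hf : ContDiffOn ℝ ∞ f (phaseSet Ω I)) (b : V3) {d : Phase → Phase}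
    (hd : ContDiffOn ℝ ∞ d (phaseSet Ω I)) :
    Continuous fun θ => fderiv ℝ f (w.1, rot b θ c, w.2) (d (w.1, rot b θ c, w.2)) :=
  (continuous_circle_of_contDiffOn hΩ hI hw c
    (hf.fderiv_of_isOpen (isOpen_phaseSet hΩ hI) (by norm_cast)) b).clm_apply
  (continuous_circle_of_contDiffOn hΩ hI hw c hd b)

omit hB hB0 hw in
lemma contDiffOn_streamDir (hF : ContDiffOn ℝ ∞ F (Ω ×ˢ I)) :
    ContDiffOn ℝ ∞ (streamDir F) (phaseSet Ω I) :=
  contDiff_snd.fst.contDiffOn.prodMk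
    ((Moderate.field hΩ hI hF).1.prodMk contDiffOn_const)

omit hB hB0 hw in
lemma contDiffOn_slowDir {u : SpaceTime → V3} (hu : ContDiffOn ℝ ∞ u (Ω ×ˢ I)) :
    ContDiffOn ℝ ∞ (slowDir u) (phaseSet Ω I) := by
  have h1 := (Moderate.field hΩ hI (hu.fderiv_of_isOpen (hΩ.prod hI) (m := ∞) (by norm_cast))).1
  have h2 : ContDiff ℝ ∞ (fun z : Phase => ((z.2.1, 0) : SpaceTime)) :=
    contDiff_snd.fst.prodMk contDiff_const
  exact (Moderate.field hΩ hI hu).1.prodMk ((h1.clm_apply h2.contDiffOn).neg.prodMk contDiffOn_const)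

lemma avg_osc (hF : ContDiffOn ℝ ∞ F (Ω ×ˢ I)) (ℓ : GyroSpace →L[ℝ] ℝ) :
    circAvg (bdir B w.1 w.2) (fun c => ℓ (osc B F (w.1, c, w.2))) c = 0 := by
  have h := circAvg_prod (b := bdir B w.1 w.2) (c := c) (X := fun c => thX B (w.1, c, w.2))
    (Y := fun c => thE B F (w.1, c, w.2)) (Z := fun c => thPar B (w.1, c, w.2)) (x := 0) 0
    (continuous_circle_of_contDiffOn hΩ hI hw c (moderate_thX hΩ hI hB hB0).1 _)
    (continuous_circle_of_contDiffOn hΩ hI hw c (moderate_thE hΩ hI hB hB0 hF).1 _)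
    (continuous_circle_of_contDiffOn hΩ hI hw c (moderate_thPar hΩ hI hB hB0).1 _)
    (fun a => by rw [inner_zero_right]; exact avg_thX hB0 hw a c)
    (avg_thE hB0 hw F c) (avg_thPar hB0 hw c) ℓ
  exact h.trans (map_zero ℓ)

lemma avg_stream_osc (hF : ContDiffOn ℝ ∞ F (Ω ×ˢ I)) (ℓ : GyroSpace →L[ℝ] ℝ) :
    circAvg (bdir B w.1 w.2)
      (fun c => ℓ (fderiv ℝ (osc B F) (w.1, c, w.2) (streamDir F (w.1, c, w.2)))) c
      = ℓ (oscAvg B F (w.1, c, w.2)) := by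
  have hd := contDiffOn_streamDir hΩ hI hF
  have h := circAvg_prod (b := bdir B w.1 w.2) (c := c) 0
    (continuous_circle_fderiv hΩ hI hw c (moderate_thX hΩ hI hB hB0).1 (bdir B w.1 w.2) hd)
    (continuous_circle_fderiv hΩ hI hw c (moderate_thE hΩ hI hB hB0 hF).1 (bdir B w.1 w.2) hd)
    (continuous_circle_fderiv hΩ hI hw c (moderate_thPar hΩ hI hB hB0).1 (bdir B w.1 w.2) hd)
    (fun a => avg_stream_thX hΩ hI hB hB0 hw F a c) (avg_stream_thE hΩ hI hB hB0 hw hF c)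
    (avg_stream_thPar hΩ hI hB hB0 hw F c) ℓ
  refine (circAvg_congr fun θ => ?_).trans h
  rw [fderiv_osc hΩ hI hB hB0 (z := (w.1, rot (bdir B w.1 w.2) θ c, w.2)) hw hF]

lemma avg_slow_gyroVars {u : SpaceTime → V3} (hu : ContDiffOn ℝ ∞ u (Ω ×ˢ I))
    (ℓ : GyroSpace →L[ℝ] ℝ) :
    circAvg (bdir B w.1 w.2)
      (fun c => ℓ (fderiv ℝ (gyroVars B) (w.1, c, w.2) (slowDir u (w.1, c, w.2)))) c
      = ℓ (slowAvg B u (w.1, c, w.2)) := by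
  have hd := contDiffOn_slowDir hΩ hI hu
  have h := circAvg_prod (b := bdir B w.1 w.2) (c := c) (X := fun _ => u w) (x := u w) 1
    continuous_const
    (continuous_circle_fderiv hΩ hI hw c (moderate_kinF hΩ hI).1 (bdir B w.1 w.2) hd)
    (continuous_circle_fderiv hΩ hI hw c (moderate_parF hΩ hI hB hB0).1 (bdir B w.1 w.2) hd)
    (fun a => circAvg_of_eq fun _ => rfl)
    (avg_slow_kinF hB0 hw (differentiableAt_of_contDiffOn hΩ hI hu hw) c)
    (avg_slow_parF hΩ hI hB hB0 hw c) ℓ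
  refine (circAvg_congr fun θ => ?_).trans h
  rw [fderiv_gyroVars hΩ hI hB hB0 (z := (w.1, rot (bdir B w.1 w.2) θ c, w.2)) hw]
  rfl

end OnCircle
end Vars
end
end

section

variable {Ω : Set V3} {I : Set ℝ} {B : VField}

/-- The equations satisfied by the first three coefficients of the expansion of the distribution
function: `F` is the leading part of the force, `u` the leading part of the bulk velocity and `v`
its first-order correction. -/
structure KineticHierarchy (Ω : Set V3) (I : Set ℝ) (B : VField) (F u v : SpaceTime → V3)
    (h₀ h₁ h₂ : Phase → ℝ) : Prop where
  rapid₀ : Rapid Ω I h₀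
  rapid₁ : Rapid Ω I h₁
  rapid₂ : Rapid Ω I h₂
  force : ContDiffOn ℝ ∞ F (Ω ×ˢ I)
  bulk : ContDiffOn ℝ ∞ u (Ω ×ˢ I)
  order₀ : ∀ z, foot z ∈ Ω ×ˢ I → fderiv ℝ h₀ z (gyroDir B z) = 0
  order₁ : ∀ z, foot z ∈ Ω ×ˢ I →
    fderiv ℝ h₀ z (streamDir F z) + fderiv ℝ h₁ z (gyroDir B z) = 0
  order₂ : ∀ z, foot z ∈ Ω ×ˢ I →
    fderiv ℝ h₀ z (slowDir u z) + (fderiv ℝ h₁ z (streamDir F z)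
      + fderiv ℝ h₀ z (0, cross (v (foot z)) (B z.1 z.2.2), 0))
      + fderiv ℝ h₂ z (gyroDir B z) = 0

section
variable (hΩ : IsOpen Ω) (hI : IsOpen I) (hB : ContDiffOn ℝ ∞ (onSpaceTime B) (Ω ×ˢ I))
  (hB0 : ∀ x ∈ Ω, ∀ t ∈ I, B x t ≠ 0)
  {F u v : SpaceTime → V3} {h₀ h₁ h₂ : Phase → ℝ}
  (H : KineticHierarchy Ω I B F u v h₀ h₁ h₂)

namespace KineticHierarchy
include hΩ hI hB0 H

/-- The leading coefficient does not depend on the gyrophase. -/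
lemma invariant {w : SpaceTime} (hw : w ∈ Ω ×ˢ I) (c : V3) (θ : ℝ) :
    h₀ (w.1, rot (bdir B w.1 w.2) θ c, w.2) = h₀ (w.1, c, w.2) :=
  gyro_invariant hB0 hw
    (fun θ => (H.rapid₀.1.contDiffAt (phase_nhds hΩ hI
      (z := (w.1, rot (bdir B w.1 w.2) θ c, w.2)) hw)).differentiableAt (by simp))
    (fun θ => H.order₀ (w.1, rot (bdir B w.1 w.2) θ c, w.2) hw) θ

lemma gyroAvg_zeroth {z : Phase} (hz : foot z ∈ Ω ×ˢ I) : gyroAvg B h₀ z = h₀ z :=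
  circAvg_of_eq fun θ => H.invariant hΩ hI hB0 (w := (z.1, z.2.2)) hz z.2.1 θ

lemma zeroth_eq {z : Phase} (hz : foot z ∈ Ω ×ˢ I) : h₀ z = redE B h₀ (gyroVars B z) := by
  rw [redE_gyroVars hB0 hz, H.gyroAvg_zeroth hΩ hI hB0 hz]

include hB

section AtPoint
variable {z : Phase} (hz : foot z ∈ Ω ×ˢ I) (hc : 0 < perpEnergy (bdir B z.1 z.2.2) z.2.1)
include hz hc

omit H in
lemma contDiffAt_redE {h : Phase → ℝ} (hh : Rapid Ω I h) :
    ContDiffAt ℝ ∞ (redE B h) (gyroVars B z) :=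
  (contDiffOn_redE hΩ hI hB hB0 hh.1).contDiffAt
    ((isOpen_energySet hΩ hI).mem_nhds (gyroVars_mem hz hc))

omit hc H in
lemma differentiableAt_gyroVars : DifferentiableAt ℝ (gyroVars B) z :=
  ((contDiffOn_gyroVars hΩ hI hB hB0).contDiffAt (phase_nhds hΩ hI hz)).differentiableAt (by simp)

lemma fderiv_zeroth (d : Phase) : fderiv ℝ h₀ z d
    = fderiv ℝ (redE B h₀) (gyroVars B z) (fderiv ℝ (gyroVars B) z d) := by
  have h1 : h₀ =ᶠ[𝓝 z] redE B h₀ ∘ gyroVars B := by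
    filter_upwards [phase_nhds hΩ hI hz] with y hy
    exact H.zeroth_eq hΩ hI hB0 ⟨hy.1, hy.2.2⟩
  have h2 := (contDiffAt_redE hΩ hI hB hB0 hz hc H.rapid₀).differentiableAt (by simp)
  rw [h1.fderiv_eq,
    fderiv_comp z h2 (differentiableAt_gyroVars hΩ hI hB hB0 hz)]
  rfl

/-- The derivative along the gyration of the first coefficient, corrected by the oscillating
part of the gyro-invariant variables, is constant along the gyration. -/
lemma gyro_first : fderiv ℝ h₁ z (gyroDir B z)
    + fderiv ℝ (redE B h₀) (gyroVars B z) (fderiv ℝ (osc B F) z (gyroDir B z))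
      = -fderiv ℝ (redE B h₀) (gyroVars B z) (streamAvg B F z) := by
  have h1 := H.order₁ z hz
  rw [H.fderiv_zeroth hΩ hI hB hB0 hz hc, stream_gyroVars hΩ hI hB hB0 hz H.force, map_add] at h1
  linarith

end AtPoint

section OnCircle
variable {w : SpaceTime} (hw : w ∈ Ω ×ˢ I) {c : V3} (hc : 0 < perpEnergy (bdir B w.1 w.2) c)
include hw

omit hΩ hI hB H in
lemma perpEnergy_rot (c : V3) (θ : ℝ) : perpEnergy (bdir B w.1 w.2) (rot (bdir B w.1 w.2) θ c)
    = perpEnergy (bdir B w.1 w.2) c := by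
  have hb := unit_bdir hB0 hw
  simp only [perpEnergy, norm_rot hb, inner_rot hb]

omit hΩ hI hB H in
lemma streamAvg_rot (c : V3) (θ : ℝ) :
    streamAvg B F (w.1, rot (bdir B w.1 w.2) θ c, w.2) = streamAvg B F (w.1, c, w.2) := by
  simp only [streamAvg, parF_rot hB0 hw, perpEnergy_rot hB0 hw, foot_apply]

omit H in
lemma contDiffAt_osc_pairing (hF : ContDiffOn ℝ ∞ F (Ω ×ˢ I)) (L : GyroSpace →L[ℝ] ℝ) (c : V3) :
    ContDiffAt ℝ ∞ (fun z => L (osc B F z)) (w.1, c, w.2) :=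
  L.contDiff.contDiffAt.comp _ ((contDiffOn_osc hΩ hI hB hB0 hF).contDiffAt
    (phase_nhds hΩ hI (z := (w.1, c, w.2)) hw))

include hc

/-- The first solvability condition: `h₀` is constant along the averaged streaming. -/
theorem streamAvg_zeroth :
    fderiv ℝ (redE B h₀) (gyroVars B (w.1, c, w.2)) (streamAvg B F (w.1, c, w.2)) = 0 := by
  set L := fderiv ℝ (redE B h₀) (gyroVars B (w.1, c, w.2)) with hL
  have hcd : ∀ c, ContDiffAt ℝ ∞ (fun z => h₁ z + L (osc B F z)) (w.1, c, w.2) := fun c =>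
    (H.rapid₁.1.contDiffAt (phase_nhds hΩ hI (z := (w.1, c, w.2)) hw)).add
      (contDiffAt_osc_pairing hΩ hI hB hB0 hw H.force L c)
  have key := avg_gyro hB0 hw (c := c) (h := fun z => h₁ z + L (osc B F z))
    (fun θ => (hcd _).of_le (by exact_mod_cast le_top))
  rw [circAvg_of_eq (Q := -L (streamAvg B F (w.1, c, w.2)))] at key
  · simpa using key
  intro θ
  have hz : foot (w.1, rot (bdir B w.1 w.2) θ c, w.2) ∈ Ω ×ˢ I := hw
  have h1 := (H.rapid₁.1.contDiffAt (phase_nhds hΩ hI hz)).differentiableAt (by simp)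
  have h2 := ((contDiffOn_osc hΩ hI hB hB0 H.force).contDiffAt
    (phase_nhds hΩ hI hz)).differentiableAt (by simp)
  have h3 := (h1.hasFDerivAt.add (L.hasFDerivAt.comp _ h2.hasFDerivAt)).fderiv
  have h4 : fderiv ℝ (fun z => h₁ z + L (osc B F z)) (w.1, rot (bdir B w.1 w.2) θ c, w.2) = _ := h3
  have h5 := H.gyro_first hΩ hI hB hB0 hz
    (by simpa only [perpEnergy_rot hB0 hw] using hc)
  rw [gyroVars_rot hB0 hw, streamAvg_rot hB0 hw] at h5
  rw [h4, ← h5]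
  rfl

/-- The first coefficient is the sum of its gyro-average and of the oscillating part which is
enforced by the leading coefficient. -/
theorem first_eq : h₁ (w.1, c, w.2) = redE B h₁ (gyroVars B (w.1, c, w.2))
    - fderiv ℝ (redE B h₀) (gyroVars B (w.1, c, w.2)) (osc B F (w.1, c, w.2)) := by
  set L := fderiv ℝ (redE B h₀) (gyroVars B (w.1, c, w.2)) with hL
  have hd : ∀ θ, DifferentiableAt ℝ (fun z => h₁ z + L (osc B F z))
      (w.1, rot (bdir B w.1 w.2) θ c, w.2) := fun θ =>
    ((H.rapid₁.1.contDiffAt (phase_nhds hΩ hI (z := (w.1, rot (bdir B w.1 w.2) θ c, w.2)) hw)).add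
      (contDiffAt_osc_pairing hΩ hI hB hB0 hw H.force L
        (rot (bdir B w.1 w.2) θ c))).differentiableAt (by simp)
  have hinv := gyro_invariant hB0 hw (c := c) (h := fun z => h₁ z + L (osc B F z)) hd (fun θ => by
    have hz : foot (w.1, rot (bdir B w.1 w.2) θ c, w.2) ∈ Ω ×ˢ I := hw
    have h1 := (H.rapid₁.1.contDiffAt (phase_nhds hΩ hI hz)).differentiableAt (by simp)
    have h2 := ((contDiffOn_osc hΩ hI hB hB0 H.force).contDiffAt
      (phase_nhds hΩ hI hz)).differentiableAt (by simp)
    have h3 := (h1.hasFDerivAt.add (L.hasFDerivAt.comp _ h2.hasFDerivAt)).fderiv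
    have h4 : fderiv ℝ (fun z => h₁ z + L (osc B F z))
      (w.1, rot (bdir B w.1 w.2) θ c, w.2) = _ := h3
    have h5 := H.gyro_first hΩ hI hB hB0 hz
      (by simpa only [perpEnergy_rot hB0 hw] using hc)
    rw [gyroVars_rot hB0 hw, streamAvg_rot hB0 hw, H.streamAvg_zeroth hΩ hI hB hB0 hw hc,
      neg_zero] at h5
    rw [h4, ← h5]
    rfl)
  have h6 : circAvg (bdir B w.1 w.2) (fun c => h₁ (w.1, c, w.2) + L (osc B F (w.1, c, w.2))) c
      = h₁ (w.1, c, w.2) + L (osc B F (w.1, c, w.2)) := circAvg_of_eq hinv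
  have h7 := circAvg_add (b := bdir B w.1 w.2) (c := c) (X := fun c => h₁ (w.1, c, w.2))
    (Y := fun c => L (osc B F (w.1, c, w.2)))
    (continuous_circle_of_contDiffOn hΩ hI hw c H.rapid₁.1 _)
    (L.continuous.comp (continuous_circle_of_contDiffOn hΩ hI hw c
      (contDiffOn_osc hΩ hI hB hB0 H.force) _))
  rw [h6, avg_osc hΩ hI hB hB0 hw c H.force L, add_zero] at h7
  rw [redE_gyroVars hB0 (z := (w.1, c, w.2)) hw, gyroAvg]
  exact eq_sub_of_add_eq h7

/-- The streaming derivative of the first coefficient. -/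
lemma fderiv_first (d : Phase) : fderiv ℝ h₁ (w.1, c, w.2) d
    = fderiv ℝ (redE B h₁) (gyroVars B (w.1, c, w.2)) (fderiv ℝ (gyroVars B) (w.1, c, w.2) d)
      - (fderiv ℝ (fderiv ℝ (redE B h₀)) (gyroVars B (w.1, c, w.2))
          (fderiv ℝ (gyroVars B) (w.1, c, w.2) d) (osc B F (w.1, c, w.2))
        + fderiv ℝ (redE B h₀) (gyroVars B (w.1, c, w.2))
          (fderiv ℝ (osc B F) (w.1, c, w.2) d)) := by
  have hz : foot (w.1, c, w.2) ∈ Ω ×ˢ I := hw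
  have hY := differentiableAt_gyroVars hΩ hI hB hB0 hz
  have hK := (contDiffAt_redE hΩ hI hB hB0 hz hc H.rapid₁).differentiableAt (by simp)
  have hG := contDiffAt_redE hΩ hI hB hB0 hz hc H.rapid₀
  have hG' : DifferentiableAt ℝ (fderiv ℝ (redE B h₀)) (gyroVars B (w.1, c, w.2)) :=
    differentiableAt_fderiv (hG.of_le (WithTop.coe_le_coe.2 le_top))
  have hT := ((contDiffOn_osc hΩ hI hB hB0 H.force).contDiffAt
    (phase_nhds hΩ hI hz)).differentiableAt (by simp)
  have ev : h₁ =ᶠ[𝓝 ((w.1, c, w.2) : Phase)] fun z => redE B h₁ (gyroVars B z)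
      - fderiv ℝ (redE B h₀) (gyroVars B z) (osc B F z) := by
    have h1 := hY.continuousAt.preimage_mem_nhds
      ((isOpen_energySet hΩ hI).mem_nhds (gyroVars_mem hz hc))
    filter_upwards [phase_nhds hΩ hI hz, h1] with y hy hy1
    have hy2 := hy1.2.2
    simp only [gyroVars, kinF_sub_parF] at hy2
    exact H.first_eq hΩ hI hB hB0 (w := (y.1, y.2.2)) (c := y.2.1) ⟨hy.1, hy.2.2⟩ hy2
  have h8 := (hK.hasFDerivAt.comp (w.1, c, w.2) hY.hasFDerivAt).sub
    ((hG'.hasFDerivAt.comp (w.1, c, w.2) hY.hasFDerivAt).clm_apply hT.hasFDerivAt)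
  have h9 : HasFDerivAt (fun z => redE B h₁ (gyroVars B z)
      - fderiv ℝ (redE B h₀) (gyroVars B z) (osc B F z)) _ (w.1, c, w.2) := h8
  rw [ev.fderiv_eq, h9.fderiv]
  simp only [_root_.sub_apply, _root_.add_apply, ContinuousLinearMap.comp_apply,
    ContinuousLinearMap.flip_apply, Function.comp_apply]
  ring

/-- The second solvability condition: the averaged transport equation in the variables
`(x, E, s, t)`. -/
theorem transport :
    fderiv ℝ (redE B h₀) (gyroVars B (w.1, c, w.2))
        (slowAvg B u (w.1, c, w.2) - oscAvg B F (w.1, c, w.2))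
      + fderiv ℝ (redE B h₁) (gyroVars B (w.1, c, w.2)) (streamAvg B F (w.1, c, w.2)) = 0 := by
  have hb := unit_bdir hB0 hw
  have hz₀ : foot (w.1, c, w.2) ∈ Ω ×ˢ I := hw
  set L := fderiv ℝ (redE B h₀) (gyroVars B (w.1, c, w.2)) with hL
  set K := fderiv ℝ (redE B h₁) (gyroVars B (w.1, c, w.2)) with hK
  set S := fderiv ℝ (fderiv ℝ (redE B h₀)) (gyroVars B (w.1, c, w.2)) with hS
  have hsymm : ∀ p q, S p q = S q p := fun p q =>
    second_deriv_symm ((contDiffAt_redE hΩ hI hB hB0 hz₀ hc H.rapid₀).of_le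
      (WithTop.coe_le_coe.2 le_top)) p q
  -- the terms which are exact derivatives along the gyration
  let q : Phase → ℝ := fun z => K (osc B F z) - 2⁻¹ * S (osc B F z) (osc B F z) + h₂ z
  have hosc := contDiffOn_osc hΩ hI hB hB0 H.force
  have hq : ContDiffOn ℝ ∞ q (phaseSet Ω I) :=
    ((K.contDiff.comp_contDiffOn hosc).sub (contDiffOn_const.mul
      (S.isBoundedBilinearMap.contDiff.comp_contDiffOn (hosc.prodMk hosc)))).add H.rapid₂.1
  have hdq : ∀ z, foot z ∈ Ω ×ˢ I → ∀ d, fderiv ℝ q z d = K (fderiv ℝ (osc B F) z d)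
      - S (fderiv ℝ (osc B F) z d) (osc B F z) + fderiv ℝ h₂ z d := by
    intro z hz d
    have h1 := ((hosc.contDiffAt (phase_nhds hΩ hI hz)).differentiableAt (by simp)).hasFDerivAt
    have h2 := ((H.rapid₂.1.contDiffAt (phase_nhds hΩ hI hz)).differentiableAt
      (by simp)).hasFDerivAt
    have h3 : HasFDerivAt q _ z := ((K.hasFDerivAt.comp z h1).sub
      ((S.hasFDerivAt_of_bilinear h1 h1).const_mul 2⁻¹)).add h2
    rw [h3.fderiv]
    simp only [_root_.add_apply, _root_.sub_apply, _root_.smul_apply,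
      ContinuousLinearMap.comp_apply, ContinuousLinearMap.precompR_apply,
      ContinuousLinearMap.precompL_apply, ContinuousLinearMap.compL_apply, smul_eq_mul]
    rw [hsymm (osc B F z)]
    ring
  have hgd : ContDiffOn ℝ ∞ (gyroDir B) (phaseSet Ω I) :=
    contDiffOn_const.prodMk ((ContDiffOn.cross contDiff_snd.fst.contDiffOn
      (Moderate.field hΩ hI hB).1).prodMk contDiffOn_const)
  set a : V3 := cross (v w) (B w.1 w.2) with ha
  have hab : inner ℝ a (bdir B w.1 w.2) = (0 : ℝ) := inner_cross_B hB0 hw (v w)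
  let T₁ : V3 → ℝ := fun c => L (fderiv ℝ (gyroVars B) (w.1, c, w.2) (slowDir u (w.1, c, w.2)))
  let T₂ : V3 → ℝ := fun c => L (fderiv ℝ (osc B F) (w.1, c, w.2) (streamDir F (w.1, c, w.2)))
  let T₃ : V3 → ℝ := fun c' => S (streamAvg B F (w.1, c, w.2)) (osc B F (w.1, c', w.2))
  let T₄ : V3 → ℝ := fun c => L (0, 1, 0, 0) * innerL a c
  let T₅ : V3 → ℝ := fun c => fderiv ℝ q (w.1, c, w.2) (gyroDir B (w.1, c, w.2))
  have hY := contDiffOn_gyroVars hΩ hI hB hB0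
  have c₁ : Continuous fun θ => T₁ (rot (bdir B w.1 w.2) θ c) := L.continuous.comp
    (continuous_circle_fderiv hΩ hI hw c hY _ (contDiffOn_slowDir hΩ hI H.bulk))
  have c₂ : Continuous fun θ => T₂ (rot (bdir B w.1 w.2) θ c) := L.continuous.comp
    (continuous_circle_fderiv hΩ hI hw c hosc _ (contDiffOn_streamDir hΩ hI H.force))
  have c₃ : Continuous fun θ => T₃ (rot (bdir B w.1 w.2) θ c) :=
    (S (streamAvg B F (w.1, c, w.2))).continuous.comp
      (continuous_circle_of_contDiffOn hΩ hI hw c hosc _)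
  have c₄ : Continuous fun θ => T₄ (rot (bdir B w.1 w.2) θ c) :=
    continuous_const.mul ((innerL a).continuous.comp (continuous_rot _ c))
  have c₅ : Continuous fun θ => T₅ (rot (bdir B w.1 w.2) θ c) :=
    continuous_circle_fderiv hΩ hI hw c hq _ hgd
  have a₁ : circAvg (bdir B w.1 w.2) T₁ c = L (slowAvg B u (w.1, c, w.2)) :=
    avg_slow_gyroVars hΩ hI hB hB0 hw c H.bulk L
  have a₂ : circAvg (bdir B w.1 w.2) T₂ c = L (oscAvg B F (w.1, c, w.2)) :=
    avg_stream_osc hΩ hI hB hB0 hw c H.force L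
  have a₃ : circAvg (bdir B w.1 w.2) T₃ c = 0 := avg_osc hΩ hI hB hB0 hw c H.force _
  have a₄ : circAvg (bdir B w.1 w.2) T₄ c = 0 := by
    refine (circAvg_const_mul ..).trans ?_
    rw [circAvg_linear hb, innerL_apply, hab, mul_zero, mul_zero]
  have a₅ : circAvg (bdir B w.1 w.2) T₅ c = 0 := avg_gyro hB0 hw fun θ =>
    (hq.contDiffAt (phase_nhds hΩ hI
      (z := (w.1, rot (bdir B w.1 w.2) θ c, w.2)) hw)).of_le (by exact_mod_cast le_top)
  have key : ∀ θ, (fun c => (T₁ c - T₂ c) + ((T₄ c - T₃ c) + T₅ c)) (rot (bdir B w.1 w.2) θ c)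
      = -K (streamAvg B F (w.1, c, w.2)) := by
    intro θ
    have hz : foot (w.1, rot (bdir B w.1 w.2) θ c, w.2) ∈ Ω ×ˢ I := hw
    have hcθ : 0 < perpEnergy (bdir B w.1 w.2) (rot (bdir B w.1 w.2) θ c) := by
      rwa [perpEnergy_rot hB0 hw]
    have h1 := H.order₂ _ hz
    rw [H.fderiv_zeroth hΩ hI hB hB0 hz hcθ, H.fderiv_zeroth hΩ hI hB hB0 hz hcθ,
      H.fderiv_first hΩ hI hB hB0 hw hcθ, gyroVars_rot hB0 hw,
      stream_gyroVars hΩ hI hB hB0 hz H.force, streamAvg_rot hB0 hw,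
      fderiv_gyroVars hΩ hI hB hB0 hz (0, _, 0), fderiv_kinF, fderiv_parF hΩ hI hB hB0 hz] at h1
    have h2 : ∀ r : ℝ, L ((0 : V3), r, 0, 0) = L (0, 1, 0, 0) * r := fun r => by
      rw [mul_comm, ← smul_eq_mul, ← map_smul]; simp
    simp only [foot_apply, hab, ← ha, Prod.mk.eta, map_add, _root_.add_apply,
      Prod.mk_zero_zero, map_zero, inner_zero_right, add_zero, ← hL, ← hK, ← hS] at h1
    have h3 : L ((0 : V3), inner ℝ (rot (bdir B w.1 w.2) θ c) a, 0) = _ :=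
      h2 (inner ℝ (rot (bdir B w.1 w.2) θ c) a)
    rw [h3, real_inner_comm] at h1
    simp only [T₁, T₂, T₃, T₄, T₅, hdq _ hz, innerL_apply]
    linarith
  have e₁ := circAvg_add (b := bdir B w.1 w.2) (c := c) (X := fun c => T₁ c - T₂ c)
    (Y := fun c => (T₄ c - T₃ c) + T₅ c) (c₁.sub c₂) ((c₄.sub c₃).add c₅)
  have e₂ := circAvg_add (b := bdir B w.1 w.2) (c := c) (X := fun c => T₄ c - T₃ c)
    (Y := T₅) (c₄.sub c₃) c₅
  have e₃ := circAvg_sub (b := bdir B w.1 w.2) (c := c) (X := T₁) (Y := T₂) c₁ c₂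
  have e₄ := circAvg_sub (b := bdir B w.1 w.2) (c := c) (X := T₄) (Y := T₃) c₄ c₃
  rw [circAvg_of_eq key, e₂, e₃, e₄, a₁, a₂, a₃, a₄, a₅] at e₁
  rw [map_sub]
  linarith

end OnCircle
end KineticHierarchy
end
end

section

/-! ### The conservative form of the transport operators -/

variable {Ω : Set V3} {I : Set ℝ} {B : VField}

/-- A reduced distribution function as a function on `(x, μ, s, t)`-space. -/
def onReduced (G : RDistr) : GyroSpace → ℝ := fun z => G z.1 z.2.1 z.2.2.1 z.2.2.2

section ReducedSlices
variable {G : RDistr} {x : V3} {μ s t : ℝ} (hG : DifferentiableAt ℝ (onReduced G) (x, μ, s, t))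
include hG

lemma hasFDerivAt_reduced_pos : HasFDerivAt (fun y => G y μ s t)
    ((fderiv ℝ (onReduced G) (x, μ, s, t)).comp (ContinuousLinearMap.inl ℝ V3 (ℝ × ℝ × ℝ))) x := by
  have h := (hasFDerivAt_id (𝕜 := ℝ) x).prodMk (hasFDerivAt_const ((μ, s, t) : ℝ × ℝ × ℝ) x)
  exact hG.hasFDerivAt.comp x h

lemma hasDerivAt_reduced_mu : HasDerivAt (fun μ' => G x μ' s t)
    (fderiv ℝ (onReduced G) (x, μ, s, t) (0, 1, 0, 0)) μ := by
  have h := (hasDerivAt_const μ x).prodMk ((hasDerivAt_id μ).prodMk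
    ((hasDerivAt_const μ s).prodMk (hasDerivAt_const μ t)))
  exact hG.hasFDerivAt.comp_hasDerivAt μ h

lemma hasDerivAt_reduced_par : HasDerivAt (fun s' => G x μ s' t)
    (fderiv ℝ (onReduced G) (x, μ, s, t) (0, 0, 1, 0)) s := by
  have h := (hasDerivAt_const s x).prodMk ((hasDerivAt_const s μ).prodMk
    ((hasDerivAt_id s).prodMk (hasDerivAt_const s t)))
  exact hG.hasFDerivAt.comp_hasDerivAt s h

lemma hasDerivAt_reduced_time : HasDerivAt (fun t' => G x μ s t')
    (fderiv ℝ (onReduced G) (x, μ, s, t) (0, 0, 0, 1)) t := by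
  have h := (hasDerivAt_const t x).prodMk ((hasDerivAt_const t μ).prodMk
    ((hasDerivAt_const t s).prodMk (hasDerivAt_id t)))
  exact hG.hasFDerivAt.comp_hasDerivAt t h

end ReducedSlices

lemma clm_gyroSpace_apply (ℓ : GyroSpace →L[ℝ] ℝ) (v : V3) (p q r : ℝ) :
    ℓ (v, p, q, r) = ℓ (v, 0) + p * ℓ (0, 1, 0, 0) + q * ℓ (0, 0, 1, 0) + r * ℓ (0, 0, 0, 1) := by
  have h : ((v, p, q, r) : GyroSpace) = (v, 0) + p • (0, 1, 0, 0)
      + q • (0, 0, 1, 0) + r • (0, 0, 0, 1) := by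
    simp
  rw [h, map_add, map_add, map_add, map_smul, map_smul, map_smul]
  simp only [smul_eq_mul]

lemma contDiffAt_slice {F : Type} [NormedAddCommGroup F] [NormedSpace ℝ F] {a : SpaceTime → F}
    (hΩ : IsOpen Ω) (hI : IsOpen I) (ha : ContDiffOn ℝ ∞ a (Ω ×ˢ I)) {x : V3} (hx : x ∈ Ω) {t : ℝ}
    (ht : t ∈ I) : ContDiffAt ℝ ∞ (fun y => a (y, t)) x :=
  (ha.contDiffAt ((hΩ.prod hI).mem_nhds ⟨hx, ht⟩)).comp (f := fun y : V3 => (y, t)) x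
    (contDiff_id.prodMk contDiff_const).contDiffAt

lemma differentiableAt_slice {F : Type} [NormedAddCommGroup F] [NormedSpace ℝ F]
    {a : SpaceTime → F} (hΩ : IsOpen Ω) (hI : IsOpen I) (ha : ContDiffOn ℝ ∞ a (Ω ×ˢ I)) {x : V3}
    (hx : x ∈ Ω) {t : ℝ} (ht : t ∈ I) : DifferentiableAt ℝ (fun y => a (y, t)) x :=
  (contDiffAt_slice hΩ hI ha hx ht).differentiableAt (by simp)

lemma two_le_infty : (2 : WithTop ℕ∞) ≤ ∞ := WithTop.coe_le_coe.2 le_top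

lemma curl_contDiffAt {v : V3 → V3} {x : V3} (h : ContDiffAt ℝ ∞ v x) :
    ContDiffAt ℝ ∞ (curl v) x := by
  have h1 : ContDiffAt ℝ ∞ (fderiv ℝ v) x := h.fderiv_right (by norm_cast)
  exact ContDiffAt.sum fun i _ =>
    (crossL (e i)).contDiff.contDiffAt.comp x (h1.clm_apply contDiffAt_const)

section
variable (hΩ : IsOpen Ω) (hI : IsOpen I) (hB : ContDiffOn ℝ ∞ (onSpaceTime B) (Ω ×ˢ I))
  (hB0 : ∀ x ∈ Ω, ∀ t ∈ I, B x t ≠ 0)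
  {x : V3} (hx : x ∈ Ω) {t : ℝ} (ht : t ∈ I)

section Magnetic
include hΩ hI hB hB0 hx ht

lemma normB_slice : ContDiffAt ℝ ∞ (fun y => ‖B y t‖) x :=
  contDiffAt_slice hΩ hI (contDiffOn_normB hB hB0) hx ht

lemma bdir_slice : ContDiffAt ℝ ∞ (fun y => bdir B y t) x :=
  contDiffAt_slice hΩ hI (contDiffOn_bdir hB hB0) hx ht

lemma fvec_slice : ContDiffAt ℝ ∞ (fun y => fvec B y t) x :=
  contDiffAt_slice hΩ hI (contDiffOn_fvec hΩ hI hB hB0) hx ht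

lemma gradB_slice : ContDiffAt ℝ ∞ (fun y => gradB B y t) x :=
  contDiffAt_gradient (n := ∞) (normB_slice hΩ hI hB hB0 hx ht)

lemma diffAt_invB_slice : DifferentiableAt ℝ (fun y => ‖B y t‖⁻¹) x :=
  (differentiableAt_slice hΩ hI (contDiffOn_invB hB hB0) hx ht)

omit hΩ hI hB hB0 hx ht in
lemma fderiv_normB (B : VField) (x : V3) (t : ℝ) (v : V3) :
    fderiv ℝ (fun y => ‖B y t‖) x v = inner ℝ (gradB B x t) v :=
  (inner_gradient x v).symm

lemma fderiv_invB_slice (v : V3) : fderiv ℝ (fun y => ‖B y t‖⁻¹) x v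
    = -(‖B x t‖⁻¹ ^ 2 * inner ℝ (gradB B x t) v) := by
  have hm := normB_ne (w := (x, t)) hB0 ⟨hx, ht⟩
  have h1 := ((normB_slice hΩ hI hB hB0 hx ht).differentiableAt (by simp)).hasFDerivAt
  have h2 := ((hasDerivAt_inv hm).comp_hasFDerivAt x h1).fderiv
  have h3 : fderiv ℝ (fun y => ‖B y t‖⁻¹) x = _ := h2
  rw [h3, _root_.smul_apply, fderiv_normB, smul_eq_mul]
  simp only [inv_pow]
  ring

lemma gradient_invB_slice : gradient (fun y => ‖B y t‖⁻¹) x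
    = -(‖B x t‖⁻¹ ^ 2 • gradB B x t) := by
  refine ext_inner_right ℝ fun v => ?_
  rw [inner_gradient, fderiv_invB_slice hΩ hI hB hB0 hx ht, inner_neg_left, inner_smul_left]
  rfl

lemma dvg_invB_smul {v : V3 → V3} (hv : DifferentiableAt ℝ v x) :
    dvg (fun y => ‖B y t‖⁻¹ • v y) x
      = ‖B x t‖⁻¹ * dvg v x - ‖B x t‖⁻¹ ^ 2 * inner ℝ (gradB B x t) (v x) := by
  rw [dvg_smul (diffAt_invB_slice hΩ hI hB hB0 hx ht) hv, fderiv_invB_slice hΩ hI hB hB0 hx ht]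
  ring

lemma curl_invBb : curl (fun y => invBb B (y, t)) x = ‖B x t‖⁻¹ • curl (fun y => bdir B y t) x
    + ‖B x t‖⁻¹ ^ 2 • cross (bdir B x t) (gradB B x t) := by
  have hb := (bdir_slice hΩ hI hB hB0 hx ht).differentiableAt (by simp)
  have h := curl_smul (diffAt_invB_slice hΩ hI hB hB0 hx ht) hb
  refine h.trans ?_
  rw [gradient_invB_slice hΩ hI hB hB0 hx ht, cross_anti (-_), ← neg_smul, cross_smul_right,
    neg_smul, neg_neg]

lemma normB_mul_divb (hdivB : dvg (fun y => B y t) x = 0) :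
    ‖B x t‖ * divb B x t = -inner ℝ (gradB B x t) (bdir B x t) := by
  have hb := (bdir_slice hΩ hI hB hB0 hx ht).differentiableAt (by simp)
  have h := dvg_smul ((normB_slice hΩ hI hB hB0 hx ht).differentiableAt (by simp)) hb
  have h1 : dvg (fun y => ‖B y t‖ • bdir B y t) x = dvg (fun y => B y t) x := by
    refine dvg_congr ?_
    filter_upwards [hΩ.mem_nhds hx] with y hy using norm_smul_bdir (hB0 y hy t ht)
  rw [h1, hdivB, fderiv_normB] at h
  rw [divb]
  linarith

lemma dvg_cross_gradB : dvg (fun y => cross (bdir B y t) (gradB B y t)) x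
    = inner ℝ (gradB B x t) (curl (fun y => bdir B y t) x) := by
  have hb := (bdir_slice hΩ hI hB hB0 hx ht).differentiableAt (by simp)
  have hg := (gradB_slice hΩ hI hB hB0 hx ht).differentiableAt (by simp)
  have h0 : curl (fun y => gradB B y t) x = 0 :=
    curl_gradient ((normB_slice hΩ hI hB hB0 hx ht).of_le two_le_infty)
  rw [dvg_cross hb hg, h0, inner_zero_right, sub_zero]

end Magnetic

section Operators
variable {F : SpaceTime → V3} (hF : ContDiffOn ℝ ∞ F (Ω ×ˢ I)) {𝒢 : RDistr}
  (hforce : ∀ x ∈ Ω, ∀ t ∈ I, force B 𝒢 x t = F (x, t))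
  {u : VField} (hu : ContDiffOn ℝ ∞ (onSpaceTime u) (Ω ×ˢ I))
include hforce hx ht

lemma phi_eq (μ : ℝ) : phi B 𝒢 x μ t = ‖B x t‖⁻¹ • (F (x, t) - μ • gradB B x t) := by
  rw [phi, hforce x hx t ht, one_div]

lemma driftX_eq (μ s : ℝ) : driftX B u 𝒢 x μ s t = u x t + μ • curl (fun y => bdir B y t) x
    - ‖B x t‖⁻¹ • cross (bdir B x t) (F (x, t))
    + (μ * ‖B x t‖⁻¹) • cross (bdir B x t) (gradB B x t)
    + (s ^ 2 * ‖B x t‖⁻¹ - μ) • fvec B x t := by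
  rw [driftX, phi_eq hx ht hforce, cross_smul_right, cross_sub_right, cross_smul_right, smul_sub,
    smul_smul, div_eq_mul_inv]
  module

lemma rateC_eq (μ : ℝ) : rateC B u 𝒢 x μ t = -stretch B u x t
    + ‖B x t‖⁻¹ * inner ℝ (F (x, t)) (fvec B x t)
    + μ * (dvg (fun y => fvec B y t) x - ‖B x t‖⁻¹ * inner ℝ (gradB B x t) (fvec B x t)) := by
  rw [rateC, phi_eq hx ht hforce, inner_smul_left, inner_sub_left, inner_smul_left]
  simp only [conj_trivial]
  ring

include hΩ hI hB hB0

lemma inner_B_phi (hdivB : dvg (fun y => B y t) x = 0) (μ : ℝ) :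
    inner ℝ (B x t) (phi B 𝒢 x μ t)
      = inner ℝ (F (x, t)) (bdir B x t) + μ * ‖B x t‖ * divb B x t := by
  have hm := normB_ne (w := (x, t)) hB0 ⟨hx, ht⟩
  have h := normB_mul_divb hΩ hI hB hB0 hx ht hdivB
  rw [phi_eq hx ht hforce]
  have hBb : inner ℝ (B x t) (‖B x t‖⁻¹ • (F (x, t) - μ • gradB B x t))
      = inner ℝ (‖B x t‖ • bdir B x t) (‖B x t‖⁻¹ • (F (x, t) - μ • gradB B x t)) := by
    rw [norm_smul_bdir (hB0 x hx t ht)]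
  rw [hBb, inner_smul_left, inner_smul_right, inner_sub_right, inner_smul_right, real_inner_comm,
    real_inner_comm (gradB B x t) (bdir B x t), mul_assoc μ, h]
  simp only [conj_trivial]
  field_simp
  ring

include hF

lemma rateMu_eq (μ s : ℝ) : rateMu B u 𝒢 x μ s t =
    (-(‖B x t‖⁻¹ * (deriv (fun s => ‖B x s‖) t + inner ℝ (gradB B x t) (u x t)))
      - dvg (fun y => u y t) x + stretch B u x t
      + ‖B x t‖⁻¹ * dvg (fun y => cross (bdir B y t) (F (y, t))) x
      - s ^ 2 * ‖B x t‖⁻¹ * dvg (fun y => fvec B y t) x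
      - ‖B x t‖⁻¹ * inner ℝ (F (x, t)) (fvec B x t))
    + μ * (-(‖B x t‖⁻¹ * inner ℝ (gradB B x t) (curl (fun y => bdir B y t) x))
      + ‖B x t‖⁻¹ * inner ℝ (gradB B x t) (fvec B x t)) := by
  have hm := normB_ne (w := (x, t)) hB0 ⟨hx, ht⟩
  have hb := (bdir_slice hΩ hI hB hB0 hx ht).differentiableAt (by simp)
  have hg := (gradB_slice hΩ hI hB hB0 hx ht).differentiableAt (by simp)
  have hFx : DifferentiableAt ℝ (fun y => F (y, t)) x :=
    (differentiableAt_slice hΩ hI hF hx ht)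
  have h1 : dvg (fun y => cross (B y t) (phi B 𝒢 y μ t)) x
      = dvg (fun y => cross (bdir B y t) (F (y, t))) x
        - μ * inner ℝ (gradB B x t) (curl (fun y => bdir B y t) x) := by
    rw [← dvg_cross_gradB hΩ hI hB hB0 hx ht, ← dvg_const_smul μ (hb.cross hg),
      ← dvg_sub (hb.cross hFx) ((hb.cross hg).fun_const_smul μ)]
    refine dvg_congr ?_
    filter_upwards [hΩ.mem_nhds hx] with y hy
    have hy0 := hB0 y hy t ht
    conv_lhs => rw [← norm_smul_bdir hy0]
    rw [phi_eq hy ht hforce, cross_smul_left, cross_smul_right, smul_smul,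
      mul_inv_cancel₀ (norm_ne_zero_iff.2 hy0), one_smul, cross_sub_right, cross_smul_right]
  have h2 : deriv (fun s => Real.log ‖B x s‖) t = ‖B x t‖⁻¹ * deriv (fun s => ‖B x s‖) t := by
    have hd : DifferentiableAt ℝ (fun s => ‖B x s‖) t := by
      have h3 := differentiableAt_of_contDiffOn hΩ hI (contDiffOn_normB hB hB0)
        (w := (x, t)) ⟨hx, ht⟩
      exact h3.comp (f := fun s : ℝ => (x, s)) t (by fun_prop)
    rw [deriv.log hd hm, div_eq_inv_mul]
  have h3 : inner ℝ (u x t) (gradient (fun y => Real.log ‖B y t‖) x)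
      = ‖B x t‖⁻¹ * inner ℝ (gradB B x t) (u x t) := by
    have hd := (normB_slice hΩ hI hB hB0 hx ht).differentiableAt (by simp)
    rw [real_inner_comm, inner_gradient, fderiv.log hd hm, _root_.smul_apply, fderiv_normB,
      smul_eq_mul]
  rw [rateMu, h1, h2, h3, phi_eq hx ht hforce, inner_smul_left, inner_sub_left, inner_smul_left]
  simp only [conj_trivial, div_eq_mul_inv]
  ring

/-- Liouville's theorem for the reduced flow: the phase space density `|B|` is transported. -/
lemma liouville (hu : ContDiffOn ℝ ∞ (onSpaceTime u) (Ω ×ˢ I)) (μ s : ℝ) :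
    DifferentiableAt ℝ (fun y => ‖B y t‖ • driftX B u 𝒢 y μ s t) x ∧
    dvg (fun y => ‖B y t‖ • driftX B u 𝒢 y μ s t) x
      = ‖B x t‖ * dvg (fun y => u y t) x + inner ℝ (gradB B x t) (u x t)
        + 2 * μ * inner ℝ (gradB B x t) (curl (fun y => bdir B y t) x)
        - dvg (fun y => cross (bdir B y t) (F (y, t))) x
        + (s ^ 2 - μ * ‖B x t‖) * dvg (fun y => fvec B y t) x
        - μ * inner ℝ (gradB B x t) (fvec B x t) := by
  have hm : DifferentiableAt ℝ (fun y => ‖B y t‖) x :=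
    (normB_slice hΩ hI hB hB0 hx ht).differentiableAt (by simp)
  have hbs := bdir_slice hΩ hI hB hB0 hx ht
  have hb := hbs.differentiableAt (by simp)
  have hg := (gradB_slice hΩ hI hB hB0 hx ht).differentiableAt (by simp)
  have hf := (fvec_slice hΩ hI hB hB0 hx ht).differentiableAt (by simp)
  have hc : DifferentiableAt ℝ (curl (fun y => bdir B y t)) x :=
    (curl_contDiffAt hbs).differentiableAt (by simp)
  have hFx : DifferentiableAt ℝ (fun y => F (y, t)) x :=
    (differentiableAt_slice hΩ hI hF hx ht)
  have hux : DifferentiableAt ℝ (fun y => u y t) x :=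
    (differentiableAt_slice hΩ hI hu hx ht)
  have d1 : DifferentiableAt ℝ (fun y => ‖B y t‖ • u y t) x := hm.smul hux
  have d2 : DifferentiableAt ℝ (fun y => ‖B y t‖ • (μ • curl (fun y => bdir B y t) y)) x :=
    hm.smul (hc.const_smul μ)
  have d3 : DifferentiableAt ℝ (fun y => cross (bdir B y t) (F (y, t))) x := hb.cross hFx
  have d4 : DifferentiableAt ℝ (fun y => μ • cross (bdir B y t) (gradB B y t)) x :=
    (hb.cross hg).fun_const_smul μ
  have dφ : DifferentiableAt ℝ (fun y => s ^ 2 - μ * ‖B y t‖) x :=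
    (hm.const_mul μ).const_sub (s ^ 2)
  have d5 : DifferentiableAt ℝ (fun y => (s ^ 2 - μ * ‖B y t‖) • fvec B y t) x := dφ.smul hf
  have e1 : (fun y => ‖B y t‖ • driftX B u 𝒢 y μ s t)
      =ᶠ[𝓝 x] (fun y => ‖B y t‖ • u y t + ‖B y t‖ • (μ • curl (fun y => bdir B y t) y)
        - cross (bdir B y t) (F (y, t)) + μ • cross (bdir B y t) (gradB B y t)
        + (s ^ 2 - μ * ‖B y t‖) • fvec B y t) := by
    filter_upwards [hΩ.mem_nhds hx] with y hy
    have hy0 := norm_ne_zero_iff.2 (hB0 y hy t ht)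
    have h1 : ‖B y t‖ * ‖B y t‖⁻¹ = 1 := mul_inv_cancel₀ hy0
    rw [driftX_eq hy ht hforce]
    simp only [smul_add, smul_sub, smul_smul, sub_smul]
    rw [h1, one_smul, mul_left_comm, h1, mul_left_comm ‖B y t‖ (s ^ 2), h1]
    simp only [mul_one]
    rw [mul_comm ‖B y t‖ μ]
  have e2 : fderiv ℝ (fun y => s ^ 2 - μ * ‖B y t‖) x (fvec B x t)
      = -(μ * inner ℝ (gradB B x t) (fvec B x t)) := by
    rw [fderiv_const_sub, fderiv_const_mul hm, ← fderiv_normB]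
    rfl
  refine ⟨((((d1.fun_add d2).fun_sub d3).fun_add d4).fun_add d5).congr_of_eventuallyEq e1, ?_⟩
  rw [dvg_congr e1, dvg_add (((d1.fun_add d2).fun_sub d3).fun_add d4) d5, dvg_add ((d1.fun_add d2).fun_sub d3) d4,
    dvg_sub (d1.fun_add d2) d3, dvg_add d1 d2, dvg_smul hm hux, dvg_smul hm (hc.fun_const_smul μ),
    dvg_const_smul μ (hb.cross hg), dvg_smul dφ hf, dvg_const_smul μ hc,
    dvg_curl (hbs.of_le two_le_infty), dvg_cross_gradB hΩ hI hB hB0 hx ht, fderiv_normB,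
    fderiv_normB, e2, inner_smul_right]
  ring

/-- The transport operator in divergence form is the derivative along the drift. -/
theorem Sdag_weighted (hu : ContDiffOn ℝ ∞ (onSpaceTime u) (Ω ×ˢ I)) {G : RDistr} {μ s : ℝ}
    (hG : DifferentiableAt ℝ (onReduced G) (x, μ, s, t)) (h𝒢 : 𝒢 = weighted B G) :
    deriv (fun t' => weighted B G x μ s t') t + Sdag B u 𝒢 x μ s t
      = 2 * Real.pi * ‖B x t‖ * fderiv ℝ (onReduced G) (x, μ, s, t)
        (driftX B u 𝒢 x μ s t, μ * rateMu B u 𝒢 x μ s t, s * rateC B u 𝒢 x μ t, 1) := by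
  subst h𝒢
  have hm := normB_ne (w := (x, t)) hB0 ⟨hx, ht⟩
  have hmt : HasDerivAt (fun s => ‖B x s‖) (deriv (fun s => ‖B x s‖) t) t := by
    have h3 := differentiableAt_of_contDiffOn hΩ hI (contDiffOn_normB hB hB0)
      (w := (x, t)) ⟨hx, ht⟩
    exact (h3.comp (f := fun s : ℝ => (x, s)) t (by fun_prop)).hasDerivAt
  set D := fderiv ℝ (onReduced G) (x, μ, s, t) with hD
  obtain ⟨hdX, hL⟩ := liouville hΩ hI hB hB0 hx ht hF hforce hu μ s
  set X := driftX B u (weighted B G) x μ s t with hX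
  -- the time derivative
  have e1 : deriv (fun t' => weighted B G x μ s t') t
      = 2 * Real.pi * (deriv (fun s => ‖B x s‖) t * G x μ s t + ‖B x t‖ * D (0, 0, 0, 1)) := by
    have h := ((hmt.const_mul (2 * Real.pi)).mul (hasDerivAt_reduced_time hG)).deriv
    have h' : deriv (fun t' => weighted B G x μ s t') t = _ := h
    rw [h']; ring
  -- the spatial divergence
  have hGx := hasFDerivAt_reduced_pos hG
  have e2 : dvg (fun y => weighted B G y μ s t • driftX B u (weighted B G) y μ s t) x
      = G x μ s t * (2 * Real.pi * dvg (fun y => ‖B y t‖ • driftX B u (weighted B G) y μ s t) x)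
        + 2 * Real.pi * ‖B x t‖ * D (X, 0) := by
    have h1 : (fun y => weighted B G y μ s t • driftX B u (weighted B G) y μ s t)
        = fun y => G y μ s t • ((2 * Real.pi) • (‖B y t‖ • driftX B u (weighted B G) y μ s t)) := by
      funext y
      simp only [weighted, smul_smul]
      congr 1; ring
    rw [h1, dvg_smul hGx.differentiableAt (hdX.fun_const_smul _), dvg_const_smul _ hdX, hGx.fderiv,
      smul_smul, map_smul, smul_eq_mul]
    rfl
  -- the derivative in the parallel velocity
  have e3 : deriv (fun c' => rateC B u (weighted B G) x μ t * c' * weighted B G x μ c' t) s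
      = 2 * Real.pi * ‖B x t‖ * rateC B u (weighted B G) x μ t
        * (G x μ s t + s * D (0, 0, 1, 0)) := by
    have h := (((hasDerivAt_id s).const_mul (rateC B u (weighted B G) x μ t)).mul
      ((hasDerivAt_reduced_par hG).const_mul (2 * Real.pi * ‖B x t‖))).deriv
    have h' : deriv (fun c' => rateC B u (weighted B G) x μ t * c' * weighted B G x μ c' t) s
      = _ := h
    rw [h']; simp only [id]; ring
  -- the derivative in the magnetic moment
  set A₀ := -(‖B x t‖⁻¹ * (deriv (fun s => ‖B x s‖) t + inner ℝ (gradB B x t) (u x t)))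
      - dvg (fun y => u y t) x + stretch B u x t
      + ‖B x t‖⁻¹ * dvg (fun y => cross (bdir B y t) (F (y, t))) x
      - s ^ 2 * ‖B x t‖⁻¹ * dvg (fun y => fvec B y t) x
      - ‖B x t‖⁻¹ * inner ℝ (F (x, t)) (fvec B x t) with hA₀
  set A₁ := -(‖B x t‖⁻¹ * inner ℝ (gradB B x t) (curl (fun y => bdir B y t) x))
      + ‖B x t‖⁻¹ * inner ℝ (gradB B x t) (fvec B x t) with hA₁
  have hrm : ∀ μ', rateMu B u (weighted B G) x μ' s t = A₀ + μ' * A₁ := fun μ' =>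
    rateMu_eq hΩ hI hB hB0 hx ht hF hforce μ' s
  have e4 : deriv (fun μ' => rateMu B u (weighted B G) x μ' s t * μ' * weighted B G x μ' s t) μ
      = 2 * Real.pi * ‖B x t‖ * ((A₀ + 2 * μ * A₁) * G x μ s t
        + (A₀ + μ * A₁) * μ * D (0, 1, 0, 0)) := by
    simp only [hrm]
    have h := (((((hasDerivAt_id μ).mul_const A₁).const_add A₀).mul (hasDerivAt_id μ)).mul
      ((hasDerivAt_reduced_mu hG).const_mul (2 * Real.pi * ‖B x t‖))).deriv
    have h' : deriv (fun μ' => (A₀ + μ' * A₁) * μ' * weighted B G x μ' s t) μ = _ := h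
    rw [h']; simp only [id, Pi.mul_apply]; ring
  rw [Sdag, e1, e2, e3, e4, hL, clm_gyroSpace_apply D X (μ * _) (s * _) 1, hrm, rateC_eq hx ht hforce, hA₀, hA₁]
  field_simp
  ring

omit hF in
/-- The constraint operator in divergence form is the derivative along the averaged streaming. -/
theorem Cdag_weighted (hdivB : dvg (fun y => B y t) x = 0) {G : RDistr} {μ s : ℝ}
    (hG : DifferentiableAt ℝ (onReduced G) (x, μ, s, t)) :
    Cdag B 𝒢 (weighted B G) x μ s t
      = 2 * Real.pi * ‖B x t‖ * fderiv ℝ (onReduced G) (x, μ, s, t)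
        (s • bdir B x t, 0, inner ℝ (F (x, t)) (bdir B x t) + μ * ‖B x t‖ * divb B x t, 0) := by
  set D := fderiv ℝ (onReduced G) (x, μ, s, t) with hD
  have hGx := hasFDerivAt_reduced_pos hG
  have hBx : DifferentiableAt ℝ (fun y => B y t) x :=
    (differentiableAt_slice hΩ hI hB hx ht)
  have e1 : dvg (fun y => (s * weighted B G y μ s t) • bdir B y t) x
      = 2 * Real.pi * ‖B x t‖ * D (s • bdir B x t, 0) := by
    have h1 : (fun y => (s * weighted B G y μ s t) • bdir B y t)
        =ᶠ[𝓝 x] fun y => G y μ s t • ((2 * Real.pi * s) • B y t) := by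
      filter_upwards [hΩ.mem_nhds hx] with y hy
      have hb : (2 * Real.pi * s) • B y t = (2 * Real.pi * s) • (‖B y t‖ • bdir B y t) := by
        rw [norm_smul_bdir (hB0 y hy t ht)]
      rw [hb]
      simp only [weighted, smul_smul]
      congr 1; ring
    rw [dvg_congr h1, dvg_smul hGx.differentiableAt (hBx.fun_const_smul _),
      dvg_const_smul _ hBx, hdivB, mul_zero, mul_zero, zero_add, hGx.fderiv]
    conv_lhs => rw [← norm_smul_bdir (hB0 x hx t ht)]
    rw [smul_smul, show (2 * Real.pi * s * ‖B x t‖) = (2 * Real.pi * ‖B x t‖) * s by ring,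
      ← smul_smul, map_smul, smul_eq_mul]
    rfl
  have e2 : deriv (fun c' => inner ℝ (B x t) (phi B 𝒢 x μ t) * weighted B G x μ c' t) s
      = 2 * Real.pi * ‖B x t‖ * (inner ℝ (B x t) (phi B 𝒢 x μ t) * D (0, 0, 1, 0)) := by
    have h := (((hasDerivAt_reduced_par hG).const_mul (2 * Real.pi * ‖B x t‖)).const_mul
      (inner ℝ (B x t) (phi B 𝒢 x μ t))).deriv
    have h' : deriv (fun c' => inner ℝ (B x t) (phi B 𝒢 x μ t) * weighted B G x μ c' t) s
      = _ := h
    rw [h']; ring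
  rw [Cdag, e1, e2, clm_gyroSpace_apply D (s • bdir B x t) 0
      (inner ℝ (F (x, t)) (bdir B x t) + μ * ‖B x t‖ * divb B x t) 0,
    inner_B_phi hΩ hI hB hB0 hx ht hforce hdivB]
  ring

end Operators
end
end

section

/-! ### The constrained transport system -/

variable {Ω : Set V3} {I : Set ℝ} {B : VField}

section
variable (hΩ : IsOpen Ω) (hI : IsOpen I) (hB : ContDiffOn ℝ ∞ (onSpaceTime B) (Ω ×ˢ I))
  (hB0 : ∀ x ∈ Ω, ∀ t ∈ I, B x t ≠ 0)
include hΩ hI hB hB0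

lemma differentiableAt_onReduced {h : Phase → ℝ} (hh : Rapid Ω I h) {x : V3} (hx : x ∈ Ω) {t : ℝ}
    (ht : t ∈ I) {μ : ℝ} (hμ : 0 < μ) (s : ℝ) :
    DifferentiableAt ℝ (onReduced (red B h)) (x, μ, s, t) :=
  ((contDiffOn_red hΩ hI hB hB0 hh.1).contDiffAt ((hΩ.prod (isOpen_Ioi.prod
    (isOpen_univ.prod hI))).mem_nhds
    (show (x, μ, s, t) ∈ Ω ×ˢ Ioi (0 : ℝ) ×ˢ (univ : Set ℝ) ×ˢ I from
      ⟨hx, hμ, mem_univ _, ht⟩))).differentiableAt (by simp)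

lemma fderiv_normB_spaceTime {x : V3} (hx : x ∈ Ω) {t : ℝ} (ht : t ∈ I) (v : V3) (τ : ℝ) :
    fderiv ℝ (fun w : SpaceTime => ‖B w.1 w.2‖) (x, t) (v, τ)
      = inner ℝ (gradB B x t) v + τ * deriv (fun s => ‖B x s‖) t := by
  have hd := differentiableAt_of_contDiffOn hΩ hI (contDiffOn_normB hB hB0) (w := (x, t)) ⟨hx, ht⟩
  have h1 := fderiv_slice_space hd v
  have h2 := deriv_slice_field hd
  have h3 : ((v, τ) : SpaceTime) = (v, 0) + τ • (0, 1) := by simp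
  rw [h3, map_add, map_smul, ← h1, ← h2, ← fderiv_normB, smul_eq_mul]

/-- Change of variables from the kinetic energy to the magnetic moment. -/
lemma fderiv_redE {h : Phase → ℝ} (hh : Rapid Ω I h) {x : V3} (hx : x ∈ Ω) {t : ℝ}
    (ht : t ∈ I) {μ : ℝ} (hμ : 0 < μ) (s : ℝ) (v : V3) (p q τ : ℝ) :
    fderiv ℝ (redE B h) (x, μ * ‖B x t‖ + s ^ 2 / 2, s, t) (v, p, q, τ)
      = fderiv ℝ (onReduced (red B h)) (x, μ, s, t)
        (v, ‖B x t‖⁻¹ * (p - s * q)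
          - μ * ‖B x t‖⁻¹ * (inner ℝ (gradB B x t) v + τ * deriv (fun s => ‖B x s‖) t), q, τ) := by
  have hm := normB_ne (w := (x, t)) hB0 ⟨hx, ht⟩
  set y : GyroSpace := (x, μ * ‖B x t‖ + s ^ 2 / 2, s, t) with hy
  have hr := differentiableAt_onReduced hΩ hI hB hB0 hh hx ht hμ s
  have hn := differentiableAt_of_contDiffOn hΩ hI (contDiffOn_normB hB hB0) (w := (x, t)) ⟨hx, ht⟩
  have h1 : HasFDerivAt (fun y : GyroSpace => ((y.1, y.2.2.2) : SpaceTime))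
      ((ContinuousLinearMap.fst ℝ V3 (ℝ × ℝ × ℝ)).prod ((ContinuousLinearMap.snd ℝ ℝ ℝ).comp
        ((ContinuousLinearMap.snd ℝ ℝ (ℝ × ℝ)).comp
          (ContinuousLinearMap.snd ℝ V3 (ℝ × ℝ × ℝ))))) y :=
    ((ContinuousLinearMap.fst ℝ V3 (ℝ × ℝ × ℝ)).prod ((ContinuousLinearMap.snd ℝ ℝ ℝ).comp
        ((ContinuousLinearMap.snd ℝ ℝ (ℝ × ℝ)).comp
          (ContinuousLinearMap.snd ℝ V3 (ℝ × ℝ × ℝ))))).hasFDerivAt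
  have h2 : HasFDerivAt (fun y : GyroSpace => y.2.1)
      ((ContinuousLinearMap.fst ℝ ℝ (ℝ × ℝ)).comp (ContinuousLinearMap.snd ℝ V3 (ℝ × ℝ × ℝ))) y :=
    ((ContinuousLinearMap.fst ℝ ℝ (ℝ × ℝ)).comp (ContinuousLinearMap.snd ℝ V3 (ℝ × ℝ × ℝ))).hasFDerivAt
  have h3 : HasFDerivAt (fun y : GyroSpace => y.2.2.1)
      ((ContinuousLinearMap.fst ℝ ℝ ℝ).comp ((ContinuousLinearMap.snd ℝ ℝ (ℝ × ℝ)).comp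
        (ContinuousLinearMap.snd ℝ V3 (ℝ × ℝ × ℝ)))) y :=
    ((ContinuousLinearMap.fst ℝ ℝ ℝ).comp ((ContinuousLinearMap.snd ℝ ℝ (ℝ × ℝ)).comp
        (ContinuousLinearMap.snd ℝ V3 (ℝ × ℝ × ℝ)))).hasFDerivAt
  have h4 : HasFDerivAt (fun y : GyroSpace => y.2.2)
      ((ContinuousLinearMap.snd ℝ ℝ (ℝ × ℝ)).comp (ContinuousLinearMap.snd ℝ V3 (ℝ × ℝ × ℝ))) y :=
    ((ContinuousLinearMap.snd ℝ ℝ (ℝ × ℝ)).comp (ContinuousLinearMap.snd ℝ V3 (ℝ × ℝ × ℝ))).hasFDerivAt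
  have h5 := (hasDerivAt_inv hm).comp_hasFDerivAt y
    (HasFDerivAt.comp (f := fun y : GyroSpace => ((y.1, y.2.2.2) : SpaceTime)) y hn.hasFDerivAt h1)
  have h6 := h5.mul (h2.sub (h3.mul (h3.mul_const (1 / 2))))
  have h7 := hasFDerivAt_fst.prodMk (h6.prodMk h4)
  have hκ : HasFDerivAt (fun y : GyroSpace => ((y.1, ‖B y.1 y.2.2.2‖⁻¹ *
      (y.2.1 - y.2.2.1 * (y.2.2.1 * (1 / 2))), y.2.2) : GyroSpace)) _ y := h7
  have hval : ((y.1, ‖B y.1 y.2.2.2‖⁻¹ * (y.2.1 - y.2.2.1 * (y.2.2.1 * (1 / 2))), y.2.2) :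
      GyroSpace) = (x, μ, s, t) := by
    simp only [hy]
    refine Prod.ext rfl (Prod.ext ?_ rfl)
    have hm' : ‖B x t‖ ≠ 0 := hm
    dsimp only
    field_simp
    ring
  have hr' : HasFDerivAt (onReduced (red B h)) (fderiv ℝ (onReduced (red B h)) (x, μ, s, t))
      ((y.1, ‖B y.1 y.2.2.2‖⁻¹ * (y.2.1 - y.2.2.1 * (y.2.2.1 * (1 / 2))), y.2.2) :
      GyroSpace) := by
    rw [hval]; exact hr.hasFDerivAt
  have h8 : redE B h = fun y : GyroSpace => onReduced (red B h) (y.1, ‖B y.1 y.2.2.2‖⁻¹ *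
      (y.2.1 - y.2.2.1 * (y.2.2.1 * (1 / 2))), y.2.2) := by
    funext y
    rw [redE, onReduced]
    congr 2
    ring
  have h9 := (HasFDerivAt.comp (f := fun y : GyroSpace => ((y.1, ‖B y.1 y.2.2.2‖⁻¹ *
      (y.2.1 - y.2.2.1 * (y.2.2.1 * (1 / 2))), y.2.2) : GyroSpace)) y hr' hκ).fderiv
  have h11 : redE B h = onReduced (red B h) ∘ fun y : GyroSpace => ((y.1, ‖B y.1 y.2.2.2‖⁻¹ *
      (y.2.1 - y.2.2.1 * (y.2.2.1 * (1 / 2))), y.2.2) : GyroSpace) := h8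
  rw [h11, h9, ContinuousLinearMap.comp_apply]
  congr 1
  refine Prod.ext rfl (Prod.ext ?_ rfl)
  have hdm := fderiv_normB_spaceTime hΩ hI hB hB0 hx ht v τ
  have hm' : ‖B x t‖ ≠ 0 := hm
  rw [← hdm]
  simp only [ContinuousLinearMap.prod_apply, _root_.add_apply, _root_.smul_apply, _root_.sub_apply,
    ContinuousLinearMap.comp_apply, ContinuousLinearMap.coe_fst', ContinuousLinearMap.coe_snd',
    smul_eq_mul, hy, Function.comp_apply, Pi.sub_apply, Pi.mul_apply]
  field_simp
  ring

variable {F u v : SpaceTime → V3} {h₀ h₁ h₂ : Phase → ℝ}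
  (H : KineticHierarchy Ω I B F u v h₀ h₁ h₂)

omit hΩ hI hB in
/-- Every value of `(x, μ, s, t)` with `μ > 0` is attained. -/
lemma exists_gyro {x : V3} (hx : x ∈ Ω) {t : ℝ} (ht : t ∈ I) {μ : ℝ} (hμ : 0 < μ) (s : ℝ) :
    ∃ c : V3, parF B (x, c, t) = s ∧ perpEnergy (bdir B x t) c = μ * ‖B x t‖ ∧
      gyroVars B (x, c, t) = (x, μ * ‖B x t‖ + s ^ 2 / 2, s, t) := by
  have hb := norm_bdir (hB0 x hx t ht)
  have hm := norm_pos_iff.2 (hB0 x hx t ht)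
  let a := perpVec (bdir B x t)
  let c : V3 := s • bdir B x t + √(2 * μ * ‖B x t‖) • a
  have h1 : parF B (x, c, t) = s := inner_gyro hb (inner_perpVec _) _ _
  have h2 : ‖c‖ ^ 2 = _ := norm_sq_gyro hb (norm_perpVec _) (inner_perpVec _) _ _
  rw [Real.sq_sqrt (by positivity)] at h2
  have h1' : (inner ℝ c (bdir B x t) : ℝ) = s := h1
  refine ⟨c, h1, ?_, ?_⟩
  · rw [perpEnergy, h1', h2]; ring
  · rw [gyroVars, h1, kinF, real_inner_self_eq_norm_sq, h2]
    refine Prod.ext rfl (Prod.ext ?_ rfl)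
    dsimp only
    ring

include H
variable {x : V3} (hx : x ∈ Ω) {t : ℝ} (ht : t ∈ I)
  (hdivB : dvg (fun y => B y t) x = 0) {μ : ℝ} (hμ : 0 < μ) (s : ℝ)
include hx ht hdivB hμ

omit H in
lemma fderiv_redE_streamAvg {h : Phase → ℝ} (hh : Rapid Ω I h) {c : V3}
    (h1 : parF B (x, c, t) = s) (h2 : perpEnergy (bdir B x t) c = μ * ‖B x t‖) :
    fderiv ℝ (redE B h) (x, μ * ‖B x t‖ + s ^ 2 / 2, s, t) (streamAvg B F (x, c, t))
      = fderiv ℝ (onReduced (red B h)) (x, μ, s, t)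
        (s • bdir B x t, 0, inner ℝ (F (x, t)) (bdir B x t) + μ * ‖B x t‖ * divb B x t, 0) := by
  have hm : ‖B x t‖ ≠ 0 := normB_ne (w := (x, t)) hB0 ⟨hx, ht⟩
  have hd := normB_mul_divb hΩ hI hB hB0 hx ht hdivB
  rw [streamAvg, fderiv_redE hΩ hI hB hB0 hh hx ht hμ]
  simp only [h1, h2, foot_apply]
  congr 1
  refine Prod.ext rfl (Prod.ext ?_ rfl)
  dsimp only
  rw [inner_smul_right]
  field_simp
  linear_combination (-(μ * s)) * hd

lemma KineticHierarchy.reduced_constraint : fderiv ℝ (onReduced (red B h₀)) (x, μ, s, t)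
    (s • bdir B x t, 0, inner ℝ (F (x, t)) (bdir B x t) + μ * ‖B x t‖ * divb B x t, 0) = 0 := by
  obtain ⟨c, h1, h2, h3⟩ := exists_gyro hB0 hx ht hμ s
  have hm : 0 < ‖B x t‖ := norm_pos_iff.2 (hB0 x hx t ht)
  have h := H.streamAvg_zeroth hΩ hI hB hB0 (w := (x, t)) ⟨hx, ht⟩ (c := c)
    (by rw [h2]; positivity)
  rw [h3, fderiv_redE_streamAvg hΩ hI hB hB0 hx ht hdivB hμ s H.rapid₀ h1 h2] at h
  exact h

lemma KineticHierarchy.reduced_transport {𝒢 : RDistr}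
    (hforce : ∀ x ∈ Ω, ∀ t ∈ I, DriftKinetic.force B 𝒢 x t = F (x, t)) {u' : VField} (hu' : onSpaceTime u' = u) :
    fderiv ℝ (onReduced (red B h₀)) (x, μ, s, t)
        (driftX B u' 𝒢 x μ s t, μ * rateMu B u' 𝒢 x μ s t, s * rateC B u' 𝒢 x μ t, 1)
      + fderiv ℝ (onReduced (red B h₁)) (x, μ, s, t)
        (s • bdir B x t, 0, inner ℝ (F (x, t)) (bdir B x t) + μ * ‖B x t‖ * divb B x t, 0)
      = 0 := by
  obtain ⟨c, h1, h2, h3⟩ := exists_gyro hB0 hx ht hμ s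
  have hm : 0 < ‖B x t‖ := norm_pos_iff.2 (hB0 x hx t ht)
  have hm' : ‖B x t‖ ≠ 0 := hm.ne'
  have h := H.transport hΩ hI hB hB0 (w := (x, t)) ⟨hx, ht⟩ (c := c) (by rw [h2]; positivity)
  rw [h3, fderiv_redE_streamAvg hΩ hI hB hB0 hx ht hdivB hμ s H.rapid₁ h1 h2] at h
  refine Eq.trans ?_ h
  congr 1
  rw [slowAvg, oscAvg, Prod.mk_sub_mk, Prod.mk_sub_mk, Prod.mk_sub_mk,
    fderiv_redE hΩ hI hB hB0 H.rapid₀ hx ht hμ]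
  simp only [h1, h2, foot_apply, sub_zero]
  have hb := (bdir_slice hΩ hI hB hB0 hx ht).differentiableAt (by simp)
  have hf := (fvec_slice hΩ hI hB hB0 hx ht).differentiableAt (by simp)
  have hFx : DifferentiableAt ℝ (fun y => F (y, t)) x :=
    differentiableAt_slice hΩ hI H.force hx ht
  subst hu'
  have hux := differentiableAt_of_contDiffOn hΩ hI H.bulk (w := (x, t)) ⟨hx, ht⟩
  have hst : (inner ℝ (fderiv ℝ (onSpaceTime u') (x, t) (bdir B x t, 0)) (bdir B x t) : ℝ)
      = stretch B u' x t := by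
    rw [stretch, ← fderiv_slice_space hux]; rfl
  have hdu : dvg (fun y => onSpaceTime u' (y, t)) x = dvg (fun y => u' y t) x := rfl
  have hcurl := curl_invBb hΩ hI hB hB0 hx ht
  have hφ : dvg (fun y => invBf B (y, t)) x = ‖B x t‖⁻¹ * dvg (fun y => fvec B y t) x
      - ‖B x t‖⁻¹ ^ 2 * inner ℝ (gradB B x t) (fvec B x t) :=
    dvg_invB_smul hΩ hI hB hB0 hx ht hf
  have hdF : dvg (fun y => driftF B F (y, t)) x
      = ‖B x t‖⁻¹ * dvg (fun y => cross (bdir B y t) (F (y, t))) x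
      - ‖B x t‖⁻¹ ^ 2 * inner ℝ (gradB B x t) (cross (bdir B x t) (F (x, t))) := by
    rw [← dvg_invB_smul hΩ hI hB hB0 hx ht (hb.cross hFx)]
    refine congrArg (fun f => dvg f x) ?_
    funext y
    rw [driftF, invBb, cross_smul_left]
  have hX : driftX B u' 𝒢 x μ s t = onSpaceTime u' (x, t) - (driftF B F (x, t)
      - s ^ 2 • invBf B (x, t)
      - (μ * ‖B x t‖) • (curl (fun y => invBb B (y, t)) x - invBf B (x, t))) := by
    rw [driftX_eq hx ht hforce, hcurl, driftF, invBb, cross_smul_left, invBf, onSpaceTime]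
    simp only [smul_sub, smul_add, smul_smul]
    have e1 : μ * ‖B x t‖ * ‖B x t‖⁻¹ = μ := by field_simp
    have e2 : μ * ‖B x t‖ * ‖B x t‖⁻¹ ^ 2 = μ * ‖B x t‖⁻¹ := by field_simp
    rw [e1, e2]
    module
  have hgX : inner ℝ (gradB B x t) (driftX B u' 𝒢 x μ s t)
      = inner ℝ (gradB B x t) (u' x t)
        + μ * inner ℝ (gradB B x t) (curl (fun y => bdir B y t) x)
        - ‖B x t‖⁻¹ * inner ℝ (gradB B x t) (cross (bdir B x t) (F (x, t)))
        + (s ^ 2 * ‖B x t‖⁻¹ - μ) * inner ℝ (gradB B x t) (fvec B x t) := by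
    rw [driftX_eq hx ht hforce]
    simp only [inner_add_right, inner_sub_right, inner_smul_right, inner_cross_self_right]
    ring
  have hFf : (inner ℝ (F (x, t)) (invBf B (x, t)) : ℝ)
      = ‖B x t‖⁻¹ * inner ℝ (F (x, t)) (fvec B x t) := by
    rw [invBf, inner_smul_right]
  rw [← hX, hgX, hst, hdu, hφ, hdF, hFf, rateMu_eq hΩ hI hB hB0 hx ht H.force hforce,
    rateC_eq hx ht hforce]
  congr 1
  refine Prod.ext rfl (Prod.ext ?_ (Prod.ext ?_ rfl))
  · dsimp only
    field_simp
    ring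
  · dsimp only
    field_simp
    ring

end
end

section

/-! ### Velocity moments of the kinetic hierarchy -/

variable {Ω : Set V3} {I : Set ℝ} {B : VField} {w : SpaceTime}

lemma fderiv_mul_apply_phase {f g : Phase → ℝ} {z : Phase} (hf : DifferentiableAt ℝ f z)
    (hg : DifferentiableAt ℝ g z) (d : Phase) :
    fderiv ℝ (fun z => f z * g z) z d = f z * fderiv ℝ g z d + fderiv ℝ f z d * g z := by
  rw [fderiv_fun_mul hf hg]
  simp only [_root_.add_apply, _root_.smul_apply, smul_eq_mul]
  ring

section Linear
variable {G : Type} [NormedAddCommGroup G] [NormedSpace ℝ G]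

lemma velInt_congr {f g : Phase → G} (h : ∀ c, f (w.1, c, w.2) = g (w.1, c, w.2)) :
    velInt f w = velInt g w := integral_congr_ae (Eventually.of_forall h)

lemma velInt_add {f g : Phase → G} (hf : Rapid Ω I f) (hg : Rapid Ω I g) (hw : w ∈ Ω ×ˢ I) :
    velInt (fun z => f z + g z) w = velInt f w + velInt g w :=
  integral_add (hf.integrable hw) (hg.integrable hw)

lemma velInt_sub {f g : Phase → G} (hf : Rapid Ω I f) (hg : Rapid Ω I g) (hw : w ∈ Ω ×ˢ I) :
    velInt (fun z => f z - g z) w = velInt f w - velInt g w :=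
  integral_sub (hf.integrable hw) (hg.integrable hw)

lemma velInt_mul_const (f : Phase → ℝ) (r : ℝ) (w : SpaceTime) :
    velInt (fun z => f z * r) w = velInt f w * r := integral_mul_const r _

lemma inner_velInt {f : Phase → V3} (hf : Rapid Ω I f) (hw : w ∈ Ω ×ˢ I) (a : V3) :
    inner ℝ a (velInt f w) = velInt (fun z => inner ℝ a (f z)) w :=
  ((innerL a).integral_comp_comm (hf.integrable hw)).symm

end Linear

variable (hΩ : IsOpen Ω) (hI : IsOpen I)

section Directions
include hΩ hI
variable {G : Type} [NormedAddCommGroup G] [NormedSpace ℝ G]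

lemma Moderate.along {f : Phase → G} {d : Phase → Phase} (hf : Moderate Ω I f)
    (hd : Moderate Ω I d) : Moderate Ω I (fun z => fderiv ℝ f z (d z)) :=
  Moderate.bilin hΩ hI (ContinuousLinearMap.id ℝ (Phase →L[ℝ] G)) (hf.differential hΩ hI) hd

lemma Rapid.along {f : Phase → G} {d : Phase → Phase} (hf : Rapid Ω I f)
    (hd : Moderate Ω I d) : Rapid Ω I (fun z => fderiv ℝ f z (d z)) :=
  Rapid.bilin hΩ hI (ContinuousLinearMap.id ℝ (Phase →L[ℝ] G)).flip hd (hf.differential hΩ hI)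

lemma moderate_streamDir {F : SpaceTime → V3} (hF : ContDiffOn ℝ ∞ F (Ω ×ˢ I)) :
    Moderate Ω I (streamDir F) := by
  have h := Moderate.add hΩ hI
    (Moderate.clm hΩ hI (ContinuousLinearMap.inl ℝ V3 (V3 × ℝ)) (Moderate.vel (Ω := Ω) (I := I)))
    (Moderate.clm hΩ hI ((ContinuousLinearMap.inr ℝ V3 (V3 × ℝ)).comp
      (ContinuousLinearMap.inl ℝ V3 ℝ)) (Moderate.field hΩ hI hF))
  convert h using 2 with z
  simp [streamDir]

lemma moderate_gyroDir (hB : ContDiffOn ℝ ∞ (onSpaceTime B) (Ω ×ˢ I)) :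
    Moderate Ω I (gyroDir B) := by
  have h := Moderate.clm hΩ hI ((ContinuousLinearMap.inr ℝ V3 (V3 × ℝ)).comp
      (ContinuousLinearMap.inl ℝ V3 ℝ)) (Moderate.cross hΩ hI (Moderate.vel (Ω := Ω) (I := I))
        (Moderate.field hΩ hI hB))
  convert h using 2 with z
  simp [gyroDir, onSpaceTime]

lemma moderate_slowDir {u : SpaceTime → V3} (hu : ContDiffOn ℝ ∞ u (Ω ×ˢ I)) :
    Moderate Ω I (slowDir u) := by
  have hdu : ContDiffOn ℝ ∞ (fderiv ℝ u) (Ω ×ˢ I) :=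
    hu.fderiv_of_isOpen (hΩ.prod hI) (by simp)
  have h1 := Moderate.clm hΩ hI (ContinuousLinearMap.inl ℝ V3 (V3 × ℝ)) (Moderate.field hΩ hI hu)
  have h2 := Moderate.bilin hΩ hI (ContinuousLinearMap.id ℝ (SpaceTime →L[ℝ] V3))
    (Moderate.field hΩ hI hdu)
    (Moderate.clm hΩ hI (ContinuousLinearMap.inl ℝ V3 ℝ) (Moderate.vel (Ω := Ω) (I := I)))
  have h3 := Moderate.clm hΩ hI (-(ContinuousLinearMap.inr ℝ V3 (V3 × ℝ)).comp
      (ContinuousLinearMap.inl ℝ V3 ℝ)) h2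
  have h := Moderate.add hΩ hI (Moderate.add hΩ hI h1 h3)
    (Moderate.const ((0, 0, 1) : Phase))
  convert h using 2 with z
  simp [slowDir]

lemma Rapid.differentiableAt {f : Phase → G} (hf : Rapid Ω I f) (hw : w ∈ Ω ×ˢ I) (c : V3) :
    DifferentiableAt ℝ f (w.1, c, w.2) :=
  (hf.1.contDiffAt (phase_nhds hΩ hI (z := (w.1, c, w.2)) hw)).differentiableAt (by simp)

lemma Moderate.differentiableAt {f : Phase → G} (hf : Moderate Ω I f) (hw : w ∈ Ω ×ˢ I) (c : V3) :
    DifferentiableAt ℝ f (w.1, c, w.2) :=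
  (hf.1.contDiffAt (phase_nhds hΩ hI (z := (w.1, c, w.2)) hw)).differentiableAt (by simp)

/-- The momentum-weighted form of the streaming. -/
lemma Rapid.velInt_stream {k : Phase → ℝ} (hk : Rapid Ω I k) (F : SpaceTime → V3)
    (hw : w ∈ Ω ×ˢ I) :
    velInt (fun z => fderiv ℝ k z (streamDir F z)) w
      = ∑ j, fderiv ℝ (velInt (fun z => k z * z.2.1 j)) w (e j, 0) := by
  have hkj : ∀ j, Rapid Ω I (fun z => k z * z.2.1 j) := fun j =>
    hk.mul_moderate hΩ hI (moderate_coord hΩ hI j)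
  have h1 : ∀ (c : V3) (j : Fin 3), fderiv ℝ (fun z : Phase => k z * z.2.1 j) (w.1, c, w.2)
      (e j, 0, 0) = c j * fderiv ℝ k (w.1, c, w.2) (e j, 0, 0) := by
    intro c j
    have hc := (Moderate.differentiableAt hΩ hI (moderate_coord hΩ hI j) hw c)
    have h2 : fderiv ℝ (fun z : Phase => z.2.1 j) (w.1, c, w.2) (e j, 0, 0) = 0 := by
      rw [fderiv_coord (differentiableAt_vel _), fderiv_vel]
      rfl
    rw [fderiv_mul_apply_phase (hk.differentiableAt hΩ hI hw c) hc, h2]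
    ring
  have hj : ∀ j : Fin 3, Integrable
      (fun c : V3 => c j * fderiv ℝ k (w.1, c, w.2) (e j, 0, 0)) := fun j => by
    have := (Rapid.mul_moderate hΩ hI (hk.along hΩ hI (Moderate.const ((e j, 0, 0) : Phase)))
      (moderate_coord hΩ hI j)).integrable hw
    simpa only [mul_comm] using this
  have h5 : ∀ c : V3, fderiv ℝ k (w.1, c, w.2) (streamDir F (w.1, c, w.2))
      = (∑ j, c j * fderiv ℝ k (w.1, c, w.2) (e j, 0, 0))
        + fderiv ℝ k (w.1, c, w.2) (0, F w, 0) := by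
    intro c
    have h6 : streamDir F (w.1, c, w.2) = (ContinuousLinearMap.inl ℝ V3 (V3 × ℝ)) c
        + (0, F w, 0) := by simp [streamDir]
    rw [h6, map_add]
    congr 1
    have h8 := congrArg ((fderiv ℝ k (w.1, c, w.2)).comp (ContinuousLinearMap.inl ℝ V3 (V3 × ℝ)))
      (sum_smul_e c)
    rw [map_sum] at h8
    simp only [map_smul, smul_eq_mul, ContinuousLinearMap.comp_apply,
      ContinuousLinearMap.inl_apply] at h8 ⊢
    exact h8.symm
  have h7 : Integrable (fun c : V3 => fderiv ℝ k (w.1, c, w.2) (0, F w, 0)) :=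
    (hk.along hΩ hI (Moderate.const ((0, F w, 0) : Phase))).integrable hw
  rw [velInt]
  simp only [h5]
  rw [integral_add (integrable_finsetSum _ fun j _ => hj j) h7, integral_finsetSum _ fun j _ => hj j,
    hk.integral_fderiv_vel hΩ hI hw, add_zero]
  refine Finset.sum_congr rfl fun j _ => ?_
  rw [(hkj j).fderiv_velInt_apply hΩ hI hw]
  exact integral_congr_ae (Eventually.of_forall fun c => (h1 c j).symm)

lemma sum_fderiv_velInt_coord {k : Phase → ℝ} (hk : Rapid Ω I k) (hw : w ∈ Ω ×ˢ I) :
    ∑ j, fderiv ℝ (velInt (fun z => k z * z.2.1 j)) w (e j, 0)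
      = dvg (fun y => velInt (fun z => k z • z.2.1) (y, w.2)) w.1 := by
  have hr : Rapid Ω I (fun z => k z • z.2.1) := hk.smul_moderate hΩ hI Moderate.vel
  have hd := (hr.hasFDerivAt_velInt hΩ hI hw).differentiableAt
  rw [dvg_field hd]
  refine Finset.sum_congr rfl fun j _ => ?_
  rw [inner_e, ← fderiv_coord hd]
  congr 1
  refine fderiv_eq_of_eqOn hΩ hI (fun y hy => ?_) hw
  rw [← inner_e, inner_velInt hr hy]
  exact velInt_congr fun c => by rw [inner_smul_right, inner_e]

/-- The slow transport in conservative form. -/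
lemma Rapid.velInt_slow {k : Phase → ℝ} (hk : Rapid Ω I k) {u : SpaceTime → V3}
    (hu : ContDiffOn ℝ ∞ u (Ω ×ˢ I)) (hw : w ∈ Ω ×ˢ I) :
    velInt (fun z => fderiv ℝ k z (slowDir u z)) w
      = fderiv ℝ (velInt k) w (0, 1)
        + dvg (fun y => velInt k (y, w.2) • u (y, w.2)) w.1 := by
  have hdu := differentiableAt_of_contDiffOn hΩ hI hu hw
  have hdk := (hk.hasFDerivAt_velInt hΩ hI hw).differentiableAt
  let a : Fin 3 → V3 := fun j => fderiv ℝ u w (e j, 0)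
  have hkj : ∀ j, Rapid Ω I (fun z => k z * z.2.1 j) := fun j =>
    hk.mul_moderate hΩ hI (moderate_coord hΩ hI j)
  have h1 : ∀ (c : V3) (j : Fin 3), fderiv ℝ (fun z : Phase => k z * z.2.1 j) (w.1, c, w.2)
      (0, a j, 0) = c j * fderiv ℝ k (w.1, c, w.2) (0, a j, 0) + k (w.1, c, w.2) * a j j := by
    intro c j
    have hc := (Moderate.differentiableAt hΩ hI (moderate_coord hΩ hI j) hw c)
    have h2 : fderiv ℝ (fun z : Phase => z.2.1 j) (w.1, c, w.2) (0, a j, 0) = a j j := by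
      rw [fderiv_coord (differentiableAt_vel _), fderiv_vel]
    rw [fderiv_mul_apply_phase (hk.differentiableAt hΩ hI hw c) hc, h2]
    ring
  have h5 : ∀ c : V3, fderiv ℝ k (w.1, c, w.2) (slowDir u (w.1, c, w.2))
      = fderiv ℝ k (w.1, c, w.2) (u w, 0, 1) + (k (w.1, c, w.2) * (∑ j, a j j)
        - ∑ j, fderiv ℝ (fun z : Phase => k z * z.2.1 j) (w.1, c, w.2) (0, a j, 0)) := by
    intro c
    have h6 : slowDir u (w.1, c, w.2) = (u w, 0, 1) - ∑ j, c j • ((0, a j, 0) : Phase) := by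
      have h7 : fderiv ℝ u w (c, 0) = ∑ j, c j • a j := by
        have h8 := congrArg ((fderiv ℝ u w).comp (ContinuousLinearMap.inl ℝ V3 ℝ)) (sum_smul_e c)
        rw [map_sum] at h8
        simpa using h8.symm
      have h9 : (∑ j, c j • ((0, a j, 0) : Phase)) = (0, ∑ j, c j • a j, 0) := by
        have := map_sum ((ContinuousLinearMap.inr ℝ V3 (V3 × ℝ)).comp
          (ContinuousLinearMap.inl ℝ V3 ℝ)) (fun j => c j • a j) Finset.univ
        simp only [map_smul] at this
        exact this.symm
      rw [h9, ← h7]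
      simp [slowDir]
    rw [h6, map_sub, map_sum, Finset.sum_congr rfl fun j _ => h1 c j, Finset.sum_add_distrib,
      Finset.mul_sum]
    simp only [map_smul, smul_eq_mul]
    ring
  have i1 : Integrable (fun c : V3 => fderiv ℝ k (w.1, c, w.2) (u w, 0, 1)) :=
    (hk.along hΩ hI (Moderate.const ((u w, 0, 1) : Phase))).integrable hw
  have i2 : Integrable (fun c : V3 => k (w.1, c, w.2) * (∑ j, a j j)) :=
    (hk.integrable hw).mul_const _
  have i3 : ∀ j, Integrable (fun c : V3 => fderiv ℝ (fun z : Phase => k z * z.2.1 j)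
      (w.1, c, w.2) (0, a j, 0)) := fun j =>
    ((hkj j).along hΩ hI (Moderate.const ((0, a j, 0) : Phase))).integrable hw
  rw [velInt]
  simp only [h5]
  have i4 : Integrable (fun c : V3 => k (w.1, c, w.2) * (∑ j, a j j)
      - ∑ j, fderiv ℝ (fun z : Phase => k z * z.2.1 j) (w.1, c, w.2) (0, a j, 0)) :=
    i2.sub (integrable_finsetSum _ fun j _ => i3 j)
  rw [integral_add i1 i4,
    integral_sub i2 (integrable_finsetSum _ fun j _ => i3 j), integral_finsetSum _ fun j _ => i3 j,
    Finset.sum_congr rfl fun j _ => (hkj j).integral_fderiv_vel hΩ hI hw (a j),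
    Finset.sum_const_zero, sub_zero, integral_mul_const,
    ← hk.fderiv_velInt_apply hΩ hI hw (u w, 1)]
  have hk' : DifferentiableAt ℝ (fun y => velInt k (y, w.2)) w.1 :=
    hdk.comp (f := fun y : V3 => ((y, w.2) : SpaceTime)) w.1
      (differentiableAt_id.prodMk (differentiableAt_const _))
  have hu' : DifferentiableAt ℝ (fun y => u (y, w.2)) w.1 :=
    hdu.comp (f := fun y : V3 => ((y, w.2) : SpaceTime)) w.1
      (differentiableAt_id.prodMk (differentiableAt_const _))
  rw [dvg_smul hk' hu', dvg_field hdu, fderiv_field_space hdk]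
  have h10 : ((u w, 1) : SpaceTime) = (0, 1) + (u w, 0) := by simp
  rw [h10, map_add]
  simp only [inner_e]
  have h11 : velInt k w = ∫ c : V3, k (w.1, c, w.2) := rfl
  rw [← h11, show ((w.1, w.2) : SpaceTime) = w from rfl]
  ring

variable (hB : ContDiffOn ℝ ∞ (onSpaceTime B) (Ω ×ˢ I)) (hB0 : ∀ x ∈ Ω, ∀ t ∈ I, B x t ≠ 0)
include hB0

omit hΩ hI in
/-- Velocity integrals only see gyro-averages. -/
lemma velInt_eq_of_circAvg {f g : Phase → ℝ} (hf : Rapid Ω I f) (hg : Rapid Ω I g)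
    (hw : w ∈ Ω ×ˢ I) (h : ∀ c, circAvg (bdir B w.1 w.2) (fun c => f (w.1, c, w.2)) c
      = circAvg (bdir B w.1 w.2) (fun c => g (w.1, c, w.2)) c) : velInt f w = velInt g w := by
  rw [show w = (w.1, w.2) from rfl, velInt_eq_red hB0 hf hw.1 hw.2, velInt_eq_red hB0 hg hw.1 hw.2]
  simp only [weighted, red, h]

/-- In a velocity integral against a rotation-invariant function, a weight can be replaced by its
gyro-average. -/
lemma velInt_mul_avg {k X X' : Phase → ℝ} (hk : Rapid Ω I k) (hX : Moderate Ω I X)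
    (hX' : Moderate Ω I X') (hw : w ∈ Ω ×ˢ I)
    (hinv : ∀ c θ, k (w.1, rot (bdir B w.1 w.2) θ c, w.2) = k (w.1, c, w.2))
    (h : ∀ c, circAvg (bdir B w.1 w.2) (fun c => X (w.1, c, w.2)) c = X' (w.1, c, w.2)) :
    velInt (fun z => k z * X z) w = velInt (fun z => k z * X' z) w := by
  refine velInt_eq_of_circAvg hB0 (hk.mul_moderate hΩ hI hX) (hk.mul_moderate hΩ hI hX') hw
    fun c => ?_
  have e1 : circAvg (bdir B w.1 w.2) (fun c => k (w.1, c, w.2) * X (w.1, c, w.2)) c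
      = circAvg (bdir B w.1 w.2) (fun c' => k (w.1, c, w.2) * X (w.1, c', w.2)) c :=
    circAvg_congr fun θ => by rw [hinv]
  rw [e1, circAvg_const_mul, h]
  refine (circAvg_of_eq fun θ => ?_).symm
  rw [hinv, ← h c, ← h, circAvg_rot (unit_bdir hB0 hw)]

include hB

lemma Rapid.velInt_gyro {k : Phase → ℝ} (hk : Rapid Ω I k) (hw : w ∈ Ω ×ˢ I) :
    velInt (fun z => fderiv ℝ k z (gyroDir B z)) w = 0 := by
  have h0 : Rapid Ω I (fun z => k z * 0) := hk.mul_moderate hΩ hI (Moderate.const 0)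
  have h := velInt_eq_of_circAvg hB0 (hk.along hΩ hI (moderate_gyroDir hΩ hI hB)) h0 hw fun c => by
    rw [avg_gyro hB0 hw fun θ => (hk.1.contDiffAt (phase_nhds hΩ hI
      (z := (w.1, rot (bdir B w.1 w.2) θ c, w.2)) hw)).of_le (by exact_mod_cast le_top)]
    exact (circAvg_of_eq fun θ => by ring).symm
  rw [h]
  simp [velInt]

/-- The gyration is skew-symmetric. -/
lemma velInt_gyro_mul {k X : Phase → ℝ} (hk : Rapid Ω I k) (hX : Moderate Ω I X)
    (hw : w ∈ Ω ×ˢ I) : velInt (fun z => k z * fderiv ℝ X z (gyroDir B z)) w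
      = -velInt (fun z => fderiv ℝ k z (gyroDir B z) * X z) w := by
  have h := (hk.mul_moderate hΩ hI hX).velInt_gyro hΩ hI hB hB0 hw
  have hd := moderate_gyroDir hΩ hI hB
  have h1 : velInt (fun z => fderiv ℝ (fun z => k z * X z) z (gyroDir B z)) w
      = velInt (fun z => k z * fderiv ℝ X z (gyroDir B z)
        + fderiv ℝ k z (gyroDir B z) * X z) w := by
    exact velInt_congr fun c => fderiv_mul_apply_phase (hk.differentiableAt hΩ hI hw c)
      (hX.differentiableAt hΩ hI hw c) _
  rw [h1, velInt_add (hk.mul_moderate hΩ hI (hX.along hΩ hI hd))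
    ((hk.along hΩ hI hd).mul_moderate hΩ hI hX) hw] at h
  linarith

omit hB hB0 in
lemma velInt_stream_mul {k X : Phase → ℝ} (hk : Rapid Ω I k) (hX : Moderate Ω I X)
    {F : SpaceTime → V3} (hF : ContDiffOn ℝ ∞ F (Ω ×ˢ I)) (hw : w ∈ Ω ×ˢ I) :
    velInt (fun z => fderiv ℝ k z (streamDir F z) * X z) w
      = ∑ j, fderiv ℝ (velInt (fun z => k z * X z * z.2.1 j)) w (e j, 0)
        - velInt (fun z => k z * fderiv ℝ X z (streamDir F z)) w := by
  have h := (hk.mul_moderate hΩ hI hX).velInt_stream hΩ hI F hw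
  have hd := moderate_streamDir hΩ hI hF
  have h1 : velInt (fun z => fderiv ℝ (fun z => k z * X z) z (streamDir F z)) w
      = velInt (fun z => k z * fderiv ℝ X z (streamDir F z)
        + fderiv ℝ k z (streamDir F z) * X z) w := by
    exact velInt_congr fun c => fderiv_mul_apply_phase (hk.differentiableAt hΩ hI hw c)
      (hX.differentiableAt hΩ hI hw c) _
  rw [h1, velInt_add (hk.mul_moderate hΩ hI (hX.along hΩ hI hd))
    ((hk.along hΩ hI hd).mul_moderate hΩ hI hX) hw] at h
  linarith

omit hB hB0 in
lemma velInt_slow_mul {k X : Phase → ℝ} (hk : Rapid Ω I k) (hX : Moderate Ω I X)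
    {u : SpaceTime → V3} (hu : ContDiffOn ℝ ∞ u (Ω ×ˢ I)) (hw : w ∈ Ω ×ˢ I) :
    velInt (fun z => fderiv ℝ k z (slowDir u z) * X z) w
      = fderiv ℝ (velInt (fun z => k z * X z)) w (0, 1)
        + dvg (fun y => velInt (fun z => k z * X z) (y, w.2) • u (y, w.2)) w.1
        - velInt (fun z => k z * fderiv ℝ X z (slowDir u z)) w := by
  have h := (hk.mul_moderate hΩ hI hX).velInt_slow hΩ hI hu hw
  have hd := moderate_slowDir hΩ hI hu
  have h1 : velInt (fun z => fderiv ℝ (fun z => k z * X z) z (slowDir u z)) w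
      = velInt (fun z => k z * fderiv ℝ X z (slowDir u z)
        + fderiv ℝ k z (slowDir u z) * X z) w := by
    exact velInt_congr fun c => fderiv_mul_apply_phase (hk.differentiableAt hΩ hI hw c)
      (hX.differentiableAt hΩ hI hw c) _
  rw [h1, velInt_add (hk.mul_moderate hΩ hI (hX.along hΩ hI hd))
    ((hk.along hΩ hI hd).mul_moderate hΩ hI hX) hw] at h
  linarith

omit hB hB0 in
lemma velInt_vel_mul {k X : Phase → ℝ} (hk : Rapid Ω I k) (hX : Moderate Ω I X)
    (hw : w ∈ Ω ×ˢ I) (a : V3) :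
    velInt (fun z => fderiv ℝ k z (0, a, 0) * X z) w
      = -velInt (fun z => k z * fderiv ℝ X z (0, a, 0)) w := by
  have h := (hk.mul_moderate hΩ hI hX).integral_fderiv_vel hΩ hI hw a
  have hd := Moderate.const (Ω := Ω) (I := I) ((0, a, 0) : Phase)
  have h1 : velInt (fun z => fderiv ℝ (fun z => k z * X z) z (0, a, 0)) w
      = velInt (fun z => k z * fderiv ℝ X z (0, a, 0)
        + fderiv ℝ k z (0, a, 0) * X z) w := by
    exact velInt_congr fun c => fderiv_mul_apply_phase (hk.differentiableAt hΩ hI hw c)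
      (hX.differentiableAt hΩ hI hw c) _
  rw [velInt_add (hk.mul_moderate hΩ hI (hX.along hΩ hI hd))
    ((hk.along hΩ hI hd).mul_moderate hΩ hI hX) hw] at h1
  have h2 : velInt (fun z => fderiv ℝ (fun z => k z * X z) z (0, a, 0)) w = 0 := h
  linarith

end Directions

end

section

/-! ### Balance laws of the rotation-invariant moments -/

variable {Ω : Set V3} {I : Set ℝ} {B : VField} {w : SpaceTime}

section
variable (hΩ : IsOpen Ω) (hI : IsOpen I) (hB : ContDiffOn ℝ ∞ (onSpaceTime B) (Ω ×ˢ I))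
  (hB0 : ∀ x ∈ Ω, ∀ t ∈ I, B x t ≠ 0)

/-- The half square of the perpendicular velocity as a function on phase space. -/
def perpF (B : VField) (z : Phase) : ℝ := kinF z - parF B z ^ 2 / 2

section
include hΩ hI hB hB0

lemma moderate_perpF : Moderate Ω I (perpF B) := by
  have h := Moderate.sub hΩ hI (moderate_kinF hΩ hI) (Moderate.mul hΩ hI
    ((moderate_parF hΩ hI hB hB0).pow hΩ hI 2) (Moderate.const (2⁻¹ : ℝ)))
  exact h

variable (hw : w ∈ Ω ×ˢ I)
include hw

omit hΩ hI hB in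
/-- The flux of `ThX` across the streaming is antisymmetric. -/
lemma avg_vel_thX (a v c : V3) : circAvg (bdir B w.1 w.2)
    (fun c => inner ℝ v c * inner ℝ a (thX B (w.1, c, w.2))) c
      = perpEnergy (bdir B w.1 w.2) c * inner ℝ a (cross (invBb B w) v) := by
  have hb := unit_bdir hB0 hw
  have h := circAvg_quadratic hb ((innerL v).smulRight ((innerL a) ∘L crossL (invBb B w))) c
  refine Eq.trans (circAvg_congr fun θ => ?_) (h.trans ?_)
  · simp [thX]
  · have h1 : cross (invBb B w) (bdir B w.1 w.2) = 0 := by simp [invBb, cross_smul_left, cross_self']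
    have h2 := congrArg ((innerL a) ∘L crossL (invBb B w)) (sum_smul_e v)
    rw [map_sum] at h2
    simp only [map_smul, smul_eq_mul, ContinuousLinearMap.comp_apply, innerL_apply,
      crossL_apply] at h2
    simp only [ContinuousLinearMap.smulRight_apply, _root_.smul_apply, smul_eq_mul,
      ContinuousLinearMap.comp_apply, innerL_apply, crossL_apply, h1, inner_zero_right, mul_zero,
      zero_add, sub_zero, real_inner_comm (e _) v, inner_e, h2]

end

variable {F u v : SpaceTime → V3} {h₀ h₁ h₂ : Phase → ℝ}
  (H : KineticHierarchy Ω I B F u v h₀ h₁ h₂)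

namespace KineticHierarchy
include hΩ hI hB hB0 H
variable (hw : w ∈ Ω ×ˢ I)
include hw

/-- The solvability condition of the second-order equation, tested against a gyro-invariant
weight `Ψ`. -/
theorem balance {Ψ : Phase → ℝ} (hΨ : Moderate Ω I Ψ)
    (hinv : ∀ z, foot z ∈ Ω ×ˢ I → fderiv ℝ Ψ z (gyroDir B z) = 0)
    (hV : velInt (fun z => h₀ z * fderiv ℝ Ψ z (0, cross (v w) (B w.1 w.2), 0)) w = 0) :
    fderiv ℝ (velInt (fun z => h₀ z * Ψ z)) w (0, 1)
      + dvg (fun y => velInt (fun z => h₀ z * Ψ z) (y, w.2) • u (y, w.2)) w.1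
      - velInt (fun z => h₀ z * fderiv ℝ Ψ z (slowDir u z)) w
      + dvg (fun y => velInt (fun z => (h₁ z * Ψ z) • z.2.1) (y, w.2)) w.1
      - velInt (fun z => h₁ z * fderiv ℝ Ψ z (streamDir F z)) w = 0 := by
  have e1 := velInt_slow_mul hΩ hI H.rapid₀ hΨ H.bulk hw
  have e2 := velInt_stream_mul hΩ hI H.rapid₁ hΨ H.force hw
  rw [sum_fderiv_velInt_coord hΩ hI (H.rapid₁.mul_moderate hΩ hI hΨ) hw] at e2
  have e3 := velInt_vel_mul hΩ hI H.rapid₀ hΨ hw (cross (v w) (B w.1 w.2))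
  have e4 := velInt_gyro_mul hΩ hI hB hB0 H.rapid₂ hΨ hw
  have e5 : velInt (fun z => h₂ z * fderiv ℝ Ψ z (gyroDir B z)) w = 0 := by
    rw [velInt_congr (g := fun _ => (0 : ℝ)) fun c => by rw [hinv (w.1, c, w.2) hw, mul_zero]]
    simp [velInt]
  have r1 := (H.rapid₀.along hΩ hI (moderate_slowDir hΩ hI H.bulk)).mul_moderate hΩ hI hΨ
  have r2 := (H.rapid₁.along hΩ hI (moderate_streamDir hΩ hI H.force)).mul_moderate hΩ hI hΨ
  have r3 := (H.rapid₀.along hΩ hI (Moderate.const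
    ((0, cross (v w) (B w.1 w.2), 0) : Phase))).mul_moderate hΩ hI hΨ
  have r4 := (H.rapid₂.along hΩ hI (moderate_gyroDir hΩ hI hB)).mul_moderate hΩ hI hΨ
  have e6 : ∀ c : V3, fderiv ℝ h₀ (w.1, c, w.2) (slowDir u (w.1, c, w.2)) * Ψ (w.1, c, w.2)
      = -(fderiv ℝ h₁ (w.1, c, w.2) (streamDir F (w.1, c, w.2)) * Ψ (w.1, c, w.2))
        - fderiv ℝ h₀ (w.1, c, w.2) (0, cross (v w) (B w.1 w.2), 0) * Ψ (w.1, c, w.2)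
        - fderiv ℝ h₂ (w.1, c, w.2) (gyroDir B (w.1, c, w.2)) * Ψ (w.1, c, w.2) := by
    intro c
    have := H.order₂ (w.1, c, w.2) hw
    simp only [foot_apply] at this
    linear_combination Ψ (w.1, c, w.2) * this
  have e7 : velInt (fun z => fderiv ℝ h₀ z (slowDir u z) * Ψ z) w
      = -velInt (fun z => fderiv ℝ h₁ z (streamDir F z) * Ψ z) w
        - velInt (fun z => fderiv ℝ h₀ z (0, cross (v w) (B w.1 w.2), 0) * Ψ z) w
        - velInt (fun z => fderiv ℝ h₂ z (gyroDir B z) * Ψ z) w := by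
    have i2 : Integrable (fun c : V3 => -(fderiv ℝ h₁ (w.1, c, w.2) (streamDir F (w.1, c, w.2))
        * Ψ (w.1, c, w.2))) := (r2.integrable hw).neg
    have i3 : Integrable (fun c : V3 => -(fderiv ℝ h₁ (w.1, c, w.2) (streamDir F (w.1, c, w.2))
        * Ψ (w.1, c, w.2)) - fderiv ℝ h₀ (w.1, c, w.2) (0, cross (v w) (B w.1 w.2), 0)
          * Ψ (w.1, c, w.2)) := i2.sub (r3.integrable hw)
    simp only [velInt, e6]
    rw [integral_sub i3 (r4.integrable hw), integral_sub i2 (r3.integrable hw), integral_neg]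
  linarith

/-- The flux of the moment with weight `Ψ`: a transport along the field lines, a curl (the
magnetization flux), a drift, and a term that compensates the oscillating part `Θ` of the change
of `Ψ` along the streaming. -/
theorem flux {Ψ Θ C : Phase → ℝ} (hΨ : Moderate Ω I Ψ) (hΘ : Moderate Ω I Θ) (hC : Moderate Ω I C)
    (hinv : ∀ z, foot z ∈ Ω ×ˢ I → fderiv ℝ Ψ z (gyroDir B z) = 0)
    (hstr : ∀ z, foot z ∈ Ω ×ˢ I →
      fderiv ℝ Ψ z (streamDir F z) = C z + fderiv ℝ Θ z (gyroDir B z))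
    (hCrot : ∀ c θ, C (w.1, rot (bdir B w.1 w.2) θ c, w.2) = C (w.1, c, w.2))
    (hΘavg : ∀ c, circAvg (bdir B w.1 w.2) (fun c => Θ (w.1, c, w.2)) c = 0) :
    velInt (fun z => (h₁ z * Ψ z) • z.2.1) w
      = velInt (fun z => h₁ z * Ψ z * parF B z) w • bdir B w.1 w.2
        - curl (fun y => velInt (fun z => h₀ z * Ψ z * perpF B z) (y, w.2) • invBb B (y, w.2)) w.1
        - velInt (fun z => (h₀ z * Ψ z) • fderiv ℝ (thX B) z (streamDir F z)) w
        + velInt (fun z => (h₀ z * Θ z) • z.2.1) w := by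
  have mpar := moderate_parF hΩ hI hB hB0
  have mX := moderate_thX hΩ hI hB hB0
  have mdX := mX.along hΩ hI (moderate_streamDir hΩ hI H.force)
  have hgyr := moderate_gyroDir hΩ hI hB
  have hstrm := moderate_streamDir hΩ hI H.force
  have r0Ψ := H.rapid₀.mul_moderate hΩ hI hΨ
  have r1Ψ := H.rapid₁.mul_moderate hΩ hI hΨ
  have r0Θ := H.rapid₀.mul_moderate hΩ hI hΘ
  have hrotΨ : ∀ y ∈ Ω ×ˢ I, ∀ c θ, Ψ (y.1, rot (bdir B y.1 y.2) θ c, y.2) = Ψ (y.1, c, y.2) :=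
    fun y hy c θ => gyro_invariant hB0 hy (fun θ => hΨ.differentiableAt hΩ hI hy _)
      (fun θ => hinv (y.1, rot (bdir B y.1 y.2) θ c, y.2) hy) θ
  have hrot0 := fun y (hy : y ∈ Ω ×ˢ I) => H.invariant hΩ hI hB0 hy
  have hcurl : DifferentiableAt ℝ (fun y => velInt (fun z => h₀ z * Ψ z * perpF B z) y
      • invBb B y) w :=
    ((r0Ψ.mul_moderate hΩ hI (moderate_perpF hΩ hI hB hB0)).hasFDerivAt_velInt hΩ hI
      hw).differentiableAt.smul (differentiableAt_of_contDiffOn hΩ hI (contDiffOn_invBb hB hB0) hw)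
  refine ext_inner_left ℝ fun a => ?_
  have mXa : Moderate Ω I (fun z => (inner ℝ a (thX B z) : ℝ)) :=
    Moderate.clm hΩ hI (innerL a) mX
  have mca : Moderate Ω I (fun z : Phase => (inner ℝ a z.2.1 : ℝ)) :=
    Moderate.clm hΩ hI (innerL a) Moderate.vel
  have dXa : ∀ (c : V3) (d : Phase), fderiv ℝ (fun z => (inner ℝ a (thX B z) : ℝ)) (w.1, c, w.2) d
      = inner ℝ a (fderiv ℝ (thX B) (w.1, c, w.2) d) := fun c d => by
    have h := ((innerL a).hasFDerivAt.comp (w.1, c, w.2)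
      (mX.differentiableAt hΩ hI hw c).hasFDerivAt).fderiv
    exact congrArg (fun T => T d) h
  have gXa : ∀ c : V3, fderiv ℝ (fun z => (inner ℝ a (thX B z) : ℝ)) (w.1, c, w.2)
      (gyroDir B (w.1, c, w.2)) = inner ℝ a c - parF B (w.1, c, w.2) * inner ℝ a (bdir B w.1 w.2) :=
    fun c => by rw [dXa, gyro_thX hΩ hI hB hB0 hw, inner_sub_right, inner_smul_right]
  rw [inner_add_right, inner_sub_right, inner_sub_right, inner_smul_right,
    inner_velInt (r1Ψ.smul_moderate hΩ hI Moderate.vel) hw,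
    inner_velInt (r0Ψ.smul_moderate hΩ hI mdX) hw,
    inner_velInt (r0Θ.smul_moderate hΩ hI Moderate.vel) hw]
  simp only [inner_smul_right]
  -- the parallel part, and the perpendicular part as a derivative along the gyration
  have s1 : velInt (fun z => h₁ z * Ψ z * inner ℝ a z.2.1) w
      = velInt (fun z => h₁ z * Ψ z * parF B z) w * inner ℝ a (bdir B w.1 w.2)
        + velInt (fun z => h₁ z * Ψ z * fderiv ℝ (fun z => (inner ℝ a (thX B z) : ℝ)) z
          (gyroDir B z)) w := by
    rw [← velInt_mul_const, ← velInt_add ((r1Ψ.mul_moderate hΩ hI mpar).mul_moderate hΩ hI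
      (Moderate.const _)) (r1Ψ.mul_moderate hΩ hI (mXa.along hΩ hI hgyr)) hw]
    refine velInt_congr fun c => ?_
    rw [gXa]
    ring
  have s2 := velInt_gyro_mul hΩ hI hB hB0 r1Ψ mXa hw
  have s3 : velInt (fun z => fderiv ℝ (fun z => h₁ z * Ψ z) z (gyroDir B z)
      * inner ℝ a (thX B z)) w
      = -velInt (fun z => fderiv ℝ h₀ z (streamDir F z) * (Ψ z * inner ℝ a (thX B z))) w := by
    rw [velInt, velInt, ← integral_neg]
    refine integral_congr_ae (Eventually.of_forall fun c => ?_)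
    dsimp only
    rw [fderiv_mul_apply_phase (H.rapid₁.differentiableAt hΩ hI hw c)
      (hΨ.differentiableAt hΩ hI hw c), hinv (w.1, c, w.2) hw]
    linear_combination (Ψ (w.1, c, w.2) * inner ℝ a (thX B (w.1, c, w.2)))
      * H.order₁ (w.1, c, w.2) hw
  have s4 := velInt_stream_mul hΩ hI H.rapid₀ (Moderate.mul hΩ hI hΨ mXa) H.force hw
  -- the flux of the flux
  have s5 : ∑ j, fderiv ℝ (velInt (fun z => h₀ z * (Ψ z * inner ℝ a (thX B z)) * z.2.1 j)) w (e j, 0)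
      = -inner ℝ a (curl (fun y => velInt (fun z => h₀ z * Ψ z * perpF B z) (y, w.2)
        • invBb B (y, w.2)) w.1) := by
    have s6 : ∀ j, ∀ y ∈ Ω ×ˢ I,
        velInt (fun z => h₀ z * (Ψ z * inner ℝ a (thX B z)) * z.2.1 j) y
        = inner ℝ a (cross (velInt (fun z => h₀ z * Ψ z * perpF B z) y • invBb B y) (e j)) := by
      intro j y hy
      have mperp := moderate_perpF hΩ hI hB hB0
      rw [cross_smul_left, inner_smul_right, ← velInt_mul_const]
      refine Eq.trans (velInt_congr (g := fun z => h₀ z * Ψ z * (inner ℝ (e j) z.2.1 *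
        inner ℝ a (thX B z))) fun c => by rw [inner_e]; ring) ?_
      refine Eq.trans (velInt_mul_avg (X' := fun z => perpF B z *
        inner ℝ a (cross (invBb B y) (e j))) hΩ hI hB0 r0Ψ (Moderate.mul hΩ hI (Moderate.clm hΩ hI
        (innerL (e j)) Moderate.vel) mXa) (Moderate.mul hΩ hI mperp (Moderate.const _)) hy
        (fun c θ => by rw [hrot0 y hy, hrotΨ y hy]) fun c => ?_) ?_
      · rw [avg_vel_thX hB0 hy, perpF, kinF_sub_parF]
      · exact velInt_congr fun c => by ring
    rw [curl_field hcurl, inner_sum, ← Finset.sum_neg_distrib]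
    refine Finset.sum_congr rfl fun j _ => ?_
    rw [fderiv_eq_of_eqOn hΩ hI (s6 j) hw]
    have h7 := ((innerL a).hasFDerivAt.comp w ((crossL.flip (e j)).hasFDerivAt.comp w
      hcurl.hasFDerivAt)).fderiv
    refine (congrArg (fun T => T ((e j, 0) : SpaceTime)) h7).trans ?_
    simp only [ContinuousLinearMap.comp_apply, ContinuousLinearMap.flip_apply, innerL_apply,
      crossL_apply]
    rw [cross_anti, inner_neg_right]
  have s8 : velInt (fun z => h₀ z * fderiv ℝ (fun z => Ψ z * inner ℝ a (thX B z)) z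
      (streamDir F z)) w
      = velInt (fun z => h₀ z * Ψ z * inner ℝ a (fderiv ℝ (thX B) z (streamDir F z))) w
        + (velInt (fun z => h₀ z * C z * inner ℝ a (thX B z)) w
        + velInt (fun z => h₀ z * inner ℝ a (thX B z) * fderiv ℝ Θ z (gyroDir B z)) w) := by
    have r5 : Rapid Ω I (fun z => h₀ z * Ψ z * inner ℝ a (fderiv ℝ (thX B) z (streamDir F z))) :=
      r0Ψ.mul_moderate hΩ hI (Moderate.clm hΩ hI (innerL a) mdX)
    have r6 : Rapid Ω I (fun z => h₀ z * C z * inner ℝ a (thX B z)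
        + h₀ z * inner ℝ a (thX B z) * fderiv ℝ Θ z (gyroDir B z)) := by
      have h := H.rapid₀.mul_moderate hΩ hI (Moderate.add hΩ hI (Moderate.mul hΩ hI hC mXa)
        (Moderate.mul hΩ hI mXa (hΘ.along hΩ hI hgyr)))
      convert h using 2
      ring
    rw [← velInt_add ((H.rapid₀.mul_moderate hΩ hI hC).mul_moderate hΩ hI mXa)
      ((H.rapid₀.mul_moderate hΩ hI mXa).mul_moderate hΩ hI (hΘ.along hΩ hI hgyr)) hw,
      ← velInt_add r5 r6 hw]
    refine velInt_congr fun c => ?_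
    rw [fderiv_mul_apply_phase (hΨ.differentiableAt hΩ hI hw c)
      (mXa.differentiableAt hΩ hI hw c), hstr (w.1, c, w.2) hw, dXa]
    ring
  have s9 : velInt (fun z => h₀ z * C z * inner ℝ a (thX B z)) w = 0 := by
    rw [velInt_mul_avg (X' := fun _ => 0) hΩ hI hB0 (H.rapid₀.mul_moderate hΩ hI hC) mXa
      (Moderate.const 0) hw (fun c θ => by rw [hrot0 w hw, hCrot]) fun c => avg_thX hB0 hw a c]
    simp [velInt]
  have s10 := velInt_gyro_mul hΩ hI hB hB0 (H.rapid₀.mul_moderate hΩ hI mXa) hΘ hw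
  have s11 : velInt (fun z => fderiv ℝ (fun z => h₀ z * inner ℝ a (thX B z)) z (gyroDir B z) * Θ z) w
      = velInt (fun z => h₀ z * Θ z * inner ℝ a z.2.1) w
        - velInt (fun z => h₀ z * parF B z * Θ z) w * inner ℝ a (bdir B w.1 w.2) := by
    rw [← velInt_mul_const, ← velInt_sub (r0Θ.mul_moderate hΩ hI mca)
      (((H.rapid₀.mul_moderate hΩ hI mpar).mul_moderate hΩ hI hΘ).mul_moderate hΩ hI
      (Moderate.const _)) hw]
    refine velInt_congr fun c => ?_
    rw [fderiv_mul_apply_phase (H.rapid₀.differentiableAt hΩ hI hw c)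
      (mXa.differentiableAt hΩ hI hw c), H.order₀ (w.1, c, w.2) hw, gXa]
    ring
  have s12 : velInt (fun z => h₀ z * parF B z * Θ z) w = 0 := by
    rw [velInt_mul_avg (X' := fun _ => 0) hΩ hI hB0 (H.rapid₀.mul_moderate hΩ hI mpar) hΘ
      (Moderate.const 0) hw (fun c θ => by rw [hrot0 w hw, parF_rot hB0 hw]) hΘavg]
    simp [velInt]
  rw [s12, zero_mul, sub_zero] at s11
  linarith

end KineticHierarchy

end
end

section

/-! ### Evolution of density and pressures -/

variable {Ω : Set V3} {I : Set ℝ} {B : VField} {w : SpaceTime}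

lemma dvg_sub_curl {a b c d g : V3 → V3} {x : V3} (ha : DifferentiableAt ℝ a x)
    (hb : DifferentiableAt ℝ b x) (hc : ContDiffAt ℝ ∞ c x) (hd : DifferentiableAt ℝ d x)
    (h : g =ᶠ[𝓝 x] fun y => a y - curl c y - b y + d y) :
    dvg g x = dvg (fun y => a y - b y) x + dvg d x := by
  have hc' : DifferentiableAt ℝ (curl c) x :=
    (curl_contDiffAt hc).differentiableAt (by simp)
  rw [dvg_congr h, dvg_add ((ha.fun_sub hc').fun_sub hb) hd, dvg_sub (ha.fun_sub hc') hb,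
    dvg_sub ha hc', dvg_sub ha hb, show dvg (fun y => curl c y) x = 0 from dvg_curl (hc.of_le two_le_infty), sub_zero]

/-- The moment of order `m` in the parallel velocity and `q` in the magnetic moment. -/
def gyroMoment (B : VField) (h : Phase → ℝ) (m q : ℕ) : SpaceTime → ℝ :=
  velInt fun z => h z * (parF B z ^ m * magF B z ^ q)

section
variable (hΩ : IsOpen Ω) (hI : IsOpen I) (hB : ContDiffOn ℝ ∞ (onSpaceTime B) (Ω ×ˢ I))
  (hB0 : ∀ x ∈ Ω, ∀ t ∈ I, B x t ≠ 0)

lemma velInt_eq_mul {f g : Phase → ℝ} (r : ℝ) (h : ∀ c, f (w.1, c, w.2) = r * g (w.1, c, w.2)) :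
    velInt f w = r * velInt g w := by
  rw [velInt_congr (g := fun z => g z * r) fun c => by rw [h, mul_comm], velInt_mul_const,
    mul_comm]

section
include hB0

lemma perpEnergy_eq (hw : w ∈ Ω ×ˢ I) (c : V3) :
    perpEnergy (bdir B w.1 w.2) c = ‖B w.1 w.2‖ * magF B (w.1, c, w.2) := by
  have h := two_mul_magMoment (c := c) (hB0 w.1 hw.1 w.2 hw.2)
  rw [perpEnergy, magF]
  simp only [cPar] at h
  dsimp only
  linarith

lemma perpF_eq (hw : w ∈ Ω ×ˢ I) (c : V3) :
    perpF B (w.1, c, w.2) = ‖B w.1 w.2‖ * magF B (w.1, c, w.2) := by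
  rw [← perpEnergy_eq hB0 hw, perpF, kinF_sub_parF]

end

lemma perpF_apply (w : SpaceTime) (c : V3) :
    perpF B (w.1, c, w.2) = perpEnergy (bdir B w.1 w.2) c := by
  rw [perpF, kinF_sub_parF]

section
include hΩ hI hB hB0

lemma contDiffOn_gyroMoment {h : Phase → ℝ} (hh : Rapid Ω I h) (m q : ℕ) :
    ContDiffOn ℝ ∞ (gyroMoment B h m q) (Ω ×ˢ I) :=
  (rapid_moment hΩ hI hB hB0 hh m q).contDiffOn_velInt hΩ hI

end

variable {F u v : SpaceTime → V3} {h₀ h₁ h₂ : Phase → ℝ}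
  (H : KineticHierarchy Ω I B F u v h₀ h₁ h₂)

namespace KineticHierarchy
include hΩ hI hB hB0 H

variable (hw : w ∈ Ω ×ˢ I)
include hw

lemma drift_moment {Ψ : Phase → ℝ} (hΨ : Moderate Ω I Ψ)
    (hinv : ∀ z, foot z ∈ Ω ×ˢ I → fderiv ℝ Ψ z (gyroDir B z) = 0) :
    velInt (fun z => (h₀ z * Ψ z) • fderiv ℝ (thX B) z (streamDir F z)) w
      = velInt (fun z => h₀ z * Ψ z) w • driftF B F w
        - velInt (fun z => h₀ z * Ψ z * parF B z ^ 2) w • invBf B w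
        - velInt (fun z => h₀ z * Ψ z * perpF B z) w •
          (curl (fun y => invBb B (y, w.2)) w.1 - invBf B w) := by
  have mpar := moderate_parF hΩ hI hB hB0
  have mperp := moderate_perpF hΩ hI hB hB0
  have mX := moderate_thX hΩ hI hB hB0
  have mdX := mX.along hΩ hI (moderate_streamDir hΩ hI H.force)
  have r := H.rapid₀.mul_moderate hΩ hI hΨ
  refine ext_inner_left ℝ fun a => ?_
  rw [inner_velInt (r.smul_moderate hΩ hI mdX) hw]
  simp only [inner_smul_right, inner_sub_right (𝕜 := ℝ) a]
  set α : ℝ := inner ℝ a (driftF B F w)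
  set β : ℝ := inner ℝ a (invBf B w)
  set γ : ℝ := inner ℝ a (curl (fun y => invBb B (y, w.2)) w.1)
  have m1 := Moderate.mul hΩ hI (mpar.pow hΩ hI 2) (Moderate.const (Ω := Ω) (I := I) β)
  have m2 := Moderate.mul hΩ hI mperp (Moderate.const (Ω := Ω) (I := I) (γ - β))
  have m0 := Moderate.const (Ω := Ω) (I := I) α
  rw [velInt_mul_avg (X := fun z => inner ℝ a (fderiv ℝ (thX B) z (streamDir F z)))
    (X' := fun z => α - parF B z ^ 2 * β - perpF B z * (γ - β)) hΩ hI hB0 r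
    (Moderate.clm hΩ hI (innerL a) mdX)
    (Moderate.sub hΩ hI (Moderate.sub hΩ hI m0 m1) m2) hw ?_ ?_]
  · have hs : velInt (fun z => h₀ z * Ψ z * (α - parF B z ^ 2 * β - perpF B z * (γ - β))) w
        = velInt (fun z => h₀ z * Ψ z * α) w
          - velInt (fun z => h₀ z * Ψ z * (parF B z ^ 2 * β)) w
          - velInt (fun z => h₀ z * Ψ z * (perpF B z * (γ - β))) w := by
      rw [← velInt_sub (r.mul_moderate hΩ hI m0) (r.mul_moderate hΩ hI m1) hw, ← velInt_sub
        (f := fun z => h₀ z * Ψ z * α - h₀ z * Ψ z * (parF B z ^ 2 * β)) ?_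
        (r.mul_moderate hΩ hI m2) hw]
      · exact velInt_congr fun c => by ring
      · have h := r.mul_moderate hΩ hI (Moderate.sub hΩ hI m0 m1)
        convert h using 2
        ring
    rw [hs]
    simp only [← mul_assoc, velInt_mul_const]
  · intro c θ
    rw [H.invariant hΩ hI hB0 hw]
    congr 1
    exact gyro_invariant hB0 hw (fun θ => hΨ.differentiableAt hΩ hI hw _)
      (fun θ => hinv (w.1, rot (bdir B w.1 w.2) θ c, w.2) hw) θ
  · intro c
    rw [avg_stream_thX hΩ hI hB hB0 hw F a c, perpF_apply, parF, cPar]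
    simp only [inner_smul_right, inner_sub_right]
    ring

/-- The balance law for the moment with weight `Ψ`, in terms of rotation-invariant moments. -/
theorem reduced_balance {Ψ Θ C : Phase → ℝ} (hΨ : Moderate Ω I Ψ) (hΘ : Moderate Ω I Θ)
    (hC : Moderate Ω I C)
    (hinv : ∀ z, foot z ∈ Ω ×ˢ I → fderiv ℝ Ψ z (gyroDir B z) = 0)
    (hV : velInt (fun z => h₀ z * fderiv ℝ Ψ z (0, cross (v w) (B w.1 w.2), 0)) w = 0)
    (hstr : ∀ z, foot z ∈ Ω ×ˢ I →
      fderiv ℝ Ψ z (streamDir F z) = C z + fderiv ℝ Θ z (gyroDir B z))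
    (hCrot : ∀ w ∈ Ω ×ˢ I, ∀ c θ, C (w.1, rot (bdir B w.1 w.2) θ c, w.2) = C (w.1, c, w.2))
    (hΘavg : ∀ w ∈ Ω ×ˢ I, ∀ c, circAvg (bdir B w.1 w.2) (fun c => Θ (w.1, c, w.2)) c = 0)
    {M K P Q : SpaceTime → ℝ} (hM : ∀ y ∈ Ω ×ˢ I, velInt (fun z => h₀ z * Ψ z) y = M y)
    (hK : ∀ y ∈ Ω ×ˢ I, velInt (fun z => h₁ z * Ψ z * parF B z) y = K y)
    (hP : ∀ y ∈ Ω ×ˢ I, velInt (fun z => h₀ z * Ψ z * parF B z ^ 2) y = P y)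
    (hQ : ∀ y ∈ Ω ×ˢ I, velInt (fun z => h₀ z * Ψ z * perpF B z) y = Q y) :
    fderiv ℝ M w (0, 1) + dvg (fun y => M (y, w.2) • u (y, w.2)) w.1
      - velInt (fun z => h₀ z * fderiv ℝ Ψ z (slowDir u z)) w
      + dvg (fun y => K (y, w.2) • bdir B y w.2
        - (M (y, w.2) • driftF B F (y, w.2) - P (y, w.2) • invBf B (y, w.2)
        - Q (y, w.2) • (curl (fun y => invBb B (y, w.2)) y - invBf B (y, w.2)))) w.1
      - velInt (fun z => h₁ z * C z) w
      + velInt (fun z => h₀ z * fderiv ℝ Θ z (streamDir F z)) w = 0 := by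
  have mpar := moderate_parF hΩ hI hB hB0
  have hstrm := moderate_streamDir hΩ hI H.force
  have hgyr := moderate_gyroDir hΩ hI hB
  have r0Ψ := H.rapid₀.mul_moderate hΩ hI hΨ
  have r1Ψ := H.rapid₁.mul_moderate hΩ hI hΨ
  have r0Θ := H.rapid₀.mul_moderate hΩ hI hΘ
  have mdX := (moderate_thX hΩ hI hB hB0).along hΩ hI hstrm
  have e1 := H.balance hΩ hI hB hB0 hw hΨ hinv hV
  have e2 : velInt (fun z => h₁ z * fderiv ℝ Ψ z (streamDir F z)) w
      = velInt (fun z => h₁ z * C z) w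
        + velInt (fun z => h₁ z * fderiv ℝ Θ z (gyroDir B z)) w := by
    rw [← velInt_add (H.rapid₁.mul_moderate hΩ hI hC)
      (H.rapid₁.mul_moderate hΩ hI (hΘ.along hΩ hI hgyr)) hw]
    exact velInt_congr fun c => by rw [hstr (w.1, c, w.2) hw]; ring
  have e3 := velInt_gyro_mul hΩ hI hB hB0 H.rapid₁ hΘ hw
  have e4 : velInt (fun z => fderiv ℝ h₁ z (gyroDir B z) * Θ z) w
      = -velInt (fun z => fderiv ℝ h₀ z (streamDir F z) * Θ z) w := by
    rw [velInt, velInt, ← integral_neg]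
    exact integral_congr_ae (Eventually.of_forall fun c => by
      dsimp only
      linear_combination Θ (w.1, c, w.2) * H.order₁ (w.1, c, w.2) hw)
  have e5 := velInt_stream_mul hΩ hI H.rapid₀ hΘ H.force hw
  rw [sum_fderiv_velInt_coord hΩ hI r0Θ hw] at e5
  -- the divergence of the flux; the curl does not contribute
  have hslice : ∀ {a : SpaceTime → V3}, ContDiffOn ℝ ∞ a (Ω ×ˢ I) →
      ContDiffAt ℝ ∞ (fun y => a (y, w.2)) w.1 := fun ha => contDiffAt_slice hΩ hI ha hw.1 hw.2
  have d1 := hslice (((r1Ψ.mul_moderate hΩ hI mpar).contDiffOn_velInt hΩ hI).smul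
    (contDiffOn_bdir hB hB0))
  have d2 := hslice (((r0Ψ.mul_moderate hΩ hI (moderate_perpF hΩ hI hB hB0)).contDiffOn_velInt
    hΩ hI).smul (contDiffOn_invBb hB hB0))
  have d3 := hslice ((r0Ψ.smul_moderate hΩ hI mdX).contDiffOn_velInt hΩ hI)
  have d4 := hslice ((r0Θ.smul_moderate hΩ hI Moderate.vel).contDiffOn_velInt hΩ hI)
  have hnear : ∀ᶠ y in 𝓝 w.1, (y, w.2) ∈ Ω ×ˢ I :=
    Eventually.mono (hΩ.mem_nhds hw.1) fun y hy => ⟨hy, hw.2⟩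
  have e6 : dvg (fun y => velInt (fun z => (h₁ z * Ψ z) • z.2.1) (y, w.2)) w.1
      = dvg (fun y => velInt (fun z => h₁ z * Ψ z * parF B z) (y, w.2) • bdir B y w.2
        - velInt (fun z => (h₀ z * Ψ z) • fderiv ℝ (thX B) z (streamDir F z)) (y, w.2)) w.1
        + dvg (fun y => velInt (fun z => (h₀ z * Θ z) • z.2.1) (y, w.2)) w.1 := by
    have h1 : (fun y => velInt (fun z => (h₁ z * Ψ z) • z.2.1) (y, w.2)) =ᶠ[𝓝 w.1] _ :=
      hnear.mono fun y hy => H.flux hΩ hI hB hB0 (w := (y, w.2)) hy hΨ hΘ hC hinv hstr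
        (hCrot _ hy) (hΘavg _ hy)
    exact dvg_sub_curl (a := fun y => velInt (fun z => h₁ z * Ψ z * parF B z) (y, w.2)
        • bdir B y w.2) (b := fun y => velInt (fun z => (h₀ z * Ψ z) •
          fderiv ℝ (thX B) z (streamDir F z)) (y, w.2))
      (c := fun y => velInt (fun z => h₀ z * Ψ z * perpF B z) (y, w.2) • invBb B (y, w.2))
      (d1.differentiableAt (by simp)) (d3.differentiableAt (by simp)) d2
      (d4.differentiableAt (by simp)) h1
  have e7 : dvg (fun y => velInt (fun z => h₁ z * Ψ z * parF B z) (y, w.2) • bdir B y w.2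
        - velInt (fun z => (h₀ z * Ψ z) • fderiv ℝ (thX B) z (streamDir F z)) (y, w.2)) w.1
      = dvg (fun y => K (y, w.2) • bdir B y w.2
        - (M (y, w.2) • driftF B F (y, w.2) - P (y, w.2) • invBf B (y, w.2)
        - Q (y, w.2) • (curl (fun y => invBb B (y, w.2)) y - invBf B (y, w.2)))) w.1 :=
    dvg_congr (hnear.mono fun y hy => by
      dsimp only
      rw [H.drift_moment hΩ hI hB hB0 (w := (y, w.2)) hy hΨ hinv, hK _ hy, hM _ hy, hP _ hy,
        hQ _ hy])
  have e8 : dvg (fun y => velInt (fun z => h₀ z * Ψ z) (y, w.2) • u (y, w.2)) w.1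
      = dvg (fun y => M (y, w.2) • u (y, w.2)) w.1 :=
    dvg_congr (hnear.mono fun y hy => by dsimp only; rw [hM _ hy])
  rw [e6, e7, e8, fderiv_eq_of_eqOn hΩ hI hM hw] at e1
  linarith

/-- The continuity equation. -/
theorem continuity (hmean : ∀ w ∈ Ω ×ˢ I, velInt (fun z => h₁ z • z.2.1) w = 0) :
    fderiv ℝ (velInt h₀) w (0, 1) + dvg (fun y => velInt h₀ (y, w.2) • u (y, w.2)) w.1 = 0 := by
  have h := H.balance hΩ hI hB hB0 hw (Ψ := fun _ => 1) (Moderate.const 1)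
    (fun z _ => by simp) (by simp [velInt])
  simp only [mul_one, fderiv_fun_const, Pi.zero_apply, _root_.zero_apply, mul_zero] at h
  have h1 : velInt (fun _ : Phase => (0 : ℝ)) w = 0 := by simp [velInt]
  have h2 : dvg (fun y => velInt (fun z => h₁ z • z.2.1) (y, w.2)) w.1 = 0 := by
    have hnear : ∀ᶠ y in 𝓝 w.1, (y, w.2) ∈ Ω ×ˢ I :=
      Eventually.mono (hΩ.mem_nhds hw.1) fun y hy => ⟨hy, hw.2⟩
    rw [dvg_congr (w := fun _ => 0) (hnear.mono fun y hy => hmean _ hy)]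
    simp [dvg]
  rw [h1, h2] at h
  linarith

end KineticHierarchy

end
end

section

variable {Ω : Set V3} {I : Set ℝ} {B : VField} {w : SpaceTime}

section
variable (hΩ : IsOpen Ω) (hI : IsOpen I) (hB : ContDiffOn ℝ ∞ (onSpaceTime B) (Ω ×ˢ I))
  (hB0 : ∀ x ∈ Ω, ∀ t ∈ I, B x t ≠ 0)

section
include hΩ hI hB hB0

lemma fderiv_parF_sq (hw : w ∈ Ω ×ˢ I) (c : V3) (d : Phase) :
    fderiv ℝ (fun z => parF B z ^ 2) (w.1, c, w.2) d
      = 2 * parF B (w.1, c, w.2) * fderiv ℝ (parF B) (w.1, c, w.2) d := by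
  have hp := (moderate_parF hΩ hI hB hB0).differentiableAt hΩ hI hw c
  simp only [pow_two]
  rw [fderiv_mul_apply_phase hp hp]
  ring

lemma fderiv_perpF (hw : w ∈ Ω ×ˢ I) (c : V3) (d : Phase) :
    fderiv ℝ (perpF B) (w.1, c, w.2) d = fderiv ℝ kinF (w.1, c, w.2) d
      - parF B (w.1, c, w.2) * fderiv ℝ (parF B) (w.1, c, w.2) d := by
  have hp := (((moderate_parF hΩ hI hB hB0).pow hΩ hI 2).differentiableAt hΩ hI hw c).mul_const
    (2⁻¹ : ℝ)
  have hk := (moderate_kinF hΩ hI).differentiableAt hΩ hI hw c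
  have h : perpF B = fun z => kinF z - parF B z ^ 2 * 2⁻¹ := by
    funext z
    rw [perpF]
    ring
  rw [h, fderiv_fun_sub hk hp, _root_.sub_apply]
  congr 1
  rw [fderiv_mul_const ((moderate_parF hΩ hI hB hB0).pow hΩ hI 2 |>.differentiableAt hΩ hI hw c),
    _root_.smul_apply, fderiv_parF_sq hΩ hI hB hB0 hw, smul_eq_mul]
  ring

end

variable {F u v : SpaceTime → V3} {h₀ h₁ h₂ : Phase → ℝ}
  (H : KineticHierarchy Ω I B F u v h₀ h₁ h₂)

namespace KineticHierarchy
include hΩ hI hB hB0 H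

variable (hw : w ∈ Ω ×ˢ I)
include hw

/-- The moment of the streaming derivative of the oscillating part of `c∥² / 2`. -/
lemma velInt_par_thPar : velInt (fun z => h₀ z * fderiv ℝ (fun z => parF B z * thPar B z) z
      (streamDir F z)) w
    = -(inner ℝ (F w) (invBf B w) * velInt (fun z => h₀ z * parF B z ^ 2) w
      + dvg (fun y => invBf B (y, w.2)) w.1
        * velInt (fun z => h₀ z * (parF B z ^ 2 * perpF B z)) w) := by
  have mpar := moderate_parF hΩ hI hB hB0
  have mperp := moderate_perpF hΩ hI hB hB0
  have mth := moderate_thPar hΩ hI hB hB0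
  have hstrm := moderate_streamDir hΩ hI H.force
  have hgyr := moderate_gyroDir hΩ hI hB
  have hrot := H.invariant hΩ hI hB0 hw
  set α : ℝ := inner ℝ (F w) (invBf B w)
  set β : ℝ := dvg (fun y => invBf B (y, w.2)) w.1
  set α' : ℝ := inner ℝ (F w) (bdir B w.1 w.2)
  set β' : ℝ := divb B w.1 w.2
  have mα := Moderate.const (Ω := Ω) (I := I) α
  have mβ := Moderate.const (Ω := Ω) (I := I) β
  have mα' := Moderate.const (Ω := Ω) (I := I) α'
  have mβ' := Moderate.const (Ω := Ω) (I := I) β'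
  have r0 := H.rapid₀
  have r1 : Rapid Ω I (fun z => h₀ z * parF B z * fderiv ℝ (thPar B) z (streamDir F z)) :=
    (r0.mul_moderate hΩ hI mpar).mul_moderate hΩ hI (mth.along hΩ hI hstrm)
  have m2 := Moderate.add hΩ hI mα' (Moderate.mul hΩ hI mperp mβ')
  have r2 : Rapid Ω I (fun z => h₀ z * (α' + perpF B z * β') * thPar B z) :=
    (r0.mul_moderate hΩ hI m2).mul_moderate hΩ hI mth
  have r3 : Rapid Ω I (fun z => h₀ z * thPar B z * fderiv ℝ (thPar B) z (gyroDir B z)) :=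
    (r0.mul_moderate hΩ hI mth).mul_moderate hΩ hI (mth.along hΩ hI hgyr)
  have r23 : Rapid Ω I (fun z => h₀ z * (α' + perpF B z * β') * thPar B z
      + h₀ z * thPar B z * fderiv ℝ (thPar B) z (gyroDir B z)) := by
    have h := r0.mul_moderate hΩ hI (Moderate.add hΩ hI (Moderate.mul hΩ hI m2 mth)
      (Moderate.mul hΩ hI mth (mth.along hΩ hI hgyr)))
    convert h using 2
    ring
  have e1 : velInt (fun z => h₀ z * fderiv ℝ (fun z => parF B z * thPar B z) z (streamDir F z)) w
      = velInt (fun z => h₀ z * parF B z * fderiv ℝ (thPar B) z (streamDir F z)) w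
        + (velInt (fun z => h₀ z * (α' + perpF B z * β') * thPar B z) w
        + velInt (fun z => h₀ z * thPar B z * fderiv ℝ (thPar B) z (gyroDir B z)) w) := by
    rw [← velInt_add r2 r3 hw, ← velInt_add r1 r23 hw]
    refine velInt_congr fun c => ?_
    rw [fderiv_mul_apply_phase (mpar.differentiableAt hΩ hI hw c)
      (mth.differentiableAt hΩ hI hw c), stream_parF hΩ hI hB hB0 hw, perpF_apply]
    ring
  have e2 : velInt (fun z => h₀ z * (α' + perpF B z * β') * thPar B z) w = 0 := by
    rw [velInt_mul_avg (X' := fun _ => 0) hΩ hI hB0 (r0.mul_moderate hΩ hI m2) mth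
      (Moderate.const 0) hw (fun c θ => by rw [hrot, perpF_apply, perpF_apply,
        perpEnergy_rot hB0 hw]) fun c => avg_thPar hB0 hw c]
    simp [velInt]
  have e3 := velInt_gyro_mul hΩ hI hB hB0 (r0.mul_moderate hΩ hI mth) mth hw
  have e4 : velInt (fun z => fderiv ℝ (fun z => h₀ z * thPar B z) z (gyroDir B z) * thPar B z) w
      = velInt (fun z => h₀ z * thPar B z * fderiv ℝ (thPar B) z (gyroDir B z)) w := by
    refine velInt_congr fun c => ?_
    rw [fderiv_mul_apply_phase (r0.differentiableAt hΩ hI hw c)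
      (mth.differentiableAt hΩ hI hw c), H.order₀ (w.1, c, w.2) hw]
    ring
  have mp : Moderate Ω I (fun z => parF B z * perpF B z * β) :=
    Moderate.mul hΩ hI (Moderate.mul hΩ hI mpar mperp) mβ
  have e5 := velInt_mul_avg (X := fun z => fderiv ℝ (thPar B) z (streamDir F z))
    (X' := fun z => -(parF B z * α + parF B z * perpF B z * β)) hΩ hI hB0
    (r0.mul_moderate hΩ hI mpar) (mth.along hΩ hI hstrm)
    (Moderate.neg hΩ hI (Moderate.add hΩ hI (Moderate.mul hΩ hI mpar mα) mp)) hw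
    (fun c θ => by rw [hrot, parF_rot hB0 hw])
    (fun c => by rw [avg_stream_thPar hΩ hI hB hB0 hw F c, perpF_apply]; rfl)
  have r6 : Rapid Ω I (fun z => h₀ z * parF B z ^ 2 * (-α)) :=
    (r0.mul_moderate hΩ hI (mpar.pow hΩ hI 2)).mul_moderate hΩ hI (Moderate.const _)
  have r7 : Rapid Ω I (fun z => h₀ z * (parF B z ^ 2 * perpF B z) * (-β)) :=
    (r0.mul_moderate hΩ hI (Moderate.mul hΩ hI (mpar.pow hΩ hI 2) mperp)).mul_moderate hΩ hI
      (Moderate.const _)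
  have e6 : velInt (fun z => h₀ z * parF B z * -(parF B z * α + parF B z * perpF B z * β)) w
      = velInt (fun z => h₀ z * parF B z ^ 2) w * (-α)
        + velInt (fun z => h₀ z * (parF B z ^ 2 * perpF B z)) w * (-β) := by
    rw [← velInt_mul_const, ← velInt_mul_const, ← velInt_add r6 r7 hw]
    exact velInt_congr fun c => by ring
  linarith

/-- Evolution of the parallel pressure. -/
theorem parallel_balance :
    fderiv ℝ (gyroMoment B h₀ 2 0) w (0, 1)
      + dvg (fun y => gyroMoment B h₀ 2 0 (y, w.2) • u (y, w.2)) w.1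
      + 2 * inner ℝ (fderiv ℝ u w (bdir B w.1 w.2, 0)) (bdir B w.1 w.2) * gyroMoment B h₀ 2 0 w
      + dvg (fun y => gyroMoment B h₁ 3 0 (y, w.2) • bdir B y w.2
        - (gyroMoment B h₀ 2 0 (y, w.2) • driftF B F (y, w.2)
        - gyroMoment B h₀ 4 0 (y, w.2) • invBf B (y, w.2)
        - (‖B y w.2‖ * gyroMoment B h₀ 2 1 (y, w.2)) •
          (curl (fun y => invBb B (y, w.2)) y - invBf B (y, w.2)))) w.1
      - 2 * (inner ℝ (F w) (bdir B w.1 w.2) * gyroMoment B h₁ 1 0 w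
        + ‖B w.1 w.2‖ * divb B w.1 w.2 * gyroMoment B h₁ 1 1 w)
      - 2 * (inner ℝ (F w) (invBf B w) * gyroMoment B h₀ 2 0 w
        + ‖B w.1 w.2‖ * dvg (fun y => invBf B (y, w.2)) w.1 * gyroMoment B h₀ 2 1 w) = 0 := by
  have mpar := moderate_parF hΩ hI hB hB0
  have mperp := moderate_perpF hΩ hI hB hB0
  have mth := moderate_thPar hΩ hI hB hB0
  have r0 := H.rapid₀
  have mΨ : Moderate Ω I (fun z => parF B z ^ 2) := mpar.pow hΩ hI 2
  have mQ : Moderate Ω I (fun z => parF B z * thPar B z) := Moderate.mul hΩ hI mpar mth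
  have mΘ : Moderate Ω I (fun z => parF B z * thPar B z * 2) :=
    Moderate.mul hΩ hI mQ (Moderate.const 2)
  have mFb : Moderate Ω I (fun z => (inner ℝ (F (foot z)) (bdir B z.1 z.2.2) : ℝ)) :=
    Moderate.inner hΩ hI (Moderate.field hΩ hI H.force) (moderate_bdir hΩ hI hB hB0)
  have mdivb : Moderate Ω I (fun z : Phase => divb B z.1 z.2.2) :=
    Moderate.field hΩ hI (contDiffOn_divb hΩ hI hB hB0)
  have mC : Moderate Ω I (fun z => 2 * parF B z * (inner ℝ (F (foot z)) (bdir B z.1 z.2.2)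
      + perpF B z * divb B z.1 z.2.2)) :=
    Moderate.mul hΩ hI (Moderate.mul hΩ hI (Moderate.const 2) mpar)
      (Moderate.add hΩ hI mFb (Moderate.mul hΩ hI mperp mdivb))
  have i1 : ∀ y ∈ Ω ×ˢ I, velInt (fun z => h₀ z * parF B z ^ 2) y = gyroMoment B h₀ 2 0 y :=
    fun y _ => velInt_congr fun c => by ring
  have i2 : ∀ y ∈ Ω ×ˢ I, velInt (fun z => h₁ z * parF B z ^ 2 * parF B z) y
      = gyroMoment B h₁ 3 0 y := fun y _ => velInt_congr fun c => by ring
  have i3 : ∀ y ∈ Ω ×ˢ I, velInt (fun z => h₀ z * parF B z ^ 2 * parF B z ^ 2) y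
      = gyroMoment B h₀ 4 0 y := fun y _ => velInt_congr fun c => by ring
  have i4 : ∀ y ∈ Ω ×ˢ I, velInt (fun z => h₀ z * parF B z ^ 2 * perpF B z) y
      = ‖B y.1 y.2‖ * gyroMoment B h₀ 2 1 y := fun y hy => velInt_eq_mul _ fun c => by
    rw [perpF_eq hB0 hy]; ring
  have h := H.reduced_balance hΩ hI hB hB0 hw mΨ mΘ mC
    (fun z hz => by
      have := fderiv_parF_sq hΩ hI hB hB0 (w := (z.1, z.2.2)) hz z.2.1 (gyroDir B z)
      rw [show ((z.1, z.2.2) : SpaceTime).1 = z.1 from rfl] at this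
      rw [this, gyro_parF hΩ hI hB hB0 (w := (z.1, z.2.2)) hz, mul_zero])
    (by
      rw [velInt_congr (g := fun _ => (0 : ℝ)) fun c => ?_]
      · simp [velInt]
      · rw [fderiv_parF_sq hΩ hI hB hB0 hw, fderiv_parF hΩ hI hB hB0 (z := (w.1, c, w.2)) hw]
        simp only [foot_apply]
        rw [show ((0 : V3), (0 : ℝ)) = 0 from rfl, map_zero, inner_zero_right]
        simp [inner_cross_B hB0 hw])
    (fun z hz => by
      obtain ⟨x, c, t⟩ := z
      have hz' : ((x, t) : SpaceTime) ∈ Ω ×ˢ I := hz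
      rw [fderiv_parF_sq hΩ hI hB hB0 hz' c, stream_parF hΩ hI hB hB0 hz' c,
        fderiv_mul_const (mQ.differentiableAt hΩ hI hz' c), _root_.smul_apply,
        fderiv_mul_apply_phase (mpar.differentiableAt hΩ hI hz' c)
          (mth.differentiableAt hΩ hI hz' c), gyro_parF hΩ hI hB hB0 hz' c,
        perpF_apply (x, t) c, smul_eq_mul]
      simp only [foot_apply]
      ring)
    (fun w hw c θ => by
      rw [parF_rot hB0 hw, perpF_apply, perpF_apply, perpEnergy_rot hB0 hw]
      rfl)
    (fun w hw c => by
      have h1 : circAvg (bdir B w.1 w.2)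
          (fun c => parF B (w.1, c, w.2) * thPar B (w.1, c, w.2) * 2) c
          = circAvg (bdir B w.1 w.2)
          (fun c' => (2 * parF B (w.1, c, w.2)) * thPar B (w.1, c', w.2)) c :=
        circAvg_congr fun θ => by rw [parF_rot hB0 hw]; ring
      rw [h1, circAvg_const_mul, avg_thPar hB0 hw, mul_zero])
    i1 i2 i3 i4
  have i5 : velInt (fun z => h₀ z * (parF B z ^ 2 * perpF B z)) w
      = ‖B w.1 w.2‖ * gyroMoment B h₀ 2 1 w := velInt_eq_mul _ fun c => by
    rw [perpF_eq hB0 hw]; ring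
  have i6 : velInt (fun z => h₁ z * (2 * parF B z * (inner ℝ (F (foot z)) (bdir B z.1 z.2.2)
      + perpF B z * divb B z.1 z.2.2))) w
      = 2 * (inner ℝ (F w) (bdir B w.1 w.2) * gyroMoment B h₁ 1 0 w
        + ‖B w.1 w.2‖ * divb B w.1 w.2 * gyroMoment B h₁ 1 1 w) := by
    rw [mul_comm (inner ℝ (F w) (bdir B w.1 w.2)), mul_comm (‖B w.1 w.2‖ * divb B w.1 w.2),
      gyroMoment, gyroMoment, ← velInt_mul_const, ← velInt_mul_const,
      ← velInt_add ((rapid_moment hΩ hI hB hB0 H.rapid₁ 1 0).mul_moderate hΩ hI (Moderate.const _))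
      ((rapid_moment hΩ hI hB hB0 H.rapid₁ 1 1).mul_moderate hΩ hI (Moderate.const _)) hw]
    refine velInt_eq_mul 2 fun c => ?_
    rw [perpF_eq hB0 hw]
    simp only [foot_apply]
    ring
  have i7 : velInt (fun z => h₀ z * fderiv ℝ (fun z => parF B z * thPar B z * 2) z
      (streamDir F z)) w = 2 * velInt (fun z => h₀ z * fderiv ℝ (fun z => parF B z * thPar B z) z
      (streamDir F z)) w := velInt_eq_mul 2 fun c => by
    rw [fderiv_mul_const (mQ.differentiableAt hΩ hI hw c), _root_.smul_apply, smul_eq_mul]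
    ring
  set σ : ℝ := inner ℝ (fderiv ℝ u w (bdir B w.1 w.2, 0)) (bdir B w.1 w.2) with hσ
  have i8 : velInt (fun z => h₀ z * fderiv ℝ (fun z => parF B z ^ 2) z (slowDir u z)) w
      = -2 * σ * gyroMoment B h₀ 2 0 w := by
    have h1 := velInt_mul_avg (k := fun z => h₀ z * parF B z)
      (X := fun z => fderiv ℝ (parF B) z (slowDir u z))
      (X' := fun z => parF B z * (-σ)) hΩ hI hB0 (r0.mul_moderate hΩ hI mpar)
      (mpar.along hΩ hI (moderate_slowDir hΩ hI H.bulk))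
      (Moderate.mul hΩ hI mpar (Moderate.const _)) hw
      (fun c θ => by rw [H.invariant hΩ hI hB0 hw, parF_rot hB0 hw])
      (fun c => by rw [avg_slow_parF hΩ hI hB hB0 hw, mul_neg]; rfl)
    rw [velInt_eq_mul 2 (g := fun z => h₀ z * parF B z * fderiv ℝ (parF B) z (slowDir u z))
      fun c => by rw [fderiv_parF_sq hΩ hI hB hB0 hw]; ring, h1,
      velInt_eq_mul (-σ) (g := fun z => h₀ z * (parF B z ^ 2 * magF B z ^ 0)) fun c => by ring,
      gyroMoment]
    ring
  dsimp only at h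
  rw [i6, i7, i8, H.velInt_par_thPar hΩ hI hB hB0 hw, i5,
    i1 w hw] at h
  linarith

/-- Evolution of the perpendicular pressure. -/
theorem perpendicular_balance :
    fderiv ℝ (fun w : SpaceTime => ‖B w.1 w.2‖ * gyroMoment B h₀ 0 1 w) w (0, 1)
      + dvg (fun y => (‖B y w.2‖ * gyroMoment B h₀ 0 1 (y, w.2)) • u (y, w.2)) w.1
      + (dvg (fun y => u (y, w.2)) w.1
        - inner ℝ (fderiv ℝ u w (bdir B w.1 w.2, 0)) (bdir B w.1 w.2))
          * (‖B w.1 w.2‖ * gyroMoment B h₀ 0 1 w)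
      + dvg (fun y => (‖B y w.2‖ * gyroMoment B h₁ 1 1 (y, w.2)) • bdir B y w.2
        - ((‖B y w.2‖ * gyroMoment B h₀ 0 1 (y, w.2)) • driftF B F (y, w.2)
        - (‖B y w.2‖ * gyroMoment B h₀ 2 1 (y, w.2)) • invBf B (y, w.2)
        - (‖B y w.2‖ ^ 2 * gyroMoment B h₀ 0 2 (y, w.2)) •
          (curl (fun y => invBb B (y, w.2)) y - invBf B (y, w.2)))) w.1
      + ‖B w.1 w.2‖ * divb B w.1 w.2 * gyroMoment B h₁ 1 1 w
      - (dvg (fun y => driftF B F (y, w.2)) w.1 - inner ℝ (F w) (invBf B w))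
        * (‖B w.1 w.2‖ * gyroMoment B h₀ 0 1 w)
      + ‖B w.1 w.2‖ * dvg (fun y => invBf B (y, w.2)) w.1 * gyroMoment B h₀ 2 1 w = 0 := by
  have mpar := moderate_parF hΩ hI hB hB0
  have mkin := moderate_kinF (Ω := Ω) (I := I) hΩ hI
  have mperp := moderate_perpF hΩ hI hB hB0
  have mth := moderate_thPar hΩ hI hB hB0
  have mthE := moderate_thE hΩ hI hB hB0 H.force
  have r0 := H.rapid₀
  have hslow := moderate_slowDir hΩ hI H.bulk
  have hstrm := moderate_streamDir hΩ hI H.force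
  have hrot := H.invariant hΩ hI hB0 hw
  have mQ : Moderate Ω I (fun z => parF B z * thPar B z) := Moderate.mul hΩ hI mpar mth
  have mΘ : Moderate Ω I (fun z => thE B F z - parF B z * thPar B z) :=
    Moderate.sub hΩ hI mthE mQ
  have mdivb : Moderate Ω I (fun z : Phase => divb B z.1 z.2.2) :=
    Moderate.field hΩ hI (contDiffOn_divb hΩ hI hB hB0)
  have mC : Moderate Ω I (fun z => -(parF B z * perpF B z * divb B z.1 z.2.2)) :=
    Moderate.neg hΩ hI (Moderate.mul hΩ hI (Moderate.mul hΩ hI mpar mperp) mdivb)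
  have dΘ : ∀ y ∈ Ω ×ˢ I, ∀ (c : V3) (d : Phase),
      fderiv ℝ (fun z => thE B F z - parF B z * thPar B z) (y.1, c, y.2) d
        = fderiv ℝ (thE B F) (y.1, c, y.2) d
          - fderiv ℝ (fun z => parF B z * thPar B z) (y.1, c, y.2) d := fun y hy c d => by
    rw [fderiv_fun_sub (mthE.differentiableAt hΩ hI hy c) (mQ.differentiableAt hΩ hI hy c),
      _root_.sub_apply]
  have i1 : ∀ y ∈ Ω ×ˢ I, velInt (fun z => h₀ z * perpF B z) y
      = ‖B y.1 y.2‖ * gyroMoment B h₀ 0 1 y := fun y hy => velInt_eq_mul _ fun c => by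
    rw [perpF_eq hB0 hy]; ring
  have i2 : ∀ y ∈ Ω ×ˢ I, velInt (fun z => h₁ z * perpF B z * parF B z) y
      = ‖B y.1 y.2‖ * gyroMoment B h₁ 1 1 y := fun y hy => velInt_eq_mul _ fun c => by
    rw [perpF_eq hB0 hy]; ring
  have i3 : ∀ y ∈ Ω ×ˢ I, velInt (fun z => h₀ z * perpF B z * parF B z ^ 2) y
      = ‖B y.1 y.2‖ * gyroMoment B h₀ 2 1 y := fun y hy => velInt_eq_mul _ fun c => by
    rw [perpF_eq hB0 hy]; ring
  have i4 : ∀ y ∈ Ω ×ˢ I, velInt (fun z => h₀ z * perpF B z * perpF B z) y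
      = ‖B y.1 y.2‖ ^ 2 * gyroMoment B h₀ 0 2 y := fun y hy => velInt_eq_mul _ fun c => by
    rw [perpF_eq hB0 hy]; ring
  have h := H.reduced_balance hΩ hI hB hB0 hw mperp mΘ mC
    (fun z hz => by
      have := fderiv_perpF hΩ hI hB hB0 (w := (z.1, z.2.2)) hz z.2.1 (gyroDir B z)
      rw [show ((z.1, z.2.2) : SpaceTime).1 = z.1 from rfl] at this
      rw [this, gyro_parF hΩ hI hB hB0 (w := (z.1, z.2.2)) hz, gyro_kinF, mul_zero, sub_zero])
    (by
      rw [velInt_congr (g := fun z => h₀ z * inner ℝ (cross (v w) (B w.1 w.2)) z.2.1) fun c => ?_]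
      · rw [velInt_mul_avg (X := fun z => inner ℝ (cross (v w) (B w.1 w.2)) z.2.1)
          (X' := fun _ => 0) hΩ hI hB0 r0 (Moderate.clm hΩ hI (innerL (cross (v w) (B w.1 w.2))) Moderate.vel) (Moderate.const 0) hw hrot fun c => ?_]
        · simp [velInt]
        · refine (circAvg_linear (unit_bdir hB0 hw) (innerL (cross (v w) (B w.1 w.2))) c).trans ?_
          rw [innerL_apply, inner_cross_B hB0 hw, mul_zero]
      · rw [fderiv_perpF hΩ hI hB hB0 hw, fderiv_kinF,
          fderiv_parF hΩ hI hB hB0 (z := (w.1, c, w.2)) hw]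
        simp only [foot_apply]
        rw [show ((0 : V3), (0 : ℝ)) = 0 from rfl, map_zero, inner_zero_right,
          inner_cross_B hB0 hw, add_zero, mul_zero, sub_zero, real_inner_comm])
    (fun z hz => by
      obtain ⟨x, c, t⟩ := z
      have hz' : ((x, t) : SpaceTime) ∈ Ω ×ˢ I := hz
      have h1 := gyro_thE hΩ hI hB hB0 hz' H.force c
      rw [fderiv_perpF hΩ hI hB hB0 hz' c, stream_parF hΩ hI hB hB0 hz' c, dΘ (x, t) hz',
        fderiv_mul_apply_phase (mpar.differentiableAt hΩ hI hz' c)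
          (mth.differentiableAt hΩ hI hz' c), gyro_parF hΩ hI hB hB0 hz' c,
        perpF_apply (x, t) c, h1, fderiv_kinF]
      simp only [streamDir, foot_apply]
      ring)
    (fun w hw c θ => by
      rw [parF_rot hB0 hw, perpF_apply, perpF_apply, perpEnergy_rot hB0 hw])
    (fun w hw c => by
      have h1 : circAvg (bdir B w.1 w.2)
          (fun c => thE B F (w.1, c, w.2) - parF B (w.1, c, w.2) * thPar B (w.1, c, w.2)) c
          = circAvg (bdir B w.1 w.2)
          (fun c' => thE B F (w.1, c', w.2) - parF B (w.1, c, w.2) * thPar B (w.1, c', w.2)) c :=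
        circAvg_congr fun θ => by rw [parF_rot hB0 hw]
      rw [h1, circAvg_sub (continuous_circle_of_contDiffOn hΩ hI hw c mthE.1 _)
        ((continuous_circle_of_contDiffOn hΩ hI hw c mth.1 _).const_mul _), avg_thE hB0 hw,
        circAvg_const_mul, avg_thPar hB0 hw, mul_zero, sub_zero])
    i1 i2 i3 i4
  have i5 : velInt (fun z => h₀ z * (parF B z ^ 2 * perpF B z)) w
      = ‖B w.1 w.2‖ * gyroMoment B h₀ 2 1 w := velInt_eq_mul _ fun c => by
    rw [perpF_eq hB0 hw]; ring
  have i6 : velInt (fun z => h₁ z * -(parF B z * perpF B z * divb B z.1 z.2.2)) w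
      = -(‖B w.1 w.2‖ * divb B w.1 w.2) * gyroMoment B h₁ 1 1 w := velInt_eq_mul _ fun c => by
    rw [perpF_eq hB0 hw]; ring
  set α : ℝ := inner ℝ (F w) (invBf B w) with hα
  set δ : ℝ := dvg (fun y => driftF B F (y, w.2)) w.1 with hδ
  set η : ℝ := dvg (fun y => u (y, w.2)) w.1 with hη
  set σ : ℝ := inner ℝ (fderiv ℝ u w (bdir B w.1 w.2, 0)) (bdir B w.1 w.2) with hσ
  have mp2 := mpar.pow hΩ hI 2
  have i7 : velInt (fun z => h₀ z * fderiv ℝ (fun z => thE B F z - parF B z * thPar B z) z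
      (streamDir F z)) w = -(α * velInt (fun z => h₀ z * parF B z ^ 2) w
        + (δ - α) * velInt (fun z => h₀ z * perpF B z) w)
        - velInt (fun z => h₀ z * fderiv ℝ (fun z => parF B z * thPar B z) z
          (streamDir F z)) w := by
    have h1 := velInt_mul_avg (X := fun z => fderiv ℝ (thE B F) z (streamDir F z))
      (X' := fun z => parF B z ^ 2 * (-α) + perpF B z * (-(δ - α))) hΩ hI hB0 r0
      (mthE.along hΩ hI hstrm) (Moderate.add hΩ hI (Moderate.mul hΩ hI mp2 (Moderate.const _))
        (Moderate.mul hΩ hI mperp (Moderate.const _))) hw hrot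
      (fun c => by
        rw [avg_stream_thE hΩ hI hB hB0 hw H.force c, perpF_apply, parF, cPar]
        ring)
    have h2 : velInt (fun z => h₀ z * (parF B z ^ 2 * (-α) + perpF B z * (-(δ - α)))) w
        = velInt (fun z => h₀ z * parF B z ^ 2) w * (-α)
          + velInt (fun z => h₀ z * perpF B z) w * (-(δ - α)) := by
      rw [← velInt_mul_const, ← velInt_mul_const, ← velInt_add ((r0.mul_moderate hΩ hI
        mp2).mul_moderate hΩ hI (Moderate.const _)) ((r0.mul_moderate hΩ hI
        mperp).mul_moderate hΩ hI (Moderate.const _)) hw]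
      exact velInt_congr fun c => by ring
    have h3 : velInt (fun z => h₀ z * fderiv ℝ (fun z => thE B F z - parF B z * thPar B z) z
        (streamDir F z)) w = velInt (fun z => h₀ z * fderiv ℝ (thE B F) z (streamDir F z)) w
        - velInt (fun z => h₀ z * fderiv ℝ (fun z => parF B z * thPar B z) z
          (streamDir F z)) w := by
      rw [← velInt_sub (r0.mul_moderate hΩ hI (mthE.along hΩ hI hstrm))
        (r0.mul_moderate hΩ hI (mQ.along hΩ hI hstrm)) hw]
      exact velInt_congr fun c => by rw [dΘ w hw]; ring
    rw [h3, h1, h2]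
    ring
  have i8 : velInt (fun z => h₀ z * fderiv ℝ (perpF B) z (slowDir u z)) w
      = -(η - σ) * velInt (fun z => h₀ z * perpF B z) w := by
    have h1 := velInt_mul_avg (X := fun z => fderiv ℝ (perpF B) z (slowDir u z))
      (X' := fun z => perpF B z * (-(η - σ))) hΩ hI hB0 r0 (mperp.along hΩ hI hslow)
      (Moderate.mul hΩ hI mperp (Moderate.const _)) hw hrot
      (fun c => by
        have h2 : circAvg (bdir B w.1 w.2)
            (fun c => fderiv ℝ (perpF B) (w.1, c, w.2) (slowDir u (w.1, c, w.2))) c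
            = circAvg (bdir B w.1 w.2) (fun c' =>
              fderiv ℝ kinF (w.1, c', w.2) (slowDir u (w.1, c', w.2))
              - parF B (w.1, c, w.2) *
                fderiv ℝ (parF B) (w.1, c', w.2) (slowDir u (w.1, c', w.2))) c :=
          circAvg_congr fun θ => by rw [fderiv_perpF hΩ hI hB hB0 hw, parF_rot hB0 hw]
        have hd := contDiffOn_slowDir hΩ hI H.bulk
        rw [h2, circAvg_sub (continuous_circle_fderiv hΩ hI hw c mkin.1 _ hd)
          ((continuous_circle_fderiv hΩ hI hw c mpar.1 _ hd).const_mul _),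
          avg_slow_kinF hB0 hw (differentiableAt_of_contDiffOn hΩ hI H.bulk hw),
          circAvg_const_mul, avg_slow_parF hΩ hI hB hB0 hw, perpF_apply, parF, cPar]
        ring)
    rw [h1]
    exact velInt_eq_mul _ fun c => by ring
  dsimp only at h
  rw [i7, i8, H.velInt_par_thPar hΩ hI hB hB0 hw, i5, i6, i1 w hw] at h
  linarith

end KineticHierarchy

end
end

section

/-! ### Gyrotropic pressure and force balance -/

variable {Ω : Set V3} {I : Set ℝ} {B : VField}

/-- The divergence of a gyrotropic tensor. -/
lemma tensorDvg_gyrotropic {p q : V3 → ℝ} {b : V3 → V3} {x : V3} (hp : DifferentiableAt ℝ p x)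
    (hq : DifferentiableAt ℝ q x) (hb : DifferentiableAt ℝ b x) :
    tensorDvg (fun y => q y • (1 - tens (b y) (b y)) + p y • tens (b y) (b y)) x
      = gradient q x + dvg (fun y => (p y - q y) • b y) x • b x
        + (p x - q x) • fderiv ℝ b x (b x) := by
  have hr : DifferentiableAt ℝ (fun y => p y - q y) x := hp.fun_sub hq
  have hbi : ∀ i, DifferentiableAt ℝ (fun y => b y i) x := fun i =>
    (EuclideanSpace.proj (𝕜 := ℝ) i).differentiableAt.comp x hb
  have hrb : DifferentiableAt ℝ (fun y => (p y - q y) • b y) x := hr.smul hb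
  have hrbi : ∀ i, DifferentiableAt ℝ (fun y => (p y - q y) * b y i) x := fun i => hr.mul (hbi i)
  ext j
  have h1 : ∀ i, fderiv ℝ (fun y => (q y • (1 - tens (b y) (b y)) + p y • tens (b y) (b y)) i j) x
      (e i) = (if i = j then (1 : ℝ) else 0) * fderiv ℝ q x (e i)
        + ((fderiv ℝ (fun y => (p y - q y) • b y) x (e i)) i * b x j
          + (p x - q x) * (b x i * (fderiv ℝ b x (e i)) j)) := by
    intro i
    have h2 : (fun y => (q y • (1 - tens (b y) (b y)) + p y • tens (b y) (b y)) i j)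
        = fun y => (if i = j then (1 : ℝ) else 0) * q y + (p y - q y) * b y i * b y j := by
      funext y
      simp only [tens, Matrix.add_apply, Matrix.smul_apply, Matrix.sub_apply, Matrix.of_apply,
        smul_eq_mul, Matrix.one_apply]
      ring
    have h4 : DifferentiableAt ℝ (fun y => (p y - q y) * b y i * b y j) x := (hrbi i).mul (hbi j)
    rw [h2, fderiv_fun_add (hq.const_mul _) h4, fderiv_const_mul hq,
      fderiv_fun_mul (hrbi i) (hbi j)]
    simp only [_root_.add_apply, _root_.smul_apply, smul_eq_mul, fderiv_coord hb]
    rw [← fderiv_coord hrb]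
    simp only [PiLp.smul_apply, smul_eq_mul]
    ring
  have h3 := congrArg (fun v : V3 => v j) (congrArg (fderiv ℝ b x) (sum_smul_e (b x)))
  simp only [map_sum, map_smul] at h3
  rw [WithLp.ofLp_sum, Finset.sum_apply] at h3
  simp only [tensorDvg, h1, Finset.sum_add_distrib, ← Finset.sum_mul, ← Finset.mul_sum]
  simp only [PiLp.add_apply, PiLp.smul_apply, smul_eq_mul, gradient_apply, dvg] at h3 ⊢
  rw [h3]
  simp only [ite_mul, one_mul, zero_mul, Finset.sum_ite_eq', Finset.mem_univ, if_true]
  ring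

/-- The perpendicular velocity from the momentum balance. -/
lemma cross_cross_of_balance {n m p q d : ℝ} {A U b b' g κ : V3} (hn : n ≠ 0) (hm : m ≠ 0)
    (hb : m • b = b') (h : n • (A + cross U b') = g + d • b + (p - q) • κ) :
    cross b (cross U b) = (1 / m) • cross A b + (1 / (n * m)) • cross b g
      + ((p - q) / (n * m)) • cross b κ := by
  have h1 := congrArg (cross b) h
  rw [← hb] at h1
  simp only [cross_smul_right, cross_add_right, cross_self', smul_zero, add_zero,
    cross_anti b A] at h1
  have h2 : (n * m) • cross b (cross U b)
      = n • cross A b + (cross b g + (p - q) • cross b κ) := by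
    rw [← h1]
    module
  have h3 := congrArg ((n * m)⁻¹ • ·) h2
  rw [smul_smul, inv_mul_cancel₀ (mul_ne_zero hn hm), one_smul] at h3
  have e1 : (n * m)⁻¹ * n = 1 / m := by field_simp
  rw [h3, smul_add, smul_add, smul_smul, smul_smul, ← add_assoc, e1, one_div (n * m), div_eq_inv_mul (p - q)]

section
variable (hΩ : IsOpen Ω) (hI : IsOpen I) (hB : ContDiffOn ℝ ∞ (onSpaceTime B) (Ω ×ˢ I))
  (hB0 : ∀ x ∈ Ω, ∀ t ∈ I, B x t ≠ 0)

section
include hΩ hI hB hB0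
variable {h : Phase → ℝ} (hh : Rapid Ω I h) {w : SpaceTime} (hw : w ∈ Ω ×ˢ I)
include hh hw

lemma mom_eq (m q : ℕ) : mom (weighted B (red B h)) m q w.1 w.2 = gyroMoment B h m q w :=
  mom_weighted_red hΩ hI hB hB0 hh m q hw.1 hw.2

lemma pPar_eq : pPar (weighted B (red B h)) w.1 w.2 = gyroMoment B h 2 0 w := by
  rw [pPar_red hΩ hI hB hB0 hh hw.1 hw.2]
  exact velInt_congr fun c => by ring

lemma pPerp_eq : pPerp B (weighted B (red B h)) w.1 w.2
    = ‖B w.1 w.2‖ * gyroMoment B h 0 1 w := by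
  rw [pPerp_red hΩ hI hB hB0 hh hw.1 hw.2]
  congr 1
  exact velInt_congr fun c => by ring

omit hΩ hI hB in
lemma dens_eq : dens (weighted B (red B h)) w.1 w.2 = velInt h w := dens_red hB0 hh hw.1 hw.2

end

section
include hΩ hI hB hB0
variable {h : Phase → ℝ} (hh : Rapid Ω I h)
include hh

lemma contDiffOn_mom (m q : ℕ) :
    ContDiffOn ℝ ∞ (fun w : SpaceTime => mom (weighted B (red B h)) m q w.1 w.2) (Ω ×ˢ I) :=
  (contDiffOn_gyroMoment hΩ hI hB hB0 hh m q).congr fun _ hw => mom_eq hΩ hI hB hB0 hh hw m q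

lemma contDiffOn_pPar :
    ContDiffOn ℝ ∞ (fun w : SpaceTime => pPar (weighted B (red B h)) w.1 w.2) (Ω ×ˢ I) :=
  (contDiffOn_gyroMoment hΩ hI hB hB0 hh 2 0).congr fun _ hw => pPar_eq hΩ hI hB hB0 hh hw

lemma contDiffOn_pPerp :
    ContDiffOn ℝ ∞ (fun w : SpaceTime => pPerp B (weighted B (red B h)) w.1 w.2) (Ω ×ˢ I) :=
  ((contDiffOn_normB hB hB0).mul (contDiffOn_gyroMoment hΩ hI hB hB0 hh 0 1)).congr
    fun _ hw => pPerp_eq hΩ hI hB hB0 hh hw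

omit hB in
lemma contDiffOn_dens :
    ContDiffOn ℝ ∞ (fun w : SpaceTime => dens (weighted B (red B h)) w.1 w.2) (Ω ×ˢ I) :=
  (hh.contDiffOn_velInt hΩ hI).congr fun _ hw => dens_eq hB0 hh hw

end

variable {F u v : SpaceTime → V3} {h₀ h₁ h₂ : Phase → ℝ}
  (H : KineticHierarchy Ω I B F u v h₀ h₁ h₂)

namespace KineticHierarchy
include hΩ hI hB hB0 H

/-- The leading pressure tensor is gyrotropic. -/
lemma pressure_eq {w : SpaceTime} (hw : w ∈ Ω ×ˢ I) (i j : Fin 3) :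
    velInt (fun z => h₀ z * (z.2.1 i * z.2.1 j)) w
      = gyroPressure B (weighted B (red B h₀)) w.1 w.2 i j := by
  have hb := unit_bdir hB0 hw
  have mpar := moderate_parF hΩ hI hB hB0
  have mperp := moderate_perpF hΩ hI hB hB0
  have r0 := H.rapid₀
  set β : ℝ := bdir B w.1 w.2 i * bdir B w.1 w.2 j with hβ
  set γ : ℝ := (1 : Matrix (Fin 3) (Fin 3) ℝ) i j - β with hγ
  have h1 := velInt_mul_avg (X := fun z : Phase => z.2.1 i * z.2.1 j)
    (X' := fun z => parF B z ^ 2 * β + perpF B z * γ) hΩ hI hB0 r0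
    (Moderate.mul hΩ hI (moderate_coord hΩ hI i) (moderate_coord hΩ hI j))
    (Moderate.add hΩ hI (Moderate.mul hΩ hI (mpar.pow hΩ hI 2) (Moderate.const _))
      (Moderate.mul hΩ hI mperp (Moderate.const _))) hw (H.invariant hΩ hI hB0 hw)
    (fun c => by
      have h2 := circAvg_quadratic hb ((innerL (e i)).smulRight (innerL (e j))) c
      refine Eq.trans (circAvg_congr fun θ => ?_) (h2.trans ?_)
      · simp [inner_e]
      · simp only [ContinuousLinearMap.smulRight_apply, _root_.smul_apply, smul_eq_mul,
          innerL_apply, inner_e, perpF_apply, parF, cPar, hγ, hβ]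
        congr 3
        simp [e_apply, Matrix.one_apply])
  have r1 := (r0.mul_moderate hΩ hI (mpar.pow hΩ hI 2)).mul_moderate hΩ hI (Moderate.const β)
  have r2 := (r0.mul_moderate hΩ hI mperp).mul_moderate hΩ hI (Moderate.const γ)
  rw [h1, velInt_congr (g := fun z => h₀ z * parF B z ^ 2 * β + h₀ z * perpF B z * γ)
    fun c => by ring, velInt_add r1 r2 hw, velInt_mul_const, velInt_mul_const, gyroPressure,
    pPar_eq hΩ hI hB hB0 r0 hw, pPerp_eq hΩ hI hB hB0 r0 hw]
  have h3 : velInt (fun z => h₀ z * parF B z ^ 2) w = gyroMoment B h₀ 2 0 w :=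
    velInt_congr fun c => by ring
  have h4 : velInt (fun z => h₀ z * perpF B z) w = ‖B w.1 w.2‖ * gyroMoment B h₀ 0 1 w :=
    velInt_eq_mul _ fun c => by rw [perpF_eq hB0 hw]; ring
  rw [h3, h4]
  simp only [tens, Matrix.add_apply, Matrix.smul_apply, Matrix.sub_apply, Matrix.of_apply,
    smul_eq_mul, hγ, hβ]
  ring

variable {x : V3} (hx : x ∈ Ω) {t : ℝ} (ht : t ∈ I)
include hx ht

omit H in
lemma tensorDvg_gyroPressure {h : Phase → ℝ} (hh : Rapid Ω I h) :
    tensorDvg (fun y => gyroPressure B (weighted B (red B h)) y t) x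
      = gradient (fun y => pPerp B (weighted B (red B h)) y t) x
        + dvg (fun y => (pPar (weighted B (red B h)) y t - pPerp B (weighted B (red B h)) y t)
            • bdir B y t) x • bdir B x t
        + (pPar (weighted B (red B h)) x t - pPerp B (weighted B (red B h)) x t)
          • curvature B x t :=
  tensorDvg_gyrotropic
    ((differentiableAt_slice hΩ hI (contDiffOn_pPar hΩ hI hB hB0 hh) hx ht))
    ((differentiableAt_slice hΩ hI (contDiffOn_pPerp hΩ hI hB hB0 hh) hx ht))
    ((bdir_slice hΩ hI hB hB0 hx ht).differentiableAt (by simp))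

variable {E u' : VField} (hE : ∀ x ∈ Ω, ∀ t ∈ I, F (x, t) = E x t + cross (u' x t) (B x t))
  (hn : dens (weighted B (red B h₀)) x t ≠ 0)
  (hforce : DriftKinetic.force B (weighted B (red B h₀)) x t = F (x, t))
include hE hn hforce

omit hE in
lemma momentum_balance : dens (weighted B (red B h₀)) x t • F (x, t)
      = gradient (fun y => pPerp B (weighted B (red B h₀)) y t) x
        + dvg (fun y => (pPar (weighted B (red B h₀)) y t - pPerp B (weighted B (red B h₀)) y t)
            • bdir B y t) x • bdir B x t
        + (pPar (weighted B (red B h₀)) x t - pPerp B (weighted B (red B h₀)) x t)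
          • curvature B x t := by
  rw [← tensorDvg_gyroPressure hΩ hI hB hB0 hx ht H.rapid₀, ← hforce, DriftKinetic.force,
    smul_smul, mul_inv_cancel₀ hn, one_smul]

/-- The constraint on the parallel electric field. -/
theorem parallel_force_balance : dens (weighted B (red B h₀)) x t * inner ℝ (E x t) (bdir B x t)
    = fderiv ℝ (fun y => pPar (weighted B (red B h₀)) y t) x (bdir B x t)
      + (pPar (weighted B (red B h₀)) x t - pPerp B (weighted B (red B h₀)) x t)
        * divb B x t := by
  have hw : ((x, t) : SpaceTime) ∈ Ω ×ˢ I := ⟨hx, ht⟩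
  have hbb := inner_self_of_unit (unit_bdir hB0 hw)
  have hp := (differentiableAt_slice hΩ hI (contDiffOn_pPar hΩ hI hB hB0 H.rapid₀) hx
    ht)
  have hq := (differentiableAt_slice hΩ hI (contDiffOn_pPerp hΩ hI hB hB0 H.rapid₀) hx
    ht)
  have hb := (bdir_slice hΩ hI hB hB0 hx ht).differentiableAt (by simp)
  have hκ : (inner ℝ (curvature B x t) (bdir B x t) : ℝ) = 0 := by
    have := curvature_eq hΩ hI hB hB0 hw
    dsimp only at this
    rw [this]
    exact inner_gradb hΩ hI hB hB0 hw _
  have h := congrArg (fun v : V3 => (inner ℝ v (bdir B x t) : ℝ))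
    (H.momentum_balance hΩ hI hB hB0 hx ht hn hforce)
  have hE' := inner_cross_B hB0 hw (u' x t)
  dsimp only at h hbb hE'
  rw [dvg_smul (hp.fun_sub hq) hb, fderiv_fun_sub hp hq, hE x hx t ht] at h
  simp only [inner_smul_left, inner_add_left, inner_gradient, hκ, hbb, hE', _root_.sub_apply,
    conj_trivial] at h
  rw [divb]
  linarith

/-- The perpendicular part of the force balance determines the perpendicular bulk velocity. -/
theorem uPerp_eq : uPerp B u' x t = driftPerp E B (weighted B (red B h₀)) x t := by
  have hm : ‖B x t‖ ≠ 0 := norm_ne_zero_iff.2 (hB0 x hx t ht)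
  have h := H.momentum_balance hΩ hI hB hB0 hx ht hn hforce
  rw [hE x hx t ht] at h
  rw [uPerp, driftPerp, fvec]
  exact cross_cross_of_balance hn hm (norm_smul_bdir (hB0 x hx t ht)) h

end KineticHierarchy

end
end

section

/-! ### Pressure equations in terms of the parallel and perpendicular bulk velocity -/

lemma dvg_rearrange {v₁ v₂ X Y Z : V3 → V3} {x : V3} (h₁ : DifferentiableAt ℝ v₁ x)
    (hX : DifferentiableAt ℝ X x) (hY : DifferentiableAt ℝ Y x) (hZ : DifferentiableAt ℝ Z x)
    (h : ∀ᶠ y in 𝓝 x, v₁ y + v₂ y = X y + Y y + Z y) :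
    dvg v₁ x + dvg v₂ x = dvg X x + dvg Y x + dvg Z x := by
  have e : v₂ =ᶠ[𝓝 x] fun y => X y + Y y + Z y - v₁ y := h.mono fun y hy => by
    dsimp only
    rw [← hy, add_sub_cancel_left]
  rw [dvg_congr e, dvg_sub ((hX.fun_add hY).fun_add hZ) h₁, dvg_add (hX.fun_add hY) hZ,
    dvg_add hX hY]
  ring

variable {Ω : Set V3} {I : Set ℝ} {B : VField}

lemma inner_force_invBf (B : VField) (x : V3) (t : ℝ) (F : V3) :
    (inner ℝ F (invBf B (x, t)) : ℝ) = inner ℝ ((1 / ‖B x t‖) • F) (fvec B x t) := by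
  rw [invBf, inner_smul_right, inner_smul_left, one_div]
  rfl

lemma divfB_eq (B : VField) (x : V3) (t : ℝ) :
    divfB B x t = dvg (fun y => invBf B (y, t)) x := by
  simp only [divfB, invBf, one_div]

lemma uPerp_add_uPar {x : V3} {t : ℝ} (hB0 : B x t ≠ 0) (u : VField) :
    u x t = uPerp B u x t + uPar B u x t • bdir B x t := by
  rw [uPerp, uPar, cross_cross_eq, inner_self_of_unit (norm_bdir hB0),
    one_smul, real_inner_comm, sub_add_cancel]

section
variable (hΩ : IsOpen Ω) (hI : IsOpen I) (hB : ContDiffOn ℝ ∞ (onSpaceTime B) (Ω ×ˢ I))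
  (hB0 : ∀ x ∈ Ω, ∀ t ∈ I, B x t ≠ 0) {u : VField}
  (hu : ContDiffOn ℝ ∞ (onSpaceTime u) (Ω ×ˢ I))

section
include hB hB0 hu

lemma contDiffOn_uPerp : ContDiffOn ℝ ∞ (onSpaceTime (uPerp B u)) (Ω ×ˢ I) :=
  ContDiffOn.cross (contDiffOn_bdir hB hB0) (ContDiffOn.cross hu (contDiffOn_bdir hB hB0))

lemma contDiffOn_uPar : ContDiffOn ℝ ∞ (fun w : SpaceTime => uPar B u w.1 w.2) (Ω ×ˢ I) :=
  ContDiffOn.inner ℝ hu (contDiffOn_bdir hB hB0)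

end

include hΩ hI hu in
lemma stretch_eq_fderiv {x : V3} (hx : x ∈ Ω) {t : ℝ} (ht : t ∈ I) : stretch B u x t
    = inner ℝ (fderiv ℝ (onSpaceTime u) (x, t) (bdir B x t, 0)) (bdir B x t) := by
  rw [← fderiv_field_space (differentiableAt_of_contDiffOn hΩ hI hu ⟨hx, ht⟩)]
  rfl

section
include hΩ hI hB hB0 hu
variable {x : V3} (hx : x ∈ Ω) {t : ℝ} (ht : t ∈ I) {V : VField}
  (hV : ∀ x ∈ Ω, ∀ t ∈ I, uPerp B u x t = V x t)
include hx ht hV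

lemma differentiableAt_perp_slice : DifferentiableAt ℝ (fun y => V y t) x :=
  ((differentiableAt_slice hΩ hI (contDiffOn_uPerp hB hB0 hu) hx ht)).congr_of_eventuallyEq
    (Eventually.mono (hΩ.mem_nhds hx) fun y hy => (hV y hy t ht).symm)

omit hI hB hu in
lemma bulk_eventuallyEq :
    (fun y => u y t) =ᶠ[𝓝 x] fun y => V y t + uPar B u y t • bdir B y t :=
  Eventually.mono (hΩ.mem_nhds hx) fun y hy => by
    dsimp only
    rw [← hV y hy t ht]
    exact uPerp_add_uPar (hB0 y hy t ht) u

lemma stretch_decomp : stretch B u x t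
    = stretch B V x t + fderiv ℝ (fun y => uPar B u y t) x (bdir B x t) := by
  have ha := (differentiableAt_slice hΩ hI (contDiffOn_uPar hB hB0 hu) hx ht)
  have hb := (bdir_slice hΩ hI hB hB0 hx ht).differentiableAt (by simp)
  have hw : ((x, t) : SpaceTime) ∈ Ω ×ˢ I := ⟨hx, ht⟩
  have hκ : (inner ℝ (fderiv ℝ (fun y => bdir B y t) x (bdir B x t)) (bdir B x t) : ℝ) = 0 := by
    have := curvature_eq hΩ hI hB hB0 hw
    dsimp only [curvature] at this
    rw [this]
    exact inner_gradb hΩ hI hB hB0 hw _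
  have hbb := inner_self_of_unit (unit_bdir hB0 hw)
  dsimp only at hbb
  rw [stretch, (bulk_eventuallyEq hΩ hB0 hx ht hV).fderiv_eq,
    fderiv_fun_add (differentiableAt_perp_slice hΩ hI hB hB0 hu hx ht hV) (ha.fun_smul hb),
    _root_.add_apply, fderiv_smul_apply ha hb, inner_add_left, inner_add_left, inner_smul_left,
    inner_smul_left, hκ, hbb, stretch]
  simp

lemma dvg_bulk_decomp : dvg (fun y => u y t) x = dvg (fun y => V y t) x
    + (uPar B u x t * divb B x t + fderiv ℝ (fun y => uPar B u y t) x (bdir B x t)) := by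
  have ha := (differentiableAt_slice hΩ hI (contDiffOn_uPar hB hB0 hu) hx ht)
  have hb := (bdir_slice hΩ hI hB hB0 hx ht).differentiableAt (by simp)
  rw [dvg_congr (bulk_eventuallyEq hΩ hB0 hx ht hV),
    dvg_add (differentiableAt_perp_slice hΩ hI hB hB0 hu hx ht hV) (ha.fun_smul hb),
    dvg_smul ha hb, divb]

end

section
include hΩ hI hB hB0
variable {x : V3} (hx : x ∈ Ω) {t : ℝ} (ht : t ∈ I)
include hx ht

omit hΩ hI hB hx in
lemma magDrift_eq {y : V3} (hy : y ∈ Ω) : magDrift B y t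
    = ‖B y t‖ • (curl (fun y => invBb B (y, t)) y - invBf B (y, t)) := by
  have hm := norm_ne_zero_iff.2 (hB0 y hy t ht)
  simp only [magDrift, invBb, invBf, one_div]
  rw [smul_sub, smul_smul, mul_inv_cancel₀ hm, one_smul]

lemma differentiableAt_magDrift : DifferentiableAt ℝ (fun y => magDrift B y t) x := by
  have h := (curl_contDiffAt (contDiffAt_slice hΩ hI (contDiffOn_invBb hB hB0) hx
    ht)).differentiableAt (by simp)
  have hm := (normB_slice hΩ hI hB hB0 hx ht).differentiableAt (by simp)
  have hf := (fvec_slice hΩ hI hB hB0 hx ht).differentiableAt (by simp)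
  refine ((hm.fun_smul h).fun_sub hf).congr_of_eventuallyEq (Eventually.of_forall fun y => ?_)
  simp only [magDrift, invBb, one_div]

end

section
variable {E : VField} {F v : SpaceTime → V3} {h₀ h₁ h₂ : Phase → ℝ}
  (H : KineticHierarchy Ω I B F (onSpaceTime u) v h₀ h₁ h₂)
  (hdivB : ∀ x ∈ Ω, ∀ t ∈ I, dvg (fun y => B y t) x = 0)
  (hforce : ∀ x ∈ Ω, ∀ t ∈ I, DriftKinetic.force B (weighted B (red B h₀)) x t = F (x, t))
  (hV : ∀ x ∈ Ω, ∀ t ∈ I, uPerp B u x t = driftPerp E B (weighted B (red B h₀)) x t)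

namespace KineticHierarchy
include hΩ hI hB hB0 H hdivB hforce hV

variable {x : V3} (hx : x ∈ Ω) {t : ℝ} (ht : t ∈ I)
include hx ht

omit hΩ hI hB hB0 H hdivB hV in
lemma bF_eq : bF B (weighted B (red B h₀)) x t = driftF B F (x, t) := by
  simp only [bF, driftF, invBb, hforce x hx t ht, cross_smul_left, one_div]

omit hI hB hB0 H hdivB hV in
lemma bF_eventuallyEq : (fun y => bF B (weighted B (red B h₀)) y t)
    =ᶠ[𝓝 x] fun y => driftF B F (y, t) :=
  Eventually.mono (hΩ.mem_nhds hx) fun _ hy => bF_eq hforce hy ht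

/-- The evolution equation of the parallel pressure. -/
theorem parallel_pressure :
    fderiv ℝ (fun w : SpaceTime => pPar (weighted B (red B h₀)) w.1 w.2) (x, t) (0, 1)
      = R1 E B (weighted B (red B h₀)) (weighted B (red B h₁)) x t
        - dvg (fun y => (pPar (weighted B (red B h₀)) y t * uPar B u y t) • bdir B y t) x
        - 2 * pPar (weighted B (red B h₀)) x t
          * fderiv ℝ (fun y => uPar B u y t) x (bdir B x t) := by
  have hu : ContDiffOn ℝ ∞ (onSpaceTime u) (Ω ×ˢ I) := H.bulk
  have hw : ((x, t) : SpaceTime) ∈ Ω ×ˢ I := ⟨hx, ht⟩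
  have sl := fun {X : Type} [NormedAddCommGroup X] [NormedSpace ℝ X] {a : SpaceTime → X}
    (ha : ContDiffOn ℝ ∞ a (Ω ×ˢ I)) => differentiableAt_slice hΩ hI ha hx ht
  have r0 := H.rapid₀
  have r1 := H.rapid₁
  set 𝒢 := weighted B (red B h₀) with h𝒢
  set 𝒦 := weighted B (red B h₁) with h𝒦
  have hdV := differentiableAt_perp_slice hΩ hI hB hB0 hu hx ht hV
  have hb := sl (contDiffOn_bdir hB hB0)
  have hp := sl (contDiffOn_pPar hΩ hI hB hB0 r0)
  have ha := sl (contDiffOn_uPar hB hB0 hu)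
  have hdr : DifferentiableAt ℝ (fun y => bF B 𝒢 y t) x :=
    (sl (contDiffOn_driftF hB hB0 H.force)).congr_of_eventuallyEq
      (bF_eventuallyEq hΩ hforce hx ht)
  have hmag := differentiableAt_magDrift hΩ hI hB hB0 hx ht
  have hf : DifferentiableAt ℝ (fun y => (mom 𝒢 4 0 y t / ‖B y t‖) • fvec B y t) x := by
    have h1 := (sl (contDiffOn_mom hΩ hI hB hB0 r0 4 0)).fun_smul
      (sl (contDiffOn_invBf hΩ hI hB hB0))
    refine h1.congr_of_eventuallyEq (Eventually.of_forall fun y => ?_)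
    simp only [invBf, smul_smul, div_eq_mul_inv, h𝒢]
  have h := H.parallel_balance hΩ hI hB hB0 hw
  have key := dvg_rearrange (x := x)
    (v₁ := fun y => gyroMoment B h₀ 2 0 (y, t) • onSpaceTime u (y, t))
    (v₂ := fun y => gyroMoment B h₁ 3 0 (y, t) • bdir B y t
        - (gyroMoment B h₀ 2 0 (y, t) • driftF B F (y, t)
        - gyroMoment B h₀ 4 0 (y, t) • invBf B (y, t)
        - (‖B y t‖ * gyroMoment B h₀ 2 1 (y, t)) •
          (curl (fun y => invBb B (y, t)) y - invBf B (y, t))))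
    (X := fun y => pPar 𝒢 y t • (driftPerp E B 𝒢 y t - bF B 𝒢 y t)
        + mom 𝒢 2 1 y t • magDrift B y t + (mom 𝒢 4 0 y t / ‖B y t‖) • fvec B y t)
    (Y := fun y => mom 𝒦 3 0 y t • bdir B y t)
    (Z := fun y => (pPar 𝒢 y t * uPar B u y t) • bdir B y t)
    ((sl (contDiffOn_gyroMoment hΩ hI hB hB0 r0 2 0)).fun_smul (sl hu))
    (((hp.fun_smul (hdV.fun_sub hdr)).fun_add ((sl (contDiffOn_mom hΩ hI hB hB0 r0 2
      1)).fun_smul hmag)).fun_add hf)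
    ((sl (contDiffOn_mom hΩ hI hB hB0 r1 3 0)).fun_smul hb)
    ((hp.fun_mul ha).fun_smul hb)
    (Eventually.mono (hΩ.mem_nhds hx) fun y hy => by
      have hy' : ((y, t) : SpaceTime) ∈ Ω ×ˢ I := ⟨hy, ht⟩
      have e1 := pPar_eq hΩ hI hB hB0 r0 hy'
      have e2 := mom_eq hΩ hI hB hB0 r0 hy' 2 1
      have e3 := mom_eq hΩ hI hB hB0 r0 hy' 4 0
      have e4 := mom_eq hΩ hI hB hB0 r1 hy' 3 0
      have e5 := uPerp_add_uPar (hB0 y hy t ht) u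
      rw [hV y hy t ht] at e5
      dsimp only at e1 e2 e3 e4 ⊢
      rw [e1, e2, e3, e4, magDrift_eq hB0 ht hy, bF_eq hforce hy ht, onSpaceTime, e5,
        invBf, div_eq_mul_inv]
      module)
  have hσ := stretch_decomp hΩ hI hB hB0 hu hx ht hV
  have hσ' := stretch_eq_fderiv (B := B) hΩ hI hu hx ht
  have hdb := normB_mul_divb hΩ hI hB hB0 hx ht (hdivB x hx t ht)
  have hFf := inner_force_invBf B x t (F (x, t))
  have hdf := divfB_eq B x t
  have e0 := fderiv_eq_of_eqOn hΩ hI (fun w hw => pPar_eq hΩ hI hB hB0 r0 hw) hw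
  have e1 := pPar_eq hΩ hI hB hB0 r0 hw
  have e2 := mom_eq hΩ hI hB hB0 r0 hw 2 1
  have e3 := mom_eq hΩ hI hB hB0 r1 hw 1 0
  have e4 := mom_eq hΩ hI hB hB0 r1 hw 1 1
  dsimp only at e0 e1 e2 e3 e4 h
  rw [e0, R1, hforce x hx t ht, e1, e2, e3, e4, ← hFf, hdf, real_inner_comm (F (x, t)),
    real_inner_comm (gradB B x t)]
  rw [← hσ', hσ, hdb] at h
  linear_combination h - key

/-- The evolution equation of the perpendicular pressure. -/
theorem perpendicular_pressure :
    fderiv ℝ (fun w : SpaceTime => pPerp B (weighted B (red B h₀)) w.1 w.2) (x, t) (0, 1)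
      = R2 E B (weighted B (red B h₀)) (weighted B (red B h₁)) x t
        - dvg (fun y => (pPerp B (weighted B (red B h₀)) y t * uPar B u y t) • bdir B y t) x
        - pPerp B (weighted B (red B h₀)) x t * uPar B u x t * divb B x t := by
  have hu : ContDiffOn ℝ ∞ (onSpaceTime u) (Ω ×ˢ I) := H.bulk
  have hw : ((x, t) : SpaceTime) ∈ Ω ×ˢ I := ⟨hx, ht⟩
  have sl := fun {X : Type} [NormedAddCommGroup X] [NormedSpace ℝ X] {a : SpaceTime → X}
    (ha : ContDiffOn ℝ ∞ a (Ω ×ˢ I)) => differentiableAt_slice hΩ hI ha hx ht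
  have r0 := H.rapid₀
  have r1 := H.rapid₁
  set 𝒢 := weighted B (red B h₀) with h𝒢
  set 𝒦 := weighted B (red B h₁) with h𝒦
  have hdV := differentiableAt_perp_slice hΩ hI hB hB0 hu hx ht hV
  have hb := sl (contDiffOn_bdir hB hB0)
  have hm := sl (contDiffOn_normB hB hB0)
  have hp := sl (contDiffOn_pPerp hΩ hI hB hB0 r0)
  have ha := sl (contDiffOn_uPar hB hB0 hu)
  have hbF := bF_eventuallyEq hΩ hforce hx ht
  have hdr : DifferentiableAt ℝ (fun y => bF B 𝒢 y t) x :=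
    (sl (contDiffOn_driftF hB hB0 H.force)).congr_of_eventuallyEq hbF
  have hmag := differentiableAt_magDrift hΩ hI hB hB0 hx ht
  have hK := (sl (contDiffOn_mom hΩ hI hB hB0 r1 1 1)).fun_smul hb
  have h := H.perpendicular_balance hΩ hI hB hB0 hw
  have key := dvg_rearrange (x := x)
    (v₁ := fun y => (‖B y t‖ * gyroMoment B h₀ 0 1 (y, t)) • onSpaceTime u (y, t))
    (v₂ := fun y => (‖B y t‖ * gyroMoment B h₁ 1 1 (y, t)) • bdir B y t
        - ((‖B y t‖ * gyroMoment B h₀ 0 1 (y, t)) • driftF B F (y, t)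
        - (‖B y t‖ * gyroMoment B h₀ 2 1 (y, t)) • invBf B (y, t)
        - (‖B y t‖ ^ 2 * gyroMoment B h₀ 0 2 (y, t)) •
          (curl (fun y => invBb B (y, t)) y - invBf B (y, t))))
    (X := fun y => pPerp B 𝒢 y t • (driftPerp E B 𝒢 y t - bF B 𝒢 y t)
        + (‖B y t‖ * mom 𝒢 0 2 y t) • magDrift B y t + mom 𝒢 2 1 y t • fvec B y t)
    (Y := fun y => ‖B y t‖ • (mom 𝒦 1 1 y t • bdir B y t))
    (Z := fun y => (pPerp B 𝒢 y t * uPar B u y t) • bdir B y t)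
    ((hm.fun_mul (sl (contDiffOn_gyroMoment hΩ hI hB hB0 r0 0 1))).fun_smul (sl hu))
    (((hp.fun_smul (hdV.fun_sub hdr)).fun_add ((hm.fun_mul (sl (contDiffOn_mom hΩ hI hB hB0 r0 0
      2))).fun_smul hmag)).fun_add ((sl (contDiffOn_mom hΩ hI hB hB0 r0 2 1)).fun_smul
      ((fvec_slice hΩ hI hB hB0 hx ht).differentiableAt (by simp))))
    (hm.fun_smul hK)
    ((hp.fun_mul ha).fun_smul hb)
    (Eventually.mono (hΩ.mem_nhds hx) fun y hy => by
      have hy' : ((y, t) : SpaceTime) ∈ Ω ×ˢ I := ⟨hy, ht⟩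
      have e1 := pPerp_eq hΩ hI hB hB0 r0 hy'
      have e2 := mom_eq hΩ hI hB hB0 r0 hy' 2 1
      have e3 := mom_eq hΩ hI hB hB0 r0 hy' 0 2
      have e4 := mom_eq hΩ hI hB hB0 r1 hy' 1 1
      have e5 := uPerp_add_uPar (hB0 y hy t ht) u
      rw [hV y hy t ht] at e5
      have e6 : ‖B y t‖ • invBf B (y, t) = fvec B y t := by
        rw [invBf, smul_smul]
        dsimp only
        rw [mul_inv_cancel₀ (norm_ne_zero_iff.2 (hB0 y hy t ht)), one_smul]
      dsimp only at e1 e2 e3 e4 ⊢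
      rw [e1, e2, e3, e4, magDrift_eq hB0 ht hy, bF_eq hforce hy ht, onSpaceTime, e5,
        ← e6]
      module)
  have hσ := stretch_decomp hΩ hI hB hB0 hu hx ht hV
  have hη := dvg_bulk_decomp hΩ hI hB hB0 hu hx ht hV
  have hσ' := stretch_eq_fderiv (B := B) hΩ hI hu hx ht
  have hη' : dvg (fun y => onSpaceTime u (y, t)) x = dvg (fun y => u y t) x := rfl
  have hdb := normB_mul_divb hΩ hI hB hB0 hx ht (hdivB x hx t ht)
  have hFf := inner_force_invBf B x t (F (x, t))
  have hdf := divfB_eq B x t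
  have hKd : dvg (fun y => ‖B y t‖ • (mom 𝒦 1 1 y t • bdir B y t)) x
      = ‖B x t‖ * dvg (fun y => mom 𝒦 1 1 y t • bdir B y t) x
        + mom 𝒦 1 1 x t * inner ℝ (gradB B x t) (bdir B x t) := by
    have h1 := dvg_smul hm hK
    rw [fderiv_normB, inner_smul_right] at h1
    exact h1
  have e0 := fderiv_eq_of_eqOn hΩ hI (fun w hw => pPerp_eq hΩ hI hB hB0 r0 hw) hw
  have e1 := pPerp_eq hΩ hI hB hB0 r0 hw
  have e2 := mom_eq hΩ hI hB hB0 r0 hw 2 1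
  have e4 := mom_eq hΩ hI hB hB0 r1 hw 1 1
  dsimp only at e0 e1 e2 e4 h
  rw [e4] at hKd
  rw [e0, R2, hforce x hx t ht, e1, e2, ← hFf, hdf, dvg_congr hbF]
  rw [← hσ', hσ, hη', hη, hdb] at h
  linear_combination h - key - hKd

end KineticHierarchy
end
end
end

section

/-! ### The elliptic equation for the parallel bulk velocity -/

variable {Ω : Set V3} {I : Set ℝ}

section
variable (hΩ : IsOpen Ω) (hI : IsOpen I) {x : V3} (hx : x ∈ Ω) {t : ℝ} (ht : t ∈ I)
include hΩ hI hx ht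

/-- Time and space derivatives commute. -/
lemma fderiv_time_space {F : Type} [NormedAddCommGroup F] [NormedSpace ℝ F] {f : SpaceTime → F}
    (hf : ContDiffOn ℝ ∞ f (Ω ×ˢ I)) (v : V3) :
    fderiv ℝ (fun z => fderiv ℝ f z (v, 0)) (x, t) (0, 1)
      = fderiv ℝ (fun y => fderiv ℝ f (y, t) (0, 1)) x v := by
  have h2 : ContDiffAt ℝ 2 f (x, t) :=
    (hf.contDiffAt ((hΩ.prod hI).mem_nhds ⟨hx, ht⟩)).of_le two_le_infty
  rw [fderiv_fderiv_apply h2, second_deriv_symm h2, ← fderiv_fderiv_apply h2]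
  exact (fderiv_slice_space (a := fun z => fderiv ℝ f z (0, 1))
    ((differentiableAt_fderiv h2).clm_apply (differentiableAt_const _)) v).symm

variable {p : SpaceTime → ℝ} {b : SpaceTime → V3} (hp : ContDiffOn ℝ ∞ p (Ω ×ˢ I))
  (hb : ContDiffOn ℝ ∞ b (Ω ×ˢ I))
include hb

lemma fderiv_time_dvg : fderiv ℝ (fun z : SpaceTime => dvg (fun y => b (y, z.2)) z.1) (x, t) (0, 1)
    = dvg (fun y => fderiv ℝ b (y, t) (0, 1)) x := by
  have h2 : ContDiffAt ℝ 2 b (x, t) :=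
    (hb.contDiffAt ((hΩ.prod hI).mem_nhds ⟨hx, ht⟩)).of_le two_le_infty
  have hd : ∀ v, DifferentiableAt ℝ (fun z => fderiv ℝ b z v) (x, t) := fun v =>
    (differentiableAt_fderiv h2).clm_apply (differentiableAt_const _)
  rw [fderiv_eq_of_eqOn hΩ hI (fun z hz => dvg_field
    (differentiableAt_of_contDiffOn hΩ hI hb hz)) ⟨hx, ht⟩, fderiv_fun_sum fun i _ =>
      (differentiableAt_const (e i)).inner ℝ (hd _), _root_.sum_apply]
  refine Finset.sum_congr rfl fun i _ => ?_
  rw [fderiv_inner_apply ℝ (differentiableAt_const _) (hd _), fderiv_time_space hΩ hI hx ht hb]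
  simp [inner_e]

include hp

lemma fderiv_time_along :
    fderiv ℝ (fun z => fderiv ℝ p z (b z, 0)) (x, t) (0, 1)
      = fderiv ℝ (fun y => fderiv ℝ p (y, t) (0, 1)) x (b (x, t))
        + fderiv ℝ (fun y => p (y, t)) x (fderiv ℝ b (x, t) (0, 1)) := by
  have h2 : ContDiffAt ℝ 2 p (x, t) :=
    (hp.contDiffAt ((hΩ.prod hI).mem_nhds ⟨hx, ht⟩)).of_le two_le_infty
  have hbd := differentiableAt_of_contDiffOn hΩ hI hb (w := (x, t)) ⟨hx, ht⟩
  have hpd := differentiableAt_of_contDiffOn hΩ hI hp (w := (x, t)) ⟨hx, ht⟩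
  have hd := differentiableAt_fderiv h2
  rw [fderiv_slice_space hpd, ← fderiv_time_space hΩ hI hx ht hp, fderiv_fderiv_apply h2,
    fderiv_clm_apply hd (hbd.prodMk (differentiableAt_const _)), _root_.add_apply,
    hbd.fderiv_prodMk (differentiableAt_const _)]
  simp [add_comm]

end

section
variable (hΩ : IsOpen Ω) (hI : IsOpen I) {p q n a w : SpaceTime → ℝ} {b : SpaceTime → V3}
  (hp : ContDiffOn ℝ ∞ p (Ω ×ˢ I)) (hq : ContDiffOn ℝ ∞ q (Ω ×ˢ I))
  (hn : ContDiffOn ℝ ∞ n (Ω ×ˢ I)) (ha : ContDiffOn ℝ ∞ a (Ω ×ˢ I))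
  (hw : ContDiffOn ℝ ∞ w (Ω ×ˢ I)) (hb : ContDiffOn ℝ ∞ b (Ω ×ˢ I))
include hΩ hI hp hq hn ha hw hb

/-- The elliptic equation is the compatibility condition between the evolution equations of `p`,
`q`, `n` and the constraint `n a = b · ∇p + (p - q) ∇ · b`: it is obtained by differentiating the
constraint in time. -/
theorem elliptic_of_constraint {S T N : SpaceTime → ℝ} {x : V3} {t : ℝ} (hx : x ∈ Ω) (ht : t ∈ I)
    (hconstr : ∀ z ∈ Ω ×ˢ I, n z * a z = fderiv ℝ (fun y => p (y, z.2)) z.1 (b z)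
      + (p z - q z) * dvg (fun y => b (y, z.2)) z.1)
    (hpt : ∀ z ∈ Ω ×ˢ I, fderiv ℝ p z (0, 1) = S z
      - dvg (fun y => (p (y, z.2) * w (y, z.2)) • b (y, z.2)) z.1
      - 2 * p z * fderiv ℝ (fun y => w (y, z.2)) z.1 (b z))
    (hqt : fderiv ℝ q (x, t) (0, 1) = T (x, t)
      - dvg (fun y => (q (y, t) * w (y, t)) • b (y, t)) x
      - q (x, t) * w (x, t) * dvg (fun y => b (y, t)) x)
    (hnt : fderiv ℝ n (x, t) (0, 1) = -N (x, t)
      - dvg (fun y => (n (y, t) * w (y, t)) • b (y, t)) x) :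
    -3 * fderiv ℝ (fun z => dvg (fun y => (p (y, t) * w (y, t)) • b (y, t)) z) x (b (x, t))
      + 2 * dvg (fun z => (w (z, t) * dvg (fun y => p (y, t) • b (y, t)) z) • b (z, t)) x
      + a (x, t) * dvg (fun y => (n (y, t) * w (y, t)) • b (y, t)) x
      + dvg (fun y => b (y, t)) x
        * dvg (fun y => ((-3 * p (y, t) + q (y, t)) * w (y, t)) • b (y, t)) x
      + q (x, t) * dvg (fun y => b (y, t)) x ^ 2 * w (x, t)
    = -fderiv ℝ (fun y => S (y, t)) x (b (x, t)) - a (x, t) * N (x, t)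
      - dvg (fun y => b (y, t)) x * (S (x, t) - T (x, t))
      + n (x, t) * fderiv ℝ a (x, t) (0, 1)
      - fderiv ℝ (fun y => p (y, t)) x (fderiv ℝ b (x, t) (0, 1))
      - (p (x, t) - q (x, t)) * dvg (fun y => fderiv ℝ b (y, t) (0, 1)) x := by
  have hz : ((x, t) : SpaceTime) ∈ Ω ×ˢ I := ⟨hx, ht⟩
  have hO := hΩ.prod hI
  have df : ∀ {X : Type} [NormedAddCommGroup X] [NormedSpace ℝ X] {f : SpaceTime → X},
      ContDiffOn ℝ ∞ f (Ω ×ˢ I) → DifferentiableAt ℝ f (x, t) := fun hf =>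
    differentiableAt_of_contDiffOn hΩ hI hf hz
  have sl : ∀ {X : Type} [NormedAddCommGroup X] [NormedSpace ℝ X] {f : SpaceTime → X},
      ContDiffOn ℝ ∞ f (Ω ×ˢ I) → ∀ {y}, y ∈ Ω → DifferentiableAt ℝ (fun y => f (y, t)) y :=
    fun hf _ hy => differentiableAt_slice hΩ hI hf hy ht
  have cf : ∀ {X : Type} [NormedAddCommGroup X] [NormedSpace ℝ X] {f : SpaceTime → X},
      ContDiffOn ℝ ∞ f (Ω ×ˢ I) → ContDiffOn ℝ ∞ (fderiv ℝ f) (Ω ×ˢ I) := fun hf =>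
    hf.fderiv_of_isOpen hO (by norm_cast)
  -- The divergence of `b` and the derivatives along `b` are smooth.
  have hdiv : ContDiffOn ℝ ∞ (fun z : SpaceTime => dvg (fun y => b (y, z.2)) z.1) (Ω ×ˢ I) := by
    refine (ContDiffOn.sum (s := Finset.univ) fun i _ => ContDiffOn.inner ℝ
      (contDiffOn_const (c := e i)) ((cf hb).clm_apply
      (contDiffOn_const (c := ((e i, 0) : SpaceTime))))).congr fun z hz =>
        dvg_field (differentiableAt_of_contDiffOn hΩ hI hb hz)
  have halong : ∀ {f : SpaceTime → ℝ}, ContDiffOn ℝ ∞ f (Ω ×ˢ I) →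
      ContDiffOn ℝ ∞ (fun z => fderiv ℝ (fun y => f (y, z.2)) z.1 (b z)) (Ω ×ˢ I) := fun hf =>
    ((cf hf).clm_apply (hb.prodMk (contDiffOn_const (c := (0 : ℝ))))).congr fun z hz =>
      fderiv_field_space (differentiableAt_of_contDiffOn hΩ hI hf hz) _
  have hnear : ∀ᶠ y in 𝓝 x, y ∈ Ω := hΩ.mem_nhds hx
  -- The constraint, differentiated in time.
  have h1 : fderiv ℝ (fun z => n z * a z) (x, t) (0, 1)
      = fderiv ℝ (fun z => fderiv ℝ p z (b z, 0)
        + (p z - q z) * dvg (fun y => b (y, z.2)) z.1) (x, t) (0, 1) := by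
    rw [fderiv_eq_of_eqOn hΩ hI (fun z hz => (hconstr z hz).trans (by
      rw [fderiv_field_space (differentiableAt_of_contDiffOn hΩ hI hp hz)])) hz]
  rw [fderiv_fun_mul (df hn) (df ha), fderiv_fun_add
      ((df (cf hp)).clm_apply ((df hb).prodMk (differentiableAt_const _)))
      (((df hp).fun_sub (df hq)).fun_mul (df hdiv)),
    fderiv_fun_mul ((df hp).fun_sub (df hq)) (df hdiv), fderiv_fun_sub (df hp) (df hq)] at h1
  simp only [_root_.add_apply, _root_.smul_apply, _root_.sub_apply, smul_eq_mul,
    fderiv_time_along hΩ hI hx ht hp hb, fderiv_time_dvg hΩ hI hx ht hb] at h1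
  -- The fluxes, expanded along the field lines.
  have hA : ∀ y ∈ Ω, dvg (fun y => p (y, t) • b (y, t)) y
      = p (y, t) * dvg (fun y => b (y, t)) y + fderiv ℝ (fun y => p (y, t)) y (b (y, t)) :=
    fun y hy => dvg_smul (sl hp hy) (sl hb hy)
  have hD : ∀ y ∈ Ω, dvg (fun y => (p (y, t) * w (y, t)) • b (y, t)) y
      = w (y, t) * dvg (fun y => p (y, t) • b (y, t)) y
        + p (y, t) * fderiv ℝ (fun y => w (y, t)) y (b (y, t)) := fun y hy => by
    have := dvg_smul (sl hw hy) ((sl hp hy).fun_smul (sl hb hy))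
    simp only [smul_smul, map_smul, smul_eq_mul] at this
    simpa only [mul_comm (w _)] using this
  have dA : DifferentiableAt ℝ (fun y => dvg (fun y => p (y, t) • b (y, t)) y) x :=
    (((sl hp hx).fun_mul (sl hdiv hx)).fun_add (sl (halong hp) hx)).congr_of_eventuallyEq
      (hnear.mono hA)
  have dW : DifferentiableAt ℝ (fun y => fderiv ℝ (fun y => w (y, t)) y (b (y, t))) x :=
    sl (halong hw) hx
  have dwA := (sl hw hx).fun_mul dA
  have dpW := (sl hp hx).fun_mul dW
  have h2 : fderiv ℝ (fun z => dvg (fun y => (p (y, t) * w (y, t)) • b (y, t)) z) x (b (x, t))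
      = fderiv ℝ (fun y => w (y, t) * dvg (fun y => p (y, t) • b (y, t)) y) x (b (x, t))
        + fderiv ℝ (fun y => p (y, t) * fderiv ℝ (fun y => w (y, t)) y (b (y, t))) x
          (b (x, t)) := by
    rw [EventuallyEq.fderiv_eq (hnear.mono hD), fderiv_fun_add dwA dpW, _root_.add_apply]
  have h3 := dvg_smul dwA (sl hb hx)
  have h4 : dvg (fun y => ((-3 * p (y, t) + q (y, t)) * w (y, t)) • b (y, t)) x
      = -3 * dvg (fun y => (p (y, t) * w (y, t)) • b (y, t)) x
        + dvg (fun y => (q (y, t) * w (y, t)) • b (y, t)) x := by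
    have e1 := ((sl hp hx).fun_mul (sl hw hx)).fun_smul (sl hb hx)
    have e2 := ((sl hq hx).fun_mul (sl hw hx)).fun_smul (sl hb hx)
    rw [← dvg_const_smul (-3) e1, ← dvg_add (e1.fun_const_smul (-3)) e2]
    exact dvg_congr (Eventually.of_forall fun y => by dsimp only; module)
  -- The source term is smooth along the field lines, because the other terms are.
  have h5 : fderiv ℝ (fun y => S (y, t)) x (b (x, t))
      = fderiv ℝ (fun y => fderiv ℝ p (y, t) (0, 1)) x (b (x, t))
        + fderiv ℝ (fun z => dvg (fun y => (p (y, t) * w (y, t)) • b (y, t)) z) x (b (x, t))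
        + 2 * fderiv ℝ (fun y => p (y, t) * fderiv ℝ (fun y => w (y, t)) y (b (y, t))) x
          (b (x, t)) := by
    have e1 : (fun y => S (y, t)) =ᶠ[𝓝 x] fun y => fderiv ℝ p (y, t) (0, 1)
        + dvg (fun y => (p (y, t) * w (y, t)) • b (y, t)) y
        + 2 * (p (y, t) * fderiv ℝ (fun y => w (y, t)) y (b (y, t))) := hnear.mono fun y hy => by
      have := hpt (y, t) ⟨hy, ht⟩
      dsimp only at this ⊢
      rw [this]
      ring
    have dP : DifferentiableAt ℝ (fun y => fderiv ℝ p (y, t) (0, 1)) x :=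
      sl ((cf hp).clm_apply (contDiffOn_const (c := ((0, 1) : SpaceTime)))) hx
    have dD : DifferentiableAt ℝ (fun z => dvg (fun y => (p (y, t) * w (y, t)) • b (y, t)) z) x :=
      (dwA.fun_add dpW).congr_of_eventuallyEq (hnear.mono hD)
    rw [e1.fderiv_eq, fderiv_fun_add (dP.fun_add dD) (dpW.const_mul 2), fderiv_fun_add dP dD,
      fderiv_const_mul dpW]
    rfl
  have h6 := hpt (x, t) hz
  have h7 := hD x hx
  dsimp only at h6
  rw [hnt, h6, hqt] at h1
  rw [h2] at h5 ⊢
  rw [h3, h4, h5]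
  linear_combination -h1 - 2 * dvg (fun y => b (y, t)) x * h7

end
end

section

variable {Ω : Set V3} {I : Set ℝ} {B : VField}

section
variable (hΩ : IsOpen Ω) (hI : IsOpen I) (hB : ContDiffOn ℝ ∞ (onSpaceTime B) (Ω ×ˢ I))
  (hB0 : ∀ x ∈ Ω, ∀ t ∈ I, B x t ≠ 0) {E u : VField} (hE : ContDiffOn ℝ ∞ (onSpaceTime E) (Ω ×ˢ I))
  {F v : SpaceTime → V3} {h₀ h₁ h₂ : Phase → ℝ}
  (H : KineticHierarchy Ω I B F (onSpaceTime u) v h₀ h₁ h₂)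
  (hdivB : ∀ x ∈ Ω, ∀ t ∈ I, dvg (fun y => B y t) x = 0)
  (hF : ∀ x ∈ Ω, ∀ t ∈ I, F (x, t) = E x t + cross (u x t) (B x t))
  (hn : ∀ x ∈ Ω, ∀ t ∈ I, dens (weighted B (red B h₀)) x t ≠ 0)
  (hforce : ∀ x ∈ Ω, ∀ t ∈ I, DriftKinetic.force B (weighted B (red B h₀)) x t = F (x, t))
  (hmean : ∀ w ∈ Ω ×ˢ I, velInt (fun z => h₁ z • z.2.1) w = 0)

namespace KineticHierarchy
include hΩ hI hB hB0 H

include hE hdivB hF hn hforce hmean in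
/-- The equation for the parallel bulk velocity. -/
theorem elliptic {x : V3} (hx : x ∈ Ω) {t : ℝ} (ht : t ∈ I) :
    ellipticLHS E B (weighted B (red B h₀)) (uPar B u) x t
      = R3 E B (weighted B (red B h₀)) (weighted B (red B h₁)) x t := by
  have hu : ContDiffOn ℝ ∞ (onSpaceTime u) (Ω ×ˢ I) := H.bulk
  have hw : ((x, t) : SpaceTime) ∈ Ω ×ˢ I := ⟨hx, ht⟩
  have r0 := H.rapid₀
  have hV : ∀ x ∈ Ω, ∀ t ∈ I, uPerp B u x t = driftPerp E B (weighted B (red B h₀)) x t :=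
    fun x hx t ht => H.uPerp_eq hΩ hI hB hB0 hx ht hF (hn x hx t ht) (hforce x hx t ht)
  have hc : ∀ x ∈ Ω, ∀ t ∈ I, _ := fun x hx t ht =>
    H.parallel_force_balance hΩ hI hB hB0 hx ht hF (hn x hx t ht) (hforce x hx t ht)
  have hpt : ∀ x ∈ Ω, ∀ t ∈ I, _ := fun x hx t ht =>
    H.parallel_pressure hΩ hI hB hB0 hdivB hforce hV hx ht
  have hqt := H.perpendicular_pressure hΩ hI hB hB0 hdivB hforce hV hx ht
  have hnt := H.continuity hΩ hI hB hB0 hw hmean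
  set 𝒢 := weighted B (red B h₀) with h𝒢
  set 𝒦 := weighted B (red B h₁) with h𝒦
  have sb := contDiffOn_bdir hB hB0
  have sa : ContDiffOn ℝ ∞ (fun w : SpaceTime => (inner ℝ (E w.1 w.2) (bdir B w.1 w.2) : ℝ))
    (Ω ×ˢ I) := ContDiffOn.inner ℝ hE sb
  have sw := contDiffOn_uPar hB hB0 hu
  have sn := contDiffOn_dens hΩ hI hB0 r0
  have hnear : ∀ᶠ y in 𝓝 x, y ∈ Ω := hΩ.mem_nhds hx
  have hnt' : fderiv ℝ (fun w : SpaceTime => dens 𝒢 w.1 w.2) (x, t) (0, 1)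
      = -dvg (fun y => dens 𝒢 y t • driftPerp E B 𝒢 y t) x
        - dvg (fun y => (dens 𝒢 y t * uPar B u y t) • bdir B y t) x := by
    have dn := (differentiableAt_slice hΩ hI sn hx ht)
    have dw := (differentiableAt_slice hΩ hI sw hx ht)
    have db := (bdir_slice hΩ hI hB hB0 hx ht).differentiableAt (by simp)
    have dV := differentiableAt_perp_slice hΩ hI hB hB0 hu hx ht hV
    have j : dvg (fun y => velInt h₀ (y, t) • onSpaceTime u (y, t)) x
        = dvg (fun y => dens 𝒢 y t • driftPerp E B 𝒢 y t
          + (dens 𝒢 y t * uPar B u y t) • bdir B y t) x :=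
      dvg_congr (hnear.mono fun y hy => by
        have e1 := dens_eq hB0 r0 (w := (y, t)) ⟨hy, ht⟩
        have e2 := uPerp_add_uPar (hB0 y hy t ht) u
        rw [hV y hy t ht] at e2
        dsimp only at e1 ⊢
        rw [← e1, onSpaceTime, e2, smul_add, smul_smul])
    rw [fderiv_eq_of_eqOn hΩ hI (fun w hw => dens_eq hB0 r0 hw) hw]
    dsimp only at hnt
    rw [j, dvg_add (dn.fun_smul dV) ((dn.fun_mul dw).fun_smul db)] at hnt
    linarith
  have key := elliptic_of_constraint hΩ hI
    (p := fun w => pPar 𝒢 w.1 w.2) (q := fun w => pPerp B 𝒢 w.1 w.2)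
    (S := fun w => R1 E B 𝒢 𝒦 w.1 w.2) (T := fun w => R2 E B 𝒢 𝒦 w.1 w.2)
    (N := fun w => dvg (fun y => dens 𝒢 y w.2 • driftPerp E B 𝒢 y w.2) w.1)
    (contDiffOn_pPar hΩ hI hB hB0 r0) (contDiffOn_pPerp hΩ hI hB hB0 r0) sn sa sw sb hx ht
    (fun z hz => hc z.1 hz.1 z.2 hz.2) (fun z hz => hpt z.1 hz.1 z.2 hz.2) hqt hnt'
  have d1 : deriv (fun s => (inner ℝ (E x s) (bdir B x s) : ℝ)) t = _ :=
    deriv_slice_field (differentiableAt_of_contDiffOn hΩ hI sa hw)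
  have d2 : ∀ y ∈ Ω, deriv (fun s => bdir B y s) t = fderiv ℝ (onSpaceTime (bdir B)) (y, t) (0, 1) :=
    fun y hy => deriv_slice_field (a := onSpaceTime (bdir B))
      (differentiableAt_of_contDiffOn hΩ hI sb (w := (y, t)) ⟨hy, ht⟩)
  have d3 : dvg (fun y => deriv (fun s => bdir B y s) t) x
      = dvg (fun y => fderiv ℝ (onSpaceTime (bdir B)) (y, t) (0, 1)) x :=
    dvg_congr (hnear.mono d2)
  rw [ellipticLHS, R3, d1, d3, d2 x hx, real_inner_comm _ (bdir B x t), inner_gradient,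
    real_inner_comm _ (bdir B x t), inner_gradient, real_inner_comm _ (fderiv ℝ _ _ _),
    inner_gradient]
  exact key

include hmean in
lemma mom_first_eq_zero {x : V3} (hx : x ∈ Ω) {t : ℝ} (ht : t ∈ I) :
    mom (weighted B (red B h₁)) 1 0 x t = 0 := by
  have hw : ((x, t) : SpaceTime) ∈ Ω ×ˢ I := ⟨hx, ht⟩
  have h1 := mom_eq hΩ hI hB hB0 H.rapid₁ hw 1 0
  have h2 := inner_velInt (H.rapid₁.smul_moderate hΩ hI Moderate.vel) hw (bdir B x t)
  rw [hmean _ hw, inner_zero_right] at h2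
  refine h1.trans ((velInt_congr fun c => ?_).trans h2.symm)
  dsimp only
  rw [inner_smul_right, parF, cPar, real_inner_comm, pow_one, pow_zero, mul_one]

end KineticHierarchy
end

/-! ### The coefficients of a Hilbert expansion -/

section
variable {E : VField} {g : ℝ → Distr} {u : ℝ → VField} {gc : ℕ → Distr} {uc : ℕ → VField}
  (hΩ : IsOpen Ω) (hI : IsOpen I) (hE : ContDiffOn ℝ ∞ (onSpaceTime E) (Ω ×ˢ I))
  (hB : ContDiffOn ℝ ∞ (onSpaceTime B) (Ω ×ˢ I)) (hB0 : ∀ x ∈ Ω, ∀ t ∈ I, B x t ≠ 0)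
  (hsol : FormalSolution Ω I E B g u) (hexp : HilbertExpansion Ω I g u gc uc)
  (hn : ∀ x ∈ Ω, ∀ t ∈ I, density (gc 0) x t ≠ 0)

/-- The leading part of the force, `E + u₀ × B`. -/
def lorentz (E B u : VField) (w : SpaceTime) : V3 := E w.1 w.2 + cross (u w.1 w.2) (B w.1 w.2)

include hΩ hI hexp hsol

include hE hB hn in
/-- The coefficients of a Hilbert expansion satisfy the kinetic hierarchy. -/
theorem kineticHierarchy_of_expansion : KineticHierarchy Ω I B (lorentz E B (uc 0))
    (onSpaceTime (uc 0)) (onSpaceTime (uc 1)) (onPhase (gc 0)) (onPhase (gc 1))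
    (onPhase (gc 2)) where
  rapid₀ := (hexp.coeff_g 0 (by norm_num)).rapid
  rapid₁ := (hexp.coeff_g 1 (by norm_num)).rapid
  rapid₂ := (hexp.coeff_g 2 (by norm_num)).rapid
  force := hE.add (ContDiffOn.cross (hexp.coeff_u 0 (by norm_num)) hB)
  bulk := hexp.coeff_u 0 (by norm_num)
  order₀ := fun z hz => (vlasov_orders hΩ hI hexp hsol hn hz.1 z.2.1 hz.2).1
  order₁ := fun z hz => (vlasov_orders hΩ hI hexp hsol hn hz.1 z.2.1 hz.2).2.1
  order₂ := fun z hz => (vlasov_orders hΩ hI hexp hsol hn hz.1 z.2.1 hz.2).2.2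

lemma mean_first {w : SpaceTime} (hw : w ∈ Ω ×ˢ I) :
    velInt (fun z => onPhase (gc 1) z • z.2.1) w = 0 := by
  have r1 : Rapid Ω I (onPhase (gc 1)) := (hexp.coeff_g 1 (by norm_num)).rapid
  have h : ∀ i : Fin 3, velInt (fun z => onPhase (gc 1) z • z.2.1) w i = 0 := fun i => by
    rw [← inner_e, inner_velInt (r1.smul_moderate hΩ hI Moderate.vel) hw,
      ← first_moment_zero hΩ hI hexp hsol hw i, weightInt]
    exact velInt_congr fun c => by rw [inner_smul_right, inner_e]
  exact v3_ext (h 0) (h 1) (h 2)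

include hE hB hB0 hn

omit hΩ hI hsol hE hB in
lemma dens_ne_zero {x : V3} (hx : x ∈ Ω) {t : ℝ} (ht : t ∈ I) :
    dens (weighted B (red B (onPhase (gc 0)))) x t ≠ 0 := by
  rw [dens_red hB0 (hexp.coeff_g 0 (by norm_num)).rapid hx ht]
  exact hn x hx t ht

lemma force_eq_lorentz {x : V3} (hx : x ∈ Ω) {t : ℝ} (ht : t ∈ I) :
    force B (weighted B (red B (onPhase (gc 0)))) x t = lorentz E B (uc 0) (x, t) := by
  have H := kineticHierarchy_of_expansion hΩ hI hE hB hsol hexp hn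
  have h1 : tensorDvg (fun y => gyroPressure B (weighted B (red B (onPhase (gc 0)))) y t) x
      = tensorDvg (fun y => pressure (gc 0) y t) x := by
    simp only [tensorDvg]
    congr 1
    funext j
    refine Finset.sum_congr rfl fun i _ => ?_
    rw [EventuallyEq.fderiv_eq (Eventually.mono (hΩ.mem_nhds hx) fun y hy =>
      (H.pressure_eq hΩ hI hB hB0 (w := (y, t)) ⟨hy, ht⟩ i j).symm)]
    rfl
  rw [force, h1, tensorDvg_pressure_eq hΩ hI hexp hsol hx ht,
    dens_red hB0 (hexp.coeff_g 0 (by norm_num)).rapid hx ht]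
  change (density (gc 0) x t)⁻¹ • _ = _
  rw [smul_smul, inv_mul_cancel₀ (hn x hx t ht), one_smul]
  rfl

end

end

end DriftKinetic
end

open DriftKinetic

theorem theorem2p1
    (Ω : Set V3) (hΩ : IsOpen Ω) (I : Set ℝ) (hI : IsOpen I)
    -- the given electromagnetic field: smooth, with `B` divergence free and nowhere zero
    (E B : VField)
    (hE : ContDiffOn ℝ ∞ (onSpaceTime E) (Ω ×ˢ I))
    (hB : ContDiffOn ℝ ∞ (onSpaceTime B) (Ω ×ˢ I))
    (hB0 : ∀ x ∈ Ω, ∀ t ∈ I, B x t ≠ 0)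
    (hdivB : ∀ x ∈ Ω, ∀ t ∈ I, dvg (fun y => B y t) x = 0)
    -- a family of solutions with a Hilbert expansion and nonvanishing leading order density
    (g : ℝ → Distr) (u : ℝ → VField) (gc : ℕ → Distr) (uc : ℕ → VField)
    (hsol : FormalSolution Ω I E B g u)
    (hexp : HilbertExpansion Ω I g u gc uc)
    (hn : ∀ x ∈ Ω, ∀ t ∈ I, density (gc 0) x t ≠ 0) :
    ∃ G K : RDistr,
      RegularReduced Ω I G ∧ RegularReduced Ω I K ∧
      -- convergence; the limit distribution does not depend on the gyrophase
      (∀ x ∈ Ω, ∀ t ∈ I, ∀ c : V3, Tendsto (fun ε => g ε x c t) (𝓝[>] 0)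
        (𝓝 (G x (magMoment B x c t) (cPar B x c t) t))) ∧
      (∀ x ∈ Ω, ∀ t ∈ I, Tendsto (fun ε => u ε x t) (𝓝[>] 0) (𝓝 (uc 0 x t))) ∧
      -- the constrained transport system
      (∀ x ∈ Ω, ∀ t ∈ I, ∀ μ > 0, ∀ c : ℝ,
        deriv (fun s => weighted B G x μ c s) t + Sdag B (uc 0) (weighted B G) x μ c t
          + Cdag B (weighted B G) (weighted B K) x μ c t = 0) ∧
      (∀ x ∈ Ω, ∀ t ∈ I, ∀ μ > 0, ∀ c : ℝ,
        Cdag B (weighted B G) (weighted B G) x μ c t = 0) ∧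
      (∀ x ∈ Ω, ∀ t ∈ I, ∫ p in domMu, weighted B K x p.1 p.2 t * p.2 = 0) ∧
      -- the perpendicular and parallel bulk velocity
      (∀ x ∈ Ω, ∀ t ∈ I, uPerp B (uc 0) x t = driftPerp E B (weighted B G) x t) ∧
      (∀ x ∈ Ω, ∀ t ∈ I,
        ellipticLHS E B (weighted B G) (uPar B (uc 0)) x t
          = R3 E B (weighted B G) (weighted B K) x t) := by
  have H := kineticHierarchy_of_expansion hΩ hI hE hB hsol hexp hn
  have hforce := fun x (hx : x ∈ Ω) t (ht : t ∈ I) =>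
    force_eq_lorentz hΩ hI hE hB hB0 hsol hexp hn hx ht
  have hdens := fun x (hx : x ∈ Ω) t (ht : t ∈ I) =>
    dens_ne_zero hB0 hexp hn hx ht
  have hmean := fun w (hw : w ∈ Ω ×ˢ I) => mean_first hΩ hI hsol hexp hw
  refine ⟨red B (onPhase (gc 0)), red B (onPhase (gc 1)),
    regularReduced_red hΩ hI hB hB0 H.rapid₀, regularReduced_red hΩ hI hB hB0 H.rapid₁,
    fun x hx t ht c => ?_, fun x hx t ht => (expansion_u hexp (w := (x, t)) ⟨hx, ht⟩).tendsto,
    fun x hx t ht μ hμ c => ?_, fun x hx t ht μ hμ c => ?_, fun x hx t ht => ?_,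
    fun x hx t ht => H.uPerp_eq hΩ hI hB hB0 hx ht (fun _ _ _ _ => rfl) (hdens x hx t ht)
      (hforce x hx t ht),
    fun x hx t ht => H.elliptic hΩ hI hB hB0 hE hdivB (fun _ _ _ _ => rfl) hdens hforce hmean
      hx ht⟩
  · rw [red_apply (hB0 x hx t ht), H.gyroAvg_zeroth hΩ hI hB0 (z := (x, c, t)) ⟨hx, ht⟩]
    exact (expansion_g hexp (z := (x, c, t)) ⟨hx, mem_univ _, ht⟩).tendsto
  · have hG := fun {h : Phase → ℝ} (hh : Rapid Ω I h) =>
      differentiableAt_onReduced hΩ hI hB hB0 hh hx ht hμ c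
    rw [Sdag_weighted hΩ hI hB hB0 hx ht H.force hforce H.bulk (hG H.rapid₀) rfl,
      Cdag_weighted hΩ hI hB hB0 hx ht hforce (hdivB x hx t ht) (hG H.rapid₁), ← mul_add,
      H.reduced_transport hΩ hI hB hB0 hx ht (hdivB x hx t ht) hμ c hforce rfl, mul_zero]
  · rw [Cdag_weighted hΩ hI hB hB0 hx ht hforce (hdivB x hx t ht)
      (differentiableAt_onReduced hΩ hI hB hB0 H.rapid₀ hx ht hμ c),
      H.reduced_constraint hΩ hI hB hB0 hx ht (hdivB x hx t ht) hμ c, mul_zero]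
  · refine (setIntegral_congr_fun (measurableSet_Ioi.prod MeasurableSet.univ) fun p _ => ?_).trans
      (H.mom_first_eq_zero hΩ hI hB hB0 hmean hx ht)
    simp
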